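/- Let $G$ be a differentiable (Lie) groupoid with manifold of identities $I$, source $s$, target $t$ and product $YX$ (defined when $s(Y)=t(X)$). Let $T=TI$ and $\mathfrak g=\ker s_*|_I$, and let $G_k$ be the Lie groupoid of $k$-jets of local bisections of $G$, with identities $I_k\cong I$; identify $TG_k|_{I}=T\oplus J^k\mathfrak g$, where $T$ is the space of vectors tangent to the identities and $j^k_x\theta\in J^k_x\mathfrak g$ is the $s$-vertical vector $\frac{d}{du}j^k_x\eta_u|_{u=0}$, for bisections $\eta_u$ with $\eta_0=\mathrm{id}$ and $\frac{d}{du}\eta_u|_{u=0}=\theta$. A bisection $S$ of $G_k$ with $tS=f$ acts on $TG_k$ on the left (resp. right) by the differential $w\mapsto j^1S\cdot w$ of $q\mapsto S(t(q))\,q$ (resp. $w\mapsto w\cdot j^1S$ of $q\mapsto q\,S(f^{-1}(s(q)))$); on $s$-vertical vectors the right action depends only on the value of $S$. For $P=j^{k+1}_xF\in G_{k+1}$ put $\lambda^1P=j^1_x(j^kF)$. Let $\mathcal R$ be the sheaf of local vector fields on $I\times G$ that are right invariant under $(a,X)\cdot Y=(a,XY)$ (in particular tangent to the submanifolds $I\times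 s^{-1}(x)$) and projectable by $\rho_1:I\times G\to I$. Then $\mathcal R=\mathcal H\oplus\mathcal V$, where $\mathcal H\cong\mathcal T$ consists of the fields projecting to $0$ on $G$, and $\mathcal V$ of those projecting to $0$ on $I$. Let $\Upsilon_k(v+\xi)=v+\xi_k$, $\xi_k(x)=j^k_x(\xi|_{\{x\}\times I})$, for $v\in\mathcal H$, $\xi\in\mathcal V$, and write $(\zeta)_k=\Upsilon_k(\zeta)$. The first bracket of order $k$ of sections of $T\oplus J^k\mathfrak g$, with values in $T\oplus J^{k-1}\mathfrak g$ (and $J^{-1}\mathfrak g=0$), is $[\Upsilon_k\zeta,\Upsilon_k\eta]_k=\Upsilon_{k-1}([\zeta,\eta])$, $\zeta,\eta\in\mathcal R$. Let $\sigma$ be a local diffeomorphism of $I\times G$, defined near the diagonal points $(x,x)$, $x$ in the domain of $f$, which is right invariant, projects by $\rho_1$ to a local diffeomorphism $f$ of $I$, and preserves $B(G)=\{(t(X),X):X\in G\}$. Write $\sigma(x,Y)=(f(x),\phi_x(t(Y))Y)$ and $\sigma_k(x)=j^k_x\phi_x$; then $\sigma_k$ is a bisection of $G_k$ with $t\sigma_k=f$.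 Then $\sigma_*$ maps $\mathcal R$ to $\mathcal R$, vertical fields to vertical fields and fields tangent to $B(G)$ to fields tangent to $B(G)$, and for every $k\ge 0$: (i) for $v\in\mathcal H$, $(\sigma_*v)_k=f_*v+\bigl(j^1\sigma_k\cdot v\cdot\lambda^1\sigma_{k+1}^{-1}-\lambda^1\sigma_{k+1}\cdot v\cdot\lambda^1\sigma_{k+1}^{-1}\bigr)$; (ii) for $\xi\in\mathcal V$, $(\sigma_*\xi)_k=\lambda^1\sigma_{k+1}\cdot\xi_k\cdot\sigma_k^{-1}$; (iii) for $\tilde\xi=\xi_H+\xi\in\mathcal R$ tangent to $B(G)$, with $\xi_H\in\mathcal H$ and $\xi\in\mathcal V$, $(\sigma_*\tilde\xi)_k=f_*\xi_H+j^1\sigma_k\cdot\xi_k\cdot\sigma_k^{-1}$. Consequently, for a local bisection $\sigma_{k+1}$ of $G_{k+1}$ with projection $\sigma_k$ to $G_k$ and $f=t\sigma_{k+1}$, the formula $$(\sigma_{k+1})_*(v+\xi_k)=f_*v+\bigl(j^1\sigma_k\cdot v\cdot\lambda^1\sigma_{k+1}^{-1}-\lambda^1\sigma_{k+1}\cdot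 v\cdot\lambda^1\sigma_{k+1}^{-1}\bigr)+\lambda^1\sigma_{k+1}\cdot\xi_k\cdot\sigma_k^{-1}$$ maps smooth local sections of $T\oplus J^k\mathfrak g$ to smooth local sections of $T\oplus J^k\mathfrak g$; it defines an action of the bisections of $G_{k+1}$ (the identity bisection acts trivially, and a product of bisections acts as the composite), which satisfies $(\sigma_*\zeta)_k=(\sigma_{k+1})_*(\zeta)_k$ for $\sigma$ as above and $\zeta\in\mathcal R$. It preserves the first bracket: $$[(\sigma_{k+1})_*(v+\xi_k),(\sigma_{k+1})_*(w+\eta_k)]_k=(\sigma_k)_*\bigl([v+\xi_k,w+\eta_k]_k\bigr),$$ where for $k=0$ both sides are vector fields on $I$ and $(\sigma_0)_*=f_*$. -/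

import Mathlib

open Set Filter Topology
open scoped Manifold ContDiff

noncomputable section

/-- A differentiable groupoid `G` over the manifold of identities `M` (written `I` in the
literature, and regarded there as a submanifold of `G` through the embedding `one`, which has the
smooth left inverse `src`).  The product `mul Y X` is meaningful only when `src Y = tgt X`; its
values at other pairs are irrelevant.  Smoothness of the product is smoothness on the submanifold
of composable pairs. -/
structure LieGroupoid (EM EG M G : Type*)
    [NormedAddCommGroup EM] [NormedSpace ℝ EM] [NormedAddCommGroup EG] [NormedSpace ℝ EG]
    [TopologicalSpace M] [ChartedSpace EM M] [TopologicalSpace G] [ChartedSpace EG G] where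
  src : G → M
  tgt : G → M
  one : M → G
  mul : G → G → G
  inv : G → G
  submersion_src : ∀ X, Manifold.IsSubmersionAt 𝓘(ℝ, EG) 𝓘(ℝ, EM) ∞ src X
  submersion_tgt : ∀ X, Manifold.IsSubmersionAt 𝓘(ℝ, EG) 𝓘(ℝ, EM) ∞ tgt X
  contMDiff_one : ContMDiff 𝓘(ℝ, EM) 𝓘(ℝ, EG) ∞ one
  contMDiffOn_mul : ContMDiffOn (𝓘(ℝ, EG).prod 𝓘(ℝ, EG)) 𝓘(ℝ, EG) ∞
    (fun p : G × G => mul p.1 p.2) {p : G × G | src p.1 = tgt p.2}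
  contMDiff_inv : ContMDiff 𝓘(ℝ, EG) 𝓘(ℝ, EG) ∞ inv
  src_one : ∀ x, src (one x) = x
  tgt_one : ∀ x, tgt (one x) = x
  src_mul : ∀ Y X, src Y = tgt X → src (mul Y X) = src X
  tgt_mul : ∀ Y X, src Y = tgt X → tgt (mul Y X) = tgt Y
  mul_assoc : ∀ Z Y X, src Z = tgt Y → src Y = tgt X → mul Z (mul Y X) = mul (mul Z Y) X
  mul_one : ∀ X, mul X (one (src X)) = X
  one_mul : ∀ X, mul (one (tgt X)) X = X
  src_inv : ∀ X, src (inv X) = tgt X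
  tgt_inv : ∀ X, tgt (inv X) = src X
  inv_mul : ∀ X, mul (inv X) X = one (src X)
  mul_inv : ∀ X, mul X (inv X) = one (tgt X)

/-- The vector space in which the Taylor coefficients of order `≤ k` of a map from an open set of
`EM` to `EG` live. -/
abbrev JetCoeff (EM EG : Type*)
    [NormedAddCommGroup EM] [NormedSpace ℝ EM] [NormedAddCommGroup EG] [NormedSpace ℝ EG]
    (k : ℕ) : Type _ :=
  (i : Fin (k + 1)) → EM [×(i : ℕ)]→L[ℝ] EG

/-- The data of a `k`-jet of a map `M → G`: its source point, its value, and its derivatives of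
order `≤ k` in the preferred charts at the source point and at the value. -/
@[ext]
structure PreJet (EM EG M G : Type*)
    [NormedAddCommGroup EM] [NormedSpace ℝ EM] [NormedAddCommGroup EG] [NormedSpace ℝ EG]
    (k : ℕ) where
  pt : M
  val : G
  coeff : JetCoeff EM EG k

namespace LieGroupoid

variable {EM EG M G : Type*}
  [NormedAddCommGroup EM] [NormedSpace ℝ EM] [NormedAddCommGroup EG] [NormedSpace ℝ EG]
  [TopologicalSpace M] [ChartedSpace EM M] [TopologicalSpace G] [ChartedSpace EG G]

/-! ### Bisections of `G` -/

/-- A (local) bisection of `G`: a smooth section `F` of `src` over the open set `base.source`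
such that `base = tgt ∘ F` is a diffeomorphism onto the open set `base.target`.
The values of `F` outside `base.source` are irrelevant. -/
structure Bisection (Γ : LieGroupoid EM EG M G) where
  toFun : M → G
  base : OpenPartialHomeomorph M M
  contMDiffOn_toFun : ContMDiffOn 𝓘(ℝ, EM) 𝓘(ℝ, EG) ∞ toFun base.source
  contMDiffOn_symm : ContMDiffOn 𝓘(ℝ, EM) 𝓘(ℝ, EM) ∞ base.symm base.target
  src_toFun : ∀ x ∈ base.source, Γ.src (toFun x) = x
  tgt_toFun : ∀ x ∈ base.source, Γ.tgt (toFun x) = base x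

variable (Γ : LieGroupoid EM EG M G)

/-- The identity bisection. -/
def oneBisection : Γ.Bisection where
  toFun := Γ.one
  base := OpenPartialHomeomorph.refl M
  contMDiffOn_toFun := Γ.contMDiff_one.contMDiffOn
  contMDiffOn_symm := contMDiffOn_id
  src_toFun := fun x _ => Γ.src_one x
  tgt_toFun := fun x _ => Γ.tgt_one x

instance : Nonempty Γ.Bisection := ⟨Γ.oneBisection⟩

/-! ### The groupoid `G_k` of `k`-jets of bisections -/

/-- The derivatives of order `≤ k` at `x` of the map `F : M → G`, written in the preferred charts
of `M` at `x₀` and of `G` at `Z₀`. -/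
def coeffs (k : ℕ) (x₀ : M) (Z₀ : G) (F : M → G) (x : M) : JetCoeff EM EG k := fun i =>
  iteratedFDeriv ℝ (i : ℕ)
    (extChartAt 𝓘(ℝ, EG) Z₀ ∘ F ∘ (extChartAt 𝓘(ℝ, EM) x₀).symm) (extChartAt 𝓘(ℝ, EM) x₀ x)

/-- The `k`-jet `j^k_x F`. -/
def jet (k : ℕ) (F : M → G) (x : M) : PreJet EM EG M G k where
  pt := x
  val := F x
  coeff := coeffs k x (F x) F x

/-- The bisection `F` represents the jet `p`, i.e. `p = j^k_x F`, `x` being the source of `p`. -/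
def Represents {k : ℕ} (F : Γ.Bisection) (p : PreJet EM EG M G k) : Prop :=
  p.pt ∈ F.base.source ∧ jet k F.toFun p.pt = p

/-- The set `G_k` of `k`-jets of bisections of `G`. -/
def jets (k : ℕ) : Set (PreJet EM EG M G k) := {p | ∃ F : Γ.Bisection, Γ.Represents F p}

/-- A bisection representing a given element of `G_k`. -/
def rep {k : ℕ} (p : PreJet EM EG M G k) : Γ.Bisection :=
  Classical.epsilon fun F => Γ.Represents F p

/-- The target of a jet; its source is `p.pt`. -/
def jetTgt {k : ℕ} (p : PreJet EM EG M G k) : M := Γ.tgt p.val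

/-- The product `j^k_{f(x)} H . j^k_x F = j^k_x (H F)`, where `(H F)(z) = H (t F (z)) F(z)`. -/
def jetMul {k : ℕ} (q p : PreJet EM EG M G k) : PreJet EM EG M G k :=
  jet k (fun z => Γ.mul ((Γ.rep q).toFun (Γ.tgt ((Γ.rep p).toFun z))) ((Γ.rep p).toFun z)) p.pt

/-- The inverse `(j^k_x F)⁻¹ = j^k_{f(x)} (F⁻¹)`, where `F⁻¹(y) = F(f⁻¹(y))⁻¹`. -/
def jetInv {k : ℕ} (p : PreJet EM EG M G k) : PreJet EM EG M G k :=
  jet k (fun y => Γ.inv ((Γ.rep p).toFun ((Γ.rep p).base.symm y))) (Γ.jetTgt p)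

/-- The identity section `I_k = j^k I` of `G_k`. -/
def jetOne (k : ℕ) (x : M) : PreJet EM EG M G k := jet k Γ.one x

end LieGroupoid

/-- The projection `π_k : G_{k+1} → G_k`. -/
def PreJet.proj {EM EG M G : Type*}
    [NormedAddCommGroup EM] [NormedSpace ℝ EM] [NormedAddCommGroup EG] [NormedSpace ℝ EG]
    {k : ℕ} (p : PreJet EM EG M G (k + 1)) : PreJet EM EG M G k where
  pt := p.pt
  val := p.val
  coeff := fun i => p.coeff i.castSucc

namespace LieGroupoid

variable {EM EG M G : Type*}
  [NormedAddCommGroup EM] [NormedSpace ℝ EM] [NormedAddCommGroup EG] [NormedSpace ℝ EG]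
  [TopologicalSpace M] [ChartedSpace EM M] [TopologicalSpace G] [ChartedSpace EG G]

variable (Γ : LieGroupoid EM EG M G)

/-! ### The differentiable structure of `G_k` -/

/-- The vector space containing the tangent spaces of `G_k`: a tangent vector at `p ∈ G_k` is
written in the jet coordinates `jetChart p` attached to the preferred charts at the source and at
the value of `p` (as a tangent vector of a manifold is written in the preferred chart). -/
abbrev JetTan (EM EG : Type*)
    [NormedAddCommGroup EM] [NormedSpace ℝ EM] [NormedAddCommGroup EG] [NormedSpace ℝ EG]
    (k : ℕ) : Type _ := EM × JetCoeff EM EG k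

/-- The jet coordinates on `G_k` around `p₀`: `j^k_x F` has as coordinates `x` and the derivatives
of `F` of order `≤ k` at `x`, all in the preferred charts at the source and the value of `p₀`.
They embed the jets with source and value in these chart domains onto a submanifold of the vector
space `JetTan EM EG k`. -/
def jetChart {k : ℕ} (p₀ p : PreJet EM EG M G k) : JetTan EM EG k :=
  (extChartAt 𝓘(ℝ, EM) p₀.pt p.pt, coeffs k p₀.pt p₀.val (Γ.rep p).toFun p.pt)

/-- `S` is a smooth map from a neighbourhood of `x` in `M` to `G_k`. -/
def SmoothJetMapAt {k : ℕ} (S : M → PreJet EM EG M G k) (x : M) : Prop :=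
  (∀ᶠ z in 𝓝 x, S z ∈ Γ.jets k) ∧
  ContinuousAt (fun z => (S z).pt) x ∧ ContinuousAt (fun z => (S z).val) x ∧
  ContMDiffAt 𝓘(ℝ, EM) 𝓘(ℝ, JetTan EM EG k) ∞ (fun z => Γ.jetChart (S x) (S z)) x

/-- The differential `S_* : T_x M → T_{S(x)} G_k` of a smooth map `S` from `M` to `G_k`. -/
def jetDeriv {k : ℕ} (S : M → PreJet EM EG M G k) (x : M) (v : TangentSpace 𝓘(ℝ, EM) x) :
    JetTan EM EG k :=
  (mfderiv 𝓘(ℝ, EM) 𝓘(ℝ, JetTan EM EG k) (fun z => Γ.jetChart (S x) (S z)) x : _ →L[ℝ] _) v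

/-- `c` is a smooth curve in `G_k` near the parameter `0`. -/
def IsJetCurve {k : ℕ} (c : ℝ → PreJet EM EG M G k) : Prop :=
  (∀ᶠ u in 𝓝 0, c u ∈ Γ.jets k) ∧
  ContinuousAt (fun u => (c u).pt) 0 ∧ ContinuousAt (fun u => (c u).val) 0 ∧
  ContDiffAt ℝ ∞ (fun u => Γ.jetChart (c 0) (c u)) 0

/-- The velocity `d/du c(u) |_{u=0}` of a curve in `G_k`, a tangent vector at `c 0`. -/
def velocity {k : ℕ} (c : ℝ → PreJet EM EG M G k) : JetTan EM EG k :=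
  deriv (fun u => Γ.jetChart (c 0) (c u)) 0

open Classical in
/-- The differential at `p` of a smooth map `Ψ` from the submanifold `A` of `G_k` to `G_k`, applied
to the vector `w` tangent to `A`: the velocity of `Ψ ∘ c` for a curve `c` in `A` through `p` with
velocity `w`. -/
def jetMapDeriv {k : ℕ} (A : Set (PreJet EM EG M G k))
    (Ψ : PreJet EM EG M G k → PreJet EM EG M G k) (p : PreJet EM EG M G k)
    (w : JetTan EM EG k) : JetTan EM EG k :=
  if h : ∃ c : ℝ → PreJet EM EG M G k, Γ.IsJetCurve c ∧ c 0 = p ∧ (∀ᶠ u in 𝓝 0, c u ∈ A) ∧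
      Γ.velocity c = w
  then Γ.velocity (Ψ ∘ h.choose) else 0

/-- A (local) bisection `S` of the groupoid `G_k`, with base diffeomorphism `f = t ∘ S`. -/
structure IsJetBisection {k : ℕ} (S : M → PreJet EM EG M G k) (f : OpenPartialHomeomorph M M) :
    Prop where
  smooth : ∀ x ∈ f.source, Γ.SmoothJetMapAt S x
  pt_eq : ∀ x ∈ f.source, (S x).pt = x
  tgt_eq : ∀ x ∈ f.source, Γ.jetTgt (S x) = f x
  smooth_symm : ContMDiffOn 𝓘(ℝ, EM) 𝓘(ℝ, EM) ∞ f.symm f.target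

/-! ### The actions of 1-jets of bisections of `G_k` on `T G_k` -/

/-- The left action `j¹S . w` of a bisection `S` of `G_k` on `w ∈ T_p G_k`: the differential at `p`
of `q ↦ S(t(q)) q`. -/
def leftAct {k : ℕ} (S : M → PreJet EM EG M G k) (p : PreJet EM EG M G k)
    (w : JetTan EM EG k) : JetTan EM EG k :=
  Γ.jetMapDeriv univ (fun q => Γ.jetMul (S (Γ.jetTgt q)) q) p w

/-- The right action `w . j¹S` of a bisection `S` of `G_k`, with base diffeomorphism `f`, on
`w ∈ T_p G_k`: the differential at `p` of `q ↦ q S(f⁻¹(s(q)))`. -/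
def rightAct {k : ℕ} (S : M → PreJet EM EG M G k) (f : OpenPartialHomeomorph M M)
    (p : PreJet EM EG M G k) (w : JetTan EM EG k) : JetTan EM EG k :=
  Γ.jetMapDeriv univ (fun q => Γ.jetMul q (S (f.symm q.pt))) p w

/-- The right action `w . g` of `g ∈ G_k` on an `s`-vertical vector `w ∈ T_p G_k`, where
`s(p) = t(g)`: the differential at `p` of the map `q ↦ q g` on the `s`-fibre. -/
def rightActVert {k : ℕ} (g : PreJet EM EG M G k) (p : PreJet EM EG M G k)
    (w : JetTan EM EG k) : JetTan EM EG k :=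
  Γ.jetMapDeriv {q | q.pt = Γ.jetTgt g} (fun q => Γ.jetMul q g) p w

/-- For `P = j^{k+1}_x F`, the bisection `j^k F` of `G_k`, whose `1`-jet at `x` is `λ¹ P`. -/
def prolong {k : ℕ} (P : PreJet EM EG M G (k + 1)) : M → PreJet EM EG M G k :=
  jet k (Γ.rep P).toFun

/-- The left action `λ¹P . w`. -/
def lamLeft {k : ℕ} (P : PreJet EM EG M G (k + 1)) (p : PreJet EM EG M G k)
    (w : JetTan EM EG k) : JetTan EM EG k :=
  Γ.leftAct (Γ.prolong P) p w

/-- The right action `w . λ¹P`. -/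
def lamRight {k : ℕ} (P : PreJet EM EG M G (k + 1)) (p : PreJet EM EG M G k)
    (w : JetTan EM EG k) : JetTan EM EG k :=
  Γ.rightAct (Γ.prolong P) (Γ.rep P).base p w

/-! ### The algebroid, its jets, and `T ⊕ J^k 𝔤 = T G_k | I` -/

variable [IsManifold 𝓘(ℝ, EM) ∞ M] [IsManifold 𝓘(ℝ, EG) ∞ G]

/-- `θ` is a smooth section over `U` of the algebroid `𝔤 = ker s_* | I`. -/
structure IsAlgSection (θ : (x : M) → TangentSpace 𝓘(ℝ, EG) (Γ.one x)) (U : Set M) : Prop where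
  smooth : ContMDiffOn 𝓘(ℝ, EM) 𝓘(ℝ, EG).tangent ∞
    (fun x => (⟨Γ.one x, θ x⟩ : TangentBundle 𝓘(ℝ, EG) G)) U
  vertical : ∀ x ∈ U, mfderiv 𝓘(ℝ, EG) 𝓘(ℝ, EM) Γ.src (Γ.one x) (θ x) = 0

/-- The derivatives of order `≤ k` at `x` of the section `θ` of `𝔤`, written in the preferred chart
of `M` at `x₀` and, for the values of `θ`, the differential of the preferred chart of `G` at
`x₀`. -/
def algCoeffs (k : ℕ) (x₀ : M) (θ : (x : M) → TangentSpace 𝓘(ℝ, EG) (Γ.one x)) (x : M) :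
    JetCoeff EM EG k := fun i =>
  iteratedFDeriv ℝ (i : ℕ)
    (fun e : EM => (mfderiv 𝓘(ℝ, EG) 𝓘(ℝ, EG) (extChartAt 𝓘(ℝ, EG) (Γ.one x₀))
      (Γ.one ((extChartAt 𝓘(ℝ, EM) x₀).symm e)) (θ ((extChartAt 𝓘(ℝ, EM) x₀).symm e)) : EG))
    (extChartAt 𝓘(ℝ, EM) x₀ x)

/-- The `k`-jet `j^k_x θ ∈ J^k_x 𝔤` of a section of `𝔤`, written in the preferred charts at `x`. -/
def algJet (k : ℕ) (θ : (x : M) → TangentSpace 𝓘(ℝ, EG) (Γ.one x)) (x : M) :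
    JetCoeff EM EG k := Γ.algCoeffs k x θ x

/-- `θ` is a section of `𝔤` near `x` whose `k`-jet at `x` is `A`. -/
def AlgRepresents {k : ℕ} (θ : (x : M) → TangentSpace 𝓘(ℝ, EG) (Γ.one x)) (x : M)
    (A : JetCoeff EM EG k) : Prop :=
  (∃ U : Set M, IsOpen U ∧ x ∈ U ∧ Γ.IsAlgSection θ U) ∧ Γ.algJet k θ x = A

/-- The fibre `J^k_x 𝔤`, a subspace of `JetCoeff EM EG k`. -/
def algJets (k : ℕ) (x : M) : Set (JetCoeff EM EG k) :=
  {A | ∃ θ : (x : M) → TangentSpace 𝓘(ℝ, EG) (Γ.one x), Γ.AlgRepresents θ x A}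

/-- A section of `𝔤` representing a given element of `J^k_x 𝔤`. -/
def algRep {k : ℕ} (x : M) (A : JetCoeff EM EG k) :
    (z : M) → TangentSpace 𝓘(ℝ, EG) (Γ.one z) :=
  @Classical.epsilon _ ⟨fun _ => 0⟩ fun θ => Γ.AlgRepresents θ x A

/-- The space containing the fibres `T_x M ⊕ J^k_x 𝔤` of the bundle `T ⊕ J^k 𝔤`. -/
abbrev CheckJet (EM EG : Type*)
    [NormedAddCommGroup EM] [NormedSpace ℝ EM] [NormedAddCommGroup EG] [NormedSpace ℝ EG]
    (k : ℕ) : Type _ := EM × JetCoeff EM EG k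

/-- `a = v + ξ_k` is a smooth section of `T ⊕ J^k 𝔤` over the open set `U`. -/
structure IsCheckSection {k : ℕ} (a : M → CheckJet EM EG k) (U : Set M) : Prop where
  isOpen : IsOpen U
  smooth_fst : ContMDiffOn 𝓘(ℝ, EM) 𝓘(ℝ, EM).tangent ∞
    (fun x => (⟨x, (a x).1⟩ : TangentBundle 𝓘(ℝ, EM) M)) U
  mem : ∀ x ∈ U, (a x).2 ∈ Γ.algJets k x
  smooth_snd : ∀ x₀ ∈ U, ContMDiffAt 𝓘(ℝ, EM) 𝓘(ℝ, JetCoeff EM EG k) ∞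
    (fun x => Γ.algCoeffs k x₀ (Γ.algRep x (a x).2) x) x₀

/-- A vector `v` tangent to `M`, seen as a vector `(I_k)_* v` of `T_{I_k(x)} G_k` tangent to the
identities. -/
def horiz (k : ℕ) (x : M) (v : TangentSpace 𝓘(ℝ, EM) x) : JetTan EM EG k :=
  Γ.jetDeriv (Γ.jetOne k) x v

/-- An element of `J^k_x 𝔤`, seen as an `s`-vertical vector in `T_{I_k(x)} G_k`:
if `η_u` are bisections with `η_0 = I` and `d/du η_u |_{u=0} = θ`, then `j^k_x θ` is identified with
`d/du j^k_x η_u |_{u=0}`, whose jet coordinates are `0` and the derivatives of order `≤ k` of `θ`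
at `x`. -/
def vert {k : ℕ} (A : JetCoeff EM EG k) : JetTan EM EG k := (0, A)

/-- The isomorphism `T_x ⊕ J^k_x 𝔤 ≅ T_{I_k(x)} G_k`. -/
def toTan {k : ℕ} (x : M) (a : CheckJet EM EG k) : JetTan EM EG k :=
  Γ.horiz k x a.1 + vert a.2

/-- The inverse `T_{I_k(x)} G_k ≅ T_x ⊕ J^k_x 𝔤` of `toTan`: the horizontal component of `w` is
`s_* w`. -/
def ofTan {k : ℕ} (x : M) (w : JetTan EM EG k) : CheckJet EM EG k :=
  (w.1, (w - Γ.horiz k x w.1).2)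

/-! ### Right invariant vector fields on `I × G` -/

/-- The submanifold `B(G) = {(t(X), X)}` of `I × G`. -/
def BG : Set (M × G) := range fun X => (Γ.tgt X, X)

/-- `Ω ⊆ I × G` is stable under the right action `(a, X) . Y = (a, X Y)` of `G`. -/
def RightStable (Ω : Set (M × G)) : Prop :=
  ∀ a X Y, (a, X) ∈ Ω → Γ.src X = Γ.tgt Y → (a, Γ.mul X Y) ∈ Ω

/-- The right translate `w . Y` of an `s`-vertical vector `w ∈ T_X G`, where `s(X) = t(Y)`: the
differential at `X` of the map `Z ↦ Z Y` on the `s`-fibre. -/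
def rightTranslate (X Y : G) (w : TangentSpace 𝓘(ℝ, EG) X) :
    TangentSpace 𝓘(ℝ, EG) (Γ.mul X Y) :=
  mfderivWithin 𝓘(ℝ, EG) 𝓘(ℝ, EG) (fun Z => Γ.mul Z Y) {Z | Γ.src Z = Γ.tgt Y} X w

/-- The component of a tangent vector of `M × G` tangent to `M`. -/
def fstTan (q : M × G) (w : TangentSpace (𝓘(ℝ, EM).prod 𝓘(ℝ, EG)) q) :
    TangentSpace 𝓘(ℝ, EM) q.1 := (show EM × EG from w).1

/-- The component of a tangent vector of `M × G` tangent to `G`. -/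
def sndTan (q : M × G) (w : TangentSpace (𝓘(ℝ, EM).prod 𝓘(ℝ, EG)) q) :
    TangentSpace 𝓘(ℝ, EG) q.2 := (show EM × EG from w).2

/-- `ζ` belongs to `𝓡` on `Ω`: it is a smooth right invariant vector field on the open right
stable set `Ω ⊆ I × G`, and it is projectable by the first projection. -/
structure IsInvariantField (Ω : Set (M × G))
    (ζ : (q : M × G) → TangentSpace (𝓘(ℝ, EM).prod 𝓘(ℝ, EG)) q) : Prop where
  isOpen : IsOpen Ω
  stable : Γ.RightStable Ω
  smooth : ContMDiffOn (𝓘(ℝ, EM).prod 𝓘(ℝ, EG)) (𝓘(ℝ, EM).prod 𝓘(ℝ, EG)).tangent ∞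
    (fun q => (⟨q, ζ q⟩ : TangentBundle (𝓘(ℝ, EM).prod 𝓘(ℝ, EG)) (M × G))) Ω
  projectable : ∀ a X X', (a, X) ∈ Ω → (a, X') ∈ Ω →
    fstTan (a, X) (ζ (a, X)) = fstTan (a, X') (ζ (a, X'))
  tangent_fibre : ∀ q ∈ Ω, mfderiv 𝓘(ℝ, EG) 𝓘(ℝ, EM) Γ.src q.2 (sndTan q (ζ q)) = 0
  right_invariant : ∀ a X Y, (a, X) ∈ Ω → Γ.src X = Γ.tgt Y →
    sndTan (a, Γ.mul X Y) (ζ (a, Γ.mul X Y)) = Γ.rightTranslate X Y (sndTan (a, X) (ζ (a, X)))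

/-- Horizontal fields: those which project to `0` on `G`. -/
def IsHorizontal (Ω : Set (M × G))
    (ζ : (q : M × G) → TangentSpace (𝓘(ℝ, EM).prod 𝓘(ℝ, EG)) q) : Prop :=
  ∀ q ∈ Ω, sndTan q (ζ q) = 0

/-- Vertical fields: those which project to `0` on `I`. -/
def IsVertical (Ω : Set (M × G))
    (ζ : (q : M × G) → TangentSpace (𝓘(ℝ, EM).prod 𝓘(ℝ, EG)) q) : Prop :=
  ∀ q ∈ Ω, fstTan q (ζ q) = 0

/-- Fields tangent to `B(G)`, the image of the embedding `X ↦ (t(X), X)`. -/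
def IsTangentBG (Ω : Set (M × G))
    (ζ : (q : M × G) → TangentSpace (𝓘(ℝ, EM).prod 𝓘(ℝ, EG)) q) : Prop :=
  ∀ X, (Γ.tgt X, X) ∈ Ω → ζ (Γ.tgt X, X) ∈ range
    (mfderiv 𝓘(ℝ, EG) (𝓘(ℝ, EM).prod 𝓘(ℝ, EG)) (fun Z : G => (Γ.tgt Z, Z)) X)

/-- The map `Υ_k` from `𝓡` to sections of `T ⊕ J^k 𝔤`: a field `v + ξ`, with `v` horizontal and `ξ`
vertical, goes to `v + ξ_k`, where `ξ_k(x)` is the `k`-jet at `x` of the restriction of `ξ` to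
`{x} × I`. -/
def upsilon (k : ℕ) (ζ : (q : M × G) → TangentSpace (𝓘(ℝ, EM).prod 𝓘(ℝ, EG)) q) (x : M) :
    CheckJet EM EG k :=
  (fstTan (x, Γ.one x) (ζ (x, Γ.one x)),
    Γ.algJet k (fun y => sndTan (x, Γ.one y) (ζ (x, Γ.one y))) x)

/-- Near the point `x`, the section `a` of `T ⊕ J^k 𝔤` is the image by `Υ_k` of the field `ζ ∈ 𝓡`. -/
def IsLift {k : ℕ} (a : M → CheckJet EM EG k) (x : M)
    (ζ : (q : M × G) → TangentSpace (𝓘(ℝ, EM).prod 𝓘(ℝ, EG)) q) : Prop :=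
  (∃ Ω : Set (M × G), (x, Γ.one x) ∈ Ω ∧ Γ.IsInvariantField Ω ζ) ∧
    ∀ᶠ z in 𝓝 x, Γ.upsilon k ζ z = a z

open Classical in
/-- The first bracket of order `k + 1`, with values in `T ⊕ J^k 𝔤`: the value at `x` is
`Υ_k([ζ, η])(x)` for fields `ζ, η ∈ 𝓡` which lift `a` and `b` near `x`. -/
def firstBracket (k : ℕ) (a b : M → CheckJet EM EG (k + 1)) (x : M) : CheckJet EM EG k :=
  if h : ∃ ζη : ((q : M × G) → TangentSpace (𝓘(ℝ, EM).prod 𝓘(ℝ, EG)) q) ×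
      ((q : M × G) → TangentSpace (𝓘(ℝ, EM).prod 𝓘(ℝ, EG)) q),
      Γ.IsLift a x ζη.1 ∧ Γ.IsLift b x ζη.2
  then Γ.upsilon k
    (VectorField.mlieBracket (𝓘(ℝ, EM).prod 𝓘(ℝ, EG)) h.choose.1 h.choose.2) x
  else 0

/-- The first bracket of order `0`, with values in `T` (as `J^{-1} 𝔤 = 0`): the bracket of the
horizontal components. -/
def firstBracketZero (a b : M → CheckJet EM EG 0) (x : M) : TangentSpace 𝓘(ℝ, EM) x :=
  VectorField.mlieBracket 𝓘(ℝ, EM)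
    (fun z => ((a z).1 : TangentSpace 𝓘(ℝ, EM) z)) (fun z => ((b z).1 : TangentSpace 𝓘(ℝ, EM) z)) x

/-! ### Right invariant diffeomorphisms of `I × G` -/

/-- `σ` belongs to `𝓙`: it is a local diffeomorphism of `I × G`, right invariant, projectable by the
first projection to the local diffeomorphism `f` of `I`, and it preserves `B(G)`.  Its domain is
right stable and contains the diagonal over the domain of `f`. -/
structure IsAdmissible (σ : OpenPartialHomeomorph (M × G) (M × G))
    (f : OpenPartialHomeomorph M M) : Prop where
  smooth : ContMDiffOn (𝓘(ℝ, EM).prod 𝓘(ℝ, EG)) (𝓘(ℝ, EM).prod 𝓘(ℝ, EG)) ∞ σ σ.source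
  smooth_symm : ContMDiffOn (𝓘(ℝ, EM).prod 𝓘(ℝ, EG)) (𝓘(ℝ, EM).prod 𝓘(ℝ, EG)) ∞
    σ.symm σ.target
  smooth_base : ContMDiffOn 𝓘(ℝ, EM) 𝓘(ℝ, EM) ∞ f f.source
  smooth_base_symm : ContMDiffOn 𝓘(ℝ, EM) 𝓘(ℝ, EM) ∞ f.symm f.target
  stable : Γ.RightStable σ.source
  src_eq : ∀ a X, (a, X) ∈ σ.source → Γ.src (σ (a, X)).2 = Γ.src X
  right_invariant : ∀ a X Y, (a, X) ∈ σ.source → Γ.src X = Γ.tgt Y →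
    σ (a, Γ.mul X Y) = ((σ (a, X)).1, Γ.mul (σ (a, X)).2 Y)
  mem_source : ∀ q ∈ σ.source, q.1 ∈ f.source
  projectable : ∀ q ∈ σ.source, (σ q).1 = f q.1
  diagonal : ∀ x ∈ f.source, (x, Γ.one x) ∈ σ.source
  preserves : σ '' (σ.source ∩ Γ.BG) ⊆ Γ.BG

/-- The section `σ_k(x) = j^k_x φ_x` of `G_k` defined by `σ ∈ 𝓙`, where
`σ(x, Y) = (f(x), φ_x(t(Y)) Y)`, i.e. `φ_x(y)` is the second component of `σ(x, y)`. -/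
def sigmaJet (k : ℕ) (σ : OpenPartialHomeomorph (M × G) (M × G)) (x : M) : PreJet EM EG M G k :=
  jet k (fun y => (σ (x, Γ.one y)).2) x

/-- The image `σ_* ζ` of a vector field on `I × G`. -/
def pushField (σ : OpenPartialHomeomorph (M × G) (M × G))
    (ζ : (q : M × G) → TangentSpace (𝓘(ℝ, EM).prod 𝓘(ℝ, EG)) q) (q : M × G) :
    TangentSpace (𝓘(ℝ, EM).prod 𝓘(ℝ, EG)) q :=
  (show EM × EG from mfderiv (𝓘(ℝ, EM).prod 𝓘(ℝ, EG)) (𝓘(ℝ, EM).prod 𝓘(ℝ, EG)) σ (σ.symm q)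
    (ζ (σ.symm q)))

/-- The vector `f_* v ∈ T_{f(x)} M`, for `v ∈ T_x M`. -/
def pushVec (f : OpenPartialHomeomorph M M) (x : M) (v : TangentSpace 𝓘(ℝ, EM) x) :
    TangentSpace 𝓘(ℝ, EM) (f x) :=
  mfderiv 𝓘(ℝ, EM) 𝓘(ℝ, EM) f x v

/-! ### The right-hand sides of the formulas -/

/-- `j¹S_k . w . λ¹P⁻¹`, for `w ∈ T_{I_k(x)} G_k`, `S_k` a bisection of `G_k` and `P ∈ G_{k+1}` with
source `x` and projection `S_k(x)`. -/
def conjFirst {k : ℕ} (S : M → PreJet EM EG M G k) (P : PreJet EM EG M G (k + 1)) (x : M)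
    (w : JetTan EM EG k) : JetTan EM EG k :=
  Γ.lamRight (Γ.jetInv P) (S x) (Γ.leftAct S (Γ.jetOne k x) w)

/-- `λ¹P . w . λ¹P⁻¹`, for `w ∈ T_{I_k(x)} G_k` and `P ∈ G_{k+1}` with source `x`. -/
def conjLam {k : ℕ} (P : PreJet EM EG M G (k + 1)) (x : M) (w : JetTan EM EG k) :
    JetTan EM EG k :=
  Γ.lamRight (Γ.jetInv P) P.proj (Γ.lamLeft P (Γ.jetOne k x) w)

/-- `λ¹P . A . P_k⁻¹`, for `A ∈ J^k_x 𝔤` and `P ∈ G_{k+1}` with source `x` and projection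
`P_k ∈ G_k`. -/
def conjVert {k : ℕ} (P : PreJet EM EG M G (k + 1)) (x : M) (A : JetCoeff EM EG k) :
    JetTan EM EG k :=
  Γ.rightActVert (Γ.jetInv P.proj) P.proj (Γ.lamLeft P (Γ.jetOne k x) (vert A))

/-- `j¹S_k . A . S_k⁻¹`, for `A ∈ J^k_x 𝔤` and a bisection `S_k` of `G_k`. -/
def conjTangent {k : ℕ} (S : M → PreJet EM EG M G k) (x : M) (A : JetCoeff EM EG k) :
    JetTan EM EG k :=
  Γ.rightActVert (Γ.jetInv (S x)) (S x) (Γ.leftAct S (Γ.jetOne k x) (vert A))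

/-- The action of a bisection `S` of `G_{k+1}`, with base diffeomorphism `f`, on a section
`a = v + ξ_k` of `T ⊕ J^k 𝔤`:
`S_* a = f_* v + (j¹S_k . v . λ¹S⁻¹ - λ¹S . v . λ¹S⁻¹) + λ¹S . ξ_k . S_k⁻¹`. -/
def act {k : ℕ} (S : M → PreJet EM EG M G (k + 1)) (f : OpenPartialHomeomorph M M)
    (a : M → CheckJet EM EG k) (y : M) : CheckJet EM EG k :=
  Γ.ofTan y
    (Γ.horiz k y (pushVec f (f.symm y) (a (f.symm y)).1)
      + (Γ.conjFirst (fun z => (S z).proj) (S (f.symm y)) (f.symm y)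
            (Γ.horiz k (f.symm y) (a (f.symm y)).1)
          - Γ.conjLam (S (f.symm y)) (f.symm y) (Γ.horiz k (f.symm y) (a (f.symm y)).1))
      + Γ.conjVert (S (f.symm y)) (f.symm y) (a (f.symm y)).2)

end LieGroupoid

end

set_option linter.unusedSectionVars false

noncomputable section

section Calculus

variable {E F W : Type*} [NormedAddCommGroup E] [NormedSpace ℝ E]
  [NormedAddCommGroup F] [NormedSpace ℝ F] [NormedAddCommGroup W] [NormedSpace ℝ W]

/-! ### Symmetry of iterated derivatives -/

theorem fderiv_iteratedFDeriv_apply {f : E → F} {n : ℕ} {x : E}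
    (hf : ContDiffAt ℝ (n + 1 : ℕ) f x) (a : E) (w : Fin n → E) :
    fderiv ℝ (iteratedFDeriv ℝ n f) x a w = fderiv ℝ (fun y => iteratedFDeriv ℝ n f y w) x a := by
  have hd : DifferentiableAt ℝ (iteratedFDeriv ℝ n f) x :=
    (hf.iteratedFDeriv_right (m := 1) (by norm_cast; omega)).differentiableAt (by simp)
  exact (congrArg (fun L => L a) (((ContinuousMultilinearMap.apply ℝ (fun _ => E) F
    w).hasFDerivAt.comp x hd.hasFDerivAt).fderiv)).symm

theorem iteratedFDeriv_add_two_apply {f : E → F} {n : ℕ} {x : E}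
    (hf : ContDiffAt ℝ (n + 2 : ℕ) f x) (m : Fin (n + 2) → E) :
    iteratedFDeriv ℝ (n + 2) f x m =
      fderiv ℝ (fderiv ℝ (iteratedFDeriv ℝ n f)) x (m 0) (m 1) (Fin.tail (Fin.tail m)) := by
  rw [iteratedFDeriv_succ_apply_left, fderiv_iteratedFDeriv_apply hf]
  simp only [iteratedFDeriv_succ_apply_left (n := n)]
  have hd : DifferentiableAt ℝ (fderiv ℝ (iteratedFDeriv ℝ n f)) x :=
    ((hf.iteratedFDeriv_right (m := 2) (by norm_cast; omega)).fderiv_right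
      (m := 1) (by norm_num)).differentiableAt (by simp)
  have h1 := hd.hasFDerivAt.clm_apply (hasFDerivAt_const (m 1) x)
  have h2 := congrArg (fun L => L (m 0)) (((ContinuousMultilinearMap.apply ℝ (fun _ => E) F
    (Fin.tail (Fin.tail m))).hasFDerivAt.comp x h1).fderiv)
  refine Eq.trans ?_ (h2.trans (by simp))
  rfl

theorem iteratedFDeriv_swap_apply {f : E → F} {n : ℕ} : ∀ {x : E},
    ContDiffAt ℝ (n + 1 : ℕ) f x → ∀ (i : Fin n) (v : Fin (n + 1) → E),
    iteratedFDeriv ℝ (n + 1) f x (v ∘ Equiv.swap i.castSucc i.succ) =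
      iteratedFDeriv ℝ (n + 1) f x v := by
  induction n with
  | zero => exact fun _ i => i.elim0
  | succ n ih =>
    intro x hf i v
    refine Fin.cases ?_ (fun i => ?_) i
    · have hg : ContDiffAt ℝ 2 (iteratedFDeriv ℝ n f) x :=
        hf.iteratedFDeriv_right (by norm_cast; omega)
      have hs := (hg.isSymmSndFDerivAt (by simp)).eq (v 0) (v 1)
      rw [iteratedFDeriv_add_two_apply hf, iteratedFDeriv_add_two_apply hf]
      have h0 : (v ∘ Equiv.swap (Fin.castSucc 0) (Fin.succ 0)) (0 : Fin (n + 2)) = v 1 := by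
        simp
      have h1 : (v ∘ Equiv.swap (Fin.castSucc 0) (Fin.succ 0)) (1 : Fin (n + 2)) = v 0 := by
        simp
      have h2 : Fin.tail (Fin.tail (v ∘ Equiv.swap (Fin.castSucc 0) (Fin.succ 0))) =
          Fin.tail (Fin.tail v) := by
        ext j
        simp only [Fin.tail, Function.comp_apply]
        rw [Equiv.swap_apply_of_ne_of_ne]
        · simp
        · intro h
          have := congrArg Fin.val h
          simp at this
      rw [h0, h1, h2, hs]
    · rw [iteratedFDeriv_succ_apply_left, iteratedFDeriv_succ_apply_left]
      have h0 : (v ∘ Equiv.swap (Fin.castSucc i.succ) (Fin.succ i.succ)) (0 : Fin (n + 2)) = v 0 := by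
        simp only [Function.comp_apply]
        rw [Equiv.swap_apply_of_ne_of_ne]
        · intro h; have := congrArg Fin.val h; simp at this
        · intro h; have := congrArg Fin.val h; simp at this
      have h1 : Fin.tail (v ∘ Equiv.swap (Fin.castSucc i.succ) (Fin.succ i.succ)) =
          Fin.tail v ∘ Equiv.swap i.castSucc i.succ := by
        ext j
        simp only [Fin.tail, Function.comp_apply]
        congr 1
        rw [← Fin.succ_castSucc, ← (Fin.succ_injective _).swap_apply]
      rw [h0, h1]
      rw [fderiv_iteratedFDeriv_apply hf, fderiv_iteratedFDeriv_apply hf]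
      congr 1
      apply Filter.EventuallyEq.fderiv_eq
      have h3 : ContDiffAt ℝ (n + 1 : ℕ) f x := hf.of_le (by norm_cast; omega)
      filter_upwards [h3.eventually (by simp)] with y hy
      exact ih hy i _

theorem iteratedFDeriv_comp_perm {f : E → F} {n : ℕ} {x : E} (hf : ContDiffAt ℝ n f x)
    (σ : Equiv.Perm (Fin n)) (v : Fin n → E) :
    iteratedFDeriv ℝ n f x (v ∘ σ) = iteratedFDeriv ℝ n f x v := by
  cases n with
  | zero => congr 1; ext i; exact i.elim0
  | succ n =>
    have hσ : σ ∈ Submonoid.closure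
        (range fun i : Fin n => Equiv.swap i.castSucc i.succ) := by
      rw [Equiv.Perm.mclosure_swap_castSucc_succ]; trivial
    induction hσ using Submonoid.closure_induction generalizing v with
    | mem τ hτ =>
      obtain ⟨i, rfl⟩ := hτ
      exact iteratedFDeriv_swap_apply hf i v
    | one => rfl
    | mul a b _ _ ha hb =>
      rw [Equiv.Perm.coe_mul, ← Function.comp_assoc, hb, ha]

/-! ### Vanishing to a given order -/

theorem isBigO_pow_succ_of_fderiv {k : ℕ} {f : E → F} {x : E}
    (hf : ∀ᶠ y in 𝓝 x, DifferentiableAt ℝ f y) (h0 : f x = 0)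
    (h : fderiv ℝ f =O[𝓝 x] fun y => ‖y - x‖ ^ k) :
    f =O[𝓝 x] fun y => ‖y - x‖ ^ (k + 1) := by
  obtain ⟨C, hC0, hC⟩ := h.exists_nonneg
  obtain ⟨ε, hε, hb⟩ := Metric.eventually_nhds_iff_ball.1 (hC.bound.and hf)
  refine Asymptotics.IsBigO.of_bound C ?_
  filter_upwards [Metric.ball_mem_nhds x hε] with y hy
  have hsub : segment ℝ x y ⊆ Metric.ball x ε :=
    (convex_ball x ε).segment_subset (Metric.mem_ball_self hε) hy
  have hle : ∀ z ∈ segment ℝ x y, ‖fderiv ℝ f z‖ ≤ C * ‖y - x‖ ^ k := by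
    intro z hz
    have hz' := (hb z (hsub hz)).1
    rw [norm_pow, norm_norm] at hz'
    refine hz'.trans ?_
    gcongr
    exact norm_sub_le_of_mem_segment hz
  have := (convex_segment x y).norm_image_sub_le_of_norm_fderiv_le
    (fun z hz => (hb z (hsub hz)).2) hle (left_mem_segment ℝ x y) (right_mem_segment ℝ x y)
  rw [h0, sub_zero] at this
  rw [norm_pow, norm_norm, pow_succ, ← mul_assoc]
  exact this

theorem iteratedFDeriv_isBigO_of_eq_zero {k : ℕ} {f : E → F} {x : E}
    (hf : ContDiffAt ℝ ∞ f x) (h : ∀ i ≤ k, iteratedFDeriv ℝ i f x = 0) {j l : ℕ}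
    (hjl : j + l = k + 1) :
    iteratedFDeriv ℝ j f =O[𝓝 x] fun y => ‖y - x‖ ^ l := by
  induction l generalizing j with
  | zero =>
    have : ContinuousAt (iteratedFDeriv ℝ j f) x :=
      (hf.iteratedFDeriv_right (m := 0) (by exact_mod_cast le_top)).continuousAt
    simpa using this.norm.isBoundedUnder_le.isBigO_one ℝ
  | succ l ih =>
    apply isBigO_pow_succ_of_fderiv
    · have : ContDiffAt ℝ 1 (iteratedFDeriv ℝ j f) x :=
        hf.iteratedFDeriv_right (by exact_mod_cast le_top)
      filter_upwards [this.eventually (by simp)] with y hy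
      exact hy.differentiableAt (by simp)
    · exact h j (by omega)
    · refine Asymptotics.IsBigO.of_norm_left ?_
      simp_rw [norm_fderiv_iteratedFDeriv]
      exact (ih (by omega)).norm_left

theorem isBigO_of_iteratedFDeriv_eq_zero {k : ℕ} {f : E → F} {x : E}
    (hf : ContDiffAt ℝ ∞ f x) (h : ∀ i ≤ k, iteratedFDeriv ℝ i f x = 0) :
    f =O[𝓝 x] fun y => ‖y - x‖ ^ (k + 1) := by
  refine Asymptotics.IsBigO.of_norm_left ?_
  have := (iteratedFDeriv_isBigO_of_eq_zero hf h (zero_add (k + 1))).norm_left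
  simpa only [norm_iteratedFDeriv_zero] using this

theorem ContinuousMultilinearMap.contDiff_diagonal {n : ℕ} (A : E [×n]→L[ℝ] F) {m : ℕ∞ω} :
    ContDiff ℝ m (fun y : E => A fun _ => y) :=
  A.contDiff.comp (contDiff_pi.2 fun _ => contDiff_id)

theorem iteratedFDeriv_diagonal_of_ne {n j : ℕ} (A : E [×n]→L[ℝ] F) (hj : j ≠ n) :
    iteratedFDeriv ℝ j (fun y : E => A fun _ => y) 0 = 0 := by
  have h1 := congrFun (iteratedFDeriv_comp_const_smul (i := j) (2 : ℝ)
    (A.contDiff_diagonal (m := (j : ℕ∞ω)))) 0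
  have h2 : (fun x : E => (fun y : E => A fun _ => y) ((2 : ℝ) • x)) =
      fun x => ((2 : ℝ) ^ n) • (fun y : E => A fun _ => y) x := by
    ext x
    simp only
    have := A.map_smul_univ (fun _ => (2 : ℝ)) (fun _ => x)
    simpa using this
  rw [h2] at h1
  erw [iteratedFDeriv_const_smul_apply (A.contDiff_diagonal.contDiffAt)] at h1
  simp only [smul_zero] at h1
  rw [← sub_eq_zero, ← sub_smul, smul_eq_zero] at h1
  rcases h1 with h1 | h1
  · exfalso
    rw [sub_eq_zero] at h1
    exact hj (pow_right_injective₀ (by norm_num : (0 : ℝ) < 2) (by norm_num) h1).symm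
  · exact h1

/-- The polynomial whose derivatives at `x` are the symmetric multilinear maps `A i`. -/
def taylorPoly {k : ℕ} (A : JetCoeff E F k) (x y : E) : F :=
  ∑ i : Fin (k + 1), ((i : ℕ).factorial : ℝ)⁻¹ • A i fun _ => y - x

theorem iteratedFDeriv_diagonal_self {n : ℕ} (A : E [×n]→L[ℝ] F)
    (hA : ∀ (σ : Equiv.Perm (Fin n)) v, A (v ∘ σ) = A v) :
    iteratedFDeriv ℝ n (fun y : E => A fun _ => y) 0 = (n.factorial : ℝ) • A := by
  ext v
  rw [ContinuousMultilinearMap.iteratedFDeriv_comp_diagonal]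
  have : ∀ σ : Equiv.Perm (Fin n), (A fun i => v (σ i)) = A v := fun σ => hA σ v
  simp only [this, Finset.sum_const, Finset.card_univ, Fintype.card_perm, Fintype.card_fin,
    smul_apply]
  rw [← Nat.cast_smul_eq_nsmul ℝ]

theorem contDiff_taylorPoly [CompleteSpace F] {k : ℕ} :
    ContDiff ℝ ∞ fun p : (E × JetCoeff E F k) × E => taylorPoly p.1.2 p.1.1 p.2 := by
  unfold taylorPoly
  refine ContDiff.sum fun i _ => contDiff_const.smul ?_
  have h : ContDiff ℝ ∞ fun q : (E [×(i : ℕ)]→L[ℝ] F) × (Fin i → E) => q.1 q.2 :=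
    contDiff_iff_contDiffAt.2 fun q => (ContinuousLinearMap.analyticAt_uncurry_of_multilinear
      (ContinuousLinearMap.id ℝ (E [×(i : ℕ)]→L[ℝ] F)) (x := q)).contDiffAt
  refine h.comp (ContDiff.prodMk ?_ ?_)
  · exact (ContinuousLinearMap.proj (R := ℝ) (φ := fun j : Fin (k + 1) => E [×(j : ℕ)]→L[ℝ] F)
      i).contDiff.comp (contDiff_snd.comp contDiff_fst)
  · exact contDiff_pi.2 fun _ => contDiff_snd.sub (contDiff_fst.comp contDiff_fst)

theorem iteratedFDeriv_taylorPoly {k : ℕ} (A : JetCoeff E F k) (x : E)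
    (hA : ∀ (i : Fin (k + 1)) (σ : Equiv.Perm (Fin i)) v, A i (v ∘ σ) = A i v)
    (i : Fin (k + 1)) : iteratedFDeriv ℝ i (taylorPoly A x) x = A i := by
  have h1 : taylorPoly A x = fun y => (fun z => ∑ j : Fin (k + 1),
      ((j : ℕ).factorial : ℝ)⁻¹ • A j fun _ => z) (y - x) := rfl
  rw [h1]
  erw [iteratedFDeriv_comp_sub (f := fun z : E => ∑ j : Fin (k + 1),
      ((j : ℕ).factorial : ℝ)⁻¹ • A j fun _ => z)]
  rw [sub_self, iteratedFDeriv_fun_sum_apply]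
  · rw [Finset.sum_eq_single i]
    · erw [iteratedFDeriv_const_smul_apply (A i).contDiff_diagonal.contDiffAt]
      rw [iteratedFDeriv_diagonal_self _ (hA i), smul_smul, inv_mul_cancel₀, one_smul]
      exact_mod_cast Nat.factorial_ne_zero _
    · intro j _ hj
      erw [iteratedFDeriv_const_smul_apply (A j).contDiff_diagonal.contDiffAt]
      rw [iteratedFDeriv_diagonal_of_ne, smul_zero]
      exact fun h => hj (Fin.ext h.symm)
    · simp
  · intro j _
    exact (contDiff_const.smul (A j).contDiff_diagonal).contDiffAt

theorem iteratedFDeriv_eq_zero_of_isBigO {k : ℕ} {f : E → F} {x : E}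
    (hf : ContDiffAt ℝ ∞ f x) (h : f =O[𝓝 x] fun y => ‖y - x‖ ^ (k + 1)) :
    ∀ i ≤ k, iteratedFDeriv ℝ i f x = 0 := by
  intro i
  induction i using Nat.strong_induction_on with
  | _ i ih =>
  intro hi
  set A := iteratedFDeriv ℝ i f x with hA
  have hsymm : ∀ (σ : Equiv.Perm (Fin i)) v, A (v ∘ σ) = A v := fun σ v =>
    iteratedFDeriv_comp_perm (hf.of_le (by exact_mod_cast le_top)) σ v
  set g : E → F := fun y => ((i.factorial : ℝ)⁻¹ • A) fun _ => y with hg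
  have hgc : ∀ {m : ℕ∞ω}, ContDiff ℝ m g := fun {m} =>
    ContinuousMultilinearMap.contDiff_diagonal _
  have hgx : ∀ {m : ℕ∞ω}, ContDiff ℝ m fun y => g (y - x) := fun {m} =>
    hgc.comp (contDiff_id.sub contDiff_const)
  have hd : ∀ j ≤ i, iteratedFDeriv ℝ j (f - fun y => g (y - x)) x = 0 := by
    intro j hj
    rw [iteratedFDeriv_sub_apply (hf.of_le (by exact_mod_cast le_top)) hgx.contDiffAt,
      iteratedFDeriv_comp_sub, sub_self]
    rcases hj.lt_or_eq with hj' | rfl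
    · rw [ih j hj' (by omega), iteratedFDeriv_diagonal_of_ne _ hj'.ne, sub_zero]
    · rw [iteratedFDeriv_diagonal_self, smul_smul, mul_inv_cancel₀, one_smul, sub_self]
      · exact_mod_cast Nat.factorial_ne_zero _
      · intro σ v
        simp only [smul_apply, hsymm]
  have h1 := isBigO_of_iteratedFDeriv_eq_zero (hf.sub hgx.contDiffAt) hd
  have h2 : (fun y => ‖y - x‖ ^ (k + 1)) =O[𝓝 x] fun y => ‖y - x‖ ^ (i + 1) := by
    have h3 : (fun y : E => ‖y - x‖ ^ (k + 1)) =
        fun y => ‖y - x‖ ^ (k - i) * ‖y - x‖ ^ (i + 1) := by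
      ext y; rw [← pow_add]; congr 1; omega
    rw [h3]
    have h4 : (fun y : E => ‖y - x‖ ^ (k - i)) =O[𝓝 x] fun _ => (1 : ℝ) := by
      have : ContinuousAt (fun y : E => ‖y - x‖ ^ (k - i)) x := by fun_prop
      simpa using this.norm.isBoundedUnder_le.isBigO_one ℝ
    simpa using h4.mul (Asymptotics.isBigO_refl (fun y : E => ‖y - x‖ ^ (i + 1)) (𝓝 x))
  have h3 : (fun y => g (y - x)) =O[𝓝 x] fun y => ‖y - x‖ ^ (i + 1) := by
    have := (h.trans h2).sub h1
    simpa using this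
  have hg0 : g = 0 := by
    ext v
    obtain ⟨C, hC0, hC⟩ := h3.exists_pos
    have hlim : Tendsto (fun t : ℝ => x + t • v) (𝓝[>] 0) (𝓝 x) := by
      have : ContinuousAt (fun t : ℝ => x + t • v) 0 := by fun_prop
      have h5 := this.tendsto
      simp only [zero_smul, add_zero] at h5
      exact h5.mono_left nhdsWithin_le_nhds
    have hb : ∀ᶠ t : ℝ in 𝓝[>] 0, ‖g v‖ ≤ C * ‖v‖ ^ (i + 1) * t := by
      filter_upwards [hlim.eventually hC.bound, self_mem_nhdsWithin] with t ht (htp : 0 < t)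
      simp only [add_sub_cancel_left] at ht
      have hsm : g (t • v) = t ^ i • g v := by
        have := ((i.factorial : ℝ)⁻¹ • A).map_smul_univ (fun _ => t) (fun _ => v)
        simpa [hg] using this
      rw [hsm, norm_smul, norm_smul, norm_pow, norm_pow, norm_mul] at ht
      rw [norm_norm, norm_norm, Real.norm_of_nonneg htp.le] at ht
      have hti : 0 < t ^ i := by positivity
      have : t ^ i * ‖g v‖ ≤ t ^ i * (C * ‖v‖ ^ (i + 1) * t) := by
        calc _ ≤ _ := ht
          _ = _ := by ring
      exact le_of_mul_le_mul_left this hti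
    have hl2 : Tendsto (fun t : ℝ => C * ‖v‖ ^ (i + 1) * t) (𝓝[>] 0) (𝓝 0) := by
      have : ContinuousAt (fun t : ℝ => C * ‖v‖ ^ (i + 1) * t) 0 := by fun_prop
      have h5 := this.tendsto
      simp only [mul_zero] at h5
      exact h5.mono_left nhdsWithin_le_nhds
    have := ge_of_tendsto hl2 hb
    simpa using this
  have h6 := hd i le_rfl
  have h7 : (f - fun y => g (y - x)) = f := by
    ext y; simp [hg0]
  rwa [h7] at h6

/-! ### Partial iterated derivatives -/

theorem iteratedFDeriv_partial {H : W × E → F} {p : W × E} {i : ℕ} (hH : ContDiffAt ℝ i H p) :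
    iteratedFDeriv ℝ i (fun z => H (p.1, z)) p.2 =
      (iteratedFDeriv ℝ i H p).compContinuousLinearMap
        fun _ => ContinuousLinearMap.inr ℝ W E := by
  set H' : W × E → F := fun q => H ((p.1, 0) + q) with hH'
  have hp : ((p.1, 0) + (0, p.2) : W × E) = p := by simp
  have hc : ContDiffAt ℝ i H' (0, p.2) := by
    have : ContDiffAt ℝ i H ((p.1, 0) + (0, p.2)) := by rwa [hp]
    exact this.comp (f := fun q : W × E => (p.1, 0) + q) (0, p.2)
      (contDiffAt_const.add contDiffAt_id)
  obtain ⟨u, hu, hcu⟩ := hc.contDiffOn (m := i) le_rfl (by simp)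
  obtain ⟨s, hsu, hs, hps⟩ := mem_nhds_iff.1 (by simpa using hu : u ∈ 𝓝 ((0, p.2) : W × E))
  have hs' : IsOpen (ContinuousLinearMap.inr ℝ W E ⁻¹' s) :=
    hs.preimage (ContinuousLinearMap.inr ℝ W E).continuous
  have h1 := ContinuousLinearMap.iteratedFDerivWithin_comp_right
    (ContinuousLinearMap.inr ℝ W E) (hcu.mono hsu) hs.uniqueDiffOn hs'.uniqueDiffOn
    (x := p.2) hps (i := i) le_rfl
  rw [iteratedFDerivWithin_of_isOpen i hs' (by exact hps),
    iteratedFDerivWithin_of_isOpen i hs (by exact hps)] at h1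
  have h2 : iteratedFDeriv ℝ i H' (ContinuousLinearMap.inr ℝ W E p.2) =
      iteratedFDeriv ℝ i H p := by
    rw [hH', iteratedFDeriv_comp_add_left]
    exact congrArg _ hp
  rw [h2] at h1
  rw [← h1]
  congr 1
  ext z
  simp [hH']

theorem eventually_iteratedFDeriv_partial {H : W × E → F} {p : W × E} {i : ℕ}
    (hH : ContDiffAt ℝ ∞ H p) :
    (fun q : W × E => iteratedFDeriv ℝ i (fun z => H (q.1, z)) q.2) =ᶠ[𝓝 p] fun q =>
      ContinuousMultilinearMap.compContinuousLinearMapL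
        (fun _ => ContinuousLinearMap.inr ℝ W E) (iteratedFDeriv ℝ i H q) := by
  have : ContDiffAt ℝ i H p := hH.of_le (by exact_mod_cast le_top)
  filter_upwards [this.eventually (by simp)] with q hq
  exact iteratedFDeriv_partial hq

theorem contDiffAt_iteratedFDeriv_partial {H : W × E → F} {p : W × E} (i : ℕ)
    (hH : ContDiffAt ℝ ∞ H p) :
    ContDiffAt ℝ ∞ (fun q : W × E => iteratedFDeriv ℝ i (fun z => H (q.1, z)) q.2) p := by
  refine ContDiffAt.congr_of_eventuallyEq ?_ (eventually_iteratedFDeriv_partial hH)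
  exact (ContinuousLinearMap.contDiff _).contDiffAt.comp p
    (hH.iteratedFDeriv_right (m := ∞) (by exact_mod_cast le_top))

theorem fderiv_iteratedFDeriv_partial {H : W × E → F} {p : W × E} (i : ℕ)
    (hH : ContDiffAt ℝ ∞ H p) :
    fderiv ℝ (fun q : W × E => iteratedFDeriv ℝ i (fun z => H (q.1, z)) q.2) p =
      (ContinuousMultilinearMap.compContinuousLinearMapL
        (fun _ => ContinuousLinearMap.inr ℝ W E)).comp (fderiv ℝ (iteratedFDeriv ℝ i H) p) := by
  rw [(eventually_iteratedFDeriv_partial hH).fderiv_eq]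
  have hd : DifferentiableAt ℝ (iteratedFDeriv ℝ i H) p :=
    (hH.iteratedFDeriv_right (m := ∞) (by exact_mod_cast le_top)).differentiableAt (by simp)
  exact ((ContinuousLinearMap.hasFDerivAt _).comp p hd.hasFDerivAt).fderiv

theorem fderiv_iteratedFDeriv_partial_inl {H : W × E → F} {p : W × E} (i : ℕ)
    (hH : ContDiffAt ℝ ∞ H p) (w : W) :
    fderiv ℝ (fun q : W × E => iteratedFDeriv ℝ i (fun z => H (q.1, z)) q.2) p (w, 0) =
      iteratedFDeriv ℝ i (fun z => fderiv ℝ H (p.1, z) (w, 0)) p.2 := by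
  have hD : ContDiffAt ℝ ∞ (fun q => fderiv ℝ H q (w, 0)) p :=
    (hH.fderiv_right (m := ∞) (by simp)).clm_apply contDiffAt_const
  rw [fderiv_iteratedFDeriv_partial i hH,
    iteratedFDeriv_partial (H := fun q => fderiv ℝ H q (w, 0))
      (hD.of_le (by exact_mod_cast le_top))]
  ext m
  have h1 := ContinuousLinearMap.iteratedFDeriv_comp_left (i := i)
    (ContinuousLinearMap.apply ℝ F ((w, 0) : W × E)) (hH.fderiv_right (m := ∞) (by simp))
    (by exact_mod_cast le_top)
  have h2 : (ContinuousLinearMap.apply ℝ F ((w, 0) : W × E)) ∘ fderiv ℝ H =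
      fun q => fderiv ℝ H q (w, 0) := rfl
  rw [← h2, h1]
  have h3 : iteratedFDeriv ℝ (i + 1) H p (Fin.cons (w, 0) fun j => (0, m j)) =
      fderiv ℝ (iteratedFDeriv ℝ i H) p (w, 0) fun j => (0, m j) := by
    rw [iteratedFDeriv_succ_apply_left]; simp
  have h4 : iteratedFDeriv ℝ (i + 1) H p (Fin.snoc (fun j => (0, m j)) (w, 0)) =
      iteratedFDeriv ℝ i (fderiv ℝ H) p (fun j => (0, m j)) (w, 0) := by
    rw [iteratedFDeriv_succ_apply_right]; simp
  have h5 : (Fin.snoc (fun j : Fin i => ((0, m j) : W × E)) (w, 0) : Fin (i + 1) → W × E) =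
      (Fin.cons (w, 0) fun j => (0, m j)) ∘ (finRotate (i + 1)) := by
    ext1 j
    refine Fin.lastCases ?_ (fun j => ?_) j
    · simp
    · simp
  rw [h5, iteratedFDeriv_comp_perm (hH.of_le (by exact_mod_cast le_top)), h3] at h4
  exact h4

theorem fderiv_iteratedFDeriv_partial_congr {H H' : W × E → F} {p : W × E} {i k : ℕ}
    (hH : ContDiffAt ℝ ∞ H p) (hH' : ContDiffAt ℝ ∞ H' p)
    (h : (fun q => H q - H' q) =O[𝓝 p] fun q => ‖q - p‖ ^ (k + 2)) (hi : i ≤ k) :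
    fderiv ℝ (fun q : W × E => iteratedFDeriv ℝ i (fun z => H (q.1, z)) q.2) p =
      fderiv ℝ (fun q : W × E => iteratedFDeriv ℝ i (fun z => H' (q.1, z)) q.2) p := by
  rw [fderiv_iteratedFDeriv_partial i hH, fderiv_iteratedFDeriv_partial i hH']
  congr 1
  have h0 := iteratedFDeriv_eq_zero_of_isBigO (hH.sub hH') h (i + 1) (by omega)
  change iteratedFDeriv ℝ (i + 1) (H - H') p = 0 at h0
  rw [iteratedFDeriv_sub_apply (hH.of_le (by exact_mod_cast le_top))
    (hH'.of_le (by exact_mod_cast le_top)), sub_eq_zero] at h0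
  refine ContinuousLinearMap.ext fun v => ContinuousMultilinearMap.ext fun m => ?_
  have := congrArg (fun L => L (Fin.cons v m)) h0
  simpa [iteratedFDeriv_succ_apply_left] using this

end Calculus

section Closeness

variable {X Y : Type*} {l : Filter X} {g : X → ℝ}
  {E H N : Type*} [NormedAddCommGroup E] [NormedSpace ℝ E] [TopologicalSpace H]
  [TopologicalSpace N] [ChartedSpace H N]
  {E' H' N' : Type*} [NormedAddCommGroup E'] [NormedSpace ℝ E'] [TopologicalSpace H']
  [TopologicalSpace N'] [ChartedSpace H' N']
  {E'' H'' N'' : Type*} [NormedAddCommGroup E''] [NormedSpace ℝ E''] [TopologicalSpace H'']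
  [TopologicalSpace N''] [ChartedSpace H'' N'']
  {I : ModelWithCorners ℝ E H} {I' : ModelWithCorners ℝ E' H'} {I'' : ModelWithCorners ℝ E'' H''}

/-- Two maps into a manifold which tend to `n` along `l` and whose difference in the preferred
chart at `n` is bounded by the gauge `g`. -/
structure ChartClose (I : ModelWithCorners ℝ E H) (l : Filter X) (g : X → ℝ) (n : N)
    (F F' : X → N) : Prop where
  tendsto_left : Tendsto F l (𝓝 n)
  tendsto_right : Tendsto F' l (𝓝 n)
  isBigO : (fun z => extChartAt I n (F z) - extChartAt I n (F' z)) =O[l] g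

namespace ChartClose

variable {n : N} {F F' F'' : X → N}

theorem of_eventuallyEq (h : Tendsto F l (𝓝 n)) (h' : F =ᶠ[l] F') : ChartClose I l g n F F' where
  tendsto_left := h
  tendsto_right := h.congr' h'
  isBigO := by
    refine (Asymptotics.isBigO_zero g l).congr' ?_ EventuallyEq.rfl
    filter_upwards [h'] with z hz
    rw [hz, sub_self]

theorem symm (h : ChartClose I l g n F F') : ChartClose I l g n F' F where
  tendsto_left := h.tendsto_right
  tendsto_right := h.tendsto_left
  isBigO := by
    refine h.isBigO.neg_left.congr_left fun z => ?_
    rw [neg_sub]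

theorem trans (h : ChartClose I l g n F F') (h' : ChartClose I l g n F' F'') :
    ChartClose I l g n F F'' where
  tendsto_left := h.tendsto_left
  tendsto_right := h'.tendsto_right
  isBigO := by
    refine (h.isBigO.add h'.isBigO).congr_left fun z => ?_
    abel

theorem congr' {G G' : X → N} (h : ChartClose I l g n F F') (hF : F =ᶠ[l] G) (hF' : F' =ᶠ[l] G') :
    ChartClose I l g n G G' :=
  ((of_eventuallyEq h.tendsto_left hF).symm.trans h).trans (of_eventuallyEq h.tendsto_right hF')

theorem mono {g' : X → ℝ} (h : ChartClose I l g n F F') (hg : g =O[l] g') :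
    ChartClose I l g' n F F' :=
  ⟨h.tendsto_left, h.tendsto_right, h.isBigO.trans hg⟩

theorem comp_tendsto {l' : Filter Y} {φ : Y → X} (h : ChartClose I l g n F F')
    (hφ : Tendsto φ l' l) : ChartClose I l' (g ∘ φ) n (F ∘ φ) (F' ∘ φ) :=
  ⟨h.tendsto_left.comp hφ, h.tendsto_right.comp hφ, h.isBigO.comp_tendsto hφ⟩

theorem map [I.Boundaryless] (h : ChartClose I l g n F F') {φ : N → N'}
    (hφ : ContMDiffAt I I' 1 φ n) :
    ChartClose I' l g (φ n) (fun z => φ (F z)) (fun z => φ (F' z)) where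
  tendsto_left := hφ.continuousAt.tendsto.comp h.tendsto_left
  tendsto_right := hφ.continuousAt.tendsto.comp h.tendsto_right
  isBigO := by
    have h1 := (contMDiffAt_iff.1 hφ).2
    rw [I.range_eq_univ, contDiffWithinAt_univ] at h1
    obtain ⟨K, t, ht, hK⟩ := h1.exists_lipschitzOnWith
    refine Asymptotics.IsBigO.trans ?_ h.isBigO
    refine Asymptotics.IsBigO.of_bound K ?_
    have hs := (extChartAt_source_mem_nhds (I := I) n)
    have hc : Tendsto (extChartAt I n) (𝓝 n) (𝓝 (extChartAt I n n)) :=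
      (continuousAt_extChartAt n).tendsto
    filter_upwards [h.tendsto_left.eventually hs, h.tendsto_right.eventually hs,
      (hc.comp h.tendsto_left).eventually ht, (hc.comp h.tendsto_right).eventually ht]
      with z h2 h3 h4 h5
    have := hK.norm_sub_le h4 h5
    simp only [Function.comp_apply] at this
    rwa [(extChartAt I n).left_inv h2, (extChartAt I n).left_inv h3] at this

theorem prodMk {n' : N'} {K K' : X → N'} (h : ChartClose I l g n F F')
    (h' : ChartClose I' l g n' K K') :
    ChartClose (I.prod I') l g (n, n') (fun z => (F z, K z)) (fun z => (F' z, K' z)) where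
  tendsto_left := h.tendsto_left.prodMk_nhds h'.tendsto_left
  tendsto_right := h.tendsto_right.prodMk_nhds h'.tendsto_right
  isBigO := by
    have := h.isBigO.prod_left h'.isBigO
    simpa [extChartAt_prod] using this

end ChartClose

/-- The distance from `z` to `x` in the preferred chart at `x`. -/
def chartGauge (I : ModelWithCorners ℝ E H) (x z : N) : ℝ :=
  ‖extChartAt I x z - extChartAt I x x‖

theorem chartGauge_isBigO [I.Boundaryless] {φ : N → N'} {n : N} (hφ : ContMDiffAt I I' 1 φ n) :
    (fun z => chartGauge I' (φ n) (φ z)) =O[𝓝 n] chartGauge I n := by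
  have h : ChartClose I (𝓝 n) (chartGauge I n) n id (fun _ => n) :=
    ⟨tendsto_id, tendsto_const_nhds, (Asymptotics.isBigO_refl
      (fun z => extChartAt I n z - extChartAt I n n) (𝓝 n)).norm_right⟩
  exact (h.map hφ).isBigO.norm_left

theorem ChartClose.comp_contMDiffAt [I'.Boundaryless] {n : N} {F F' : N' → N} {k : ℕ} {y : N''}
    [I''.Boundaryless] {φ : N'' → N'}
    (h : ChartClose I (𝓝 (φ y)) (fun z => chartGauge I' (φ y) z ^ k) n F F')
    (hφ : ContMDiffAt I'' I' 1 φ y) :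
    ChartClose I (𝓝 y) (fun z => chartGauge I'' y z ^ k) n (fun z => F (φ z))
      (fun z => F' (φ z)) :=
  (h.comp_tendsto hφ.continuousAt.tendsto).mono ((chartGauge_isBigO hφ).pow k)

theorem chartGauge_pow_isBigO {x : N} {j k : ℕ} (hjk : j ≤ k) :
    (fun z => chartGauge I x z ^ k) =O[𝓝 x] fun z => chartGauge I x z ^ j := by
  obtain ⟨m, rfl⟩ := Nat.exists_eq_add_of_le hjk
  have hc : ContinuousAt (fun z => chartGauge I x z ^ m) x := by
    unfold chartGauge
    exact (((continuousAt_extChartAt x).sub continuousAt_const).norm).pow m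
  have h1 : (fun z => chartGauge I x z ^ m) =O[𝓝 x] fun _ => (1 : ℝ) :=
    hc.norm.isBoundedUnder_le.isBigO_one ℝ
  have := (Asymptotics.isBigO_refl (fun z => chartGauge I x z ^ j) (𝓝 x)).mul h1
  simpa [pow_add] using this

end Closeness

section Coefficients

variable {EM EG M G W : Type*}
  [NormedAddCommGroup EM] [NormedSpace ℝ EM] [NormedAddCommGroup EG] [NormedSpace ℝ EG]
  [NormedAddCommGroup W] [NormedSpace ℝ W]
  [TopologicalSpace M] [ChartedSpace EM M] [TopologicalSpace G] [ChartedSpace EG G]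
  [IsManifold 𝓘(ℝ, EM) ∞ M] [IsManifold 𝓘(ℝ, EG) ∞ G]

open LieGroupoid

theorem contMDiffAt_extChartAt_symm' {x₀ : M} {e : EM} (he : e ∈ (extChartAt 𝓘(ℝ, EM) x₀).target) :
    ContMDiffAt 𝓘(ℝ, EM) 𝓘(ℝ, EM) ∞ (extChartAt 𝓘(ℝ, EM) x₀).symm e :=
  (contMDiffOn_extChartAt_symm x₀).contMDiffAt
    ((isOpen_extChartAt_target x₀).mem_nhds he)

theorem contMDiffAt_prod_extChartAt_symm {x₀ x : M} (hx : x ∈ (chartAt EM x₀).source) (w : W) :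
    ContMDiffAt (𝓘(ℝ, W).prod 𝓘(ℝ, EM)) (𝓘(ℝ, W).prod 𝓘(ℝ, EM)) ∞
      (fun p : W × EM => (p.1, (extChartAt 𝓘(ℝ, EM) x₀).symm p.2))
      (w, extChartAt 𝓘(ℝ, EM) x₀ x) := by
  have hx' : x ∈ (extChartAt 𝓘(ℝ, EM) x₀).source := by rwa [extChartAt_source]
  exact contMDiffAt_fst.prodMk (ContMDiffAt.comp (f := Prod.snd) (w, extChartAt 𝓘(ℝ, EM) x₀ x)
    (contMDiffAt_extChartAt_symm' ((extChartAt 𝓘(ℝ, EM) x₀).map_source hx')) contMDiffAt_snd)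

/-- A map `W × M → G` read in the preferred charts at `x₀` and `Z₀`. -/
def inCharts (x₀ : M) (Z₀ : G) (Φ : W × M → G) (p : W × EM) : EG :=
  extChartAt 𝓘(ℝ, EG) Z₀ (Φ (p.1, (extChartAt 𝓘(ℝ, EM) x₀).symm p.2))

theorem contDiffAt_inCharts {x₀ : M} {Z₀ : G} {Φ : W × M → G} {w : W} {x : M}
    (hΦ : ContMDiffAt (𝓘(ℝ, W).prod 𝓘(ℝ, EM)) 𝓘(ℝ, EG) ∞ Φ (w, x))
    (hx : x ∈ (chartAt EM x₀).source) (hZ : Φ (w, x) ∈ (chartAt EG Z₀).source) :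
    ContDiffAt ℝ ∞ (inCharts x₀ Z₀ Φ : W × EM → EG) (w, extChartAt 𝓘(ℝ, EM) x₀ x) := by
  have hx' : x ∈ (extChartAt 𝓘(ℝ, EM) x₀).source := by rwa [extChartAt_source]
  have h2 : (extChartAt 𝓘(ℝ, EM) x₀).symm (extChartAt 𝓘(ℝ, EM) x₀ x) = x :=
    (extChartAt 𝓘(ℝ, EM) x₀).left_inv hx'
  have h3 : ContMDiffAt (𝓘(ℝ, W).prod 𝓘(ℝ, EM)) 𝓘(ℝ, EG) ∞ (inCharts x₀ Z₀ Φ : W × EM → EG)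
      (w, extChartAt 𝓘(ℝ, EM) x₀ x) := by
    refine ContMDiffAt.comp (I' := 𝓘(ℝ, EG)) _ (contMDiffAt_extChartAt' ?_) (ContMDiffAt.comp
      (I' := 𝓘(ℝ, W).prod 𝓘(ℝ, EM)) _ ?_ (contMDiffAt_prod_extChartAt_symm hx w))
    · simpa only [h2] using hZ
    · simpa only [h2] using hΦ
  rw [← modelWithCornersSelf_prod, chartedSpaceSelf_prod] at h3
  exact h3.contDiffAt

/-- The derivatives of order `≤ k` of the maps `Φ (w, ·)` at the point with coordinates `e`. -/
def famCoeffs (k : ℕ) (x₀ : M) (Z₀ : G) (Φ : W × M → G) (p : W × EM) : JetCoeff EM EG k :=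
  fun i => iteratedFDeriv ℝ (i : ℕ) (fun e => inCharts x₀ Z₀ Φ (p.1, e)) p.2

theorem coeffs_eq_famCoeffs (k : ℕ) (x₀ : M) (Z₀ : G) (Φ : W × M → G) (w : W) (x : M) :
    (coeffs k x₀ Z₀ (fun z => Φ (w, z)) x : JetCoeff EM EG k) =
      famCoeffs k x₀ Z₀ Φ (w, extChartAt 𝓘(ℝ, EM) x₀ x) :=
  rfl

theorem contDiffAt_famCoeffs {k : ℕ} {x₀ : M} {Z₀ : G} {Φ : W × M → G} {w : W} {x : M}
    (hΦ : ContMDiffAt (𝓘(ℝ, W).prod 𝓘(ℝ, EM)) 𝓘(ℝ, EG) ∞ Φ (w, x))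
    (hx : x ∈ (chartAt EM x₀).source) (hZ : Φ (w, x) ∈ (chartAt EG Z₀).source) :
    ContDiffAt ℝ ∞ (famCoeffs k x₀ Z₀ Φ : W × EM → JetCoeff EM EG k) (w, extChartAt 𝓘(ℝ, EM) x₀ x) :=
  contDiffAt_pi.2 fun _ => contDiffAt_iteratedFDeriv_partial _ (contDiffAt_inCharts hΦ hx hZ)

theorem ChartClose.inCharts {m : ℕ} {x₀ : M} {Z₀ : G} {Φ Φ' : W × M → G} {w : W} {x : M}
    (h : ChartClose 𝓘(ℝ, EG) (𝓝 (w, x))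
      (fun p => chartGauge (𝓘(ℝ, W).prod 𝓘(ℝ, EM)) (w, x) p ^ m) (Φ (w, x)) Φ Φ')
    (hx : x ∈ (chartAt EM x₀).source) (hZ : Φ (w, x) ∈ (chartAt EG Z₀).source) :
    (fun p => (_root_.inCharts x₀ Z₀ Φ : W × EM → EG) p - _root_.inCharts x₀ Z₀ Φ' p)
      =O[𝓝 (w, extChartAt 𝓘(ℝ, EM) x₀ x)]
        fun p => ‖p - (w, extChartAt 𝓘(ℝ, EM) x₀ x)‖ ^ m := by
  have hx' : x ∈ (extChartAt 𝓘(ℝ, EM) x₀).source := by rwa [extChartAt_source]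
  have h1 := contMDiffAt_prod_extChartAt_symm hx w
  have h2 : (extChartAt 𝓘(ℝ, EM) x₀).symm (extChartAt 𝓘(ℝ, EM) x₀ x) = x :=
    (extChartAt 𝓘(ℝ, EM) x₀).left_inv hx'
  set φ := fun p : W × EM => (p.1, (extChartAt 𝓘(ℝ, EM) x₀).symm p.2) with hφ
  have h3 : φ (w, extChartAt 𝓘(ℝ, EM) x₀ x) = (w, x) := by simp only [hφ, h2]
  rw [← h3] at h
  have h4 := (h.comp_contMDiffAt (h1.of_le (by simp))).map (φ := extChartAt 𝓘(ℝ, EG) Z₀)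
    (I' := 𝓘(ℝ, EG)) (by rw [h3]; exact contMDiffAt_extChartAt' (n := 1) hZ)
  have h5 := h4.isBigO
  simpa [chartGauge, extChartAt_prod, chartAt_self_eq, _root_.inCharts, hφ] using h5

theorem ChartClose.fderiv_famCoeffs_eq {k : ℕ} {x₀ : M} {Z₀ : G} {Φ Φ' : W × M → G} {w : W}
    {x : M} (hΦ : ContMDiffAt (𝓘(ℝ, W).prod 𝓘(ℝ, EM)) 𝓘(ℝ, EG) ∞ Φ (w, x))
    (hΦ' : ContMDiffAt (𝓘(ℝ, W).prod 𝓘(ℝ, EM)) 𝓘(ℝ, EG) ∞ Φ' (w, x))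
    (h0 : Φ (w, x) = Φ' (w, x))
    (h : ChartClose 𝓘(ℝ, EG) (𝓝 (w, x))
      (fun p => chartGauge (𝓘(ℝ, W).prod 𝓘(ℝ, EM)) (w, x) p ^ (k + 2)) (Φ (w, x)) Φ Φ')
    (hx : x ∈ (chartAt EM x₀).source) (hZ : Φ (w, x) ∈ (chartAt EG Z₀).source) :
    fderiv ℝ (famCoeffs k x₀ Z₀ Φ : W × EM → JetCoeff EM EG k) (w, extChartAt 𝓘(ℝ, EM) x₀ x) =
      fderiv ℝ (famCoeffs k x₀ Z₀ Φ') (w, extChartAt 𝓘(ℝ, EM) x₀ x) := by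
  have h1 := contDiffAt_inCharts hΦ hx hZ
  have h2 := contDiffAt_inCharts hΦ' hx (h0 ▸ hZ)
  have hb := h.inCharts hx hZ
  have hd1 := fun i : Fin (k + 1) =>
    (contDiffAt_iteratedFDeriv_partial (i : ℕ) h1).differentiableAt (by simp)
  have hd2 := fun i : Fin (k + 1) =>
    (contDiffAt_iteratedFDeriv_partial (i : ℕ) h2).differentiableAt (by simp)
  unfold famCoeffs
  rw [fderiv_pi hd1, fderiv_pi hd2]
  congr 1
  ext1 i
  exact fderiv_iteratedFDeriv_partial_congr h1 h2 hb (by omega)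

theorem contDiffAt_comp_charts {x₀ : M} {Z₀ : G} {F : M → G} {x : M}
    (hF : ContMDiffAt 𝓘(ℝ, EM) 𝓘(ℝ, EG) ∞ F x)
    (hx : x ∈ (chartAt EM x₀).source) (hZ : F x ∈ (chartAt EG Z₀).source) :
    ContDiffAt ℝ ∞ (extChartAt 𝓘(ℝ, EG) Z₀ ∘ F ∘ (extChartAt 𝓘(ℝ, EM) x₀).symm)
      (extChartAt 𝓘(ℝ, EM) x₀ x) := by
  have h := contDiffAt_inCharts (W := ℝ) (w := 0) (Φ := fun p => F p.2)
    (ContMDiffAt.comp (I' := 𝓘(ℝ, EM)) (0, x) hF contMDiffAt_snd) hx hZ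
  exact h.comp (extChartAt 𝓘(ℝ, EM) x₀ x) (contDiffAt_const.prodMk contDiffAt_id)

theorem ChartClose.isBigO_comp_charts {m : ℕ} {x₀ : M} {Z₀ : G} {F F' : M → G} {x : M}
    (h : ChartClose 𝓘(ℝ, EG) (𝓝 x) (fun z => chartGauge 𝓘(ℝ, EM) x z ^ m) (F x) F F')
    (hx : x ∈ (chartAt EM x₀).source) (hZ : F x ∈ (chartAt EG Z₀).source) :
    (fun e => (extChartAt 𝓘(ℝ, EG) Z₀ ∘ F ∘ (extChartAt 𝓘(ℝ, EM) x₀).symm) e -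
      (extChartAt 𝓘(ℝ, EG) Z₀ ∘ F' ∘ (extChartAt 𝓘(ℝ, EM) x₀).symm) e)
      =O[𝓝 (extChartAt 𝓘(ℝ, EM) x₀ x)] fun e => ‖e - extChartAt 𝓘(ℝ, EM) x₀ x‖ ^ m := by
  have hx' : x ∈ (extChartAt 𝓘(ℝ, EM) x₀).source := by rwa [extChartAt_source]
  have h2 : (extChartAt 𝓘(ℝ, EM) x₀).symm (extChartAt 𝓘(ℝ, EM) x₀ x) = x :=
    (extChartAt 𝓘(ℝ, EM) x₀).left_inv hx'
  have h3 := ((show ChartClose 𝓘(ℝ, EG) (𝓝 ((extChartAt 𝓘(ℝ, EM) x₀).symm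
      (extChartAt 𝓘(ℝ, EM) x₀ x))) _ _ F F' by simpa only [h2] using h).comp_contMDiffAt
        (I'' := 𝓘(ℝ, EM)) ((contMDiffAt_extChartAt_symm'
        ((extChartAt 𝓘(ℝ, EM) x₀).map_source hx')).of_le (by simp))).map
        (contMDiffAt_extChartAt' (n := 1) hZ)
  simpa [chartGauge, chartAt_self_eq] using h3.isBigO

theorem ChartClose.coeffs_eq {k : ℕ} {x₀ : M} {Z₀ : G} {F F' : M → G} {x : M}
    (hF : ContMDiffAt 𝓘(ℝ, EM) 𝓘(ℝ, EG) ∞ F x) (hF' : ContMDiffAt 𝓘(ℝ, EM) 𝓘(ℝ, EG) ∞ F' x)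
    (h0 : F x = F' x)
    (h : ChartClose 𝓘(ℝ, EG) (𝓝 x) (fun z => chartGauge 𝓘(ℝ, EM) x z ^ (k + 1)) (F x) F F')
    (hx : x ∈ (chartAt EM x₀).source) (hZ : F x ∈ (chartAt EG Z₀).source) :
    (coeffs k x₀ Z₀ F x : JetCoeff EM EG k) = coeffs k x₀ Z₀ F' x := by
  have h1 := contDiffAt_comp_charts hF hx hZ
  have h2 := contDiffAt_comp_charts hF' hx (h0 ▸ hZ)
  ext1 i
  have h3 := iteratedFDeriv_eq_zero_of_isBigO (h1.sub h2) (h.isBigO_comp_charts hx hZ) i (by omega)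
  rwa [fun_iteratedFDeriv_sub_apply (h1.of_le (by exact_mod_cast le_top))
    (h2.of_le (by exact_mod_cast le_top)), sub_eq_zero] at h3

theorem chartClose_of_coeffs_eq {k : ℕ} {F F' : M → G} {x : M}
    (hF : ContMDiffAt 𝓘(ℝ, EM) 𝓘(ℝ, EG) ∞ F x) (hF' : ContMDiffAt 𝓘(ℝ, EM) 𝓘(ℝ, EG) ∞ F' x)
    (h0 : F x = F' x) {Z₀ : G} (hZ₀ : F x = Z₀)
    (h : (coeffs k x Z₀ F x : JetCoeff EM EG k) = coeffs k x Z₀ F' x) :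
    ChartClose 𝓘(ℝ, EG) (𝓝 x) (fun z => chartGauge 𝓘(ℝ, EM) x z ^ (k + 1)) Z₀ F F' := by
  subst hZ₀
  have h1 := contDiffAt_comp_charts hF (mem_chart_source EM x) (mem_chart_source EG (F x))
  have h2 := contDiffAt_comp_charts (Z₀ := F x) hF' (mem_chart_source EM x)
    (h0 ▸ mem_chart_source EG (F x))
  refine ⟨hF.continuousAt, by rw [h0]; exact hF'.continuousAt, ?_⟩
  have h3 := isBigO_of_iteratedFDeriv_eq_zero (k := k) (h1.sub h2) fun i hi => by
    rw [fun_iteratedFDeriv_sub_apply (h1.of_le (by exact_mod_cast le_top))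
      (h2.of_le (by exact_mod_cast le_top)), sub_eq_zero]
    exact congrFun h ⟨i, by omega⟩
  have h4 := h3.comp_tendsto (continuousAt_extChartAt (I := 𝓘(ℝ, EM)) x).tendsto
  refine h4.congr' ?_ (Eventually.of_forall fun z => rfl)
  filter_upwards [extChartAt_source_mem_nhds (I := 𝓘(ℝ, EM)) x] with z hz
  simp only [Function.comp_apply, (extChartAt 𝓘(ℝ, EM) x).left_inv hz]

theorem jet_eq_jet_iff {k : ℕ} {F F' : M → G} {x : M}
    (hF : ContMDiffAt 𝓘(ℝ, EM) 𝓘(ℝ, EG) ∞ F x) (hF' : ContMDiffAt 𝓘(ℝ, EM) 𝓘(ℝ, EG) ∞ F' x) :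
    (jet k F x : PreJet EM EG M G k) = jet k F' x ↔ F x = F' x ∧
      ChartClose 𝓘(ℝ, EG) (𝓝 x) (fun z => chartGauge 𝓘(ℝ, EM) x z ^ (k + 1)) (F x) F F' := by
  constructor
  · intro h
    have h0 : F x = F' x := congrArg PreJet.val h
    refine ⟨h0, chartClose_of_coeffs_eq hF hF' h0 rfl ?_⟩
    have := congrArg PreJet.coeff h
    simp only [jet] at this
    rw [this, h0]
  · rintro ⟨h0, h⟩
    refine PreJet.ext rfl h0 ?_
    simp only [jet, ← h0]
    exact h.coeffs_eq hF hF' h0 (mem_chart_source EM x) (mem_chart_source EG (F x))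

end Coefficients

section CloseComp

variable {X : Type*} {l : Filter X} {g : X → ℝ}
  {E H N : Type*} [NormedAddCommGroup E] [NormedSpace ℝ E] [TopologicalSpace H]
  [TopologicalSpace N] [ChartedSpace H N]
  {E' H' N' : Type*} [NormedAddCommGroup E'] [NormedSpace ℝ E'] [TopologicalSpace H']
  [TopologicalSpace N'] [ChartedSpace H' N']
  {I : ModelWithCorners ℝ E H} {I' : ModelWithCorners ℝ E' H'}

theorem ChartClose.comp [I.Boundaryless] [I'.Boundaryless] {n : N} {T T' : X → N} {F F' : N → N'}
    {m : ℕ} (hT : ChartClose I l g n T T') (hF : ContMDiffAt I I' 1 F n)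
    (hFF' : ChartClose I' (𝓝 n) (fun z => chartGauge I n z ^ m) (F n) F F')
    (hg : (fun z => chartGauge I n (T' z) ^ m) =O[l] g) :
    ChartClose I' l g (F n) (fun z => F (T z)) (fun z => F' (T' z)) :=
  (hT.map hF).trans ((hFF'.comp_tendsto hT.tendsto_right).mono hg)

end CloseComp

section SmoothNear

variable {E H N : Type*} [NormedAddCommGroup E] [NormedSpace ℝ E] [TopologicalSpace H]
  [TopologicalSpace N] [ChartedSpace H N]
  {E' H' N' : Type*} [NormedAddCommGroup E'] [NormedSpace ℝ E'] [TopologicalSpace H']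
  [TopologicalSpace N'] [ChartedSpace H' N']
  {E'' H'' N'' : Type*} [NormedAddCommGroup E''] [NormedSpace ℝ E''] [TopologicalSpace H'']
  [TopologicalSpace N''] [ChartedSpace H'' N'']
  {I : ModelWithCorners ℝ E H} {I' : ModelWithCorners ℝ E' H'} {I'' : ModelWithCorners ℝ E'' H''}

/-- The map `f` is smooth in a neighbourhood of `x`. -/
def SmoothNear (I : ModelWithCorners ℝ E H) (I' : ModelWithCorners ℝ E' H') (f : N → N') (x : N) :
    Prop :=
  ∀ᶠ z in 𝓝 x, ContMDiffAt I I' ∞ f z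

namespace SmoothNear

theorem contMDiffAt {f : N → N'} {x : N} (h : SmoothNear I I' f x) : ContMDiffAt I I' ∞ f x :=
  h.self_of_nhds

theorem continuousAt {f : N → N'} {x : N} (h : SmoothNear I I' f x) : ContinuousAt f x :=
  h.contMDiffAt.continuousAt

theorem tendsto {f : N → N'} {x : N} (h : SmoothNear I I' f x) : Tendsto f (𝓝 x) (𝓝 (f x)) :=
  h.continuousAt

theorem tendsto_of_eq {f : N → N'} {x : N} {y : N'} (h : SmoothNear I I' f x) (hy : f x = y) :
    Tendsto f (𝓝 x) (𝓝 y) := hy ▸ h.continuousAt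

theorem eventually {f : N → N'} {x : N} (h : SmoothNear I I' f x) :
    ∀ᶠ z in 𝓝 x, SmoothNear I I' f z := eventually_eventually_nhds.2 h

theorem comp {f : N → N'} {g : N' → N''} {x : N} (hg : SmoothNear I' I'' g (f x))
    (hf : SmoothNear I I' f x) : SmoothNear I I'' (fun z => g (f z)) x := by
  filter_upwards [hf, hf.tendsto.eventually hg] with z hz hz'
  exact hz'.comp z hz

theorem comp_of_eq {f : N → N'} {g : N' → N''} {x : N} {y : N'} (hg : SmoothNear I' I'' g y)
    (hf : SmoothNear I I' f x) (hy : f x = y) : SmoothNear I I'' (fun z => g (f z)) x := by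
  subst hy; exact hg.comp hf

theorem prodMk {f : N → N'} {g : N → N''} {x : N} (hf : SmoothNear I I' f x)
    (hg : SmoothNear I I'' g x) : SmoothNear I (I'.prod I'') (fun z => (f z, g z)) x := by
  filter_upwards [hf, hg] with z hz hz'
  exact hz.prodMk hz'

theorem congr_of_eventuallyEq {f f' : N → N'} {x : N} (hf : SmoothNear I I' f x)
    (h : f' =ᶠ[𝓝 x] f) : SmoothNear I I' f' x := by
  filter_upwards [hf, h.eventuallyEq_nhds] with z hz hz'
  exact hz.congr_of_eventuallyEq hz'

end SmoothNear

theorem ContMDiff.smoothNear {f : N → N'} (h : ContMDiff I I' ∞ f) (x : N) :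
    SmoothNear I I' f x := Eventually.of_forall fun z => h z

theorem ContMDiffOn.smoothNear {f : N → N'} {s : Set N} {x : N} (h : ContMDiffOn I I' ∞ f s)
    (hs : s ∈ 𝓝 x) : SmoothNear I I' f x := by
  filter_upwards [eventually_mem_nhds_iff.2 hs] with z hz
  exact h.contMDiffAt hz

theorem smoothNear_fst {x : N × N'} : SmoothNear (I.prod I') I Prod.fst x :=
  contMDiff_fst.smoothNear x

theorem smoothNear_snd {x : N × N'} : SmoothNear (I.prod I') I' Prod.snd x :=
  contMDiff_snd.smoothNear x

theorem smoothNear_id {x : N} : SmoothNear I I (fun z => z) x := contMDiff_id.smoothNear x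

theorem smoothNear_const {x : N} {c : N'} : SmoothNear I I' (fun _ => c) x :=
  contMDiff_const.smoothNear x

end SmoothNear

section Retraction

variable {EM EG M G : Type*}
  [NormedAddCommGroup EM] [NormedSpace ℝ EM] [NormedAddCommGroup EG] [NormedSpace ℝ EG]
  [TopologicalSpace M] [ChartedSpace EM M] [TopologicalSpace G] [ChartedSpace EG G]

theorem Manifold.IsSubmersionAt.exists_retraction {f : G → M} {Z₀ : G}
    (h : Manifold.IsSubmersionAt 𝓘(ℝ, EG) 𝓘(ℝ, EM) ∞ f Z₀) :
    ∃ r : M × G → G, SmoothNear (𝓘(ℝ, EM).prod 𝓘(ℝ, EG)) 𝓘(ℝ, EG) r (f Z₀, Z₀) ∧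
      (∀ᶠ p in 𝓝 (f Z₀, Z₀), f (r p) = p.1) ∧ ∀ᶠ Z in 𝓝 Z₀, r (f Z, Z) = Z := by
  have hw : ∀ e ∈ h.domChart.target, h.codChart (f (h.domChart.symm e)) = (h.equiv e).1 := by
    intro e he
    have he' : e ∈ (h.domChart.extend 𝓘(ℝ, EG)).target := by simpa using he
    simpa using h.writtenInCharts he'
  have hw' : ∀ Z ∈ h.domChart.source, h.codChart (f Z) = (h.equiv (h.domChart Z)).1 := by
    intro Z hZ
    have := hw _ (h.domChart.map_source hZ)
    rwa [h.domChart.left_inv hZ] at this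
  set q : M × G → EG := fun p => h.equiv.symm (h.codChart p.1, (h.equiv (h.domChart p.2)).2)
    with hq
  have hqZ : ∀ Z ∈ h.domChart.source, q (f Z, Z) = h.domChart Z := by
    intro Z hZ
    simp only [hq, hw' Z hZ, Prod.mk.eta, ContinuousLinearEquiv.symm_apply_apply]
  set s : Set (M × G) := h.codChart.source ×ˢ h.domChart.source with hs
  have hso : IsOpen s := h.codChart.open_source.prod h.domChart.open_source
  have hqs : ContMDiffOn (𝓘(ℝ, EM).prod 𝓘(ℝ, EG)) 𝓘(ℝ, EG) ∞ q s := by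
    have h1 : ContMDiffOn (𝓘(ℝ, EM).prod 𝓘(ℝ, EG)) 𝓘(ℝ, EM) ∞
        (fun p : M × G => h.codChart p.1) s :=
      (contMDiffOn_of_mem_maximalAtlas h.codChart_mem_maximalAtlas).comp
        contMDiffOn_fst fun p hp => hp.1
    have h2 : ContMDiffOn (𝓘(ℝ, EM).prod 𝓘(ℝ, EG)) 𝓘(ℝ, EG) ∞
        (fun p : M × G => h.domChart p.2) s :=
      (contMDiffOn_of_mem_maximalAtlas h.domChart_mem_maximalAtlas).comp
        contMDiffOn_snd fun p hp => hp.2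
    have h3 := h1.prodMk_space h2
    have h4 : ContDiff ℝ ∞ fun e : EM × EG => h.equiv.symm (e.1, (h.equiv e.2).2) :=
      h.equiv.symm.contDiff.comp (contDiff_fst.prodMk
        (contDiff_snd.comp (h.equiv.contDiff.comp contDiff_snd)))
    exact h4.contMDiff.comp_contMDiffOn h3
  have hmem : (f Z₀, Z₀) ∈ s := ⟨h.mem_codChart_source, h.mem_domChart_source⟩
  have hev : ∀ᶠ p in 𝓝 (f Z₀, Z₀), p ∈ s ∧ q p ∈ h.domChart.target := by
    refine Eventually.and (hso.mem_nhds hmem) ?_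
    have hc : ContinuousAt q (f Z₀, Z₀) := (hqs.contMDiffAt (hso.mem_nhds hmem)).continuousAt
    refine hc.eventually (h.domChart.open_target.mem_nhds ?_)
    rw [hqZ _ h.mem_domChart_source]
    exact h.domChart.map_source h.mem_domChart_source
  refine ⟨fun p => h.domChart.symm (q p), ?_, ?_, ?_⟩
  · filter_upwards [hev] with p hp
    exact (contMDiffAt_symm_of_mem_maximalAtlas h.domChart_mem_maximalAtlas hp.2).comp p
      (hqs.contMDiffAt (hso.mem_nhds hp.1))
  · filter_upwards [hev] with p hp
    apply h.codChart.injOn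
    · exact h.source_subset_preimage_source (h.domChart.map_target hp.2)
    · exact hp.1.1
    · rw [hw _ hp.2]
      simp [hq]
  · filter_upwards [h.domChart.open_source.mem_nhds h.mem_domChart_source] with Z hZ
    rw [hqZ Z hZ, h.domChart.left_inv hZ]

end Retraction

namespace LieGroupoid

section Product

variable {EM EG M G : Type*}
  [NormedAddCommGroup EM] [NormedSpace ℝ EM] [NormedAddCommGroup EG] [NormedSpace ℝ EG]
  [TopologicalSpace M] [ChartedSpace EM M] [TopologicalSpace G] [ChartedSpace EG G]
  (Γ : LieGroupoid EM EG M G)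
  {E H N : Type*} [NormedAddCommGroup E] [NormedSpace ℝ E] [TopologicalSpace H]
  [TopologicalSpace N] [ChartedSpace H N] {I : ModelWithCorners ℝ E H}

theorem contMDiff_src : ContMDiff 𝓘(ℝ, EG) 𝓘(ℝ, EM) ∞ Γ.src := fun X =>
  (Γ.submersion_src X).contMDiffAt

theorem contMDiff_tgt : ContMDiff 𝓘(ℝ, EG) 𝓘(ℝ, EM) ∞ Γ.tgt := fun X =>
  (Γ.submersion_tgt X).contMDiffAt

theorem contMDiffAt_mul {A B : N → G} {x : N} (hA : ContMDiffAt I 𝓘(ℝ, EG) ∞ A x)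
    (hB : ContMDiffAt I 𝓘(ℝ, EG) ∞ B x) (h : ∀ᶠ z in 𝓝 x, Γ.src (A z) = Γ.tgt (B z)) :
    ContMDiffAt I 𝓘(ℝ, EG) ∞ (fun z => Γ.mul (A z) (B z)) x := by
  have h1 := Γ.contMDiffOn_mul (A x, B x) h.self_of_nhds
  have h2 : ContMDiffWithinAt I (𝓘(ℝ, EG).prod 𝓘(ℝ, EG)) ∞ (fun z => (A z, B z))
      {z | Γ.src (A z) = Γ.tgt (B z)} x := (hA.prodMk hB).contMDiffWithinAt
  exact (ContMDiffWithinAt.comp x h1 h2 fun z hz => hz).contMDiffAt h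

theorem smoothNear_mul {A B : N → G} {x : N} (hA : SmoothNear I 𝓘(ℝ, EG) A x)
    (hB : SmoothNear I 𝓘(ℝ, EG) B x) (h : ∀ᶠ z in 𝓝 x, Γ.src (A z) = Γ.tgt (B z)) :
    SmoothNear I 𝓘(ℝ, EG) (fun z => Γ.mul (A z) (B z)) x := by
  filter_upwards [hA, hB, h.eventually_nhds] with z h1 h2 h3
  exact Γ.contMDiffAt_mul h1 h2 h3

/-- The product of composable pairs extends to a smooth map on a neighbourhood in `G × G`. -/
theorem exists_mul_extension {Y X : G} (h : Γ.src Y = Γ.tgt X) :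
    ∃ m : G × G → G, SmoothNear (𝓘(ℝ, EG).prod 𝓘(ℝ, EG)) 𝓘(ℝ, EG) m (Y, X) ∧
      ∀ᶠ p in 𝓝 (Y, X), Γ.src p.1 = Γ.tgt p.2 → m p = Γ.mul p.1 p.2 := by
  obtain ⟨r, hr, hr1, hr2⟩ := (Γ.submersion_src Y).exists_retraction
  have hι : SmoothNear (𝓘(ℝ, EG).prod 𝓘(ℝ, EG)) (𝓘(ℝ, EM).prod 𝓘(ℝ, EG))
      (fun p : G × G => (Γ.tgt p.2, p.1)) (Y, X) :=
    ((Γ.contMDiff_tgt.smoothNear _).comp smoothNear_snd).prodMk smoothNear_fst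
  have h0 : (fun p : G × G => (Γ.tgt p.2, p.1)) (Y, X) = (Γ.src Y, Y) := by simp [h]
  refine ⟨fun p => Γ.mul (r (Γ.tgt p.2, p.1)) p.2, ?_, ?_⟩
  · refine Γ.smoothNear_mul (hr.comp_of_eq hι h0) smoothNear_snd ?_
    exact (hι.tendsto_of_eq h0).eventually hr1
  · filter_upwards [continuousAt_fst.eventually hr2] with p hp hc
    simp only [← hc, hp]

theorem _root_.ChartClose.mul [IsManifold 𝓘(ℝ, EG) ∞ G] {Y : Type*} {l : Filter Y} {g : Y → ℝ}
    {A A' B B' : Y → G} {a b : G} (hA : ChartClose 𝓘(ℝ, EG) l g a A A')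
    (hB : ChartClose 𝓘(ℝ, EG) l g b B B') (hab : Γ.src a = Γ.tgt b)
    (h : ∀ᶠ z in l, Γ.src (A z) = Γ.tgt (B z)) (h' : ∀ᶠ z in l, Γ.src (A' z) = Γ.tgt (B' z)) :
    ChartClose 𝓘(ℝ, EG) l g (Γ.mul a b) (fun z => Γ.mul (A z) (B z))
      (fun z => Γ.mul (A' z) (B' z)) := by
  obtain ⟨m, hm, hm'⟩ := Γ.exists_mul_extension hab
  have h1 := (hA.prodMk hB).map (hm.contMDiffAt.of_le (m := 1) (by simp))
  have h0 : m (a, b) = Γ.mul a b := hm'.self_of_nhds hab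
  rw [h0] at h1
  refine h1.congr' ?_ ?_
  · filter_upwards [h, (hA.prodMk hB).tendsto_left.eventually hm'] with z hz hz'
    exact hz' hz
  · filter_upwards [h', (hA.prodMk hB).tendsto_right.eventually hm'] with z hz hz'
    exact hz' hz

end Product

section Germs

variable {EM EG M G : Type*}
  [NormedAddCommGroup EM] [NormedSpace ℝ EM] [NormedAddCommGroup EG] [NormedSpace ℝ EG]
  [TopologicalSpace M] [ChartedSpace EM M] [TopologicalSpace G] [ChartedSpace EG G]
  (Γ : LieGroupoid EM EG M G)

/-- The germ at `x` of a bisection `F`, with `g` a local inverse of its base map `tgt ∘ F`. -/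
structure IsBisectionGerm (F : M → G) (g : M → M) (x : M) : Prop where
  smooth : SmoothNear 𝓘(ℝ, EM) 𝓘(ℝ, EG) F x
  src_eq : ∀ᶠ z in 𝓝 x, Γ.src (F z) = z
  smooth_inv : SmoothNear 𝓘(ℝ, EM) 𝓘(ℝ, EM) g (Γ.tgt (F x))
  left_inv : ∀ᶠ z in 𝓝 x, g (Γ.tgt (F z)) = z
  right_inv : ∀ᶠ y in 𝓝 (Γ.tgt (F x)), Γ.tgt (F (g y)) = y

variable {Γ}

namespace IsBisectionGerm

variable {F H : M → G} {g h : M → M} {x : M}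

theorem smooth_base (hF : Γ.IsBisectionGerm F g x) :
    SmoothNear 𝓘(ℝ, EM) 𝓘(ℝ, EM) (fun z => Γ.tgt (F z)) x :=
  (Γ.contMDiff_tgt.smoothNear _).comp hF.smooth

theorem inv_apply (hF : Γ.IsBisectionGerm F g x) : g (Γ.tgt (F x)) = x :=
  hF.left_inv.self_of_nhds

theorem src_apply (hF : Γ.IsBisectionGerm F g x) : Γ.src (F x) = x :=
  hF.src_eq.self_of_nhds

theorem tendsto_inv (hF : Γ.IsBisectionGerm F g x) : Tendsto g (𝓝 (Γ.tgt (F x))) (𝓝 x) := by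
  have := hF.smooth_inv.tendsto
  rwa [hF.inv_apply] at this

theorem eventually (hF : Γ.IsBisectionGerm F g x) : ∀ᶠ z in 𝓝 x, Γ.IsBisectionGerm F g z := by
  filter_upwards [hF.smooth.eventually, hF.src_eq.eventually_nhds,
    hF.smooth_base.tendsto.eventually hF.smooth_inv.eventually, hF.left_inv.eventually_nhds,
    hF.smooth_base.tendsto.eventually hF.right_inv.eventually_nhds] with z h1 h2 h3 h4 h5
  exact ⟨h1, h2, h3, h4, h5⟩

theorem congr (hF : Γ.IsBisectionGerm F g x) (hFH : F =ᶠ[𝓝 x] H) : Γ.IsBisectionGerm H g x := by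
  have h0 : F x = H x := hFH.self_of_nhds
  refine ⟨hF.smooth.congr_of_eventuallyEq hFH.symm, ?_, h0 ▸ hF.smooth_inv, ?_, ?_⟩
  · filter_upwards [hF.src_eq, hFH] with z hz hz'
    rwa [← hz']
  · filter_upwards [hF.left_inv, hFH] with z hz hz'
    rwa [← hz']
  · rw [← h0]
    filter_upwards [hF.right_inv, hF.tendsto_inv.eventually hFH] with y hy hy'
    rwa [← hy']

theorem one (x : M) : Γ.IsBisectionGerm Γ.one id x where
  smooth := Γ.contMDiff_one.smoothNear x
  src_eq := Eventually.of_forall Γ.src_one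
  smooth_inv := smoothNear_id
  left_inv := Eventually.of_forall Γ.tgt_one
  right_inv := Eventually.of_forall Γ.tgt_one

theorem mul (hF : Γ.IsBisectionGerm F g x) (hH : Γ.IsBisectionGerm H h (Γ.tgt (F x))) :
    Γ.IsBisectionGerm (fun z => Γ.mul (H (Γ.tgt (F z))) (F z)) (fun y => g (h y)) x := by
  have hc : ∀ᶠ z in 𝓝 x, Γ.src (H (Γ.tgt (F z))) = Γ.tgt (F z) :=
    hF.smooth_base.tendsto.eventually hH.src_eq
  have ht : ∀ᶠ z in 𝓝 x, Γ.tgt (Γ.mul (H (Γ.tgt (F z))) (F z)) = Γ.tgt (H (Γ.tgt (F z))) := by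
    filter_upwards [hc] with z hz
    exact Γ.tgt_mul _ _ hz
  have ht0 := ht.self_of_nhds
  refine ⟨Γ.smoothNear_mul (hH.smooth.comp_of_eq hF.smooth_base rfl) hF.smooth hc, ?_, ?_, ?_, ?_⟩
  · filter_upwards [hc, hF.src_eq] with z hz hz'
    rw [Γ.src_mul _ _ hz, hz']
  · simp only [ht0]
    exact SmoothNear.comp_of_eq hF.smooth_inv hH.smooth_inv hH.inv_apply
  · filter_upwards [ht, hF.left_inv, hF.smooth_base.tendsto.eventually hH.left_inv]
      with z h1 h2 h3
    rw [h1, h3, h2]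
  · simp only [ht0]
    filter_upwards [hH.right_inv, hH.tendsto_inv.eventually hF.right_inv,
      (hF.tendsto_inv.comp hH.tendsto_inv).eventually ht] with y h1 h2 h3
    simp only [Function.comp_apply] at h3
    rw [h3, h2, h1]

theorem inv (hF : Γ.IsBisectionGerm F g x) :
    Γ.IsBisectionGerm (fun y => Γ.inv (F (g y))) (fun z => Γ.tgt (F z)) (Γ.tgt (F x)) := by
  have h0 : Γ.tgt (Γ.inv (F (g (Γ.tgt (F x))))) = x := by
    rw [hF.inv_apply, Γ.tgt_inv, hF.src_apply]
  refine ⟨?_, ?_, ?_, ?_, ?_⟩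
  · exact (Γ.contMDiff_inv.smoothNear _).comp (hF.smooth.comp_of_eq hF.smooth_inv hF.inv_apply)
  · filter_upwards [hF.right_inv] with y hy
    rw [Γ.src_inv, hy]
  · rw [h0]; exact hF.smooth_base
  · filter_upwards [hF.right_inv, hF.tendsto_inv.eventually hF.src_eq] with y h1 h2
    rw [Γ.tgt_inv, h2, h1]
  · rw [h0]
    filter_upwards [hF.left_inv, hF.src_eq] with z h1 h2
    rw [h1, Γ.tgt_inv, h2]

theorem exists_bisection (hF : Γ.IsBisectionGerm F g x) :
    ∃ B : Γ.Bisection, x ∈ B.base.source ∧ B.toFun = F := by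
  obtain ⟨U, hU, hUo, hxU⟩ := eventually_nhds_iff.1
    (hF.smooth.and (hF.src_eq.and hF.left_inv))
  obtain ⟨V, hV, hVo, hyV⟩ := eventually_nhds_iff.1 (hF.smooth_inv.and hF.right_inv)
  have hcU : ContinuousOn (fun z => Γ.tgt (F z)) U := fun z hz =>
    ((Γ.contMDiff_tgt.continuous.continuousAt).comp
      (hU z hz).1.continuousAt).continuousWithinAt
  have hcV : ContinuousOn g V := fun y hy => (hV y hy).1.continuousAt.continuousWithinAt
  let e : OpenPartialHomeomorph M M :=
    { toFun := fun z => Γ.tgt (F z)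
      invFun := g
      source := U ∩ (fun z => Γ.tgt (F z)) ⁻¹' V
      target := V ∩ g ⁻¹' U
      map_source' := fun z hz => ⟨hz.2, by
        simpa only [mem_preimage, (hU z hz.1).2.2] using hz.1⟩
      map_target' := fun y hy => ⟨hy.2, by
        simpa only [mem_preimage, (hV y hy.1).2] using hy.1⟩
      left_inv' := fun z hz => (hU z hz.1).2.2
      right_inv' := fun y hy => (hV y hy.1).2
      open_source := hcU.isOpen_inter_preimage hUo hVo
      open_target := hcV.isOpen_inter_preimage hVo hUo
      continuousOn_toFun := hcU.mono inter_subset_left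
      continuousOn_invFun := hcV.mono inter_subset_left }
  refine ⟨⟨F, e, fun z hz => (hU z hz.1).1.contMDiffWithinAt,
    fun y hy => (hV y hy.1).1.contMDiffWithinAt, fun z hz => (hU z hz.1).2.1,
    fun z _ => rfl⟩, ⟨hxU, hyV⟩, rfl⟩

end IsBisectionGerm

theorem Bisection.isBisectionGerm (B : Γ.Bisection) {x : M} (hx : x ∈ B.base.source) :
    Γ.IsBisectionGerm B.toFun B.base.symm x := by
  have hs := B.base.open_source.mem_nhds hx
  have ht : ∀ᶠ z in 𝓝 x, Γ.tgt (B.toFun z) = B.base z := by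
    filter_upwards [hs] with z hz using B.tgt_toFun z hz
  have h0 := B.base.open_target.mem_nhds (B.base.map_source hx)
  have ht0 := ht.self_of_nhds
  refine ⟨B.contMDiffOn_toFun.smoothNear hs, ?_, ?_, ?_, ?_⟩
  · filter_upwards [hs] with z hz using B.src_toFun z hz
  · rw [ht0]; exact B.contMDiffOn_symm.smoothNear h0
  · filter_upwards [ht, hs] with z hz hz'
    rw [hz, B.base.left_inv hz']
  · rw [ht0]
    filter_upwards [h0] with y hy
    rw [B.tgt_toFun _ (B.base.map_target hy), B.base.right_inv hy]

end Germs

section Jets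

theorem _root_.ChartClose.product {EM EG M G : Type*}
    [NormedAddCommGroup EM] [NormedSpace ℝ EM] [NormedAddCommGroup EG] [NormedSpace ℝ EG]
    [TopologicalSpace M] [ChartedSpace EM M] [TopologicalSpace G] [ChartedSpace EG G]
    [IsManifold 𝓘(ℝ, EG) ∞ G] {Γ : LieGroupoid EM EG M G}
    {X : Type*} {l : Filter X} {γ : X → ℝ} {A A' : X → G} {a : G} {m : ℕ} {H H' : M → G}
    (hA : ChartClose 𝓘(ℝ, EG) l γ a A A')
    (hH : ContMDiffAt 𝓘(ℝ, EM) 𝓘(ℝ, EG) ∞ H (Γ.tgt a))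
    (hs : ∀ᶠ z in 𝓝 (Γ.tgt a), Γ.src (H z) = z) (hs' : ∀ᶠ z in 𝓝 (Γ.tgt a), Γ.src (H' z) = z)
    (hHH' : ChartClose 𝓘(ℝ, EG) (𝓝 (Γ.tgt a))
      (fun z => chartGauge 𝓘(ℝ, EM) (Γ.tgt a) z ^ m) (H (Γ.tgt a)) H H')
    (hg : (fun z => chartGauge 𝓘(ℝ, EM) (Γ.tgt a) (Γ.tgt (A' z)) ^ m) =O[l] γ) :
    ChartClose 𝓘(ℝ, EG) l γ (Γ.mul (H (Γ.tgt a)) a) (fun z => Γ.mul (H (Γ.tgt (A z))) (A z))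
      (fun z => Γ.mul (H' (Γ.tgt (A' z))) (A' z)) := by
  have h1 := hA.map (Γ.contMDiff_tgt a |>.of_le (m := 1) (by simp))
  have h2 := h1.comp (hH.of_le (m := 1) (by simp)) hHH' hg
  exact h2.mul Γ hA hs.self_of_nhds (h1.tendsto_left.eventually hs)
    (h1.tendsto_right.eventually hs')

variable {EM EG M G : Type*}
  [NormedAddCommGroup EM] [NormedSpace ℝ EM] [NormedAddCommGroup EG] [NormedSpace ℝ EG]
  [TopologicalSpace M] [ChartedSpace EM M] [TopologicalSpace G] [ChartedSpace EG G]
  {Γ : LieGroupoid EM EG M G} {F H : M → G} {g h : M → M} {x : M} {k : ℕ}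

theorem IsBisectionGerm.jet_mem (hF : Γ.IsBisectionGerm F g x) (k : ℕ) : jet k F x ∈ Γ.jets k := by
  obtain ⟨B, hB, rfl⟩ := hF.exists_bisection
  exact ⟨B, hB, rfl⟩

theorem represents_rep {p : PreJet EM EG M G k} (hp : p ∈ Γ.jets k) : Γ.Represents (Γ.rep p) p :=
  Classical.epsilon_spec hp

theorem isBisectionGerm_rep {p : PreJet EM EG M G k} (hp : p ∈ Γ.jets k) :
    Γ.IsBisectionGerm (Γ.rep p).toFun (Γ.rep p).base.symm p.pt :=
  (Γ.rep p).isBisectionGerm (represents_rep hp).1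

theorem jet_rep {p : PreJet EM EG M G k} (hp : p ∈ Γ.jets k) :
    jet k (Γ.rep p).toFun p.pt = p := (represents_rep hp).2

theorem rep_apply {p : PreJet EM EG M G k} (hp : p ∈ Γ.jets k) :
    (Γ.rep p).toFun p.pt = p.val := congrArg PreJet.val (jet_rep hp)

variable [IsManifold 𝓘(ℝ, EM) ∞ M] [IsManifold 𝓘(ℝ, EG) ∞ G]

theorem IsBisectionGerm.rep_close (hF : Γ.IsBisectionGerm F g x) (k : ℕ) :
    ChartClose 𝓘(ℝ, EG) (𝓝 x) (fun z => chartGauge 𝓘(ℝ, EM) x z ^ (k + 1)) (F x)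
      F (Γ.rep (jet k F x)).toFun :=
  ((jet_eq_jet_iff hF.smooth.contMDiffAt
    (isBisectionGerm_rep (hF.jet_mem k)).smooth.contMDiffAt).1 (jet_rep (hF.jet_mem k)).symm).2

theorem jet_congr {F F' : M → G} {x : M} (h : F =ᶠ[𝓝 x] F') :
    (jet k F x : PreJet EM EG M G k) = jet k F' x := by
  refine PreJet.ext rfl h.self_of_nhds ?_
  simp only [jet, h.self_of_nhds]
  have hx : (extChartAt 𝓘(ℝ, EM) x).symm (extChartAt 𝓘(ℝ, EM) x x) = x := extChartAt_to_inv x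
  have hc := (continuousAt_extChartAt_symm (I := 𝓘(ℝ, EM)) x).tendsto
  rw [hx] at hc
  ext1 i
  simp only [coeffs, ← iteratedFDerivWithin_univ]
  refine Filter.EventuallyEq.iteratedFDerivWithin_eq ?_ ?_ i
  · rw [nhdsWithin_univ]
    filter_upwards [hc.eventually h] with e he
    simp only [Function.comp_apply, he]
  · simp only [Function.comp_apply, hx, h.self_of_nhds]

theorem jetChart_jet (hF : Γ.IsBisectionGerm F g x) {p₀ : PreJet EM EG M G k}
    (hx : x ∈ (chartAt EM p₀.pt).source) (hZ : F x ∈ (chartAt EG p₀.val).source) :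
    Γ.jetChart p₀ (jet k F x) = (extChartAt 𝓘(ℝ, EM) p₀.pt x, coeffs k p₀.pt p₀.val F x) := by
  have h1 := isBisectionGerm_rep (hF.jet_mem k)
  have h2 := hF.rep_close k
  refine Prod.ext rfl ?_
  exact (h2.coeffs_eq hF.smooth.contMDiffAt h1.smooth.contMDiffAt
    (rep_apply (hF.jet_mem k)).symm hx hZ).symm

theorem jetMul_jet {F H : M → G} {g h : M → M} {x : M} (hF : Γ.IsBisectionGerm F g x)
    (hH : Γ.IsBisectionGerm H h (Γ.tgt (F x))) (k : ℕ) :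
    Γ.jetMul (jet k H (Γ.tgt (F x))) (jet k F x) =
      jet k (fun z => Γ.mul (H (Γ.tgt (F z))) (F z)) x := by
  have hR := isBisectionGerm_rep (hF.jet_mem k)
  have hS := isBisectionGerm_rep (hH.jet_mem k)
  have hRx : (Γ.rep (jet k F x)).toFun x = F x := rep_apply (hF.jet_mem k)
  have hSx : (Γ.rep (jet k H (Γ.tgt (F x)))).toFun (Γ.tgt (F x)) = H (Γ.tgt (F x)) :=
    rep_apply (hH.jet_mem k)
  have hS' : Γ.IsBisectionGerm (Γ.rep (jet k H (Γ.tgt (F x)))).toFun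
      (Γ.rep (jet k H (Γ.tgt (F x)))).base.symm
      (Γ.tgt ((Γ.rep (jet k F x)).toFun x)) := by rw [hRx]; exact hS
  have h1 := hF.mul hH
  have h2 := IsBisectionGerm.mul (x := x) hR hS'
  refine ((jet_eq_jet_iff h1.smooth.contMDiffAt h2.smooth.contMDiffAt).2 ⟨?_, ?_⟩).symm
  · simp only [hRx, hSx]
  · refine (hF.rep_close k).product hH.smooth.contMDiffAt hH.src_eq hS.src_eq
      (hH.rep_close k) ?_
    have := (chartGauge_isBigO (I := 𝓘(ℝ, EM)) (I' := 𝓘(ℝ, EM)) (n := x)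
      (hR.smooth_base.contMDiffAt.of_le (m := 1) (by simp))).pow (k + 1)
    rw [hRx] at this
    exact this

theorem jetInv_jet {F : M → G} {g : M → M} {x : M} (hF : Γ.IsBisectionGerm F g x) (k : ℕ) :
    Γ.jetInv (jet k F x) = jet k (fun y => Γ.inv (F (g y))) (Γ.tgt (F x)) := by
  have hR := isBisectionGerm_rep (hF.jet_mem k)
  have hRx : (Γ.rep (jet k F x)).toFun x = F x := rep_apply (hF.jet_mem k)
  set R := (Γ.rep (jet k F x)).toFun with hRdef
  set gR : M → M := ⇑(Γ.rep (jet k F x)).base.symm with hgR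
  have hR0 : Γ.IsBisectionGerm R gR x := hR
  have hRi := hR0.inv
  rw [hRx] at hRi
  have hinvR : gR (Γ.tgt (F x)) = x := by rw [← hRx]; exact hR0.inv_apply
  refine ((jet_eq_jet_iff hF.inv.smooth.contMDiffAt hRi.smooth.contMDiffAt).2 ⟨?_, ?_⟩).symm
  · rw [hF.inv_apply, hinvR, hRx]
  · have hg1 : ContMDiffAt 𝓘(ℝ, EM) 𝓘(ℝ, EM) 1 g (Γ.tgt (F x)) :=
      hF.smooth_inv.contMDiffAt.of_le (by simp)
    have hgR1 : ContMDiffAt 𝓘(ℝ, EM) 𝓘(ℝ, EM) 1 gR (Γ.tgt (F x)) := by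
      rw [← hRx]; exact hR0.smooth_inv.contMDiffAt.of_le (by simp)
    have hc := hF.rep_close k
    -- the inverses of the base maps are close
    have h1 := hc.map (Γ.contMDiff_tgt (F x) |>.of_le (m := 1) (by simp))
    have h2 := h1.map hgR1
    rw [hinvR] at h2
    have h3 := (show ChartClose 𝓘(ℝ, EM) (𝓝 (g (Γ.tgt (F x)))) (fun z =>
      chartGauge 𝓘(ℝ, EM) (g (Γ.tgt (F x))) z ^ (k + 1)) x _ _ by
        rw [hF.inv_apply]; exact h2).comp_contMDiffAt hg1
    have h4 : ChartClose 𝓘(ℝ, EM) (𝓝 (Γ.tgt (F x)))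
        (fun z => chartGauge 𝓘(ℝ, EM) (Γ.tgt (F x)) z ^ (k + 1)) x g gR := by
      refine h3.symm.congr' ?_ ?_
      · exact hF.tendsto_inv.eventually hR0.left_inv
      · filter_upwards [hF.right_inv] with y hy
        rw [hy]
    have h5 := h4.comp (hF.smooth.contMDiffAt.of_le (m := 1) (by simp)) hc (by
      have := (chartGauge_isBigO (I := 𝓘(ℝ, EM)) (I' := 𝓘(ℝ, EM)) hgR1).pow (k + 1)
      rwa [hinvR] at this)
    have h6 := h5.map (Γ.contMDiff_inv (F x) |>.of_le (m := 1) (by simp))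
    rw [hF.inv_apply]
    exact h6

end Jets

end LieGroupoid

section PlainDerivative

variable {E H N : Type*} [NormedAddCommGroup E] [NormedSpace ℝ E] [TopologicalSpace H]
  [TopologicalSpace N] [ChartedSpace H N]
  {E' H' N' : Type*} [NormedAddCommGroup E'] [NormedSpace ℝ E'] [TopologicalSpace H']
  [TopologicalSpace N'] [ChartedSpace H' N']
  {E'' H'' N'' : Type*} [NormedAddCommGroup E''] [NormedSpace ℝ E''] [TopologicalSpace H'']
  [TopologicalSpace N''] [ChartedSpace H'' N'']
  {I : ModelWithCorners ℝ E H} {I' : ModelWithCorners ℝ E' H'} {I'' : ModelWithCorners ℝ E'' H''}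

/-- The differential of `f` at `x`, as a linear map between the model vector spaces. -/
def mderiv (I : ModelWithCorners ℝ E H) (I' : ModelWithCorners ℝ E' H') (f : N → N') (x : N) :
    E →L[ℝ] E' := mfderiv I I' f x

theorem mderiv_comp {f : N → N'} {g : N' → N''} {x : N} {y : N'}
    (hg : MDifferentiableAt I' I'' g y) (hf : MDifferentiableAt I I' f x) (hy : f x = y) :
    mderiv I I'' (fun z => g (f z)) x = (mderiv I' I'' g y).comp (mderiv I I' f x) := by
  subst hy
  exact mfderiv_comp x hg hf

theorem mderiv_comp_apply {f : N → N'} {g : N' → N''} {x : N} {y : N'}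
    (hg : MDifferentiableAt I' I'' g y) (hf : MDifferentiableAt I I' f x) (hy : f x = y) (v : E) :
    mderiv I I'' (fun z => g (f z)) x v = mderiv I' I'' g y (mderiv I I' f x v) := by
  rw [mderiv_comp hg hf hy]; rfl

theorem mderiv_congr {f f' : N → N'} {x : N} (h : f =ᶠ[𝓝 x] f') :
    mderiv I I' f x = mderiv I I' f' x := h.mfderiv_eq

theorem mderiv_prodMk {f : N → N'} {g : N → N''} {x : N} (hf : MDifferentiableAt I I' f x)
    (hg : MDifferentiableAt I I'' g x) :
    mderiv I (I'.prod I'') (fun z => (f z, g z)) x = (mderiv I I' f x).prod (mderiv I I'' g x) :=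
  mfderiv_prodMk hf hg

theorem mderiv_id {x : N} : mderiv I I (fun z => z) x = ContinuousLinearMap.id ℝ E := mfderiv_id

theorem mderiv_const {x : N} {c : N'} : mderiv I I' (fun _ => c) x = 0 := mfderiv_const

theorem mderiv_fst {x : N × N'} :
    mderiv (I.prod I') I Prod.fst x = ContinuousLinearMap.fst ℝ E E' := mfderiv_fst

theorem mderiv_snd {x : N × N'} :
    mderiv (I.prod I') I' Prod.snd x = ContinuousLinearMap.snd ℝ E E' := mfderiv_snd

theorem mderiv_eq_fderiv {f : E → E'} {x : E} : mderiv 𝓘(ℝ, E) 𝓘(ℝ, E') f x = fderiv ℝ f x :=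
  mfderiv_eq_fderiv

theorem mderiv_prod_apply {f : N × N' → N''} {x : N} {y : N'}
    (hf : MDifferentiableAt (I.prod I') I'' f (x, y)) (a : E) (b : E') :
    mderiv (I.prod I') I'' f (x, y) (a, b) =
      mderiv I I'' (fun z => f (z, y)) x a + mderiv I' I'' (fun z => f (x, z)) y b := by
  have h1 := mderiv_comp (f := fun z : N => (z, y)) (x := x) hf
    (mdifferentiableAt_id.prodMk mdifferentiableAt_const) rfl
  have h2 := mderiv_comp (f := fun z : N' => (x, z)) (x := y) hf
    (mdifferentiableAt_const.prodMk mdifferentiableAt_id) rfl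
  rw [h1, h2, mderiv_prodMk (f := fun z : N => z) mdifferentiableAt_id mdifferentiableAt_const,
    mderiv_prodMk (g := fun z : N' => z) mdifferentiableAt_const mdifferentiableAt_id, mderiv_id,
    mderiv_id, mderiv_const, mderiv_const]
  simp only [ContinuousLinearMap.comp_apply, ContinuousLinearMap.prod_apply,
    ContinuousLinearMap.id_apply, zero_apply, ← map_add, Prod.mk_add_mk,
    add_zero, zero_add]

end PlainDerivative

section InverseFunction

theorem ContDiffAt.exists_local_inverse {E E' : Type*} [NormedAddCommGroup E] [NormedSpace ℝ E]
    [NormedAddCommGroup E'] [NormedSpace ℝ E'] [CompleteSpace E] {q : E → E'} {e : E}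
    (hq : ∀ᶠ z in 𝓝 e, ContDiffAt ℝ ∞ q z) (h : (fderiv ℝ q e).IsInvertible) :
    ∃ R : E' → E, (∀ᶠ y in 𝓝 (q e), ContDiffAt ℝ ∞ R y) ∧ R (q e) = e ∧
      (∀ᶠ z in 𝓝 e, R (q z) = z) ∧ ∀ᶠ y in 𝓝 (q e), q (R y) = y := by
  obtain ⟨L, hL⟩ := h
  have hq0 := hq.self_of_nhds
  have hd : HasFDerivAt q (L : E →L[ℝ] E') e := by
    rw [hL]; exact (hq0.differentiableAt (by simp)).hasFDerivAt
  set φ := hq0.toOpenPartialHomeomorph q hd (by simp) with hφ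
  have hφq : ⇑φ = q := hq0.toOpenPartialHomeomorph_coe hd (by simp)
  have he : e ∈ φ.source := hq0.mem_toOpenPartialHomeomorph_source hd (by simp)
  have hqe : q e ∈ φ.target := hq0.image_mem_toOpenPartialHomeomorph_target hd (by simp)
  have hinv : φ.symm (q e) = e := by rw [← hφq]; exact φ.left_inv he
  have hc : ContinuousAt (fderiv ℝ q) e :=
    (hq0.fderiv_right (m := 0) (by exact_mod_cast le_top)).continuousAt
  have hiso : ∀ᶠ z in 𝓝 e, ∃ L' : E ≃L[ℝ] E', (L' : E →L[ℝ] E') = fderiv ℝ q z := by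
    have := hc.eventually (by rw [← hL]; exact ContinuousLinearEquiv.nhds L)
    filter_upwards [this] with z hz using hz
  have hcs : Tendsto φ.symm (𝓝 (q e)) (𝓝 e) := by
    have := (φ.continuousAt_symm hqe).tendsto
    rwa [hinv] at this
  refine ⟨φ.symm, ?_, hinv, ?_, ?_⟩
  · filter_upwards [hcs.eventually (hiso.and hq), φ.open_target.mem_nhds hqe] with y hy hyt
    obtain ⟨⟨L', hL'⟩, hyq⟩ := hy
    refine φ.contDiffAt_symm hyt (f₀' := L') ?_ ?_
    · rw [hφq, hL']; exact (hyq.differentiableAt (by simp)).hasFDerivAt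
    · rw [hφq]; exact hyq
  · filter_upwards [φ.open_source.mem_nhds he] with z hz
    rw [← hφq]; exact φ.left_inv hz
  · filter_upwards [φ.open_target.mem_nhds hqe] with y hy
    rw [← hφq]; exact φ.right_inv hy

variable {E H N : Type*} [NormedAddCommGroup E] [NormedSpace ℝ E] [TopologicalSpace H]
  [TopologicalSpace N] [ChartedSpace H N]
  {E' H' N' : Type*} [NormedAddCommGroup E'] [NormedSpace ℝ E'] [TopologicalSpace H']
  [TopologicalSpace N'] [ChartedSpace H' N']
  {I : ModelWithCorners ℝ E H} {I' : ModelWithCorners ℝ E' H'}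

theorem smoothNear_extChartAt [IsManifold I ∞ N] {x z : N} (hz : z ∈ (extChartAt I x).source) :
    SmoothNear I 𝓘(ℝ, E) (extChartAt I x) z := by
  filter_upwards [(isOpen_extChartAt_source x).mem_nhds hz] with y hy
  exact contMDiffAt_extChartAt' (by rwa [extChartAt_source] at hy)

theorem smoothNear_extChartAt_symm [I.Boundaryless] [IsManifold I ∞ N] {x : N} {e : E}
    (he : e ∈ (extChartAt I x).target) :
    SmoothNear 𝓘(ℝ, E) I (extChartAt I x).symm e :=
  (contMDiffOn_extChartAt_symm x).smoothNear ((isOpen_extChartAt_target x).mem_nhds he)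

theorem SmoothNear.contDiffAt {f : E → E'} {x : E} (h : SmoothNear 𝓘(ℝ, E) 𝓘(ℝ, E') f x) :
    ContDiffAt ℝ ∞ f x := h.contMDiffAt.contDiffAt

theorem smoothNear_iff_contDiffAt {f : E → E'} {x : E} :
    SmoothNear 𝓘(ℝ, E) 𝓘(ℝ, E') f x ↔ ∀ᶠ z in 𝓝 x, ContDiffAt ℝ ∞ f z := by
  simp only [SmoothNear, contMDiffAt_iff_contDiffAt]

theorem SmoothNear.mdifferentiableAt {f : N → N'} {x : N} (h : SmoothNear I I' f x) :
    MDifferentiableAt I I' f x := h.contMDiffAt.mdifferentiableAt (by simp)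

/-- The inverse function theorem. -/
theorem SmoothNear.exists_local_inverse [I.Boundaryless] [I'.Boundaryless] [IsManifold I ∞ N]
    [IsManifold I' ∞ N'] [CompleteSpace E] {Q : N → N'} {n : N} (hQ : SmoothNear I I' Q n)
    (h : (mderiv I I' Q n).IsInvertible) :
    ∃ R : N' → N, SmoothNear I' I R (Q n) ∧ R (Q n) = n ∧ (∀ᶠ z in 𝓝 n, R (Q z) = z) ∧
      ∀ᶠ y in 𝓝 (Q n), Q (R y) = y := by
  set φ := extChartAt I n
  set ψ := extChartAt I' (Q n)
  set q : E → E' := fun e => ψ (Q (φ.symm e)) with hqdef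
  have hφn : φ.symm (φ n) = n := extChartAt_to_inv n
  have hψn : ψ.symm (ψ (Q n)) = Q n := extChartAt_to_inv (Q n)
  have hq : SmoothNear 𝓘(ℝ, E) 𝓘(ℝ, E') q (φ n) :=
    (smoothNear_extChartAt (mem_extChartAt_source (Q n))).comp_of_eq (hQ.comp_of_eq
      (smoothNear_extChartAt_symm (mem_extChartAt_target n)) hφn) (by rw [hφn])
  have hqn : q (φ n) = ψ (Q n) := by simp only [hqdef, hφn]
  have hd : fderiv ℝ q (φ n) = mderiv I I' Q n := by
    rw [mderiv, hQ.mdifferentiableAt.mfderiv, I.range_eq_univ, fderivWithin_univ]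
    rfl
  obtain ⟨R, hR, hR0, hR1, hR2⟩ := ContDiffAt.exists_local_inverse
    (smoothNear_iff_contDiffAt.1 hq) (by rw [hd]; exact h)
  rw [hqn] at hR hR0 hR2
  have hR' : SmoothNear I' 𝓘(ℝ, E) (fun y => R (ψ y)) (Q n) :=
    (smoothNear_iff_contDiffAt.2 hR).comp_of_eq
      (smoothNear_extChartAt (mem_extChartAt_source (Q n))) rfl
  have hRn : φ.symm (R (ψ (Q n))) = n := by rw [hR0, hφn]
  have hRs : SmoothNear I' I (fun y => φ.symm (R (ψ y))) (Q n) :=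
    (smoothNear_extChartAt_symm (mem_extChartAt_target n)).comp_of_eq hR' hR0
  refine ⟨fun y => φ.symm (R (ψ y)), hRs, hRn, ?_, ?_⟩
  · have h1 := (continuousAt_extChartAt (I := I) n).eventually hR1
    filter_upwards [h1, extChartAt_source_mem_nhds (I := I) n] with z hz hzs
    simp only [hqdef] at hz
    rw [φ.left_inv hzs] at hz
    rw [hz, φ.left_inv hzs]
  · have h1 := (continuousAt_extChartAt (I := I') (Q n)).eventually hR2
    have h2 := hRs.tendsto_of_eq hRn |>.eventually
      (hQ.continuousAt.eventually (extChartAt_source_mem_nhds (I := I') (Q n)))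
    filter_upwards [h1, h2, extChartAt_source_mem_nhds (I := I') (Q n)] with y hy h2 hys
    have := congrArg ψ.symm hy
    rwa [ψ.left_inv hys, ψ.left_inv h2] at this

end InverseFunction

section Slices

variable {E H N : Type*} [NormedAddCommGroup E] [NormedSpace ℝ E] [TopologicalSpace H]
  [TopologicalSpace N] [ChartedSpace H N]
  {E' H' N' : Type*} [NormedAddCommGroup E'] [NormedSpace ℝ E'] [TopologicalSpace H']
  [TopologicalSpace N'] [ChartedSpace H' N']
  {E'' H'' N'' : Type*} [NormedAddCommGroup E''] [NormedSpace ℝ E''] [TopologicalSpace H'']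
  [TopologicalSpace N''] [ChartedSpace H'' N'']
  {I : ModelWithCorners ℝ E H} {I' : ModelWithCorners ℝ E' H'} {I'' : ModelWithCorners ℝ E'' H''}

theorem smoothNear_mk_left {x : N} {y : N'} :
    SmoothNear I' (I.prod I') (fun z => (x, z)) y := smoothNear_const.prodMk smoothNear_id

theorem tendsto_mk_left {x : N} {y : N'} : Tendsto (fun z => (x, z)) (𝓝 y) (𝓝 (x, y)) :=
  (Continuous.prodMk_right x).tendsto y

theorem SmoothNear.slice {f : N × N' → N''} {p : N × N'} (h : SmoothNear (I.prod I') I'' f p) :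
    SmoothNear I' I'' (fun z => f (p.1, z)) p.2 :=
  SmoothNear.comp_of_eq h (smoothNear_mk_left (I := I)) rfl

/-- The implicit function theorem: a smooth family of maps is a smooth family of local
diffeomorphisms near a point where the partial derivative is invertible. -/
theorem SmoothNear.exists_family_inverse [I.Boundaryless] [I'.Boundaryless] [I''.Boundaryless]
    [IsManifold I ∞ N] [IsManifold I' ∞ N'] [IsManifold I'' ∞ N''] [CompleteSpace E]
    [CompleteSpace E'] {T : N × N' → N''} {p : N × N'} (hT : SmoothNear (I.prod I') I'' T p)
    (h : (mderiv I' I'' (fun z => T (p.1, z)) p.2).IsInvertible) :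
    ∃ g : N × N'' → N', SmoothNear (I.prod I'') I' g (p.1, T p) ∧ g (p.1, T p) = p.2 ∧
      (∀ᶠ q in 𝓝 p, g (q.1, T q) = q.2) ∧ ∀ᶠ q in 𝓝 (p.1, T p), T (q.1, g q) = q.2 := by
  set Q : N × N' → N × N'' := fun q => (q.1, T q) with hQdef
  have hQ : SmoothNear (I.prod I') (I.prod I'') Q p := smoothNear_fst.prodMk hT
  obtain ⟨L, hL⟩ := h
  obtain ⟨w, y⟩ := p
  have hTd := hT.mdifferentiableAt
  have hd : mderiv (I.prod I') (I.prod I'') Q (w, y) = ContinuousLinearEquiv.skewProd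
      (ContinuousLinearEquiv.refl ℝ E) L (mderiv I I'' (fun z => T (z, y)) w) := by
    refine ContinuousLinearMap.ext fun v => ?_
    obtain ⟨a, b⟩ := v
    have hLb : L b = mderiv I' I'' (fun z => T (w, z)) y b :=
      congrArg (fun l : E' →L[ℝ] E'' => l b) hL
    rw [hQdef, mderiv_prodMk mdifferentiableAt_fst hTd, mderiv_fst]
    simp only [ContinuousLinearMap.prod_apply, mderiv_prod_apply hTd, ContinuousLinearMap.coe_fst',
      ContinuousLinearEquiv.coe_coe, ContinuousLinearEquiv.skewProd_apply,
      ContinuousLinearEquiv.refl_apply, hLb, add_comm]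
  obtain ⟨R, hR, hR0, hR1, hR2⟩ := hQ.exists_local_inverse (by
    rw [hd]; exact ⟨_, rfl⟩)
  refine ⟨fun q => (R q).2, smoothNear_snd.comp hR, congrArg Prod.snd hR0, ?_, ?_⟩
  · filter_upwards [hR1] with q hq using congrArg Prod.snd hq
  · filter_upwards [hR2] with q hq
    have h1 : (R q).1 = q.1 := congrArg Prod.fst hq
    have h2 : T (R q) = q.2 := congrArg Prod.snd hq
    rw [← h1]; exact h2

end Slices


section CloseDerivative

variable {E H N : Type*} [NormedAddCommGroup E] [NormedSpace ℝ E] [TopologicalSpace H]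
  [TopologicalSpace N] [ChartedSpace H N]
  {E' H' N' : Type*} [NormedAddCommGroup E'] [NormedSpace ℝ E'] [TopologicalSpace H']
  [TopologicalSpace N'] [ChartedSpace H' N']
  {I : ModelWithCorners ℝ E H} {I' : ModelWithCorners ℝ E' H'}

theorem ChartClose.mderiv_eq [I.Boundaryless] {F F' : N → N'} {x : N}
    (hF : MDifferentiableAt I I' F x) (hF' : MDifferentiableAt I I' F' x) (h0 : F x = F' x)
    (h : ChartClose I' (𝓝 x) (fun z => chartGauge I x z ^ 2) (F x) F F') :
    mderiv I I' F x = mderiv I I' F' x := by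
  set φ := extChartAt I x
  set ψ := extChartAt I' (F x) with hψ
  have hφx : φ.symm (φ x) = x := extChartAt_to_inv x
  set f : E → E' := fun e => ψ (F (φ.symm e)) with hf
  set f' : E → E' := fun e => ψ (F' (φ.symm e)) with hf'
  have e1 : mderiv I I' F x = fderiv ℝ f (φ x) := by
    rw [mderiv, hF.mfderiv, I.range_eq_univ, fderivWithin_univ]; rfl
  have e2 : mderiv I I' F' x = fderiv ℝ f' (φ x) := by
    rw [mderiv, hF'.mfderiv, I.range_eq_univ, fderivWithin_univ, hf', hψ, h0]; rfl
  have d1 : DifferentiableAt ℝ f (φ x) := by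
    have := hF.differentiableWithinAt_writtenInExtChartAt
    rwa [I.range_eq_univ, differentiableWithinAt_univ] at this
  have d2 : DifferentiableAt ℝ f' (φ x) := by
    have := hF'.differentiableWithinAt_writtenInExtChartAt
    rw [I.range_eq_univ, differentiableWithinAt_univ] at this
    rw [hf', hψ, h0]; exact this
  have hc : Tendsto φ.symm (𝓝 (φ x)) (𝓝 x) := by
    have := (continuousAt_extChartAt_symm (I := I) x).tendsto
    rwa [hφx] at this
  have hO : (fun e => f e - f' e) =O[𝓝 (φ x)] fun e => ‖e - φ x‖ ^ 2 := by
    refine (h.isBigO.comp_tendsto hc).congr' (EventuallyEq.of_eq rfl) ?_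
    filter_upwards [extChartAt_target_mem_nhds (I := I) x] with e he
    simp only [Function.comp_apply, chartGauge]
    rw [(extChartAt I x).right_inv he]
  have hz : HasFDerivAt (fun e => f e - f' e) (0 : E →L[ℝ] E') (φ x) :=
    hO.hasFDerivAt (by norm_num)
  rw [e1, e2, ← sub_eq_zero, ← fderiv_fun_sub d1 d2, hz.fderiv]

end CloseDerivative

namespace LieGroupoid

variable {EM EG M G : Type*}
  [NormedAddCommGroup EM] [NormedSpace ℝ EM] [NormedAddCommGroup EG] [NormedSpace ℝ EG]
  [TopologicalSpace M] [ChartedSpace EM M] [TopologicalSpace G] [ChartedSpace EG G]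
  {Γ : LieGroupoid EM EG M G} {F H : M → G} {g h : M → M} {x : M}

namespace IsBisectionGerm

theorem mderiv_inv_comp (hF : Γ.IsBisectionGerm F g x) :
    (mderiv 𝓘(ℝ, EM) 𝓘(ℝ, EM) g (Γ.tgt (F x))).comp
      (mderiv 𝓘(ℝ, EM) 𝓘(ℝ, EM) (fun z => Γ.tgt (F z)) x) = ContinuousLinearMap.id ℝ EM := by
  rw [← mderiv_comp hF.smooth_inv.mdifferentiableAt hF.smooth_base.mdifferentiableAt rfl,
    ← mderiv_id (I := 𝓘(ℝ, EM)) (x := x)]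
  exact mderiv_congr hF.left_inv

theorem mderiv_comp_inv (hF : Γ.IsBisectionGerm F g x) :
    (mderiv 𝓘(ℝ, EM) 𝓘(ℝ, EM) (fun z => Γ.tgt (F z)) x).comp
      (mderiv 𝓘(ℝ, EM) 𝓘(ℝ, EM) g (Γ.tgt (F x))) = ContinuousLinearMap.id ℝ EM := by
  rw [← mderiv_comp hF.smooth_base.mdifferentiableAt hF.smooth_inv.mdifferentiableAt
    hF.inv_apply, ← mderiv_id (I := 𝓘(ℝ, EM)) (x := Γ.tgt (F x))]
  exact mderiv_congr hF.right_inv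

theorem isInvertible_mderiv (hF : Γ.IsBisectionGerm F g x) :
    (mderiv 𝓘(ℝ, EM) 𝓘(ℝ, EM) (fun z => Γ.tgt (F z)) x).IsInvertible :=
  ContinuousLinearMap.IsInvertible.of_inverse hF.mderiv_comp_inv hF.mderiv_inv_comp

end IsBisectionGerm

variable [IsManifold 𝓘(ℝ, EM) ∞ M] [CompleteSpace EM]

variable {EW W : Type*} [NormedAddCommGroup EW] [NormedSpace ℝ EW] [CompleteSpace EW]
  [TopologicalSpace W] [ChartedSpace EW W] [IsManifold 𝓘(ℝ, EW) ∞ W]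

/-- A smooth family of sections of `src` which is a bisection near one point is a smooth family
of bisections. -/
theorem IsBisectionGerm.exists_family {Φ : W × M → G} {p : W × M}
    (hΦ : SmoothNear (𝓘(ℝ, EW).prod 𝓘(ℝ, EM)) 𝓘(ℝ, EG) Φ p)
    (hs : ∀ᶠ q in 𝓝 p, Γ.src (Φ q) = q.2)
    (hF : Γ.IsBisectionGerm (fun z => Φ (p.1, z)) g p.2) :
    ∃ γ : W × M → M,
      SmoothNear (𝓘(ℝ, EW).prod 𝓘(ℝ, EM)) 𝓘(ℝ, EM) γ (p.1, Γ.tgt (Φ p)) ∧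
      (∀ᶠ q in 𝓝 p, γ (q.1, Γ.tgt (Φ q)) = q.2) ∧
      (∀ᶠ q in 𝓝 (p.1, Γ.tgt (Φ p)), Γ.tgt (Φ (q.1, γ q)) = q.2) ∧
      ∀ᶠ q in 𝓝 p, Γ.IsBisectionGerm (fun z => Φ (q.1, z)) (fun y => γ (q.1, y)) q.2 := by
  have hT : SmoothNear (𝓘(ℝ, EW).prod 𝓘(ℝ, EM)) 𝓘(ℝ, EM) (fun q => Γ.tgt (Φ q)) p :=
    (Γ.contMDiff_tgt.smoothNear _).comp hΦ
  obtain ⟨γ, h1, h2, h3, h4⟩ := hT.exists_family_inverse hF.isInvertible_mderiv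
  refine ⟨γ, h1, h3, h4, ?_⟩
  have hc : Tendsto (fun q : W × M => (q.1, Γ.tgt (Φ q))) (𝓝 p) (𝓝 (p.1, Γ.tgt (Φ p))) :=
    continuousAt_fst.tendsto.prodMk_nhds hT.tendsto
  filter_upwards [hΦ.eventually, hs.eventually_nhds, hc.eventually h1.eventually,
    h3.eventually_nhds, hc.eventually h4.eventually_nhds] with q k1 k2 k3 k4 k5
  exact ⟨k1.slice, tendsto_mk_left.eventually k2, k3.slice, tendsto_mk_left.eventually k4,
    tendsto_mk_left.eventually k5⟩

end LieGroupoid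

namespace LieGroupoid

variable {EM EG M G W : Type*}
  [NormedAddCommGroup EM] [NormedSpace ℝ EM] [NormedAddCommGroup EG] [NormedSpace ℝ EG]
  [NormedAddCommGroup W] [NormedSpace ℝ W]
  [TopologicalSpace M] [ChartedSpace EM M] [TopologicalSpace G] [ChartedSpace EG G]
  {Γ : LieGroupoid EM EG M G} {k : ℕ}

/-- The map `Φ : W × M → G` is, near `p`, a smooth family of germs of bisections. -/
structure IsBisectionFamily (Γ : LieGroupoid EM EG M G) (Φ : W × M → G) (p : W × M) : Prop where
  smooth : SmoothNear (𝓘(ℝ, W).prod 𝓘(ℝ, EM)) 𝓘(ℝ, EG) Φ p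
  src_eq : ∀ᶠ q in 𝓝 p, Γ.src (Φ q) = q.2
  germ : ∃ g, Γ.IsBisectionGerm (fun z => Φ (p.1, z)) g p.2

namespace IsBisectionFamily

theorem src_apply {Φ : W × M → G} {p : W × M} (h : Γ.IsBisectionFamily Φ p) :
    Γ.src (Φ p) = p.2 := h.src_eq.self_of_nhds

theorem smooth_tgt {Φ : W × M → G} {p : W × M} (h : Γ.IsBisectionFamily Φ p) :
    SmoothNear (𝓘(ℝ, W).prod 𝓘(ℝ, EM)) 𝓘(ℝ, EM) (fun q => Γ.tgt (Φ q)) p :=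
  (Γ.contMDiff_tgt.smoothNear _).comp h.smooth

variable [IsManifold 𝓘(ℝ, EM) ∞ M] [CompleteSpace EM] [CompleteSpace W]

theorem eventually_germ {Φ : W × M → G} {p : W × M} (h : Γ.IsBisectionFamily Φ p) :
    ∀ᶠ q in 𝓝 p, ∃ g, Γ.IsBisectionGerm (fun z => Φ (q.1, z)) g q.2 := by
  obtain ⟨g, hg⟩ := h.germ
  obtain ⟨γ, -, -, -, h4⟩ := hg.exists_family h.smooth h.src_eq
  filter_upwards [h4] with q hq using ⟨_, hq⟩

variable [IsManifold 𝓘(ℝ, EG) ∞ G]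

theorem eventually_jetChart {Φ : W × M → G} {w₀ : W} {x₀ : M}
    (h : Γ.IsBisectionFamily Φ (w₀, x₀)) {p : PreJet EM EG M G k} (hp : p.pt = x₀)
    (hpv : p.val = Φ (w₀, x₀)) :
    ∀ᶠ q in 𝓝 (w₀, x₀), jet k (fun z => Φ (q.1, z)) q.2 ∈ Γ.jets k ∧
      Γ.jetChart p (jet k (fun z => Φ (q.1, z)) q.2) =
        (extChartAt 𝓘(ℝ, EM) x₀ q.2,
          famCoeffs k x₀ (Φ (w₀, x₀)) Φ (q.1, extChartAt 𝓘(ℝ, EM) x₀ q.2)) := by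
  filter_upwards [h.eventually_germ,
    continuousAt_snd.eventually (chart_source_mem_nhds EM x₀),
    h.smooth.continuousAt.eventually (chart_source_mem_nhds EG (Φ (w₀, x₀)))] with q h1 h2 h3
  obtain ⟨g, hg⟩ := h1
  refine ⟨hg.jet_mem k, ?_⟩
  rw [jetChart_jet hg (by rwa [hp]) (by rwa [hpv]), hp, hpv, coeffs_eq_famCoeffs]

theorem isJetCurve {Φ : W × M → G} {w : ℝ → W} {y : ℝ → M}
    (h : Γ.IsBisectionFamily Φ (w 0, y 0)) (hw : ContDiffAt ℝ ∞ w 0)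
    (hy : ContMDiffAt 𝓘(ℝ, ℝ) 𝓘(ℝ, EM) ∞ y 0) (k : ℕ) :
    Γ.IsJetCurve (fun u => jet k (fun z => Φ (w u, z)) (y u)) ∧
    Γ.velocity (fun u => jet k (fun z => Φ (w u, z)) (y u)) =
      (mderiv 𝓘(ℝ, ℝ) 𝓘(ℝ, EM) y 0 1,
        fderiv ℝ (famCoeffs k (y 0) (Φ (w 0, y 0)) Φ : W × EM → JetCoeff EM EG k)
          (w 0, extChartAt 𝓘(ℝ, EM) (y 0) (y 0))
          (deriv w 0, mderiv 𝓘(ℝ, ℝ) 𝓘(ℝ, EM) y 0 1)) := by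
  have hc : Tendsto (fun u => (w u, y u)) (𝓝 0) (𝓝 (w 0, y 0)) :=
    hw.continuousAt.tendsto.prodMk_nhds hy.continuousAt.tendsto
  have hev := hc.eventually (h.eventually_jetChart (k := k)
    (p := jet k (fun z => Φ (w 0, z)) (y 0)) rfl rfl)
  have hF := contDiffAt_famCoeffs (k := k) h.smooth.contMDiffAt
    (mem_chart_source EM (y 0)) (mem_chart_source EG (Φ (w 0, y 0)))
  have hy' : ContDiffAt ℝ ∞ (fun u => extChartAt 𝓘(ℝ, EM) (y 0) (y u)) 0 :=
    ((contMDiffAt_extChartAt (I := 𝓘(ℝ, EM)) (x := y 0)).comp (0 : ℝ) hy).contDiffAt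
  have hdy : HasDerivAt (fun u => extChartAt 𝓘(ℝ, EM) (y 0) (y u))
      (mderiv 𝓘(ℝ, ℝ) 𝓘(ℝ, EM) y 0 1) 0 := by
    have h1 := (hy'.differentiableAt (by simp)).hasDerivAt
    convert h1 using 1
    rw [mderiv, (hy.mdifferentiableAt (by simp)).mfderiv]
    simp only [ModelWithCorners.range_eq_univ, fderivWithin_univ]
    exact fderiv_apply_one_eq_deriv
  have hdw := (hw.differentiableAt (by simp)).hasDerivAt
  have hEq : (fun u => Γ.jetChart (jet k (fun z => Φ (w 0, z)) (y 0))
      (jet k (fun z => Φ (w u, z)) (y u))) =ᶠ[𝓝 0] fun u =>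
      (extChartAt 𝓘(ℝ, EM) (y 0) (y u),
        (famCoeffs k (y 0) (Φ (w 0, y 0)) Φ : W × EM → JetCoeff EM EG k)
          (w u, extChartAt 𝓘(ℝ, EM) (y 0) (y u))) := by
    filter_upwards [hev] with u hu using hu.2
  refine ⟨⟨?_, hy.continuousAt, ?_, ?_⟩, ?_⟩
  · filter_upwards [hev] with u hu using hu.1
  · exact h.smooth.continuousAt.tendsto.comp hc
  · have h1 : ContDiffAt ℝ ∞ (fun u => (famCoeffs k (y 0) (Φ (w 0, y 0)) Φ :
        W × EM → JetCoeff EM EG k) (w u, extChartAt 𝓘(ℝ, EM) (y 0) (y u))) 0 :=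
      ContDiffAt.comp (f := fun u => (w u, extChartAt 𝓘(ℝ, EM) (y 0) (y u))) (0 : ℝ) hF
        (hw.prodMk hy')
    exact (hy'.prodMk h1).congr_of_eventuallyEq hEq
  · unfold velocity
    rw [hEq.deriv_eq]
    have hd := ((hF.differentiableAt (by simp)).hasFDerivAt.comp_hasDerivAt (0 : ℝ)
      (hdw.prodMk hdy))
    exact (hdy.prodMk hd).deriv

end IsBisectionFamily

theorem velocity_congr {c c' : ℝ → PreJet EM EG M G k} (h : c =ᶠ[𝓝 0] c') :
    Γ.velocity c = Γ.velocity c' := by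
  unfold velocity
  rw [h.self_of_nhds]
  exact EventuallyEq.deriv_eq (by filter_upwards [h] with u hu; rw [hu])

/-- The neighbourhoods of `p` in `G_k`. -/
def jetNhds (Γ : LieGroupoid EM EG M G) (p : PreJet EM EG M G k) : Filter (PreJet EM EG M G k) :=
  comap (fun q => (q.pt, q.val, Γ.jetChart p q)) (𝓝 (p.pt, p.val, Γ.jetChart p p)) ⊓ 𝓟 (Γ.jets k)

section JetNhds

variable {p : PreJet EM EG M G k}

theorem tendsto_jetNhds_iff {X : Type*} {l : Filter X} {S : X → PreJet EM EG M G k} :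
    Tendsto S l (Γ.jetNhds p) ↔ (∀ᶠ z in l, S z ∈ Γ.jets k) ∧
      Tendsto (fun z => (S z).pt) l (𝓝 p.pt) ∧ Tendsto (fun z => (S z).val) l (𝓝 p.val) ∧
      Tendsto (fun z => Γ.jetChart p (S z)) l (𝓝 (Γ.jetChart p p)) := by
  simp only [jetNhds, tendsto_inf, tendsto_comap_iff, tendsto_principal, nhds_prod_eq,
    tendsto_prod_iff', Function.comp_def]
  tauto

theorem eventually_mem_jets : ∀ᶠ q in Γ.jetNhds p, q ∈ Γ.jets k :=
  (tendsto_jetNhds_iff.1 tendsto_id).1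

theorem tendsto_pt : Tendsto PreJet.pt (Γ.jetNhds p) (𝓝 p.pt) :=
  (tendsto_jetNhds_iff.1 tendsto_id).2.1

theorem tendsto_val : Tendsto PreJet.val (Γ.jetNhds p) (𝓝 p.val) :=
  (tendsto_jetNhds_iff.1 tendsto_id).2.2.1

theorem tendsto_jetChart : Tendsto (Γ.jetChart p) (Γ.jetNhds p) (𝓝 (Γ.jetChart p p)) :=
  (tendsto_jetNhds_iff.1 tendsto_id).2.2.2

theorem IsJetCurve.tendsto {c : ℝ → PreJet EM EG M G k} (hc : Γ.IsJetCurve c) :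
    Tendsto c (𝓝 0) (Γ.jetNhds (c 0)) :=
  tendsto_jetNhds_iff.2 ⟨hc.1, hc.2.1, hc.2.2.1, hc.2.2.2.continuousAt⟩

theorem SmoothJetMapAt.tendsto {S : M → PreJet EM EG M G k} {x : M} (h : Γ.SmoothJetMapAt S x) :
    Tendsto S (𝓝 x) (Γ.jetNhds (S x)) :=
  tendsto_jetNhds_iff.2 ⟨h.1, h.2.1, h.2.2.1, h.2.2.2.continuousAt⟩

end JetNhds

variable [IsManifold 𝓘(ℝ, EM) ∞ M] [IsManifold 𝓘(ℝ, EG) ∞ G] [CompleteSpace EM]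
  [CompleteSpace EG]

theorem jetMapDeriv_velocity {A : Set (PreJet EM EG M G k)}
    {Ψ : PreJet EM EG M G k → PreJet EM EG M G k} {p : PreJet EM EG M G k}
    {K : JetTan EM EG k × M → G} {b : JetTan EM EG k → M}
    (hK : Γ.IsBisectionFamily K (Γ.jetChart p p, b (Γ.jetChart p p)))
    (hb : SmoothNear 𝓘(ℝ, JetTan EM EG k) 𝓘(ℝ, EM) b (Γ.jetChart p p))
    (h : ∀ᶠ q in Γ.jetNhds p, q ∈ A →
      Ψ q = jet k (fun z => K (Γ.jetChart p q, z)) (b (Γ.jetChart p q)))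
    {c : ℝ → PreJet EM EG M G k} (hc : Γ.IsJetCurve c) (hc0 : c 0 = p)
    (hcA : ∀ᶠ u in 𝓝 0, c u ∈ A) :
    Γ.jetMapDeriv A Ψ p (Γ.velocity c) = Γ.velocity (Ψ ∘ c) := by
  have key : ∀ c' : ℝ → PreJet EM EG M G k, Γ.IsJetCurve c' → c' 0 = p →
      (∀ᶠ u in 𝓝 0, c' u ∈ A) → Γ.velocity (Ψ ∘ c') =
        (mderiv 𝓘(ℝ, JetTan EM EG k) 𝓘(ℝ, EM) b (Γ.jetChart p p) (Γ.velocity c'),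
          fderiv ℝ (famCoeffs k (b (Γ.jetChart p p)) (K (Γ.jetChart p p, b (Γ.jetChart p p))) K :
              JetTan EM EG k × EM → JetCoeff EM EG k)
            (Γ.jetChart p p, extChartAt 𝓘(ℝ, EM) (b (Γ.jetChart p p)) (b (Γ.jetChart p p)))
            (Γ.velocity c',
              mderiv 𝓘(ℝ, JetTan EM EG k) 𝓘(ℝ, EM) b (Γ.jetChart p p) (Γ.velocity c'))) := by
    intro c' h1 h2 h3
    subst h2
    have hw : ContDiffAt ℝ ∞ (fun u => Γ.jetChart (c' 0) (c' u)) 0 := h1.2.2.2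
    have hwm := hw.contMDiffAt
    have hy : ContMDiffAt 𝓘(ℝ, ℝ) 𝓘(ℝ, EM) ∞ (fun u => b (Γ.jetChart (c' 0) (c' u))) 0 :=
      ContMDiffAt.comp (I' := 𝓘(ℝ, JetTan EM EG k)) (0 : ℝ) hb.contMDiffAt hwm
    have hv := (IsBisectionFamily.isJetCurve (w := fun u => Γ.jetChart (c' 0) (c' u))
      (y := fun u => b (Γ.jetChart (c' 0) (c' u))) hK hw hy k).2
    have he : Ψ ∘ c' =ᶠ[𝓝 0] fun u => jet k (fun z => K (Γ.jetChart (c' 0) (c' u), z))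
        (b (Γ.jetChart (c' 0) (c' u))) := by
      filter_upwards [h1.tendsto.eventually h, h3] with u hu hu'
      exact hu hu'
    rw [velocity_congr he, hv]
    have hm : mderiv 𝓘(ℝ, ℝ) 𝓘(ℝ, EM) (fun u => b (Γ.jetChart (c' 0) (c' u))) 0 1 =
        mderiv 𝓘(ℝ, JetTan EM EG k) 𝓘(ℝ, EM) b (Γ.jetChart (c' 0) (c' 0)) (Γ.velocity c') := by
      rw [mderiv_comp_apply hb.mdifferentiableAt (hwm.mdifferentiableAt (by simp)) rfl,
        mderiv_eq_fderiv]
      exact congrArg _ fderiv_apply_one_eq_deriv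
    rw [hm]
    rfl
  have hex : ∃ c' : ℝ → PreJet EM EG M G k, Γ.IsJetCurve c' ∧ c' 0 = p ∧
      (∀ᶠ u in 𝓝 0, c' u ∈ A) ∧ Γ.velocity c' = Γ.velocity c := ⟨c, hc, hc0, hcA, rfl⟩
  rw [jetMapDeriv, dif_pos hex]
  obtain ⟨h1, h2, h3, h4⟩ := hex.choose_spec
  rw [key _ h1 h2 h3, key _ hc hc0 hcA, h4]

end LieGroupoid

namespace LieGroupoid

variable {EM EG M G : Type*}
  [NormedAddCommGroup EM] [NormedSpace ℝ EM] [NormedAddCommGroup EG] [NormedSpace ℝ EG]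
  [TopologicalSpace M] [ChartedSpace EM M] [TopologicalSpace G] [ChartedSpace EG G]
  {Γ : LieGroupoid EM EG M G} {k : ℕ}
  [IsManifold 𝓘(ℝ, EM) ∞ M] [IsManifold 𝓘(ℝ, EG) ∞ G] [CompleteSpace EM] [CompleteSpace EG]

/-- Near every element `p` of `G_k`, the jets are the values of a smooth family of bisections
parametrized by the jet coordinates. -/
theorem exists_jet_family {p : PreJet EM EG M G k} (hp : p ∈ Γ.jets k) :
    ∃ Φ : JetTan EM EG k × M → G, Γ.IsBisectionFamily Φ (Γ.jetChart p p, p.pt) ∧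
      Φ (Γ.jetChart p p, p.pt) = p.val ∧
      ∀ᶠ q in Γ.jetNhds p, (∃ g, Γ.IsBisectionGerm (fun z => Φ (Γ.jetChart p q, z)) g q.pt) ∧
        jet k (fun z => Φ (Γ.jetChart p q, z)) q.pt = q := by
  have hB := isBisectionGerm_rep hp
  have hBp : (Γ.rep p).toFun p.pt = p.val := rep_apply hp
  have hsp : Γ.src p.val = p.pt := by rw [← hBp]; exact hB.src_apply
  set F := (Γ.rep p).toFun with hF
  set φ := extChartAt 𝓘(ℝ, EM) p.pt with hφ
  set ψ := extChartAt 𝓘(ℝ, EG) p.val with hψ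
  have hφp : φ.symm (φ p.pt) = p.pt := extChartAt_to_inv p.pt
  set f : EM → EG := fun e => ψ (F (φ.symm e)) with hf
  have hfs : SmoothNear 𝓘(ℝ, EM) 𝓘(ℝ, EG) f (φ p.pt) :=
    (smoothNear_extChartAt (mem_extChartAt_source p.val)).comp_of_eq
      (hB.smooth.comp_of_eq (smoothNear_extChartAt_symm (mem_extChartAt_target p.pt)) hφp)
      (by rw [hφp, hBp])
  obtain ⟨r, hr, hr1, hr2⟩ := (Γ.submersion_src p.val).exists_retraction
  rw [hsp] at hr hr1
  -- the Taylor coefficients of the reference bisection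
  set c : EM → JetCoeff EM EG k := fun e i => iteratedFDeriv ℝ (i : ℕ) f e with hc
  have hcs : SmoothNear 𝓘(ℝ, EM) 𝓘(ℝ, JetCoeff EM EG k) c (φ p.pt) := by
    rw [smoothNear_iff_contDiffAt] at hfs ⊢
    filter_upwards [hfs] with e he
    exact contDiffAt_pi.2 fun i => he.iteratedFDeriv_right (by exact_mod_cast le_top)
  set w₀ := Γ.jetChart p p with hw₀
  have hw₀1 : w₀.1 = φ p.pt := rfl
  have hw₀2 : w₀.2 = c (φ p.pt) := rfl
  set t : JetTan EM EG k × M → EG := fun q =>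
    f (φ q.2) + taylorPoly (q.1.2 - c q.1.1) q.1.1 (φ q.2) with ht
  have htay0 : ∀ x y : EM, taylorPoly (0 : JetCoeff EM EG k) x y = 0 := fun x y => by
    simp [taylorPoly]
  have hfp : f (φ p.pt) = ψ p.val := by simp only [hf, hφp, hBp]
  have ht0 : t (w₀, p.pt) = ψ p.val := by
    simp only [ht, hw₀1, hw₀2, sub_self, htay0, add_zero, hfp]
  set I := 𝓘(ℝ, JetTan EM EG k).prod 𝓘(ℝ, EM) with hI
  have hφ2 : SmoothNear I 𝓘(ℝ, EM) (fun q : JetTan EM EG k × M => φ q.2) (w₀, p.pt) :=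
    (smoothNear_extChartAt (mem_extChartAt_source p.pt)).comp_of_eq smoothNear_snd rfl
  have hq11 : SmoothNear I 𝓘(ℝ, EM) (fun q : JetTan EM EG k × M => q.1.1) (w₀, p.pt) :=
    (contDiff_fst.contMDiff.smoothNear (I := 𝓘(ℝ, JetTan EM EG k)) (I' := 𝓘(ℝ, EM)) w₀).comp_of_eq
      smoothNear_fst rfl
  have hq12 : SmoothNear I 𝓘(ℝ, JetCoeff EM EG k) (fun q : JetTan EM EG k × M => q.1.2)
      (w₀, p.pt) :=
    (contDiff_snd.contMDiff.smoothNear (I := 𝓘(ℝ, JetTan EM EG k))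
      (I' := 𝓘(ℝ, JetCoeff EM EG k)) w₀).comp_of_eq smoothNear_fst rfl
  have hcq := hcs.comp_of_eq hq11 hw₀1
  have hfq := hfs.comp_of_eq hφ2 rfl
  have hts : SmoothNear I 𝓘(ℝ, EG) t (w₀, p.pt) := by
    filter_upwards [hφ2, hq11, hq12, hcq, hfq] with q h1 h2 h3 h4 h5
    refine h5.add ?_
    have hsub : ContMDiffAt I 𝓘(ℝ, JetCoeff EM EG k) ∞
      (fun q : JetTan EM EG k × M => q.1.2 - c q.1.1) q := h3.sub h4
    exact ContDiff.comp_contMDiffAt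
      (f := fun q : JetTan EM EG k × M => ((q.1.1, q.1.2 - c q.1.1), φ q.2))
      (contDiff_taylorPoly (E := EM) (F := EG) (k := k)) ((h2.prodMk_space hsub).prodMk_space h1)
  have hψs : SmoothNear I 𝓘(ℝ, EG) (fun q => ψ.symm (t q)) (w₀, p.pt) :=
    (smoothNear_extChartAt_symm (mem_extChartAt_target p.val)).comp_of_eq hts ht0
  have hψ0 : ψ.symm (t (w₀, p.pt)) = p.val := by rw [ht0]; exact extChartAt_to_inv p.val
  have hpair : SmoothNear I (𝓘(ℝ, EM).prod 𝓘(ℝ, EG))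
      (fun q : JetTan EM EG k × M => (q.2, ψ.symm (t q))) (w₀, p.pt) :=
    smoothNear_snd.prodMk hψs
  have hpair0 : (fun q : JetTan EM EG k × M => (q.2, ψ.symm (t q))) (w₀, p.pt) =
      (p.pt, p.val) := by simp only [hψ0]
  set Φ : JetTan EM EG k × M → G := fun q => r (q.2, ψ.symm (t q)) with hΦ
  have hΦs : SmoothNear I 𝓘(ℝ, EG) Φ (w₀, p.pt) := hr.comp_of_eq hpair hpair0
  have hrp : r (p.pt, p.val) = p.val := by
    have := hr2.self_of_nhds
    rwa [hsp] at this
  have hΦ0 : Φ (w₀, p.pt) = p.val := by simp only [hΦ, hψ0, hrp]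
  have hfam : Γ.IsBisectionFamily Φ (w₀, p.pt) := by
    refine ⟨hΦs, (hpair.tendsto_of_eq hpair0).eventually hr1, (Γ.rep p).base.symm, ?_⟩
    refine hB.congr ?_
    have h1 : Tendsto F (𝓝 p.pt) (𝓝 p.val) := hB.smooth.tendsto_of_eq hBp
    filter_upwards [extChartAt_source_mem_nhds (I := 𝓘(ℝ, EM)) p.pt,
      h1.eventually (extChartAt_source_mem_nhds (I := 𝓘(ℝ, EG)) p.val), h1.eventually hr2,
      hB.src_eq] with z k1 k2 k3 k4
    simp only [hΦ, ht, hw₀2, hw₀1, sub_self, htay0, add_zero, hf]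
    rw [φ.left_inv k1, ψ.left_inv k2]
    rw [k4] at k3
    exact k3.symm
  refine ⟨Φ, hfam, hΦ0, ?_⟩
  have hpr : Tendsto (fun q : PreJet EM EG M G k => (Γ.jetChart p q, q.pt)) (Γ.jetNhds p)
      (𝓝 (w₀, p.pt)) := tendsto_jetChart.prodMk_nhds tendsto_pt
  have hprv : Tendsto (fun q : PreJet EM EG M G k => (q.pt, q.val)) (Γ.jetNhds p)
      (𝓝 (p.pt, p.val)) := tendsto_pt.prodMk_nhds tendsto_val
  filter_upwards [hpr.eventually hfam.eventually_germ, eventually_mem_jets,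
    tendsto_pt.eventually (extChartAt_source_mem_nhds (I := 𝓘(ℝ, EM)) p.pt),
    tendsto_val.eventually (extChartAt_source_mem_nhds (I := 𝓘(ℝ, EG)) p.val),
    hprv.eventually hr.eventually, tendsto_val.eventually hr2.eventually_nhds,
    (tendsto_jetChart.fst_nhds).eventually hfs.eventually,
    (tendsto_pt.eventually ((smoothNear_extChartAt (I := 𝓘(ℝ, EM))
      (mem_extChartAt_source p.pt)).eventually))]
    with q h1 h2 h3 h4 h5 h6 h7 h8
  obtain ⟨g, hg⟩ := h1
  refine ⟨⟨g, hg⟩, ?_⟩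
  have hRq := isBisectionGerm_rep h2
  have hRqv : (Γ.rep q).toFun q.pt = q.val := rep_apply h2
  set R := (Γ.rep q).toFun with hR
  have hw1 : (Γ.jetChart p q).1 = φ q.pt := rfl
  set A : JetCoeff EM EG k := (Γ.jetChart p q).2 - c (φ q.pt) with hA
  -- both sides agree to order `k` in the charts at `p`
  set t' : EM → EG := fun e => f e + taylorPoly A (φ q.pt) e with ht'
  set R' : EM → EG := fun e => ψ (R (φ.symm e)) with hR'
  have hft : ContDiffAt ℝ ∞ f (φ q.pt) := by
    have := h7.contDiffAt
    rwa [hw1] at this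
  have hR's : ContDiffAt ℝ ∞ R' (φ q.pt) :=
    contDiffAt_comp_charts hRq.smooth.contMDiffAt (by rwa [extChartAt_source] at h3)
      (by
        change R q.pt ∈ _
        rw [hRqv]; rwa [extChartAt_source] at h4)
  have hw2 : (Γ.jetChart p q).2 =
      fun i : Fin (k + 1) => iteratedFDeriv ℝ (i : ℕ) R' (φ q.pt) := rfl
  have hAsym : ∀ (i : Fin (k + 1)) (σ : Equiv.Perm (Fin i)) v, A i (v ∘ σ) = A i v := by
    intro i σ v
    have h1 := iteratedFDeriv_comp_perm (n := i) (hft.of_le (by exact_mod_cast le_top)) σ v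
    have h2 := iteratedFDeriv_comp_perm (n := i) (hR's.of_le (by exact_mod_cast le_top)) σ v
    simp only [hA, hw2, hc, Pi.sub_apply, sub_apply, h1, h2]
  have hPs : ContDiff ℝ ∞ (taylorPoly A (φ q.pt)) :=
    (contDiff_taylorPoly (E := EM) (F := EG) (k := k)).comp
      (contDiff_const.prodMk contDiff_id : ContDiff ℝ ∞ fun e => ((φ q.pt, A), e))
  have ht's : ContDiffAt ℝ ∞ t' (φ q.pt) := hft.add hPs.contDiffAt
  have hO : (fun e => t' e - R' e) =O[𝓝 (φ q.pt)] fun e => ‖e - φ q.pt‖ ^ (k + 1) := by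
    refine isBigO_of_iteratedFDeriv_eq_zero (ht's.sub hR's) fun i hi => ?_
    have e1 := iteratedFDeriv_taylorPoly A (φ q.pt) hAsym ⟨i, by omega⟩
    have e2 : iteratedFDeriv ℝ i (fun e => t' e - R' e) (φ q.pt) =
        iteratedFDeriv ℝ i f (φ q.pt) + iteratedFDeriv ℝ i (taylorPoly A (φ q.pt)) (φ q.pt) -
          iteratedFDeriv ℝ i R' (φ q.pt) := by
      have := iteratedFDeriv_sub_apply (i := i) (ht's.of_le (by exact_mod_cast le_top))
        (hR's.of_le (by exact_mod_cast le_top))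
      have h' := iteratedFDeriv_add_apply (i := i) (hft.of_le (by exact_mod_cast le_top))
        ((hPs.contDiffAt (x := φ q.pt)).of_le (by exact_mod_cast le_top))
      exact this.trans (congrArg (fun l => l - iteratedFDeriv ℝ i R' (φ q.pt)) h')
    rw [e2]
    simp only at e1
    rw [e1]
    simp only [hA, hw2, hc, Pi.sub_apply]
    abel
  have hφq : φ.symm (φ q.pt) = q.pt := φ.left_inv h3
  have hR'q : R' (φ q.pt) = ψ q.val := by simp only [hR', hφq, hRqv]
  have hφc : ContinuousAt φ q.pt := h8.continuousAt
  have ht'q : t' (φ q.pt) = ψ q.val := by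
    have h9 := hO.eq_zero_imp.self_of_nhds (by simp)
    rw [← hR'q]
    exact sub_eq_zero.1 h9
  have hclose : ChartClose 𝓘(ℝ, EG) (𝓝 q.pt) (fun z => chartGauge 𝓘(ℝ, EM) q.pt z ^ (k + 1))
      (ψ q.val) (fun z => t' (φ z)) (fun z => R' (φ z)) := by
    refine ⟨?_, ?_, ?_⟩
    · rw [← ht'q]; exact ht's.continuousAt.tendsto.comp hφc
    · rw [← hR'q]; exact hR's.continuousAt.tendsto.comp hφc
    · simp only [extChartAt_model_space_eq_id, PartialEquiv.refl_coe, id_eq]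
      refine (hO.comp_tendsto hφc.tendsto).trans ?_
      have h9 := (chartGauge_isBigO (I := 𝓘(ℝ, EM)) (I' := 𝓘(ℝ, EM)) (φ := φ) (n := q.pt)
        (h8.contMDiffAt.of_le (m := 1) (by simp))).pow (k + 1)
      exact h9
  have hψq : ψ q.val ∈ ψ.target := ψ.map_source h4
  have h9 := hclose.map ((smoothNear_extChartAt_symm (I := 𝓘(ℝ, EG)) hψq).contMDiffAt.of_le
    (m := 1) (by simp))
  rw [ψ.left_inv h4] at h9
  have h10 := (ChartClose.of_eventuallyEq (I := 𝓘(ℝ, EM))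
    (g := fun z => chartGauge 𝓘(ℝ, EM) q.pt z ^ (k + 1)) (tendsto_id (x := 𝓝 q.pt))
      (EventuallyEq.refl _ _)).prodMk h9
  have h11 := h10.map (h5.contMDiffAt.of_le (m := 1) (by simp))
  have hsq : Γ.src q.val = q.pt := by rw [← hRqv]; exact hRq.src_apply
  have hrq : r (q.pt, q.val) = q.val := by
    have := h6.self_of_nhds
    rwa [hsq] at this
  have hRt : Tendsto R (𝓝 q.pt) (𝓝 q.val) := hRq.smooth.tendsto_of_eq hRqv
  have h12 : ChartClose 𝓘(ℝ, EG) (𝓝 q.pt) (fun z => chartGauge 𝓘(ℝ, EM) q.pt z ^ (k + 1))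
      q.val (fun z => Φ (Γ.jetChart p q, z)) R := by
    rw [hrq] at h11
    refine h11.congr' (EventuallyEq.of_eq rfl) ?_
    filter_upwards [hRt.eventually h6, hRq.src_eq, (isOpen_extChartAt_source p.pt).mem_nhds h3,
      hRt.eventually ((isOpen_extChartAt_source p.val).mem_nhds h4)] with z m1 m2 m3 m4
    simp only [hR', id_eq]
    rw [φ.left_inv m3, ψ.left_inv m4]
    rwa [m2] at m1
  have h13 : Φ (Γ.jetChart p q, q.pt) = q.val := by
    change r (q.pt, ψ.symm (t' (φ q.pt))) = q.val
    rw [ht'q, ψ.left_inv h4, hrq]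
  conv_rhs => rw [← jet_rep h2]
  refine (jet_eq_jet_iff hg.smooth.contMDiffAt hRq.smooth.contMDiffAt).2 ⟨?_, ?_⟩
  · rw [h13, hRqv]
  · rw [h13]; exact h12

end LieGroupoid

namespace LieGroupoid

variable {EM EG M G W : Type*}
  [NormedAddCommGroup EM] [NormedSpace ℝ EM] [NormedAddCommGroup EG] [NormedSpace ℝ EG]
  [NormedAddCommGroup W] [NormedSpace ℝ W]
  [TopologicalSpace M] [ChartedSpace EM M] [TopologicalSpace G] [ChartedSpace EG G]
  {Γ : LieGroupoid EM EG M G} {k : ℕ}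

theorem IsBisectionGerm.isBisectionFamily {F : M → G} {g : M → M} {x : M}
    (hF : Γ.IsBisectionGerm F g x) (w : W) :
    Γ.IsBisectionFamily (fun q : W × M => F q.2) (w, x) :=
  ⟨hF.smooth.comp_of_eq smoothNear_snd rfl,
    (continuous_snd.tendsto (w, x)).eventually hF.src_eq, g, hF⟩

theorem IsBisectionFamily.mul {Φ Θ : W × M → G} {w : W} {x y : M}
    (hΦ : Γ.IsBisectionFamily Φ (w, x)) (hy : Γ.tgt (Φ (w, x)) = y)
    (hΘ : Γ.IsBisectionFamily Θ (w, y)) :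
    Γ.IsBisectionFamily (fun q => Γ.mul (Θ (q.1, Γ.tgt (Φ q))) (Φ q)) (w, x) := by
  subst hy
  have h1 : SmoothNear (𝓘(ℝ, W).prod 𝓘(ℝ, EM)) (𝓘(ℝ, W).prod 𝓘(ℝ, EM))
      (fun q => (q.1, Γ.tgt (Φ q))) (w, x) := smoothNear_fst.prodMk hΦ.smooth_tgt
  have h2 : ∀ᶠ q in 𝓝 (w, x), Γ.src (Θ (q.1, Γ.tgt (Φ q))) = Γ.tgt (Φ q) :=
    h1.tendsto.eventually hΘ.src_eq
  obtain ⟨g, hg⟩ := hΦ.germ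
  obtain ⟨h, hh⟩ := hΘ.germ
  refine ⟨Γ.smoothNear_mul (hΘ.smooth.comp_of_eq h1 rfl) hΦ.smooth h2, ?_, _, hg.mul hh⟩
  filter_upwards [h2, hΦ.src_eq] with q hq hq'
  rw [Γ.src_mul _ _ hq, hq']

/-- Near `b₀`, the map `S : M → G_k` is `b ↦ j^k_b T(b, ·)`, with `T` smooth and the `T(b, ·)`
bisections. -/
structure IsLocalFamily (Γ : LieGroupoid EM EG M G) (S : M → PreJet EM EG M G k) (T : M × M → G)
    (b₀ : M) : Prop where
  smooth : SmoothNear (𝓘(ℝ, EM).prod 𝓘(ℝ, EM)) 𝓘(ℝ, EG) T (b₀, b₀)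
  src_eq : ∀ᶠ q in 𝓝 (b₀, b₀), Γ.src (T q) = q.2
  germ : ∀ᶠ b in 𝓝 b₀, ∃ g, Γ.IsBisectionGerm (fun z => T (b, z)) g b
  jet_eq : ∀ᶠ b in 𝓝 b₀, S b = jet k (fun z => T (b, z)) b

theorem IsBisectionGerm.isLocalFamily {F : M → G} {g : M → M} {x : M}
    (hF : Γ.IsBisectionGerm F g x) (k : ℕ) :
    Γ.IsLocalFamily (fun b => (jet k F b : PreJet EM EG M G k)) (fun q => F q.2) x where
  smooth := hF.smooth.comp_of_eq smoothNear_snd rfl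
  src_eq := (continuous_snd.tendsto (x, x)).eventually hF.src_eq
  germ := hF.eventually.mono fun _ hb => ⟨g, hb⟩
  jet_eq := Eventually.of_forall fun _ => rfl

theorem IsLocalFamily.comp_param {S : M → PreJet EM EG M G k} {T : M × M → G} {b₀ : M}
    (h : Γ.IsLocalFamily S T b₀) {a : W → M} {w : W} (ha : SmoothNear 𝓘(ℝ, W) 𝓘(ℝ, EM) a w)
    (haw : a w = b₀) :
    Γ.IsBisectionFamily (fun q : W × M => T (a q.1, q.2)) (w, b₀) := by
  subst haw
  have h1 : SmoothNear (𝓘(ℝ, W).prod 𝓘(ℝ, EM)) (𝓘(ℝ, EM).prod 𝓘(ℝ, EM))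
      (fun q : W × M => (a q.1, q.2)) (w, a w) :=
    (ha.comp_of_eq smoothNear_fst rfl).prodMk smoothNear_snd
  obtain ⟨g, hg⟩ := h.germ.self_of_nhds
  exact ⟨h.smooth.comp_of_eq h1 rfl, h1.tendsto.eventually h.src_eq, g, hg⟩

variable [IsManifold 𝓘(ℝ, EM) ∞ M] [IsManifold 𝓘(ℝ, EG) ∞ G] [CompleteSpace EM]
  [CompleteSpace EG]

theorem IsLocalFamily.jetChart_eq {S : M → PreJet EM EG M G k} {T : M × M → G} {x : M}
    (h : Γ.IsLocalFamily S T x) :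
    (∀ᶠ z in 𝓝 x, S z ∈ Γ.jets k) ∧ ∀ᶠ z in 𝓝 x, Γ.jetChart (S x) (S z) =
      (extChartAt 𝓘(ℝ, EM) x z, famCoeffs k x (T (x, x))
        (fun q : EM × M => T ((extChartAt 𝓘(ℝ, EM) x).symm q.1, q.2))
          (extChartAt 𝓘(ℝ, EM) x z, extChartAt 𝓘(ℝ, EM) x z)) := by
  have hx0 : (extChartAt 𝓘(ℝ, EM) x).symm (extChartAt 𝓘(ℝ, EM) x x) = x := extChartAt_to_inv x
  have hfam := h.comp_param (smoothNear_extChartAt_symm (mem_extChartAt_target x)) hx0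
  have hSx := h.jet_eq.self_of_nhds
  have h1 := hfam.eventually_jetChart (k := k) (p := S x) (by rw [hSx]; rfl)
    (by rw [hSx]; simp only [jet, hx0])
  have hc : Tendsto (fun z => (extChartAt 𝓘(ℝ, EM) x z, z)) (𝓝 x)
      (𝓝 (extChartAt 𝓘(ℝ, EM) x x, x)) :=
    (continuousAt_extChartAt x).tendsto.prodMk_nhds tendsto_id
  have h2 := hc.eventually h1
  rw [hx0] at h2
  constructor
  · filter_upwards [h2, h.jet_eq, extChartAt_source_mem_nhds (I := 𝓘(ℝ, EM)) x] with z h3 h4 h5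
    rw [(extChartAt 𝓘(ℝ, EM) x).left_inv h5] at h3
    rw [h4]; exact h3.1
  · filter_upwards [h2, h.jet_eq, extChartAt_source_mem_nhds (I := 𝓘(ℝ, EM)) x] with z h3 h4 h5
    rw [(extChartAt 𝓘(ℝ, EM) x).left_inv h5] at h3
    rw [h4]; exact h3.2

theorem IsLocalFamily.smoothJetMapAt {S : M → PreJet EM EG M G k} {T : M × M → G} {x : M}
    (h : Γ.IsLocalFamily S T x) : Γ.SmoothJetMapAt S x := by
  have hd : Tendsto (fun b : M => (b, b)) (𝓝 x) (𝓝 (x, x)) :=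
    tendsto_id.prodMk_nhds tendsto_id
  have hx0 : (extChartAt 𝓘(ℝ, EM) x).symm (extChartAt 𝓘(ℝ, EM) x x) = x := extChartAt_to_inv x
  have hfam := h.comp_param (smoothNear_extChartAt_symm (mem_extChartAt_target x)) hx0
  have hSx := h.jet_eq.self_of_nhds
  refine ⟨h.jetChart_eq.1, ?_, ?_, ?_⟩
  · refine (continuousAt_id (x := x)).congr ?_
    filter_upwards [h.jet_eq] with z hz
    rw [hz]; rfl
  · have h1 : ContinuousAt (fun z => T (z, z)) x :=
      ContinuousAt.comp (f := fun z : M => (z, z)) h.smooth.continuousAt hd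
    refine h1.congr ?_
    filter_upwards [h.jet_eq] with z hz
    rw [hz]; rfl
  · refine ContMDiffAt.congr_of_eventuallyEq ?_ h.jetChart_eq.2
    have h1 := contDiffAt_famCoeffs (k := k) (Z₀ := T (x, x)) hfam.smooth.contMDiffAt
      (mem_chart_source EM x) (by simp only [hx0]; exact mem_chart_source EG _)
    have h2 : ContMDiffAt 𝓘(ℝ, EM) 𝓘(ℝ, EM) ∞ (extChartAt 𝓘(ℝ, EM) x) x := contMDiffAt_extChartAt
    exact h2.prodMk_space (ContDiffAt.comp_contMDiffAt
      (f := fun z => (extChartAt 𝓘(ℝ, EM) x z, extChartAt 𝓘(ℝ, EM) x z)) h1 (h2.prodMk_space h2))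

/-! ### The left and right actions on velocities -/

theorem leftAct_velocity {S : M → PreJet EM EG M G k} {T : M × M → G} {p : PreJet EM EG M G k}
    (hS : Γ.IsLocalFamily S T (Γ.tgt p.val)) {c : ℝ → PreJet EM EG M G k} (hc : Γ.IsJetCurve c)
    (hc0 : c 0 = p) :
    Γ.leftAct S p (Γ.velocity c) =
      Γ.velocity (fun u => Γ.jetMul (S (Γ.tgt (c u).val)) (c u)) := by
  have hp : p ∈ Γ.jets k := hc0 ▸ hc.1.self_of_nhds
  obtain ⟨Φ, hΦ, hΦ0, hΦq⟩ := exists_jet_family hp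
  set b : JetTan EM EG k → M := fun w => (extChartAt 𝓘(ℝ, EM) p.pt).symm w.1 with hb
  have hb0 : b (Γ.jetChart p p) = p.pt := extChartAt_to_inv p.pt
  have hbs : SmoothNear 𝓘(ℝ, JetTan EM EG k) 𝓘(ℝ, EM) b (Γ.jetChart p p) :=
    (smoothNear_extChartAt_symm (mem_extChartAt_target p.pt)).comp_of_eq
      (contDiff_fst.contMDiff.smoothNear _) rfl
  have has : SmoothNear 𝓘(ℝ, JetTan EM EG k) 𝓘(ℝ, EM) (fun w => Γ.tgt (Φ (w, b w)))
      (Γ.jetChart p p) :=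
    hΦ.smooth_tgt.comp_of_eq (smoothNear_id.prodMk hbs) (by rw [hb0])
  have hΘ := hS.comp_param has (by rw [hb0, hΦ0])
  have hK := hΦ.mul (by rw [hΦ0]) hΘ
  refine jetMapDeriv_velocity (b := b) (by rw [hb0]; exact hK) hbs ?_ hc hc0
    (Eventually.of_forall fun _ => mem_univ _)
  have hv : Tendsto (fun q : PreJet EM EG M G k => Γ.tgt q.val) (Γ.jetNhds p)
      (𝓝 (Γ.tgt p.val)) := (Γ.contMDiff_tgt.continuous.tendsto _).comp tendsto_val
  filter_upwards [hΦq, hv.eventually hS.germ, hv.eventually hS.jet_eq,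
    tendsto_pt.eventually (extChartAt_source_mem_nhds (I := 𝓘(ℝ, EM)) p.pt)] with q h1 h2 h3 h4 _
  obtain ⟨⟨g, hg⟩, hq⟩ := h1
  obtain ⟨h, hh⟩ := h2
  have hbq : b (Γ.jetChart p q) = q.pt := (extChartAt 𝓘(ℝ, EM) p.pt).left_inv h4
  have hval : Φ (Γ.jetChart p q, q.pt) = q.val := congrArg PreJet.val hq
  have := jetMul_jet hg (H := fun z => T (Γ.tgt q.val, z)) (h := h) (by rw [hval]; exact hh) k
  rw [hq] at this
  simp only [hval] at this
  rw [jetTgt, h3, this, hbq]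
  simp only [hval]

theorem jetMapDeriv_mul_right_velocity {A : Set (PreJet EM EG M G k)}
    {Ψ : PreJet EM EG M G k → PreJet EM EG M G k} {p : PreJet EM EG M G k} {Q : M → G}
    {g β : M → M} {x₁ : M} (hQ : Γ.IsBisectionGerm Q g x₁) (hQp : Γ.tgt (Q x₁) = p.pt)
    (hβ : SmoothNear 𝓘(ℝ, EM) 𝓘(ℝ, EM) β p.pt) (hβp : β p.pt = x₁)
    (hΨ : ∀ᶠ q in Γ.jetNhds p, q ∈ A → Ψ q = Γ.jetMul q (jet k Q (β q.pt)) ∧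
      Γ.tgt (Q (β q.pt)) = q.pt)
    {c : ℝ → PreJet EM EG M G k} (hc : Γ.IsJetCurve c) (hc0 : c 0 = p)
    (hcA : ∀ᶠ u in 𝓝 0, c u ∈ A) :
    Γ.jetMapDeriv A Ψ p (Γ.velocity c) = Γ.velocity (Ψ ∘ c) := by
  have hp : p ∈ Γ.jets k := hc0 ▸ hc.1.self_of_nhds
  obtain ⟨Φ, hΦ, hΦ0, hΦq⟩ := exists_jet_family hp
  set b : JetTan EM EG k → M := fun w => (extChartAt 𝓘(ℝ, EM) p.pt).symm w.1 with hb
  have hb0 : b (Γ.jetChart p p) = p.pt := extChartAt_to_inv p.pt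
  have hbs : SmoothNear 𝓘(ℝ, JetTan EM EG k) 𝓘(ℝ, EM) b (Γ.jetChart p p) :=
    (smoothNear_extChartAt_symm (mem_extChartAt_target p.pt)).comp_of_eq
      (contDiff_fst.contMDiff.smoothNear _) rfl
  have hK := (hQ.isBisectionFamily (Γ.jetChart p p)).mul hQp hΦ
  refine jetMapDeriv_velocity (b := fun w => β (b w)) (by rw [hb0, hβp]; exact hK)
    (hβ.comp_of_eq hbs hb0) ?_ hc hc0 hcA
  have hβt : Tendsto (fun q : PreJet EM EG M G k => β q.pt) (Γ.jetNhds p) (𝓝 x₁) :=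
    (hβ.tendsto_of_eq hβp).comp tendsto_pt
  filter_upwards [hΦq, hΨ, hβt.eventually hQ.eventually,
    tendsto_pt.eventually (extChartAt_source_mem_nhds (I := 𝓘(ℝ, EM)) p.pt)]
    with q h1 h2 h3 h4 hqA
  obtain ⟨⟨h, hh⟩, hq⟩ := h1
  obtain ⟨h5, h6⟩ := h2 hqA
  have hbq : b (Γ.jetChart p q) = q.pt := (extChartAt 𝓘(ℝ, EM) p.pt).left_inv h4
  have := jetMul_jet h3 (H := fun z => Φ (Γ.jetChart p q, z)) (h := h) (by rw [h6]; exact hh) k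
  rw [h6, hq] at this
  rw [h5, this, hbq]

end LieGroupoid

namespace LieGroupoid

variable {EM EG M G W : Type*}
  [NormedAddCommGroup EM] [NormedSpace ℝ EM] [NormedAddCommGroup EG] [NormedSpace ℝ EG]
  [NormedAddCommGroup W] [NormedSpace ℝ W]
  [TopologicalSpace M] [ChartedSpace EM M] [TopologicalSpace G] [ChartedSpace EG G]
  {Γ : LieGroupoid EM EG M G} {k : ℕ}
  [IsManifold 𝓘(ℝ, EM) ∞ M] [IsManifold 𝓘(ℝ, EG) ∞ G] [CompleteSpace EM]
  [CompleteSpace EG]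

section Curves

variable {Φ Φ' : ℝ × M → G} {y y' : ℝ → M}

theorem IsBisectionFamily.isJetCurve_real (hΦ : Γ.IsBisectionFamily Φ (0, y 0))
    (hy : SmoothNear 𝓘(ℝ, ℝ) 𝓘(ℝ, EM) y 0) (k : ℕ) :
    Γ.IsJetCurve (fun u => jet k (fun z => Φ (u, z)) (y u)) :=
  (IsBisectionFamily.isJetCurve (w := fun u => u) hΦ contDiffAt_id hy.contMDiffAt k).1

theorem IsBisectionFamily.velocity_real (hΦ : Γ.IsBisectionFamily Φ (0, y 0))
    (hy : SmoothNear 𝓘(ℝ, ℝ) 𝓘(ℝ, EM) y 0) (k : ℕ) :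
    Γ.velocity (fun u => jet k (fun z => Φ (u, z)) (y u)) =
      (mderiv 𝓘(ℝ, ℝ) 𝓘(ℝ, EM) y 0 1,
        fderiv ℝ (famCoeffs k (y 0) (Φ (0, y 0)) Φ : ℝ × EM → JetCoeff EM EG k)
          (0, extChartAt 𝓘(ℝ, EM) (y 0) (y 0)) (1, mderiv 𝓘(ℝ, ℝ) 𝓘(ℝ, EM) y 0 1)) := by
  rw [(IsBisectionFamily.isJetCurve (w := fun u => u) hΦ contDiffAt_id hy.contMDiffAt k).2]
  rw [show deriv (fun u : ℝ => u) 0 = 1 from deriv_id 0]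

theorem velocity_eq_of_close (hΦ : Γ.IsBisectionFamily Φ (0, y 0))
    (hΦ' : Γ.IsBisectionFamily Φ' (0, y 0)) (hy : SmoothNear 𝓘(ℝ, ℝ) 𝓘(ℝ, EM) y 0)
    (hy' : SmoothNear 𝓘(ℝ, ℝ) 𝓘(ℝ, EM) y' 0) (hyy : y 0 = y' 0)
    (hd : mderiv 𝓘(ℝ, ℝ) 𝓘(ℝ, EM) y 0 = mderiv 𝓘(ℝ, ℝ) 𝓘(ℝ, EM) y' 0)
    (h0 : Φ (0, y 0) = Φ' (0, y 0))
    (h : ChartClose 𝓘(ℝ, EG) (𝓝 (0, y 0))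
      (fun p => chartGauge (𝓘(ℝ, ℝ).prod 𝓘(ℝ, EM)) (0, y 0) p ^ (k + 2)) (Φ (0, y 0)) Φ Φ') :
    Γ.velocity (fun u => jet k (fun z => Φ (u, z)) (y u)) =
      Γ.velocity (fun u => jet k (fun z => Φ' (u, z)) (y' u)) := by
  have h1 : Γ.IsBisectionFamily Φ' (0, y' 0) := by rw [← hyy]; exact hΦ'
  rw [hΦ.velocity_real hy k, h1.velocity_real hy' k, ← hd, ← hyy, ← h0,
    h.fderiv_famCoeffs_eq hΦ.smooth.contMDiffAt hΦ'.smooth.contMDiffAt h0 (mem_chart_source _ _)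
      (mem_chart_source _ _)]

theorem smoothNear_prod_curve (hΦ : Γ.IsBisectionFamily Φ (0, y 0))
    (hy : SmoothNear 𝓘(ℝ, ℝ) 𝓘(ℝ, EM) y 0) :
    SmoothNear 𝓘(ℝ, ℝ) 𝓘(ℝ, EM) (fun u => Γ.tgt (Φ (u, y u))) 0 :=
  hΦ.smooth_tgt.comp_of_eq (smoothNear_id.prodMk hy) rfl

theorem leftAct_family {S : M → PreJet EM EG M G k} {T : M × M → G}
    (hΦ : Γ.IsBisectionFamily Φ (0, y 0)) (hy : SmoothNear 𝓘(ℝ, ℝ) 𝓘(ℝ, EM) y 0)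
    (hS : Γ.IsLocalFamily S T (Γ.tgt (Φ (0, y 0)))) :
    Γ.leftAct S (jet k (fun z => Φ (0, z)) (y 0))
        (Γ.velocity (fun u => jet k (fun z => Φ (u, z)) (y u))) =
      Γ.velocity (fun u => jet k (fun z => Γ.mul (T (Γ.tgt (Φ (u, y u)), Γ.tgt (Φ (u, z))))
        (Φ (u, z))) (y u)) := by
  rw [leftAct_velocity hS (hΦ.isJetCurve_real hy k) rfl]
  apply velocity_congr
  have h1 : Tendsto (fun u => (u, y u)) (𝓝 0) (𝓝 (0, y 0)) :=
    (smoothNear_id.prodMk hy).tendsto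
  have h2 := (smoothNear_prod_curve hΦ hy).tendsto
  filter_upwards [h1.eventually hΦ.eventually_germ, h2.eventually hS.germ,
    h2.eventually hS.jet_eq] with u h3 h4 h5
  obtain ⟨g, hg⟩ := h3
  obtain ⟨h, hh⟩ := h4
  exact (congrArg (fun s => Γ.jetMul s _) h5).trans (jetMul_jet hg hh k)

theorem IsLocalFamily.mul_family {S : M → PreJet EM EG M G k} {T : M × M → G}
    (hΦ : Γ.IsBisectionFamily Φ (0, y 0)) (hy : SmoothNear 𝓘(ℝ, ℝ) 𝓘(ℝ, EM) y 0)
    (hS : Γ.IsLocalFamily S T (Γ.tgt (Φ (0, y 0)))) :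
    Γ.IsBisectionFamily (fun q : ℝ × M => Γ.mul (T (Γ.tgt (Φ (q.1, y q.1)), Γ.tgt (Φ q))) (Φ q))
      (0, y 0) :=
  hΦ.mul rfl (hS.comp_param (smoothNear_prod_curve hΦ hy) rfl)

theorem chartGauge_mk_isBigO {f : ℝ × M → M} {p : ℝ × M} {n : ℕ}
    (hf : SmoothNear (𝓘(ℝ, ℝ).prod 𝓘(ℝ, EM)) 𝓘(ℝ, EM) f p) :
    (fun q => chartGauge 𝓘(ℝ, EM) (f p) (f q) ^ n) =O[𝓝 p]
      fun q => chartGauge (𝓘(ℝ, ℝ).prod 𝓘(ℝ, EM)) p q ^ n :=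
  (chartGauge_isBigO (hf.contMDiffAt.of_le (m := 1) (by simp))).pow n

theorem lamLeft_family {F : M → G} {g : M → M} {x : M}
    (hΦ : Γ.IsBisectionFamily Φ (0, y 0)) (hy : SmoothNear 𝓘(ℝ, ℝ) 𝓘(ℝ, EM) y 0)
    (hF : Γ.IsBisectionGerm F g x) (hx : Γ.tgt (Φ (0, y 0)) = x) :
    Γ.lamLeft (jet (k + 1) F x) (jet k (fun z => Φ (0, z)) (y 0))
        (Γ.velocity (fun u => jet k (fun z => Φ (u, z)) (y u))) =
      Γ.velocity (fun u => jet k (fun z => Γ.mul (F (Γ.tgt (Φ (u, z)))) (Φ (u, z))) (y u)) := by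
  have hR := isBisectionGerm_rep (hF.jet_mem (k + 1))
  have hRx : (Γ.rep (jet (k + 1) F x)).toFun x = F x := rep_apply (hF.jet_mem (k + 1))
  have hcl : ChartClose 𝓘(ℝ, EG) (𝓝 x) (fun z => chartGauge 𝓘(ℝ, EM) x z ^ (k + 2)) (F x)
      F (Γ.rep (jet (k + 1) F x)).toFun := hF.rep_close (k + 1)
  set R := (Γ.rep (jet (k + 1) F x)).toFun with hRdef
  set gR : M → M := ⇑(Γ.rep (jet (k + 1) F x)).base.symm with hgR
  replace hR : Γ.IsBisectionGerm R gR x := hR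
  have h1 := hΦ.mul hx (hR.isBisectionFamily (0 : ℝ))
  have h2 := hΦ.mul hx (hF.isBisectionFamily (0 : ℝ))
  have hl : Γ.IsLocalFamily (fun b => (jet k R b : PreJet EM EG M G k)) (fun q => R q.2)
      (Γ.tgt (Φ (0, y 0))) := by rw [hx]; exact hR.isLocalFamily k
  have h3 : ChartClose 𝓘(ℝ, EG) (𝓝 (0, y 0))
      (fun p => chartGauge (𝓘(ℝ, ℝ).prod 𝓘(ℝ, EM)) (0, y 0) p ^ (k + 2))
      (Γ.mul (F x) (Φ (0, y 0))) (fun q => Γ.mul (F (Γ.tgt (Φ q))) (Φ q))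
      (fun q => Γ.mul (R (Γ.tgt (Φ q))) (Φ q)) := by
    subst hx
    exact (ChartClose.of_eventuallyEq hΦ.smooth.tendsto (EventuallyEq.refl _ _)).product
      hF.smooth.contMDiffAt hF.src_eq hR.src_eq hcl
        (chartGauge_mk_isBigO (f := fun q => Γ.tgt (Φ q)) (p := (0, y 0)) (n := k + 2) hΦ.smooth_tgt)
  have h0 : Γ.mul (R (Γ.tgt (Φ (0, y 0)))) (Φ (0, y 0)) = Γ.mul (F x) (Φ (0, y 0)) := by
    rw [hx, hRx]
  refine (leftAct_family hΦ hy hl).trans ?_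
  exact velocity_eq_of_close (y := y) (y' := y) (Φ := fun q => Γ.mul (R (Γ.tgt (Φ q))) (Φ q))
    (Φ' := fun q => Γ.mul (F (Γ.tgt (Φ q))) (Φ q)) h1 h2 hy hy rfl rfl
    (by rw [hx, hRx]) (by rw [h0]; exact h3.symm)

theorem IsBisectionFamily.mul_right {Q : M → G} {g : M → M} {x : M}
    (hΦ : Γ.IsBisectionFamily Φ (0, y 0)) (hQ : Γ.IsBisectionGerm Q g x)
    (hQx : Γ.tgt (Q x) = y 0) :
    Γ.IsBisectionFamily (fun q : ℝ × M => Γ.mul (Φ (q.1, Γ.tgt (Q q.2))) (Q q.2)) (0, x) :=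
  (hQ.isBisectionFamily (0 : ℝ)).mul hQx hΦ

theorem mul_right_jetMul {Q : M → G} {g g' : M → M} {x : M} {F : M → G}
    (hQ : Γ.IsBisectionGerm Q g x) (hF : Γ.IsBisectionGerm F g' (Γ.tgt (Q x))) {x' : M}
    (hx' : Γ.tgt (Q x) = x') :
    Γ.jetMul (jet k F x') (jet k Q x) = jet k (fun z => Γ.mul (F (Γ.tgt (Q z))) (Q z)) x := by
  subst hx'
  exact jetMul_jet hQ hF k

theorem rightActVert_family {Q : M → G} {g : M → M} {x y₀ : M}
    (hΦ : Γ.IsBisectionFamily Φ (0, y₀)) (hQ : Γ.IsBisectionGerm Q g x)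
    (hQx : Γ.tgt (Q x) = y₀) :
    Γ.rightActVert (jet k Q x) (jet k (fun z => Φ (0, z)) y₀)
        (Γ.velocity (fun u => jet k (fun z => Φ (u, z)) y₀)) =
      Γ.velocity (fun u => jet k (fun z => Γ.mul (Φ (u, Γ.tgt (Q z))) (Q z)) x) := by
  have hc := IsBisectionFamily.isJetCurve_real (y := fun _ => y₀) hΦ smoothNear_const k
  have := jetMapDeriv_mul_right_velocity (β := fun _ => x)
    (A := {q : PreJet EM EG M G k | q.pt = Γ.jetTgt (jet k Q x)})
    (Ψ := fun q => Γ.jetMul q (jet k Q x)) hQ hQx smoothNear_const rfl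
    (Eventually.of_forall fun q hq => ⟨rfl, hq.symm⟩) hc rfl
    (Eventually.of_forall fun u => hQx.symm)
  refine this.trans (velocity_congr ?_)
  have h1 : Tendsto (fun u : ℝ => (u, y₀)) (𝓝 0) (𝓝 (0, y₀)) :=
    tendsto_id.prodMk_nhds tendsto_const_nhds
  filter_upwards [h1.eventually hΦ.eventually_germ] with u hu
  obtain ⟨g', hg'⟩ := hu
  exact mul_right_jetMul hQ (by rw [hQx]; exact hg') hQx

theorem IsBisectionGerm.mderiv_inv_eq_of_close {F F' : M → G} {g g' : M → M} {x : M}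
    (hF : Γ.IsBisectionGerm F g x) (hF' : Γ.IsBisectionGerm F' g' x) (h0 : F x = F' x)
    (h : ChartClose 𝓘(ℝ, EG) (𝓝 x) (fun z => chartGauge 𝓘(ℝ, EM) x z ^ 2) (F x) F F') :
    mderiv 𝓘(ℝ, EM) 𝓘(ℝ, EM) g (Γ.tgt (F x)) = mderiv 𝓘(ℝ, EM) 𝓘(ℝ, EM) g' (Γ.tgt (F x)) := by
  have h1 := (h.map (Γ.contMDiff_tgt (F x) |>.of_le (m := 1) (by simp))).mderiv_eq
    hF.smooth_base.mdifferentiableAt hF'.smooth_base.mdifferentiableAt (by rw [h0])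
  have h2 := hF.mderiv_inv_comp
  have h3 := hF'.mderiv_comp_inv
  rw [← h1, ← h0] at h3
  have h4 := congrArg (fun L => L.comp (mderiv 𝓘(ℝ, EM) 𝓘(ℝ, EM) g' (Γ.tgt (F x)))) h2
  simp only [ContinuousLinearMap.comp_assoc, h3, ContinuousLinearMap.comp_id,
    ContinuousLinearMap.id_comp] at h4
  exact h4

theorem lamRight_family {Q : M → G} {g : M → M} {x : M}
    (hΦ : Γ.IsBisectionFamily Φ (0, y 0)) (hy : SmoothNear 𝓘(ℝ, ℝ) 𝓘(ℝ, EM) y 0)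
    (hQ : Γ.IsBisectionGerm Q g x) (hQx : Γ.tgt (Q x) = y 0) :
    Γ.lamRight (jet (k + 1) Q x) (jet k (fun z => Φ (0, z)) (y 0))
        (Γ.velocity (fun u => jet k (fun z => Φ (u, z)) (y u))) =
      Γ.velocity (fun u => jet k (fun z => Γ.mul (Φ (u, Γ.tgt (Q z))) (Q z)) (g (y u))) := by
  have hR := isBisectionGerm_rep (hQ.jet_mem (k + 1))
  have hRx : (Γ.rep (jet (k + 1) Q x)).toFun x = Q x := rep_apply (hQ.jet_mem (k + 1))
  have hcl : ChartClose 𝓘(ℝ, EG) (𝓝 x) (fun z => chartGauge 𝓘(ℝ, EM) x z ^ (k + 2)) (Q x)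
      Q (Γ.rep (jet (k + 1) Q x)).toFun := hQ.rep_close (k + 1)
  set R := (Γ.rep (jet (k + 1) Q x)).toFun with hRdef
  set gR : M → M := ⇑(Γ.rep (jet (k + 1) Q x)).base.symm with hgR
  replace hR : Γ.IsBisectionGerm R gR x := hR
  have hRy : Γ.tgt (R x) = y 0 := by rw [hRx, hQx]
  have hgRs : SmoothNear 𝓘(ℝ, EM) 𝓘(ℝ, EM) gR (y 0) := hRy ▸ hR.smooth_inv
  have hgs : SmoothNear 𝓘(ℝ, EM) 𝓘(ℝ, EM) g (y 0) := hQx ▸ hQ.smooth_inv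
  have hgR0 : gR (y 0) = x := by rw [← hRy]; exact hR.inv_apply
  have hg0 : g (y 0) = x := by rw [← hQx]; exact hQ.inv_apply
  have hri : ∀ᶠ z in 𝓝 (y 0), Γ.tgt (R (gR z)) = z := by rw [← hRy]; exact hR.right_inv
  have hc := hΦ.isJetCurve_real hy k
  have h1 := jetMapDeriv_mul_right_velocity (A := univ)
    (Ψ := fun q => Γ.jetMul q (jet k R (gR q.pt))) hR hRy hgRs hgR0
    ((tendsto_pt.eventually hri).mono fun q hq _ => ⟨rfl, hq⟩) hc rfl
    (Eventually.of_forall fun _ => mem_univ _)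
  refine h1.trans ?_
  have h2 : Tendsto (fun u => (u, y u)) (𝓝 0) (𝓝 (0, y 0)) :=
    (smoothNear_id.prodMk hy).tendsto
  have h3 : (fun q : PreJet EM EG M G k => Γ.jetMul q (jet k R (gR q.pt))) ∘
      (fun u => jet k (fun z => Φ (u, z)) (y u)) =ᶠ[𝓝 0]
      fun u => jet k (fun z => Γ.mul (Φ (u, Γ.tgt (R z))) (R z)) (gR (y u)) := by
    filter_upwards [h2.eventually hΦ.eventually_germ, hy.tendsto.eventually hri,
      ((hgRs.tendsto_of_eq hgR0).comp hy.tendsto).eventually hR.eventually] with u h4 h5 h6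
    obtain ⟨g', hg'⟩ := h4
    exact mul_right_jetMul h6 (by
      change Γ.IsBisectionGerm _ g' (Γ.tgt (R (gR (y u))))
      rw [h5]; exact hg') h5
  rw [velocity_congr h3]
  have h4 := hΦ.mul_right hR hRy
  have h5 := hΦ.mul_right hQ hQx
  refine velocity_eq_of_close (y := fun u => gR (y u)) (y' := fun u => g (y u))
    (Φ := fun q => Γ.mul (Φ (q.1, Γ.tgt (R q.2))) (R q.2))
    (Φ' := fun q => Γ.mul (Φ (q.1, Γ.tgt (Q q.2))) (Q q.2)) (by rw [hgR0]; exact h4)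
    (by rw [hgR0]; exact h5) (hgRs.comp hy) (hgs.comp hy) (by rw [hgR0, hg0]) ?_
    (by rw [hgR0, hRx]) ?_
  · rw [mderiv_comp hgRs.mdifferentiableAt hy.mdifferentiableAt rfl,
      mderiv_comp hgs.mdifferentiableAt hy.mdifferentiableAt rfl]
    have h6 := hQ.mderiv_inv_eq_of_close hR hRx.symm
      (hcl.mono (chartGauge_pow_isBigO (by omega)))
    rw [hQx] at h6
    rw [h6]
  · rw [hgR0]
    set γ : ℝ × M → ℝ := fun p => chartGauge (𝓘(ℝ, ℝ).prod 𝓘(ℝ, EM)) (0, x) p ^ (k + 2) with hγ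
    have h7 : ChartClose 𝓘(ℝ, EG) (𝓝 ((0 : ℝ), x)) γ (R x)
        (fun q : ℝ × M => R q.2) (fun q => Q q.2) := by
      have h8 := hcl.symm.comp_contMDiffAt (I'' := 𝓘(ℝ, ℝ).prod 𝓘(ℝ, EM)) (φ := Prod.snd)
        (y := ((0 : ℝ), x)) contMDiffAt_snd
      rw [hRx]
      exact h8
    have h9 := h7.map (Γ.contMDiff_tgt (R x) |>.of_le (m := 1) (by simp))
    rw [hRy] at h9
    have h10 := (ChartClose.of_eventuallyEq (I := 𝓘(ℝ, ℝ)) (g := γ)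
      (continuous_fst.tendsto ((0 : ℝ), x)) (EventuallyEq.refl _ _)).prodMk h9
    have h11 := h10.map (hΦ.smooth.contMDiffAt.of_le (m := 1) (by simp))
    have h12 := h11.mul Γ h7 (by rw [hΦ.src_apply, hRy])
      (h10.tendsto_left.eventually hΦ.src_eq) (h10.tendsto_right.eventually hΦ.src_eq)
    rw [hRy]
    exact h12

end Curves

end LieGroupoid

section Paths

variable {EM M : Type*} [NormedAddCommGroup EM] [NormedSpace ℝ EM] [TopologicalSpace M]
  [ChartedSpace EM M]

theorem mderiv_curve {y : ℝ → M} (hy : MDifferentiableAt 𝓘(ℝ, ℝ) 𝓘(ℝ, EM) y 0) :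
    mderiv 𝓘(ℝ, ℝ) 𝓘(ℝ, EM) y 0 1 = deriv (fun u => extChartAt 𝓘(ℝ, EM) (y 0) (y u)) 0 := by
  rw [mderiv, hy.mfderiv]
  simp only [ModelWithCorners.range_eq_univ, fderivWithin_univ]
  exact fderiv_apply_one_eq_deriv

theorem exists_curve [IsManifold 𝓘(ℝ, EM) ∞ M] (x : M) (v : EM) :
    ∃ y : ℝ → M, SmoothNear 𝓘(ℝ, ℝ) 𝓘(ℝ, EM) y 0 ∧ y 0 = x ∧
      mderiv 𝓘(ℝ, ℝ) 𝓘(ℝ, EM) y 0 1 = v := by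
  set φ := extChartAt 𝓘(ℝ, EM) x
  have h1 : SmoothNear 𝓘(ℝ, ℝ) 𝓘(ℝ, EM) (fun u : ℝ => φ x + u • v) 0 :=
    ContMDiff.smoothNear (ContDiff.contMDiff (contDiff_const.add
      (contDiff_id.smul contDiff_const))) 0
  have h0 : φ x + (0 : ℝ) • v = φ x := by simp
  have h2 : SmoothNear 𝓘(ℝ, ℝ) 𝓘(ℝ, EM) (fun u : ℝ => φ.symm (φ x + u • v)) 0 :=
    (smoothNear_extChartAt_symm (mem_extChartAt_target x)).comp_of_eq h1 h0
  have hx : φ.symm (φ x + (0 : ℝ) • v) = x := by rw [h0]; exact extChartAt_to_inv x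
  refine ⟨_, h2, hx, ?_⟩
  rw [mderiv_curve h2.mdifferentiableAt, hx]
  have h3 : (fun u : ℝ => φ (φ.symm (φ x + u • v))) =ᶠ[𝓝 0] fun u => φ x + u • v := by
    filter_upwards [(h1.tendsto_of_eq h0).eventually
      (extChartAt_target_mem_nhds (I := 𝓘(ℝ, EM)) x)] with u hu using φ.right_inv hu
  rw [h3.deriv_eq]
  simpa using (((hasDerivAt_id (0 : ℝ)).smul_const v).const_add (φ x)).deriv

end Paths

namespace LieGroupoid

variable {EM EG M G W : Type*}
  [NormedAddCommGroup EM] [NormedSpace ℝ EM] [NormedAddCommGroup EG] [NormedSpace ℝ EG]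
  [NormedAddCommGroup W] [NormedSpace ℝ W]
  [TopologicalSpace M] [ChartedSpace EM M] [TopologicalSpace G] [ChartedSpace EG G]
  {Γ : LieGroupoid EM EG M G} {k : ℕ}
  [IsManifold 𝓘(ℝ, EM) ∞ M] [IsManifold 𝓘(ℝ, EG) ∞ G] [CompleteSpace EM]
  [CompleteSpace EG]

theorem velocity_const (p : PreJet EM EG M G k) : Γ.velocity (fun _ => p) = 0 := by
  simp [velocity]

theorem velocity_family_congr {Φ Φ' : ℝ × M → G} {y y' : ℝ → M} (hy : ContinuousAt y 0)
    (h : Φ =ᶠ[𝓝 (0, y 0)] Φ') (hyy : y =ᶠ[𝓝 0] y') :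
    Γ.velocity (fun u => (jet k (fun z => Φ (u, z)) (y u) : PreJet EM EG M G k)) =
      Γ.velocity (fun u => jet k (fun z => Φ' (u, z)) (y' u)) := by
  apply velocity_congr
  have h1 : Tendsto (fun u : ℝ => (u, y u)) (𝓝 0) (𝓝 (0, y 0)) := tendsto_id.prodMk_nhds hy
  filter_upwards [h1.eventually h.eventually_nhds, hyy] with u hu hu'
  rw [← hu']
  exact jet_congr (tendsto_mk_left.eventually hu)

theorem one_isLocalFamily (k : ℕ) (x : M) :
    Γ.IsLocalFamily (Γ.jetOne k) (fun q => Γ.one q.2) x :=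
  (IsBisectionGerm.one x).isLocalFamily k

theorem one_isBisectionFamily (w : W) (x : M) :
    Γ.IsBisectionFamily (fun q : W × M => Γ.one q.2) (w, x) :=
  (IsBisectionGerm.one x).isBisectionFamily w

theorem velocity_jetOne {y : ℝ → M} (hy : SmoothNear 𝓘(ℝ, ℝ) 𝓘(ℝ, EM) y 0) :
    Γ.velocity (fun u => Γ.jetOne k (y u)) =
      Γ.horiz k (y 0) (mderiv 𝓘(ℝ, ℝ) 𝓘(ℝ, EM) y 0 1) := by
  have h1 := (one_isLocalFamily (Γ := Γ) k (y 0)).smoothJetMapAt.2.2.2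
  have h2 := mderiv_comp_apply (h1.mdifferentiableAt (by simp)) hy.mdifferentiableAt rfl 1
  rw [mderiv_eq_fderiv] at h2
  exact fderiv_apply_one_eq_deriv.symm.trans h2

theorem horiz_eq (x : M) (v : EM) :
    Γ.horiz k x v = (v, fderiv ℝ (famCoeffs k x (Γ.one x) (fun q => Γ.one q.2) :
      ℝ × EM → JetCoeff EM EG k) (0, extChartAt 𝓘(ℝ, EM) x x) (1, v)) := by
  obtain ⟨y, hy, rfl, rfl⟩ := exists_curve x v
  rw [← velocity_jetOne hy]
  exact IsBisectionFamily.velocity_real (Φ := fun q => Γ.one q.2) (one_isBisectionFamily 0 (y 0))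
    hy k

theorem horiz_fst (x : M) (v : EM) : (Γ.horiz k x v).1 = v := by rw [horiz_eq]

theorem ofTan_toTan (x : M) (a : CheckJet EM EG k) : Γ.ofTan x (Γ.toTan x a) = a := by
  have h1 : (Γ.toTan x a).1 = a.1 := by
    simp only [toTan, vert, Prod.fst_add, add_zero]
    exact horiz_fst x a.1
  refine Prod.ext h1 ?_
  simp only [ofTan, h1]
  simp [toTan, vert]

theorem horiz_zero (x : M) : Γ.horiz k x (0 : EM) = 0 := by
  simp only [horiz, jetDeriv]
  exact map_zero (mfderiv 𝓘(ℝ, EM) 𝓘(ℝ, JetTan EM EG k) _ x : EM →L[ℝ] JetTan EM EG k)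

theorem algJet_congr {θ θ' : M → EG} {x : M} (h : θ =ᶠ[𝓝 x] θ') :
    Γ.algJet k (fun z => θ z) x = Γ.algJet k (fun z => θ' z) x := by
  have hx : (extChartAt 𝓘(ℝ, EM) x).symm (extChartAt 𝓘(ℝ, EM) x x) = x := extChartAt_to_inv x
  have hc := (continuousAt_extChartAt_symm (I := 𝓘(ℝ, EM)) x).tendsto
  rw [hx] at hc
  ext1 i
  have h1 : (fun e : EM => (mfderiv 𝓘(ℝ, EG) 𝓘(ℝ, EG) (extChartAt 𝓘(ℝ, EG) (Γ.one x))
      (Γ.one ((extChartAt 𝓘(ℝ, EM) x).symm e)) (θ ((extChartAt 𝓘(ℝ, EM) x).symm e)) : EG))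
      =ᶠ[𝓝 (extChartAt 𝓘(ℝ, EM) x x)] fun e : EM =>
      (mfderiv 𝓘(ℝ, EG) 𝓘(ℝ, EG) (extChartAt 𝓘(ℝ, EG) (Γ.one x))
      (Γ.one ((extChartAt 𝓘(ℝ, EM) x).symm e)) (θ' ((extChartAt 𝓘(ℝ, EM) x).symm e)) : EG) := by
    filter_upwards [hc.eventually h] with e he
    rw [he]
  exact (h1.iteratedFDeriv ℝ (i : ℕ)).self_of_nhds

theorem velocity_eq_vert {κ : ℝ × M → G} {x : M} (hκ : Γ.IsBisectionFamily κ (0, x))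
    (h0 : ∀ᶠ z in 𝓝 x, κ (0, z) = Γ.one z) :
    Γ.velocity (fun u => jet k (fun z => κ (u, z)) x) =
      vert (Γ.algJet k (fun z => mderiv 𝓘(ℝ, ℝ) 𝓘(ℝ, EG) (fun u => κ (u, z)) 0 1) x) := by
  have hv := IsBisectionFamily.velocity_real (y := fun _ => x) hκ smoothNear_const k
  rw [mderiv_const] at hv
  rw [hv]
  refine Prod.ext rfl ?_
  have hx : (extChartAt 𝓘(ℝ, EM) x).symm (extChartAt 𝓘(ℝ, EM) x x) = x := extChartAt_to_inv x
  have hc := (continuousAt_extChartAt_symm (I := 𝓘(ℝ, EM)) x).tendsto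
  rw [hx] at hc
  have hx0 : κ (0, x) = Γ.one x := h0.self_of_nhds
  have hin := contDiffAt_inCharts hκ.smooth.contMDiffAt (mem_chart_source EM x)
    (mem_chart_source EG _)
  have hfam := contDiffAt_famCoeffs (k := k) hκ.smooth.contMDiffAt (mem_chart_source EM x)
    (mem_chart_source EG _)
  have hev : (fun e : EM => (mfderiv 𝓘(ℝ, EG) 𝓘(ℝ, EG) (extChartAt 𝓘(ℝ, EG) (Γ.one x))
      (Γ.one ((extChartAt 𝓘(ℝ, EM) x).symm e))
        (mderiv 𝓘(ℝ, ℝ) 𝓘(ℝ, EG) (fun u => κ (u, (extChartAt 𝓘(ℝ, EM) x).symm e)) 0 1) : EG))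
      =ᶠ[𝓝 (extChartAt 𝓘(ℝ, EM) x x)] fun e =>
        fderiv ℝ (inCharts x (κ (0, x)) κ : ℝ × EM → EG) (0, e) (1, 0) := by
    have hc0 : Tendsto (fun e : EM => ((0 : ℝ), (extChartAt 𝓘(ℝ, EM) x).symm e))
        (𝓝 (extChartAt 𝓘(ℝ, EM) x x)) (𝓝 (0, x)) := tendsto_const_nhds.prodMk_nhds hc
    have hin' : ∀ᶠ p in 𝓝 ((0 : ℝ), extChartAt 𝓘(ℝ, EM) x x),
        DifferentiableAt ℝ (inCharts x (κ (0, x)) κ : ℝ × EM → EG) p :=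
      ((hin.of_le (m := 1) (by simp)).eventually (by simp)).mono fun p hp =>
        hp.differentiableAt (by simp)
    filter_upwards [hc.eventually h0, hc0.eventually hκ.smooth, tendsto_mk_left.eventually hin',
      (hc0.eventually (hκ.smooth.continuousAt.eventually
        (extChartAt_source_mem_nhds (I := 𝓘(ℝ, EG)) (κ (0, x)))))] with e h1 h2 h3 h4
    set z := (extChartAt 𝓘(ℝ, EM) x).symm e with hz
    have hd : MDifferentiableAt 𝓘(ℝ, ℝ) 𝓘(ℝ, EG) (fun u => κ (u, z)) 0 :=
      MDifferentiableAt.comp (I' := 𝓘(ℝ, ℝ).prod 𝓘(ℝ, EM)) (0 : ℝ)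
        (h2.mdifferentiableAt (by simp)) (mdifferentiableAt_id.prodMk mdifferentiableAt_const)
    have h5 : MDifferentiableAt 𝓘(ℝ, EG) 𝓘(ℝ, EG) (extChartAt 𝓘(ℝ, EG) (κ (0, x))) (κ (0, z)) :=
      (smoothNear_extChartAt h4).mdifferentiableAt
    have h6 := mderiv_comp_apply h5 hd rfl 1
    have h7 : fderiv ℝ (inCharts x (κ (0, x)) κ : ℝ × EM → EG) (0, e) (1, 0) =
        fderiv ℝ (fun u : ℝ => (inCharts x (κ (0, x)) κ : ℝ × EM → EG) (u, e)) 0 1 := by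
      have h8 := (h3.hasFDerivAt.comp_hasDerivAt (0 : ℝ)
        ((hasDerivAt_id (0 : ℝ)).prodMk (hasDerivAt_const (0 : ℝ) e))).deriv
      rw [← h8]
      exact (fderiv_apply_one_eq_deriv).symm
    rw [h7, ← hx0, ← h1]
    rw [mderiv_eq_fderiv] at h6
    exact h6.symm
  ext1 i
  have h8 : (vert (Γ.algJet k (fun z => mderiv 𝓘(ℝ, ℝ) 𝓘(ℝ, EG) (fun u => κ (u, z)) 0 1) x) :
      JetTan EM EG k).2 i = iteratedFDeriv ℝ (i : ℕ) (fun e =>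
        fderiv ℝ (inCharts x (κ (0, x)) κ : ℝ × EM → EG) (0, e) (1, 0))
          (extChartAt 𝓘(ℝ, EM) x x) := by
    exact (hev.iteratedFDeriv ℝ (i : ℕ)).self_of_nhds
  rw [h8]
  have h9 := fderiv_iteratedFDeriv_partial_inl (i : ℕ) hin (1 : ℝ)
  rw [← h9]
  have h10 := hfam.differentiableAt (by simp)
  have h11 := (hasFDerivAt_pi'.1 h10.hasFDerivAt i).fderiv
  exact (congrArg (fun L => L ((1 : ℝ), (0 : EM))) h11).symm

end LieGroupoid

namespace LieGroupoid

variable {EM EG M G : Type*}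
  [NormedAddCommGroup EM] [NormedSpace ℝ EM] [NormedAddCommGroup EG] [NormedSpace ℝ EG]
  [TopologicalSpace M] [ChartedSpace EM M] [TopologicalSpace G] [ChartedSpace EG G]
  {Γ : LieGroupoid EM EG M G} {k : ℕ}
  [IsManifold 𝓘(ℝ, EM) ∞ M] [IsManifold 𝓘(ℝ, EG) ∞ G] [CompleteSpace EM]
  [CompleteSpace EG]

/-- The bisections `z ↦ T(y(s), t η_u(z')) η_u(z') ψ(z)`, with `z' = t ψ(z)`, for the parameters
`(s, u)`. -/
def conjFamily (Γ : LieGroupoid EM EG M G) (T : M × M → G) (ψ : M → G) (y : ℝ → M)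
    (η : ℝ × M → G) (q : (ℝ × ℝ) × M) : G :=
  Γ.mul (Γ.mul (T (y q.1.1, Γ.tgt (η (q.1.2, Γ.tgt (ψ q.2))))) (η (q.1.2, Γ.tgt (ψ q.2)))) (ψ q.2)

section Conj

variable {S : M → PreJet EM EG M G k} {T : M × M → G} {x : M} {g : M → M} {y : ℝ → M}
  {η : ℝ × M → G}

theorem IsLocalFamily.eq_jet (hT : Γ.IsLocalFamily S T x) : S x = jet k (fun z => T (x, z)) x :=
  hT.jet_eq.self_of_nhds

theorem IsBisectionFamily.comp_left {W W' : Type*} [NormedAddCommGroup W] [NormedSpace ℝ W]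
    [NormedAddCommGroup W'] [NormedSpace ℝ W'] {Φ : W' × M → G} {a : W → W'} {w : W} {w' : W'}
    {z : M} (hΦ : Γ.IsBisectionFamily Φ (w', z)) (ha : ContDiff ℝ ∞ a) (hw : a w = w') :
    Γ.IsBisectionFamily (fun q : W × M => Φ (a q.1, q.2)) (w, z) := by
  subst hw
  have h1 : SmoothNear (𝓘(ℝ, W).prod 𝓘(ℝ, EM)) (𝓘(ℝ, W').prod 𝓘(ℝ, EM))
      (fun q : W × M => (a q.1, q.2)) (w, z) :=
    ((ha.contMDiff.smoothNear w).comp_of_eq smoothNear_fst rfl).prodMk smoothNear_snd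
  obtain ⟨g, hg⟩ := hΦ.germ
  exact ⟨hΦ.smooth.comp_of_eq h1 rfl, h1.tendsto.eventually hΦ.src_eq, g, hg⟩

theorem conjFamily_isBisectionFamily (hT : Γ.IsLocalFamily S T x)
    (hF : Γ.IsBisectionGerm (fun z => T (x, z)) g x) (hy : SmoothNear 𝓘(ℝ, ℝ) 𝓘(ℝ, EM) y 0)
    (hy0 : y 0 = x) (hη : Γ.IsBisectionFamily η (0, x)) (hη0 : ∀ᶠ z in 𝓝 x, η (0, z) = Γ.one z) :
    Γ.IsBisectionFamily (Γ.conjFamily T (fun z => Γ.inv (T (x, g z))) y η)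
      ((0, 0), Γ.tgt (T (x, x))) := by
  have h1 : Γ.IsBisectionFamily (fun q : (ℝ × ℝ) × M => η (q.1.2, q.2)) ((0, 0), x) :=
    hη.comp_left (a := Prod.snd) contDiff_snd rfl
  have h2 : SmoothNear 𝓘(ℝ, ℝ × ℝ) 𝓘(ℝ, EM) (fun w : ℝ × ℝ => y w.1) (0, 0) :=
    hy.comp_of_eq (contDiff_fst.contMDiff.smoothNear _) rfl
  have h3 := h1.mul (by
    show Γ.tgt (η (0, x)) = x
    rw [hη0.self_of_nhds, Γ.tgt_one]) (hT.comp_param h2 hy0)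
  exact (hF.inv.isBisectionFamily ((0, 0) : ℝ × ℝ)).mul (by
    show Γ.tgt (Γ.inv (T (x, g (Γ.tgt (T (x, x)))))) = x
    rw [Γ.tgt_inv, hF.inv_apply, hF.src_apply]) h3

theorem tendsto_tgt_inv (hF : Γ.IsBisectionGerm (fun z => T (x, z)) g x) :
    Tendsto (fun z => Γ.tgt (Γ.inv (T (x, g z)))) (𝓝 (Γ.tgt (T (x, x)))) (𝓝 x) :=
  hF.inv.smooth_base.tendsto_of_eq (by rw [Γ.tgt_inv, hF.inv_apply, hF.src_apply])

theorem conjFamily_zero (hF : Γ.IsBisectionGerm (fun z => T (x, z)) g x)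
    (hy0 : y 0 = x) (hη0 : ∀ᶠ z in 𝓝 x, η (0, z) = Γ.one z) :
    ∀ᶠ z in 𝓝 (Γ.tgt (T (x, x))),
      Γ.conjFamily T (fun z => Γ.inv (T (x, g z))) y η ((0, 0), z) = Γ.one z := by
  filter_upwards [(tendsto_tgt_inv hF).eventually hη0, hF.right_inv,
    hF.tendsto_inv.eventually hF.src_eq] with z h1 h2 h3
  have h4 := Γ.mul_one (T (x, g z))
  rw [h3] at h4
  rw [Γ.tgt_inv, h3] at h1
  simp only [conjFamily, hy0, Γ.tgt_inv, h3, h1, Γ.tgt_one, h4, Γ.mul_inv, h2]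

theorem jetInv_jet_family (hF : Γ.IsBisectionGerm (fun z => T (x, z)) g x) (k : ℕ) :
    Γ.jetInv (jet k (fun z => T (x, z)) x) =
      jet k (fun z => Γ.inv (T (x, g z))) (Γ.tgt (T (x, x))) := jetInv_jet hF k

theorem conjFirst_eq (hT : Γ.IsLocalFamily S T x)
    (hF : Γ.IsBisectionGerm (fun z => T (x, z)) g x) (hy : SmoothNear 𝓘(ℝ, ℝ) 𝓘(ℝ, EM) y 0)
    (hy0 : y 0 = x) (hη0 : ∀ᶠ z in 𝓝 x, η (0, z) = Γ.one z) :
    Γ.conjFirst S (jet (k + 1) (fun z => T (x, z)) x) x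
        (Γ.horiz k x (mderiv 𝓘(ℝ, ℝ) 𝓘(ℝ, EM) y 0 1)) =
      Γ.velocity (fun u => jet k (fun z => Γ.conjFamily T (fun z => Γ.inv (T (x, g z))) y η
        ((u, 0), z)) (Γ.tgt (T (x, y u)))) := by
  subst hy0
  have h1 := one_isBisectionFamily (Γ := Γ) (0 : ℝ) (y 0)
  have hS' : Γ.IsLocalFamily S T (Γ.tgt (Γ.one (y 0))) := by rwa [Γ.tgt_one]
  have h2 := leftAct_family (Φ := fun q => Γ.one q.2) h1 hy hS'
  have h3 := hS'.mul_family h1 hy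
  rw [conjFirst, jetInv_jet_family hF, ← velocity_jetOne hy]
  change Γ.lamRight _ _ (Γ.leftAct S (jet k (fun z => Γ.one z) (y 0))
    (Γ.velocity (fun u => jet k (fun z => Γ.one z) (y u)))) = _
  rw [h2]
  have h4 : S (y 0) = jet k (fun z => Γ.mul (T (Γ.tgt (Γ.one (y 0)), Γ.tgt (Γ.one z))) (Γ.one z))
      (y 0) := by
    rw [hT.eq_jet]
    apply jet_congr
    filter_upwards [hF.src_eq] with z hz
    have := Γ.mul_one (T (y 0, z))
    rw [hz] at this
    simp only [Γ.tgt_one, this]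
  rw [h4]
  have h5 := lamRight_family (k := k) h3 hy hF.inv (by
    rw [Γ.tgt_inv, hF.inv_apply, hF.src_apply])
  refine h5.trans ?_
  refine velocity_family_congr (Φ := fun q : ℝ × M => Γ.mul (Γ.mul (T (Γ.tgt (Γ.one (y q.1)),
      Γ.tgt (Γ.one (Γ.tgt (Γ.inv (T (y 0, g q.2))))))) (Γ.one (Γ.tgt (Γ.inv (T (y 0, g q.2))))))
      (Γ.inv (T (y 0, g q.2)))) (Φ' := fun q : ℝ × M => Γ.conjFamily T
    (fun z => Γ.inv (T (y 0, g z))) y η ((q.1, 0), q.2)) (y := fun u => Γ.tgt (T (y 0, y u)))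
    (y' := fun u => Γ.tgt (T (y 0, y u))) ?_ ?_ (EventuallyEq.refl _ _)
  · exact (hF.smooth_base.comp_of_eq hy rfl).continuousAt
  · have h6 : ∀ᶠ q in 𝓝 ((0 : ℝ), Γ.tgt (T (y 0, y 0))),
        η (0, Γ.tgt (Γ.inv (T (y 0, g q.2)))) = Γ.one (Γ.tgt (Γ.inv (T (y 0, g q.2)))) :=
      (continuous_snd.tendsto ((0 : ℝ), Γ.tgt (T (y 0, y 0)))).eventually
        ((tendsto_tgt_inv hF).eventually hη0)
    filter_upwards [h6] with q hq
    simp only [conjFamily, hq, Γ.tgt_one]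

theorem conjLam_eq (hF : Γ.IsBisectionGerm (fun z => T (x, z)) g x)
    (hy : SmoothNear 𝓘(ℝ, ℝ) 𝓘(ℝ, EM) y 0)
    (hy0 : y 0 = x) (hη0 : ∀ᶠ z in 𝓝 x, η (0, z) = Γ.one z) :
    Γ.conjLam (jet (k + 1) (fun z => T (x, z)) x) x
        (Γ.horiz k x (mderiv 𝓘(ℝ, ℝ) 𝓘(ℝ, EM) y 0 1)) =
      Γ.velocity (fun u => jet k (fun z => Γ.conjFamily T (fun z => Γ.inv (T (x, g z))) y η
        ((0, 0), z)) (Γ.tgt (T (x, y u)))) := by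
  subst hy0
  have h1 := one_isBisectionFamily (Γ := Γ) (0 : ℝ) (y 0)
  have h2 := lamLeft_family (Φ := fun q => Γ.one q.2) (k := k) h1 hy hF (Γ.tgt_one _)
  have h3 := h1.mul (Γ.tgt_one _) (hF.isBisectionFamily (0 : ℝ))
  rw [conjLam, jetInv_jet_family hF, ← velocity_jetOne hy]
  change Γ.lamRight _ _ (Γ.lamLeft _ (jet k (fun z => Γ.one z) (y 0))
    (Γ.velocity (fun u => jet k (fun z => Γ.one z) (y u)))) = _
  rw [h2]
  have h4 : (jet (k + 1) (fun z => T (y 0, z)) (y 0) : PreJet EM EG M G (k + 1)).proj =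
      jet k (fun z => Γ.mul (T (y 0, Γ.tgt (Γ.one z))) (Γ.one z)) (y 0) := by
    change (jet k (fun z => T (y 0, z)) (y 0) : PreJet EM EG M G k) = _
    apply jet_congr
    filter_upwards [hF.src_eq] with z hz
    have := Γ.mul_one (T (y 0, z))
    rw [hz] at this
    simp only [Γ.tgt_one, this]
  rw [h4]
  have h5 := lamRight_family (k := k) h3 hy hF.inv (by
    rw [Γ.tgt_inv, hF.inv_apply, hF.src_apply])
  refine h5.trans ?_
  refine velocity_family_congr (Φ := fun q : ℝ × M => Γ.mul (Γ.mul (T (y 0,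
      Γ.tgt (Γ.one (Γ.tgt (Γ.inv (T (y 0, g q.2))))))) (Γ.one (Γ.tgt (Γ.inv (T (y 0, g q.2))))))
      (Γ.inv (T (y 0, g q.2)))) (Φ' := fun q : ℝ × M => Γ.conjFamily T
    (fun z => Γ.inv (T (y 0, g z))) y η ((0, 0), q.2)) (y := fun u => Γ.tgt (T (y 0, y u)))
    (y' := fun u => Γ.tgt (T (y 0, y u))) ?_ ?_ (EventuallyEq.refl _ _)
  · exact (hF.smooth_base.comp_of_eq hy rfl).continuousAt
  · have h6 : ∀ᶠ q in 𝓝 ((0 : ℝ), Γ.tgt (T (y 0, y 0))),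
        η (0, Γ.tgt (Γ.inv (T (y 0, g q.2)))) = Γ.one (Γ.tgt (Γ.inv (T (y 0, g q.2)))) :=
      (continuous_snd.tendsto ((0 : ℝ), Γ.tgt (T (y 0, y 0)))).eventually
        ((tendsto_tgt_inv hF).eventually hη0)
    filter_upwards [h6] with q hq
    simp only [conjFamily, hq, Γ.tgt_one]

theorem conjVert_eq {A : JetCoeff EM EG k} (hF : Γ.IsBisectionGerm (fun z => T (x, z)) g x)
    (hy0 : y 0 = x) (hη : Γ.IsBisectionFamily η (0, x))
    (hη0 : ∀ᶠ z in 𝓝 x, η (0, z) = Γ.one z)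
    (hA : Γ.velocity (fun u => jet k (fun z => η (u, z)) x) = vert A) :
    Γ.conjVert (jet (k + 1) (fun z => T (x, z)) x) x A =
      Γ.velocity (fun u => jet k (fun z => Γ.conjFamily T (fun z => Γ.inv (T (x, g z))) y η
        ((0, u), z)) (Γ.tgt (T (x, x)))) := by
  have hηx : Γ.tgt (η (0, x)) = x := by rw [hη0.self_of_nhds, Γ.tgt_one]
  have h2 := lamLeft_family (k := k) (y := fun _ => x) hη smoothNear_const hF hηx
  have h3 := hη.mul hηx (hF.isBisectionFamily (0 : ℝ))
  have h4 : (jet (k + 1) (fun z => T (x, z)) x : PreJet EM EG M G (k + 1)).proj =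
      jet k (fun z => Γ.mul (T (x, Γ.tgt (η (0, z)))) (η (0, z))) x := by
    change (jet k (fun z => T (x, z)) x : PreJet EM EG M G k) = _
    apply jet_congr
    filter_upwards [hF.src_eq, hη0] with z hz hz'
    have := Γ.mul_one (T (x, z))
    rw [hz] at this
    simp only [hz', Γ.tgt_one, this]
  have h5 : Γ.jetOne k x = jet k (fun z => η (0, z)) x :=
    jet_congr (by filter_upwards [hη0] with z hz using hz.symm)
  have h6 : Γ.jetInv (jet (k + 1) (fun z => T (x, z)) x : PreJet EM EG M G (k + 1)).proj =
      jet k (fun z => Γ.inv (T (x, g z))) (Γ.tgt (T (x, x))) := jetInv_jet_family hF k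
  rw [conjVert, h6, h4, h5, ← hA, h2]
  have h7 := rightActVert_family (k := k) h3 hF.inv (by
    rw [Γ.tgt_inv, hF.inv_apply, hF.src_apply])
  refine h7.trans ?_
  refine velocity_congr (EventuallyEq.of_eq (funext fun u => ?_))
  simp only [conjFamily, hy0]

theorem conjTangent_eq {A : JetCoeff EM EG k} (hT : Γ.IsLocalFamily S T x)
    (hF : Γ.IsBisectionGerm (fun z => T (x, z)) g x) (hη : Γ.IsBisectionFamily η (0, x))
    (hη0 : ∀ᶠ z in 𝓝 x, η (0, z) = Γ.one z)
    (hA : Γ.velocity (fun u => jet k (fun z => η (u, z)) x) = vert A) :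
    Γ.conjTangent S x A =
      Γ.velocity (fun u => jet k (fun z => Γ.conjFamily T (fun z => Γ.inv (T (x, g z)))
        (fun s => Γ.tgt (η (s, x))) η ((u, u), z)) (Γ.tgt (T (x, x)))) := by
  have hηx : Γ.tgt (η (0, x)) = x := by rw [hη0.self_of_nhds, Γ.tgt_one]
  have hT' : Γ.IsLocalFamily S T (Γ.tgt (η (0, x))) := by rwa [hηx]
  have h2 := leftAct_family (k := k) (y := fun _ => x) hη smoothNear_const hT'
  have h3 := IsLocalFamily.mul_family (y := fun _ => x) hη smoothNear_const hT'
  have h4 : S x = jet k (fun z => Γ.mul (T (Γ.tgt (η (0, x)), Γ.tgt (η (0, z)))) (η (0, z))) x := by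
    rw [hT.eq_jet]
    apply jet_congr
    filter_upwards [hF.src_eq, hη0] with z hz hz'
    have := Γ.mul_one (T (x, z))
    rw [hz] at this
    simp only [hηx, hz', Γ.tgt_one, this]
  have h5 : Γ.jetOne k x = jet k (fun z => η (0, z)) x :=
    jet_congr (by filter_upwards [hη0] with z hz using hz.symm)
  have h6 : Γ.jetInv (S x) = jet k (fun z => Γ.inv (T (x, g z))) (Γ.tgt (T (x, x))) := by
    rw [hT.eq_jet]; exact jetInv_jet_family hF k
  rw [conjTangent, h6, h4, h5, ← hA, h2]
  exact rightActVert_family (k := k) h3 hF.inv (by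
    rw [Γ.tgt_inv, hF.inv_apply, hF.src_apply])

theorem conj_sum {A : JetCoeff EM EG k} (hT : Γ.IsLocalFamily S T x)
    (hF : Γ.IsBisectionGerm (fun z => T (x, z)) g x) (hy : SmoothNear 𝓘(ℝ, ℝ) 𝓘(ℝ, EM) y 0)
    (hy0 : y 0 = x) (hη : Γ.IsBisectionFamily η (0, x))
    (hη0 : ∀ᶠ z in 𝓝 x, η (0, z) = Γ.one z)
    (hA : Γ.velocity (fun u => jet k (fun z => η (u, z)) x) = vert A) :
    Γ.conjFirst S (jet (k + 1) (fun z => T (x, z)) x) x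
        (Γ.horiz k x (mderiv 𝓘(ℝ, ℝ) 𝓘(ℝ, EM) y 0 1)) -
      Γ.conjLam (jet (k + 1) (fun z => T (x, z)) x) x
        (Γ.horiz k x (mderiv 𝓘(ℝ, ℝ) 𝓘(ℝ, EM) y 0 1)) +
      Γ.conjVert (jet (k + 1) (fun z => T (x, z)) x) x A =
      Γ.velocity (fun u => jet k (fun z => Γ.conjFamily T (fun z => Γ.inv (T (x, g z))) y η
        ((u, u), z)) (Γ.tgt (T (x, x)))) := by
  have hκ := conjFamily_isBisectionFamily hT hF hy hy0 hη hη0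
  have hz : ContMDiffAt 𝓘(ℝ, ℝ) 𝓘(ℝ, EM) ∞ (fun u => Γ.tgt (T (x, y u))) 0 :=
    (hF.smooth_base.comp_of_eq hy hy0).contMDiffAt
  have e1 := (IsBisectionFamily.isJetCurve (w := fun u : ℝ => (u, (0 : ℝ)))
    (y := fun u => Γ.tgt (T (x, y u))) (by rw [hy0]; exact hκ)
    (contDiff_id.prodMk contDiff_const).contDiffAt hz k).2
  have e2 := (IsBisectionFamily.isJetCurve (w := fun u : ℝ => ((0 : ℝ), (0 : ℝ)))
    (y := fun u => Γ.tgt (T (x, y u))) (by rw [hy0]; exact hκ)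
    contDiffAt_const hz k).2
  have e3 := (IsBisectionFamily.isJetCurve (w := fun u : ℝ => ((0 : ℝ), u))
    (y := fun _ => Γ.tgt (T (x, x))) hκ
    (contDiff_const.prodMk contDiff_id).contDiffAt contMDiffAt_const k).2
  have e4 := (IsBisectionFamily.isJetCurve (w := fun u : ℝ => (u, u))
    (y := fun _ => Γ.tgt (T (x, x))) hκ
    (contDiff_id.prodMk contDiff_id).contDiffAt contMDiffAt_const k).2
  rw [conjFirst_eq hT hF hy hy0 hη0, conjLam_eq hF hy hy0 hη0, conjVert_eq hF hy0 hη hη0 hA,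
    e1, e2, e3, e4]
  have d1 : deriv (fun u : ℝ => (u, (0 : ℝ))) 0 = (1, 0) :=
    ((hasDerivAt_id (0 : ℝ)).prodMk (hasDerivAt_const (0 : ℝ) (0 : ℝ))).deriv
  have d2 : deriv (fun _ : ℝ => ((0 : ℝ), (0 : ℝ))) 0 = 0 := by simp
  have d3 : deriv (fun u : ℝ => ((0 : ℝ), u)) 0 = (0, 1) :=
    ((hasDerivAt_const (0 : ℝ) (0 : ℝ)).prodMk (hasDerivAt_id (0 : ℝ))).deriv
  have d4 : deriv (fun u : ℝ => (u, u)) 0 = (1, 1) :=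
    ((hasDerivAt_id (0 : ℝ)).prodMk (hasDerivAt_id (0 : ℝ))).deriv
  rw [d1, d2, d3, d4, hy0, mderiv_const]
  refine Prod.ext (by simp) ?_
  simp only [Prod.snd_add, Prod.snd_sub, ← map_sub, ← map_add, zero_apply]
  congr 1
  simp

theorem conjFirst_zero (hT : Γ.IsLocalFamily S T x)
    (hF : Γ.IsBisectionGerm (fun z => T (x, z)) g x) :
    Γ.conjFirst S (jet (k + 1) (fun z => T (x, z)) x) x (Γ.horiz k x (0 : EM)) = 0 := by
  have h := conjFirst_eq (η := fun q => Γ.one q.2) (y := fun _ => x) hT hF smoothNear_const rfl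
    (Eventually.of_forall fun _ => rfl)
  rw [mderiv_const] at h
  exact h.trans (velocity_const _)

theorem conjLam_zero (hF : Γ.IsBisectionGerm (fun z => T (x, z)) g x) :
    Γ.conjLam (jet (k + 1) (fun z => T (x, z)) x) x (Γ.horiz k x (0 : EM)) = 0 := by
  have h := conjLam_eq (k := k) (η := fun q => Γ.one q.2) (y := fun _ => x) hF smoothNear_const rfl
    (Eventually.of_forall fun _ => rfl)
  rw [mderiv_const] at h
  exact h.trans (velocity_const _)

theorem conjVert_zero (hF : Γ.IsBisectionGerm (fun z => T (x, z)) g x) :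
    Γ.conjVert (jet (k + 1) (fun z => T (x, z)) x) x (0 : JetCoeff EM EG k) = 0 := by
  have h := conjVert_eq (k := k) (A := 0) (η := fun q => Γ.one q.2) (y := fun _ => x) hF rfl
    (one_isBisectionFamily 0 x) (Eventually.of_forall fun _ => rfl)
    (velocity_const _)
  exact h.trans (velocity_const _)

end Conj

end LieGroupoid

section Fields

variable {E H N : Type*} [NormedAddCommGroup E] [NormedSpace ℝ E] [TopologicalSpace H]
  [TopologicalSpace N] [ChartedSpace H N]
  {E' H' N' : Type*} [NormedAddCommGroup E'] [NormedSpace ℝ E'] [TopologicalSpace H']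
  [TopologicalSpace N'] [ChartedSpace H' N']
  {E'' H'' N'' : Type*} [NormedAddCommGroup E''] [NormedSpace ℝ E''] [TopologicalSpace H'']
  [TopologicalSpace N''] [ChartedSpace H'' N'']
  {I : ModelWithCorners ℝ E H} {I' : ModelWithCorners ℝ E' H'} {I'' : ModelWithCorners ℝ E'' H''}

theorem snd_trivializationAt_tangent [IsManifold I ∞ N] {n Z₀ : N}
    (h : n ∈ (chartAt H Z₀).source) (v : TangentSpace I n) :
    (trivializationAt E (TangentSpace I) Z₀ (⟨n, v⟩ : TangentBundle I N)).2 =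
      (mfderiv I 𝓘(ℝ, E) (extChartAt I Z₀) n : _ →L[ℝ] _) v := by
  have h2 := DFunLike.congr_fun (TangentBundle.continuousLinearMapAt_trivializationAt (I := I) h) v
  refine Eq.trans ?_ h2
  rw [Bundle.Trivialization.continuousLinearMapAt_apply,
    Bundle.Trivialization.linearMapAt_apply, if_pos]
  rwa [TangentBundle.trivializationAt_baseSet]

theorem contMDiffAt_tangent_iff [IsManifold I' ∞ N'] {b : N → N'} {V : N → E'} {n : N} {Z₀ : N'}
    (h : b n ∈ (chartAt H' Z₀).source) :
    ContMDiffAt I I'.tangent ∞ (fun z => (⟨b z, V z⟩ : TangentBundle I' N')) n ↔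
      ContMDiffAt I I' ∞ b n ∧
        ContMDiffAt I 𝓘(ℝ, E') ∞ (fun z => mderiv I' 𝓘(ℝ, E') (extChartAt I' Z₀) (b z) (V z)) n := by
  have : IsManifold I' 1 N' := IsManifold.of_le (n := ∞) (by simp)
  have : IsManifold I' (∞ + 1) N' := IsManifold.of_le (n := ∞) (by simp)
  rw [Bundle.Trivialization.contMDiffAt_iff (e := trivializationAt E' (TangentSpace I') Z₀)
    (by rw [TangentBundle.trivializationAt_source]; exact h)]
  refine and_congr_right fun hb => ?_
  have hb' : ∀ᶠ z in 𝓝 n, b z ∈ (chartAt H' Z₀).source :=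
    hb.continuousAt.tendsto.eventually ((chartAt H' Z₀).open_source.mem_nhds h)
  refine Filter.EventuallyEq.contMDiffAt_iff ?_
  filter_upwards [hb'] with z hz
  exact snd_trivializationAt_tangent hz (V z)

/-- `V` is a vector field along the map `b`, smooth near `n`. -/
def SmoothField (I : ModelWithCorners ℝ E H) (I' : ModelWithCorners ℝ E' H') [IsManifold I' ∞ N'] (b : N → N')
    (V : N → E') (n : N) : Prop :=
  SmoothNear I I'.tangent (fun z => (⟨b z, V z⟩ : TangentBundle I' N')) n

theorem smoothField_iff [IsManifold I' ∞ N'] {b : N → N'} {V : N → E'} {n : N} {Z₀ : N'}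
    (h : b n ∈ (chartAt H' Z₀).source) :
    SmoothField I I' b V n ↔ SmoothNear I I' b n ∧
      SmoothNear I 𝓘(ℝ, E') (fun z => mderiv I' 𝓘(ℝ, E') (extChartAt I' Z₀) (b z) (V z)) n := by
  have key : ∀ z, b z ∈ (chartAt H' Z₀).source →
      (ContMDiffAt I I'.tangent ∞ (fun z => (⟨b z, V z⟩ : TangentBundle I' N')) z ↔
      ContMDiffAt I I' ∞ b z ∧ ContMDiffAt I 𝓘(ℝ, E') ∞
        (fun z => mderiv I' 𝓘(ℝ, E') (extChartAt I' Z₀) (b z) (V z)) z) := fun z hz =>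
    contMDiffAt_tangent_iff hz
  have ho : ∀ {b : N → N'}, b n ∈ (chartAt H' Z₀).source → ContinuousAt b n →
      ∀ᶠ z in 𝓝 n, b z ∈ (chartAt H' Z₀).source := fun h hb =>
    hb.tendsto.eventually ((chartAt H' Z₀).open_source.mem_nhds h)
  constructor
  · intro hV
    have h1 := ho h ((key n h).1 hV.contMDiffAt).1.continuousAt
    constructor
    · filter_upwards [h1, hV] with z hz hVz using ((key z hz).1 hVz).1
    · filter_upwards [h1, hV] with z hz hVz using ((key z hz).1 hVz).2
  · rintro ⟨hb, hV⟩
    filter_upwards [ho h hb.continuousAt, hb, hV] with z hz h1 h2 using (key z hz).2 ⟨h1, h2⟩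

theorem SmoothField.congr [IsManifold I' ∞ N'] {b b' : N → N'} {V V' : N → E'} {n : N} (h : SmoothField I I' b V n)
    (hb : b =ᶠ[𝓝 n] b') (hV : V =ᶠ[𝓝 n] V') : SmoothField I I' b' V' n := by
  refine h.congr_of_eventuallyEq ?_
  filter_upwards [hb, hV] with z h1 h2
  rw [h1, h2]

theorem SmoothField.smoothNear [IsManifold I' ∞ N'] {b : N → N'} {V : N → E'} {n : N}
    (h : SmoothField I I' b V n) : SmoothNear I I' b n :=
  ((smoothField_iff (mem_chart_source H' (b n))).1 h).1

theorem SmoothField.eventually [IsManifold I' ∞ N'] {b : N → N'} {V : N → E'} {n : N} (h : SmoothField I I' b V n) :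
    ∀ᶠ z in 𝓝 n, SmoothField I I' b V z := SmoothNear.eventually h

/-- The velocity at `u = 0` of a smooth family of curves. -/
theorem smoothField_of_flow [IsManifold I ∞ N] [IsManifold I' ∞ N'] {K : ℝ × N → N'} {n : N}
    (hK : SmoothNear (𝓘(ℝ, ℝ).prod I) I' K (0, n)) :
    SmoothField I I' (fun z => K (0, z)) (fun z => mderiv 𝓘(ℝ, ℝ) I' (fun u => K (u, z)) 0 1) n := by
  have : IsManifold I' 1 N' := IsManifold.of_le (n := ∞) (by simp)
  have : IsManifold I 1 N := IsManifold.of_le (n := ∞) (by simp)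
  have hb : SmoothNear I I' (fun z => K (0, z)) n := hK.slice
  rw [smoothField_iff (b := fun z => K (0, z)) (mem_chart_source H' (K (0, n)))]
  refine ⟨hb, ?_⟩
  have hx : SmoothNear I' 𝓘(ℝ, E') (extChartAt I' (K (0, n))) (K (0, n)) :=
    smoothNear_extChartAt (mem_extChartAt_source _)
  have hQ := hx.comp hK
  have hsl : ∀ᶠ z in 𝓝 n, SmoothNear (𝓘(ℝ, ℝ).prod I) 𝓘(ℝ, E')
      (fun p => extChartAt I' (K (0, n)) (K p)) (0, z) := tendsto_mk_left.eventually hQ.eventually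
  have hsl' : ∀ᶠ z in 𝓝 n, SmoothNear (𝓘(ℝ, ℝ).prod I) I' K (0, z) :=
    tendsto_mk_left.eventually hK.eventually
  have hx' : ∀ᶠ z in 𝓝 n, SmoothNear I' 𝓘(ℝ, E') (extChartAt I' (K (0, n))) (K (0, z)) :=
    hb.tendsto.eventually hx.eventually
  have hcurve : ∀ {z : N} {E₁ H₁ N₁ : Type _} [NormedAddCommGroup E₁] [NormedSpace ℝ E₁]
      [TopologicalSpace H₁] [TopologicalSpace N₁] [ChartedSpace H₁ N₁]
      {I₁ : ModelWithCorners ℝ E₁ H₁} {Q : ℝ × N → N₁},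
      SmoothNear (𝓘(ℝ, ℝ).prod I) I₁ Q (0, z) → SmoothNear 𝓘(ℝ, ℝ) I₁ (fun u => Q (u, z)) 0 :=
    fun h => h.comp_of_eq (smoothNear_id.prodMk smoothNear_const) rfl
  have key : (fun z => mderiv I' 𝓘(ℝ, E') (extChartAt I' (K (0, n))) (K (0, z))
      (mderiv 𝓘(ℝ, ℝ) I' (fun u => K (u, z)) 0 1)) =ᶠ[𝓝 n]
      fun z => mderiv 𝓘(ℝ, ℝ) 𝓘(ℝ, E') (fun u => extChartAt I' (K (0, n)) (K (u, z))) 0 1 := by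
    filter_upwards [hsl', hx'] with z h1 h2
    exact (mderiv_comp_apply (h2.mdifferentiableAt) (hcurve h1).mdifferentiableAt rfl _).symm
  refine SmoothNear.congr_of_eventuallyEq ?_ key
  filter_upwards [hsl] with z hz
  have h3 : ContMDiffAt (I.prod 𝓘(ℝ, ℝ)) 𝓘(ℝ, E') ∞
      (Function.uncurry fun z u => extChartAt I' (K (0, n)) (K (u, z))) (z, 0) :=
    (hz.comp_of_eq (f := fun p : N × ℝ => (p.2, p.1)) (x := (z, 0)) (smoothNear_snd.prodMk smoothNear_fst) rfl).contMDiffAt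
  have h4 := ContMDiffAt.mfderiv (J := I) (I := 𝓘(ℝ, ℝ)) (m := ∞)
    (fun z u => extChartAt I' (K (0, n)) (K (u, z))) (fun _ => (0 : ℝ)) h3 contMDiffAt_const
    (by simp)
  have h5 : ContMDiffAt I 𝓘(ℝ, ℝ →L[ℝ] E') ∞ (fun z => mderiv 𝓘(ℝ, ℝ) 𝓘(ℝ, E')
      (fun u => extChartAt I' (K (0, n)) (K (u, z))) 0) z :=
    (congrArg (fun F : N → ℝ →L[ℝ] E' => ContMDiffAt I 𝓘(ℝ, ℝ →L[ℝ] E') ∞ F z)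
      (inTangentCoordinates_model_space (I := 𝓘(ℝ, ℝ)) (I' := 𝓘(ℝ, E')) (fun _ : N => (0 : ℝ))
        (fun z => extChartAt I' (K (0, n)) (K (0, z))) (fun z => mderiv 𝓘(ℝ, ℝ) 𝓘(ℝ, E')
          (fun u => extChartAt I' (K (0, n)) (K (u, z))) 0) z)).mp h4
  exact h5.clm_apply contMDiffAt_const

theorem SmoothField.exists_flow [IsManifold I ∞ N] [I'.Boundaryless] [IsManifold I' ∞ N']
    {b : N → N'} {V : N → E'} {n : N} (h : SmoothField I I' b V n) :
    ∃ K : ℝ × N → N', SmoothNear (𝓘(ℝ, ℝ).prod I) I' K (0, n) ∧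
      ∀ᶠ z in 𝓝 n, K (0, z) = b z ∧ mderiv 𝓘(ℝ, ℝ) I' (fun u => K (u, z)) 0 1 = V z := by
  obtain ⟨hb, hV⟩ := (smoothField_iff (mem_chart_source H' (b n))).1 h
  set e := extChartAt I' (b n) with he
  set Ξ : N → E' := fun z => mderiv I' 𝓘(ℝ, E') e (b z) (V z)
  have hsrc : ∀ᶠ z in 𝓝 n, b z ∈ e.source :=
    hb.continuousAt.tendsto.eventually (extChartAt_source_mem_nhds _)
  have hbn : b n ∈ e.source := mem_extChartAt_source _
  have hchart : SmoothNear I 𝓘(ℝ, E') (fun z => e (b z)) n :=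
    (smoothNear_extChartAt hbn).comp hb
  have harg : SmoothNear (𝓘(ℝ, ℝ).prod I) 𝓘(ℝ, E') (fun p : ℝ × N => e (b p.2) + p.1 • Ξ p.2)
      (0, n) := by
    have h1 : SmoothNear (𝓘(ℝ, ℝ).prod I) 𝓘(ℝ, E') (fun p : ℝ × N => e (b p.2)) (0, n) :=
      hchart.comp_of_eq smoothNear_snd rfl
    have h2 : SmoothNear (𝓘(ℝ, ℝ).prod I) 𝓘(ℝ, E') (fun p : ℝ × N => Ξ p.2) (0, n) :=
      hV.comp_of_eq smoothNear_snd rfl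
    have h3 : SmoothNear (𝓘(ℝ, ℝ).prod I) 𝓘(ℝ, ℝ) (fun p : ℝ × N => p.1) (0, n) := smoothNear_fst
    filter_upwards [h1, h2, h3] with p a1 a2 a3 using a1.add (a3.smul a2)
  refine ⟨fun p => e.symm (e (b p.2) + p.1 • Ξ p.2), ?_, ?_⟩
  · refine (smoothNear_extChartAt_symm (e.map_source hbn)).comp_of_eq harg ?_
    simp
  · filter_upwards [hsrc] with z hz
    have ht : e (b z) ∈ e.target := e.map_source hz
    refine ⟨by simp [e.left_inv hz], ?_⟩
    have hl : MDifferentiableAt 𝓘(ℝ, ℝ) 𝓘(ℝ, E') (fun u : ℝ => e (b z) + u • Ξ z) 0 :=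
      (by fun_prop : DifferentiableAt ℝ (fun u : ℝ => e (b z) + u • Ξ z) 0).mdifferentiableAt
    have hs := (smoothNear_extChartAt_symm (I := I') (x := b n) ht).mdifferentiableAt
    have h1 := mderiv_comp_apply hs hl (by simp) (1 : ℝ)
    refine h1.trans ?_
    have h2 : mderiv 𝓘(ℝ, ℝ) 𝓘(ℝ, E') (fun u : ℝ => e (b z) + u • Ξ z) 0 1 = Ξ z := by
      rw [mderiv_eq_fderiv]
      have : HasDerivAt (fun u : ℝ => e (b z) + u • Ξ z) (Ξ z) 0 := by
        simpa using ((hasDerivAt_id (0 : ℝ)).smul_const (Ξ z)).const_add (e (b z))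
      rw [this.hasFDerivAt.fderiv]
      simp
    rw [h2]
    have h3 := mderiv_comp_apply hs (smoothNear_extChartAt (I := I') hz).mdifferentiableAt rfl (V z)
    refine h3.symm.trans ?_
    have h4 : (fun w => e.symm (e w)) =ᶠ[𝓝 (b z)] fun w => w := by
      filter_upwards [(isOpen_extChartAt_source (I := I') (b n)).mem_nhds hz] with w hw
        using e.left_inv hw
    rw [mderiv_congr h4, mderiv_id]
    rfl

/-- The image of a vector field along `b` under the differential of `f`. -/
theorem SmoothField.map [IsManifold I ∞ N] [I'.Boundaryless] [IsManifold I' ∞ N']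
    [IsManifold I'' ∞ N''] {b : N → N'} {V : N → E'} {n : N} {f : N' → N''}
    (h : SmoothField I I' b V n) (hf : SmoothNear I' I'' f (b n)) :
    SmoothField I I'' (fun z => f (b z)) (fun z => mderiv I' I'' f (b z) (V z)) n := by
  obtain ⟨K, hK, hKe⟩ := h.exists_flow
  have h0 : K (0, n) = b n := hKe.self_of_nhds.1
  have h1 := smoothField_of_flow (hf.comp_of_eq hK h0)
  refine h1.congr (hKe.mono fun z hz => by simp only [hz.1]) ?_
  have hsl' : ∀ᶠ z in 𝓝 n, SmoothNear (𝓘(ℝ, ℝ).prod I) I' K (0, z) :=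
    tendsto_mk_left.eventually hK.eventually
  filter_upwards [hKe, hsl', (h.smoothNear.tendsto).eventually hf.eventually] with z hz h2 h3
  have h4 : SmoothNear 𝓘(ℝ, ℝ) I' (fun u => K (u, z)) 0 :=
    h2.comp_of_eq (smoothNear_id.prodMk smoothNear_const) rfl
  rw [mderiv_comp_apply h3.mdifferentiableAt h4.mdifferentiableAt hz.1, hz.2]

theorem SmoothField.comp [IsManifold I'' ∞ N''] {b : N' → N''} {V : N' → E''} {n : N} {c : N → N'}
    (h : SmoothField I' I'' b V (c n)) (hc : SmoothNear I I' c n) :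
    SmoothField I I'' (fun z => b (c z)) (fun z => V (c z)) n :=
  SmoothNear.comp (g := fun z => (⟨b z, V z⟩ : TangentBundle I'' N'')) h hc

end Fields

section Slice

variable {E H N : Type*} [NormedAddCommGroup E] [NormedSpace ℝ E] [TopologicalSpace H]
  [TopologicalSpace N] [ChartedSpace H N]
  {E' H' N' : Type*} [NormedAddCommGroup E'] [NormedSpace ℝ E'] [TopologicalSpace H']
  [TopologicalSpace N'] [ChartedSpace H' N']
  {E'' H'' N'' : Type*} [NormedAddCommGroup E''] [NormedSpace ℝ E''] [TopologicalSpace H'']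
  [TopologicalSpace N''] [ChartedSpace H'' N'']
  {I : ModelWithCorners ℝ E H} {I' : ModelWithCorners ℝ E' H'} {I'' : ModelWithCorners ℝ E'' H''}

theorem SmoothNear.slice_left {f : N × N' → N''} {p : N × N'} (h : SmoothNear (I.prod I') I'' f p) :
    SmoothNear I I'' (fun z => f (z, p.2)) p.1 :=
  h.comp_of_eq (smoothNear_id.prodMk smoothNear_const) rfl

end Slice

namespace LieGroupoid

variable {EM EG M G : Type*}
  [NormedAddCommGroup EM] [NormedSpace ℝ EM] [NormedAddCommGroup EG] [NormedSpace ℝ EG]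
  [TopologicalSpace M] [ChartedSpace EM M] [TopologicalSpace G] [ChartedSpace EG G]
  {Γ : LieGroupoid EM EG M G}

section VerticalFlow

variable {E H N : Type*} [NormedAddCommGroup E] [NormedSpace ℝ E] [TopologicalSpace H]
  [TopologicalSpace N] [ChartedSpace H N] {I : ModelWithCorners ℝ E H} [IsManifold I ∞ N]
  [IsManifold 𝓘(ℝ, EM) ∞ M] [IsManifold 𝓘(ℝ, EG) ∞ G]

theorem exists_vertical_flow {b : N → G} {V : N → EG} {n : N}
    (h : SmoothField I 𝓘(ℝ, EG) b V n)
    (hv : ∀ᶠ z in 𝓝 n, mderiv 𝓘(ℝ, EG) 𝓘(ℝ, EM) Γ.src (b z) (V z) = 0) :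
    ∃ K : ℝ × N → G, SmoothNear (𝓘(ℝ, ℝ).prod I) 𝓘(ℝ, EG) K (0, n) ∧
      (∀ᶠ z in 𝓝 n, K (0, z) = b z ∧ mderiv 𝓘(ℝ, ℝ) 𝓘(ℝ, EG) (fun u => K (u, z)) 0 1 = V z) ∧
      ∀ᶠ p in 𝓝 ((0 : ℝ), n), Γ.src (K p) = Γ.src (b p.2) := by
  obtain ⟨K, hK, hK0⟩ := h.exists_flow
  obtain ⟨r, hr, hr1, hr2⟩ := (Γ.submersion_src (b n)).exists_retraction
  have hb := h.smoothNear
  have hs : SmoothNear I 𝓘(ℝ, EM) (fun z => Γ.src (b z)) n := (Γ.contMDiff_src.smoothNear _).comp hb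
  have hK0n : K (0, n) = b n := hK0.self_of_nhds.1
  have hA : SmoothNear (𝓘(ℝ, ℝ).prod I) (𝓘(ℝ, EM).prod 𝓘(ℝ, EG))
      (fun p : ℝ × N => (Γ.src (b p.2), K p)) (0, n) :=
    (hs.comp_of_eq smoothNear_snd rfl).prodMk hK
  have hAn : (Γ.src (b n), K (0, n)) = (Γ.src (b n), b n) := by rw [hK0n]
  have hsb : ∀ᶠ z in 𝓝 n, r (Γ.src (b z), b z) = b z := hb.tendsto.eventually hr2
  refine ⟨fun p => r (Γ.src (b p.2), K p), hr.comp_of_eq hA hAn, ?_,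
    (hA.tendsto_of_eq hAn).eventually hr1⟩
  have hr' : ∀ᶠ z in 𝓝 n, SmoothNear (𝓘(ℝ, EM).prod 𝓘(ℝ, EG)) 𝓘(ℝ, EG) r (Γ.src (b z), b z) :=
    ((hs.prodMk hb).tendsto).eventually hr.eventually
  have hK' : ∀ᶠ z in 𝓝 n, SmoothNear (𝓘(ℝ, ℝ).prod I) 𝓘(ℝ, EG) K (0, z) :=
    tendsto_mk_left.eventually hK.eventually
  filter_upwards [hK0, hsb, hv, hr', hK', hb.tendsto.eventually hr2.eventually_nhds]
    with z h1 h2 h3 h4 h5 h6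
  refine ⟨by rw [h1.1, h2], ?_⟩
  have h7 : SmoothNear 𝓘(ℝ, EG) 𝓘(ℝ, EG) (fun Z => r (Γ.src (b z), Z)) (b z) := h4.slice
  rw [mderiv_comp_apply h7.mdifferentiableAt h5.slice_left.mdifferentiableAt h1.1, h1.2]
  have h8 : mderiv 𝓘(ℝ, EG) 𝓘(ℝ, EG) (fun Z => r (Γ.src Z, Z)) (b z) = ContinuousLinearMap.id ℝ EG :=
    (mderiv_congr h6).trans mderiv_id
  have h9 : MDifferentiableAt 𝓘(ℝ, EG) 𝓘(ℝ, EM) Γ.src (b z) :=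
    (Γ.contMDiff_src.smoothNear _).mdifferentiableAt
  have h10 := mderiv_comp_apply (g := r) (f := fun Z => (Γ.src Z, Z)) h4.mdifferentiableAt
    (h9.prodMk mdifferentiableAt_id) rfl (V z)
  have h11 := mderiv_prodMk (f := Γ.src) (g := fun Z => Z) h9 mdifferentiableAt_id
  rw [h11, h8, mderiv_id, ContinuousLinearMap.prod_apply, h3,
    mderiv_prod_apply h4.mdifferentiableAt] at h10
  simpa using h10.symm

theorem exists_family_of_section {θ : M → EG} {x : M}
    (h : SmoothField 𝓘(ℝ, EM) 𝓘(ℝ, EG) Γ.one θ x)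
    (hv : ∀ᶠ z in 𝓝 x, mderiv 𝓘(ℝ, EG) 𝓘(ℝ, EM) Γ.src (Γ.one z) (θ z) = 0) :
    ∃ η : ℝ × M → G, Γ.IsBisectionFamily η (0, x) ∧ (∀ᶠ z in 𝓝 x, η (0, z) = Γ.one z) ∧
      ∀ᶠ z in 𝓝 x, mderiv 𝓘(ℝ, ℝ) 𝓘(ℝ, EG) (fun u => η (u, z)) 0 1 = θ z := by
  obtain ⟨K, hK, hK0, hKs⟩ := exists_vertical_flow h hv
  refine ⟨K, ⟨hK, ?_, id, ?_⟩, hK0.mono fun z hz => hz.1, hK0.mono fun z hz => hz.2⟩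
  · filter_upwards [hKs] with p hp using by rw [hp, Γ.src_one]
  · exact (IsBisectionGerm.one x).congr (hK0.mono fun z hz => hz.1.symm)

theorem rightTranslate_curve {c : ℝ → G} {Y : G} (hc : MDifferentiableAt 𝓘(ℝ, ℝ) 𝓘(ℝ, EG) c 0)
    (hs : ∀ᶠ u in 𝓝 0, Γ.src (c u) = Γ.tgt Y) :
    Γ.rightTranslate (c 0) Y (mderiv 𝓘(ℝ, ℝ) 𝓘(ℝ, EG) c 0 1) =
      mderiv 𝓘(ℝ, ℝ) 𝓘(ℝ, EG) (fun u => Γ.mul (c u) Y) 0 1 := by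
  have h1 : ContMDiffOn 𝓘(ℝ, EG) 𝓘(ℝ, EG) ∞ (fun Z => Γ.mul Z Y) {Z | Γ.src Z = Γ.tgt Y} :=
    Γ.contMDiffOn_mul.comp (contMDiff_id.prodMk contMDiff_const).contMDiffOn fun _ hz => hz
  have h2 : MDifferentiableWithinAt 𝓘(ℝ, EG) 𝓘(ℝ, EG) (fun Z => Γ.mul Z Y)
      {Z | Γ.src Z = Γ.tgt Y} (c 0) := (h1 _ hs.self_of_nhds).mdifferentiableWithinAt (by simp)
  have h3 := h2.hasMFDerivWithinAt.comp (0 : ℝ)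
    (hc.hasMFDerivAt.hasMFDerivWithinAt (s := {u | Γ.src (c u) = Γ.tgt Y})) (fun _ hu => hu)
  have h4 := h3.hasMFDerivAt hs
  exact (DFunLike.congr_fun h4.mfderiv (1 : ℝ)).symm

end VerticalFlow

theorem mul_inv_cancel_left' {X Y : G} (h : Γ.tgt X = Γ.tgt Y) :
    Γ.mul X (Γ.mul (Γ.inv X) Y) = Y := by
  rw [Γ.mul_assoc _ _ _ (Γ.tgt_inv X).symm ((Γ.src_inv X).trans h), Γ.mul_inv, h, Γ.one_mul]

theorem one_mul_of_eq {X : G} {y : M} (h : Γ.tgt X = y) : Γ.mul (Γ.one y) X = X := by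
  subst h; exact Γ.one_mul X

theorem mul_one_of_eq {X : G} {y : M} (h : Γ.src X = y) : Γ.mul X (Γ.one y) = X := by
  subst h; exact Γ.mul_one X

theorem eq_inv_of_mul_eq_one {X Y : G} {y : M} (hs : Γ.src Y = Γ.tgt X)
    (h : Γ.mul Y X = Γ.one y) : X = Γ.inv Y := by
  have h1 : Γ.tgt Y = y := by rw [← Γ.tgt_mul _ _ hs, h, Γ.tgt_one]
  have h2 : Γ.mul (Γ.inv Y) (Γ.mul Y X) = X := by
    rw [Γ.mul_assoc _ _ _ (Γ.src_inv Y) hs, Γ.inv_mul, one_mul_of_eq hs.symm]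
  rw [← h2, h, mul_one_of_eq ((Γ.src_inv Y).trans h1)]

theorem RightStable.mem_one_iff {Ω : Set (M × G)} (h : Γ.RightStable Ω) {a : M} {X : G} :
    (a, Γ.one (Γ.tgt X)) ∈ Ω ↔ (a, X) ∈ Ω := by
  constructor
  · intro h1
    have := h a _ X h1 (Γ.src_one _)
    rwa [Γ.one_mul] at this
  · intro h1
    have := h a X (Γ.inv X) h1 (Γ.tgt_inv X).symm
    rwa [Γ.mul_inv] at this

namespace IsAdmissible

variable {σ σ' : OpenPartialHomeomorph (M × G) (M × G)} {f f' : OpenPartialHomeomorph M M}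

theorem mem_one (h : Γ.IsAdmissible σ f) {a : M} {X : G} (hX : (a, X) ∈ σ.source) :
    (a, Γ.one (Γ.tgt X)) ∈ σ.source := h.stable.mem_one_iff.2 hX

theorem apply_eq (h : Γ.IsAdmissible σ f) {a : M} {X : G} (hX : (a, X) ∈ σ.source) :
    σ (a, X) = (f a, Γ.mul (σ (a, Γ.one (Γ.tgt X))).2 X) := by
  have h1 := h.right_invariant a _ X (h.mem_one hX) (Γ.src_one _)
  rw [Γ.one_mul] at h1
  rw [h1, h.projectable _ (h.mem_one hX)]

theorem src_phi (h : Γ.IsAdmissible σ f) {a y : M} (hy : (a, Γ.one y) ∈ σ.source) :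
    Γ.src (σ (a, Γ.one y)).2 = y := by rw [h.src_eq _ _ hy, Γ.src_one]

theorem tgt_of_mem_BG (h : Γ.IsAdmissible σ f) {X : G} (hX : (Γ.tgt X, X) ∈ σ.source) :
    Γ.tgt (σ (Γ.tgt X, X)).2 = f (Γ.tgt X) := by
  obtain ⟨Z, hZ⟩ := h.preserves ⟨_, ⟨hX, X, rfl⟩, rfl⟩
  have h1 := h.projectable _ hX
  rw [← hZ] at h1 ⊢
  exact h1

theorem tgt_phi (h : Γ.IsAdmissible σ f) {x : M} (hx : x ∈ f.source) :
    Γ.tgt (σ (x, Γ.one x)).2 = f x := by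
  have h1 := h.tgt_of_mem_BG (X := Γ.one x) (by rw [Γ.tgt_one]; exact h.diagonal x hx)
  rwa [Γ.tgt_one] at h1

theorem eq_tgt_of_apply_mem_BG (h : Γ.IsAdmissible σ f) {a : M} {X Z : G}
    (hX : (a, X) ∈ σ.source) (hZ : σ (a, X) = (Γ.tgt Z, Z)) : a = Γ.tgt X := by
  have ha : a ∈ f.source := h.mem_source _ hX
  have hd := h.diagonal a ha
  have hfa : f a = Γ.tgt Z := by rw [← h.projectable _ hX, hZ]
  have hs := h.src_phi hd
  have ht := h.tgt_phi ha
  set W := (σ (a, Γ.one a)).2 with hW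
  have hWZ : Γ.tgt W = Γ.tgt Z := ht.trans hfa
  have hs1 : Γ.src (Γ.inv W) = Γ.tgt Z := (Γ.src_inv W).trans hWZ
  have htm : Γ.tgt (Γ.mul (Γ.inv W) Z) = a := by rw [Γ.tgt_mul _ _ hs1, Γ.tgt_inv, hs]
  have h1 := h.stable a (Γ.one a) (Γ.mul (Γ.inv W) Z) hd ((Γ.src_one a).trans htm.symm)
  have h2 := h.right_invariant a (Γ.one a) (Γ.mul (Γ.inv W) Z) hd ((Γ.src_one a).trans htm.symm)
  rw [← hW, h.projectable _ hd, mul_inv_cancel_left' hWZ, hfa, ← hZ] at h2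
  have h3 := σ.injOn h1 hX h2
  rw [← (Prod.mk.inj h3).2, one_mul_of_eq htm, htm]

theorem mul_mem_target (h : Γ.IsAdmissible σ f) {b : M} {Z Y : G} (hZ : (b, Z) ∈ σ.target)
    (hs : Γ.src Z = Γ.tgt Y) : (b, Γ.mul Z Y) ∈ σ.target ∧
      Γ.src (σ.symm (b, Z)).2 = Γ.src Z ∧
      σ.symm (b, Γ.mul Z Y) = ((σ.symm (b, Z)).1, Γ.mul (σ.symm (b, Z)).2 Y) := by
  have hp := σ.map_target hZ
  have hσ := σ.right_inv hZ
  generalize σ.symm (b, Z) = q at hp hσ ⊢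
  obtain ⟨a, X⟩ := q
  have hs' : Γ.src X = Γ.src Z := by rw [← h.src_eq a X hp, hσ]
  have h1 := h.right_invariant a X Y hp (hs'.trans hs)
  rw [hσ] at h1
  have h2 := h.stable a X Y hp (hs'.trans hs)
  refine ⟨?_, hs', ?_⟩
  · rw [← h1]; exact σ.map_source h2
  · rw [← h1, σ.left_inv h2]

theorem symm (h : Γ.IsAdmissible σ f) : Γ.IsAdmissible σ.symm f.symm where
  smooth := h.smooth_symm
  smooth_symm := h.smooth
  smooth_base := h.smooth_base_symm
  smooth_base_symm := h.smooth_base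
  stable := fun _ _ _ hZ hs => (h.mul_mem_target hZ hs).1
  src_eq := fun b Z hZ =>
    (h.mul_mem_target (Y := Γ.one (Γ.src Z)) hZ (Γ.tgt_one _).symm).2.1
  right_invariant := fun _ _ _ hZ hs => (h.mul_mem_target hZ hs).2.2
  mem_source := by
    intro q hq
    have hp := σ.map_target hq
    have h1 := h.projectable _ hp
    rw [σ.right_inv hq] at h1
    rw [h1]
    exact f.map_source (h.mem_source _ hp)
  projectable := by
    intro q hq
    have hp := σ.map_target hq
    have h1 := h.projectable _ hp
    rw [σ.right_inv hq] at h1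
    rw [h1, f.left_inv (h.mem_source _ hp)]
  diagonal := by
    intro y hy
    have hx := f.map_target hy
    have h1 := σ.map_source (h.diagonal _ hx)
    have h2 := h.tgt_phi hx
    rw [f.right_inv hy] at h2
    have h3 : σ (f.symm y, Γ.one (f.symm y)) = (y, (σ (f.symm y, Γ.one (f.symm y))).2) :=
      Prod.ext ((h.projectable _ (h.diagonal _ hx)).trans (f.right_inv hy)) rfl
    rw [h3] at h1
    have h4 := (RightStable.mem_one_iff (Γ := Γ) (Ω := σ.target)
      (fun _ _ _ hZ hs => (h.mul_mem_target hZ hs).1)).2 h1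
    rwa [h2] at h4
  preserves := by
    rintro _ ⟨q, ⟨hq, Z, rfl⟩, rfl⟩
    have hp := σ.map_target hq
    have hσ := σ.right_inv hq
    exact ⟨(σ.symm (Γ.tgt Z, Z)).2, Prod.ext (h.eq_tgt_of_apply_mem_BG
      (a := (σ.symm (Γ.tgt Z, Z)).1) (X := (σ.symm (Γ.tgt Z, Z)).2) hp hσ).symm rfl⟩

theorem trans (h : Γ.IsAdmissible σ f) (h' : Γ.IsAdmissible σ' f') :
    Γ.IsAdmissible (σ.trans σ') (f.trans f') where
  smooth := h'.smooth.comp (h.smooth.mono (by simp [inter_subset_left])) (by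
    rw [OpenPartialHomeomorph.trans_source]; exact fun q hq => hq.2)
  smooth_symm := by
    rw [OpenPartialHomeomorph.trans_target]
    exact h.smooth_symm.comp (h'.smooth_symm.mono inter_subset_left) fun q hq => hq.2
  smooth_base := h'.smooth_base.comp (h.smooth_base.mono (by simp [inter_subset_left])) (by
    rw [OpenPartialHomeomorph.trans_source]; exact fun q hq => hq.2)
  smooth_base_symm := by
    rw [OpenPartialHomeomorph.trans_target]
    exact h.smooth_base_symm.comp (h'.smooth_base_symm.mono inter_subset_left) fun q hq => hq.2
  stable := by
    intro a X Y hX hs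
    rw [OpenPartialHomeomorph.trans_source] at hX ⊢
    refine ⟨h.stable a X Y hX.1 hs, ?_⟩
    show σ _ ∈ σ'.source
    rw [h.right_invariant a X Y hX.1 hs]
    exact h'.stable _ _ _ hX.2 (by rw [h.src_eq _ _ hX.1, hs])
  src_eq := by
    intro a X hX
    rw [OpenPartialHomeomorph.trans_source] at hX
    have h1 := h'.src_eq (σ (a, X)).1 (σ (a, X)).2 hX.2
    rw [h.src_eq _ _ hX.1] at h1
    exact h1
  right_invariant := by
    intro a X Y hX hs
    rw [OpenPartialHomeomorph.trans_source] at hX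
    show σ' (σ _) = ((σ' (σ (a, X))).1, _)
    rw [h.right_invariant a X Y hX.1 hs]
    exact h'.right_invariant _ _ _ hX.2 (by rw [h.src_eq _ _ hX.1, hs])
  mem_source := by
    intro q hq
    rw [OpenPartialHomeomorph.trans_source] at hq ⊢
    refine ⟨h.mem_source _ hq.1, ?_⟩
    show f q.1 ∈ f'.source
    rw [← h.projectable _ hq.1]
    exact h'.mem_source _ hq.2
  projectable := by
    intro q hq
    rw [OpenPartialHomeomorph.trans_source] at hq
    show (σ' (σ q)).1 = f' (f q.1)
    rw [h'.projectable _ hq.2, h.projectable _ hq.1]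
  diagonal := by
    intro x hx
    rw [OpenPartialHomeomorph.trans_source] at hx ⊢
    refine ⟨h.diagonal x hx.1, ?_⟩
    show σ (x, Γ.one x) ∈ σ'.source
    have h3 : σ (x, Γ.one x) = (f x, (σ (x, Γ.one x)).2) :=
      Prod.ext (h.projectable _ (h.diagonal _ hx.1)) rfl
    rw [h3]
    refine h'.stable.mem_one_iff.1 ?_
    rw [h.tgt_phi hx.1]
    exact h'.diagonal _ hx.2
  preserves := by
    rintro _ ⟨q, ⟨hq, hB⟩, rfl⟩
    rw [OpenPartialHomeomorph.trans_source] at hq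
    exact h'.preserves ⟨_, ⟨hq.2, h.preserves ⟨_, ⟨hq.1, hB⟩, rfl⟩⟩, rfl⟩

theorem refl : Γ.IsAdmissible (OpenPartialHomeomorph.refl (M × G))
    (OpenPartialHomeomorph.refl M) where
  smooth := contMDiffOn_id
  smooth_symm := contMDiffOn_id
  smooth_base := contMDiffOn_id
  smooth_base_symm := contMDiffOn_id
  stable := fun _ _ _ _ _ => trivial
  src_eq := fun _ _ _ => rfl
  right_invariant := fun _ _ _ _ _ => rfl
  mem_source := fun _ _ => trivial
  projectable := fun _ _ => rfl
  diagonal := fun _ _ => trivial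
  preserves := by rintro _ ⟨q, ⟨-, hB⟩, rfl⟩; exact hB

/-- The inverse image of `one y` under `σ`, on the slice through `b`. -/
theorem symm_apply_one (h : Γ.IsAdmissible σ f) {b y : M} (hb : b ∈ f.source)
    (hy : (f b, Γ.one y) ∈ σ.target) :
    σ.symm (f b, Γ.one y) =
        (b, Γ.inv (σ (b, Γ.one (Γ.tgt (σ.symm (f b, Γ.one y)).2))).2) ∧
      (b, Γ.one (Γ.tgt (σ.symm (f b, Γ.one y)).2)) ∈ σ.source ∧
      Γ.tgt (σ (b, Γ.one (Γ.tgt (σ.symm (f b, Γ.one y)).2))).2 = y := by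
  have hp := σ.map_target hy
  have h1 := h.symm.projectable _ hy
  rw [f.left_inv hb] at h1
  have hq : σ.symm (f b, Γ.one y) = (b, (σ.symm (f b, Γ.one y)).2) := Prod.ext h1 rfl
  have hσ := σ.right_inv hy
  set X := (σ.symm (f b, Γ.one y)).2
  rw [hq] at hp hσ
  rw [h.apply_eq hp] at hσ
  have hm := h.mem_one hp
  have hs := h.src_phi hm
  have h2 := (Prod.mk.inj hσ).2
  refine ⟨?_, hm, ?_⟩
  · rw [hq, ← eq_inv_of_mul_eq_one hs h2]
  · rw [← Γ.tgt_mul _ _ hs, h2, Γ.tgt_one]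

theorem symm_tgt_phi (h : Γ.IsAdmissible σ f) {b z : M} (hz : (b, Γ.one z) ∈ σ.source) :
    Γ.tgt (σ.symm (f b, Γ.one (Γ.tgt (σ (b, Γ.one z)).2))).2 = z := by
  have hs := h.src_phi hz
  have h1 := h.stable b (Γ.one z) (Γ.inv (σ (b, Γ.one z)).2) hz
    (by rw [Γ.src_one, Γ.tgt_inv, hs])
  have h2 := h.right_invariant b (Γ.one z) (Γ.inv (σ (b, Γ.one z)).2) hz
    (by rw [Γ.src_one, Γ.tgt_inv, hs])
  rw [Γ.mul_inv, h.projectable _ hz] at h2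
  rw [← h2, σ.left_inv h1, Γ.tgt_mul _ _ (by rw [Γ.src_one, Γ.tgt_inv, hs]), Γ.tgt_one]

variable [IsManifold 𝓘(ℝ, EM) ∞ M] [IsManifold 𝓘(ℝ, EG) ∞ G]

theorem smoothNear_apply_one (h : Γ.IsAdmissible σ f) {a y : M} (hy : (a, Γ.one y) ∈ σ.source) :
    SmoothNear (𝓘(ℝ, EM).prod 𝓘(ℝ, EM)) 𝓘(ℝ, EG) (fun q : M × M => (σ (q.1, Γ.one q.2)).2)
      (a, y) := by
  have h1 : SmoothNear (𝓘(ℝ, EM).prod 𝓘(ℝ, EG)) (𝓘(ℝ, EM).prod 𝓘(ℝ, EG)) σ (a, Γ.one y) :=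
    h.smooth.smoothNear (σ.open_source.mem_nhds hy)
  have h2 : SmoothNear (𝓘(ℝ, EM).prod 𝓘(ℝ, EM)) (𝓘(ℝ, EM).prod 𝓘(ℝ, EG))
      (fun q : M × M => (q.1, Γ.one q.2)) (a, y) :=
    smoothNear_fst.prodMk ((Γ.contMDiff_one.smoothNear y).comp_of_eq smoothNear_snd rfl)
  exact (smoothNear_snd (N := M)).comp (h1.comp_of_eq h2 rfl)

theorem eventually_mem_source (_h : Γ.IsAdmissible σ f) {a y : M} (hy : (a, Γ.one y) ∈ σ.source) :
    ∀ᶠ q in 𝓝 (a, y), (q.1, Γ.one q.2) ∈ σ.source := by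
  have h2 : SmoothNear (𝓘(ℝ, EM).prod 𝓘(ℝ, EM)) (𝓘(ℝ, EM).prod 𝓘(ℝ, EG))
      (fun q : M × M => (q.1, Γ.one q.2)) (a, y) :=
    smoothNear_fst.prodMk ((Γ.contMDiff_one.smoothNear y).comp_of_eq smoothNear_snd rfl)
  exact h2.tendsto.eventually (σ.open_source.mem_nhds hy)

theorem isBisectionGerm (h : Γ.IsAdmissible σ f) {b : M} (hb : b ∈ f.source) :
    Γ.IsBisectionGerm (fun z => (σ (b, Γ.one z)).2)
      (fun y => Γ.tgt (σ.symm (f b, Γ.one y)).2) b where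
  smooth := (h.smoothNear_apply_one (h.diagonal b hb)).slice
  src_eq := (tendsto_mk_left.eventually (h.eventually_mem_source (h.diagonal b hb))).mono
    fun z hz => h.src_phi hz
  smooth_inv := by
    rw [h.tgt_phi hb]
    exact (Γ.contMDiff_tgt.smoothNear _).comp
      (h.symm.smoothNear_apply_one (h.symm.diagonal _ (f.map_source hb))).slice
  left_inv := (tendsto_mk_left.eventually (h.eventually_mem_source (h.diagonal b hb))).mono
    fun z hz => h.symm_tgt_phi hz
  right_inv := by
    rw [h.tgt_phi hb]
    exact (tendsto_mk_left.eventually (h.symm.eventually_mem_source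
      (h.symm.diagonal _ (f.map_source hb)))).mono fun y hy => (h.symm_apply_one hb hy).2.2

theorem isLocalFamily (h : Γ.IsAdmissible σ f) {x : M} (hx : x ∈ f.source) (k : ℕ) :
    Γ.IsLocalFamily (Γ.sigmaJet k σ) (fun q => (σ (q.1, Γ.one q.2)).2) x where
  smooth := h.smoothNear_apply_one (h.diagonal x hx)
  src_eq := (h.eventually_mem_source (h.diagonal x hx)).mono fun _ hq => h.src_phi hq
  germ := by
    filter_upwards [f.open_source.mem_nhds hx] with b hb using ⟨_, h.isBisectionGerm hb⟩
  jet_eq := Eventually.of_forall fun _ => rfl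

theorem isJetBisection (h : Γ.IsAdmissible σ f) [CompleteSpace EM] [CompleteSpace EG] (k : ℕ) :
    Γ.IsJetBisection (Γ.sigmaJet k σ) f where
  smooth := fun _ hx => (h.isLocalFamily hx k).smoothJetMapAt
  pt_eq := fun _ _ => rfl
  tgt_eq := fun _ hx => h.tgt_phi hx
  smooth_symm := h.smooth_base_symm

end IsAdmissible

end LieGroupoid

section Components

variable {E H N : Type*} [NormedAddCommGroup E] [NormedSpace ℝ E] [TopologicalSpace H]
  [TopologicalSpace N] [ChartedSpace H N]
  {E' H' N' : Type*} [NormedAddCommGroup E'] [NormedSpace ℝ E'] [TopologicalSpace H']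
  [TopologicalSpace N'] [ChartedSpace H' N']
  {E'' H'' N'' : Type*} [NormedAddCommGroup E''] [NormedSpace ℝ E''] [TopologicalSpace H'']
  [TopologicalSpace N''] [ChartedSpace H'' N'']
  {I : ModelWithCorners ℝ E H} {I' : ModelWithCorners ℝ E' H'} {I'' : ModelWithCorners ℝ E'' H''}

theorem mderiv_apply_fst {f : N → N' × N''} {x : N} (hf : MDifferentiableAt I (I'.prod I'') f x)
    (v : E) : (mderiv I (I'.prod I'') f x v).1 = mderiv I I' (fun z => (f z).1) x v := by
  rw [mderiv_comp_apply (g := Prod.fst) mdifferentiableAt_fst hf rfl, mderiv_fst]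
  rfl

theorem mderiv_apply_snd {f : N → N' × N''} {x : N} (hf : MDifferentiableAt I (I'.prod I'') f x)
    (v : E) : (mderiv I (I'.prod I'') f x v).2 = mderiv I I'' (fun z => (f z).2) x v := by
  rw [mderiv_comp_apply (g := Prod.snd) mdifferentiableAt_snd hf rfl, mderiv_snd]
  rfl

end Components

namespace LieGroupoid

variable {EM EG M G : Type*}
  [NormedAddCommGroup EM] [NormedSpace ℝ EM] [NormedAddCommGroup EG] [NormedSpace ℝ EG]
  [TopologicalSpace M] [ChartedSpace EM M] [TopologicalSpace G] [ChartedSpace EG G]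
  {Γ : LieGroupoid EM EG M G}
  [IsManifold 𝓘(ℝ, EM) ∞ M] [IsManifold 𝓘(ℝ, EG) ∞ G]

theorem rightTranslate_eq {c : ℝ → G} {X Y : G} {w : EG}
    (hc : MDifferentiableAt 𝓘(ℝ, ℝ) 𝓘(ℝ, EG) c 0) (hX : c 0 = X)
    (hw : mderiv 𝓘(ℝ, ℝ) 𝓘(ℝ, EG) c 0 1 = w)
    (hs : ∀ᶠ u in 𝓝 0, Γ.src (c u) = Γ.tgt Y) :
    (Γ.rightTranslate X Y w : EG) = mderiv 𝓘(ℝ, ℝ) 𝓘(ℝ, EG) (fun u => Γ.mul (c u) Y) 0 1 := by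
  subst hX hw
  exact rightTranslate_curve hc hs

namespace IsInvariantField

variable {Ω : Set (M × G)} {ζ : M × G → EM × EG}

theorem smoothField (hζ : Γ.IsInvariantField Ω ζ) {q : M × G} (hq : q ∈ Ω) :
    SmoothField (𝓘(ℝ, EM).prod 𝓘(ℝ, EG)) (𝓘(ℝ, EM).prod 𝓘(ℝ, EG)) (fun p => p) ζ q :=
  hζ.smooth.smoothNear (hζ.isOpen.mem_nhds hq)

theorem smoothField_snd (hζ : Γ.IsInvariantField Ω ζ) {q : M × G} (hq : q ∈ Ω) :
    SmoothField (𝓘(ℝ, EM).prod 𝓘(ℝ, EG)) 𝓘(ℝ, EG) (fun p => p.2) (fun p => (ζ p).2) q := by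
  refine ((hζ.smoothField hq).map (I'' := 𝓘(ℝ, EG)) smoothNear_snd).congr
    (EventuallyEq.refl _ _) (Eventually.of_forall fun p => ?_)
  simp only [mderiv_snd]
  rfl

theorem smoothField_fst (hζ : Γ.IsInvariantField Ω ζ) {q : M × G} (hq : q ∈ Ω) :
    SmoothField (𝓘(ℝ, EM).prod 𝓘(ℝ, EG)) 𝓘(ℝ, EM) (fun p => p.1) (fun p => (ζ p).1) q := by
  refine ((hζ.smoothField hq).map (I'' := 𝓘(ℝ, EM)) smoothNear_fst).congr
    (EventuallyEq.refl _ _) (Eventually.of_forall fun p => ?_)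
  simp only [mderiv_fst]
  rfl

theorem smoothField_one (hζ : Γ.IsInvariantField Ω ζ) {x y : M} (h : (x, Γ.one y) ∈ Ω) :
    SmoothField 𝓘(ℝ, EM) 𝓘(ℝ, EG) Γ.one (fun z => (ζ (x, Γ.one z)).2) y :=
  (hζ.smoothField_snd h).comp (c := fun z => (x, Γ.one z)) (n := y) (smoothNear_const.prodMk (Γ.contMDiff_one.smoothNear y))

theorem vertical (hζ : Γ.IsInvariantField Ω ζ) {q : M × G} (hq : q ∈ Ω) :
    mderiv 𝓘(ℝ, EG) 𝓘(ℝ, EM) Γ.src q.2 (ζ q).2 = 0 := hζ.tangent_fibre q hq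

theorem eventually_one_mem (hζ : Γ.IsInvariantField Ω ζ) {x y : M} (h : (x, Γ.one y) ∈ Ω) :
    ∀ᶠ q in 𝓝 (x, y), (q.1, Γ.one q.2) ∈ Ω := by
  have h2 : SmoothNear (𝓘(ℝ, EM).prod 𝓘(ℝ, EM)) (𝓘(ℝ, EM).prod 𝓘(ℝ, EG))
      (fun q : M × M => (q.1, Γ.one q.2)) (x, y) :=
    smoothNear_fst.prodMk ((Γ.contMDiff_one.smoothNear y).comp_of_eq smoothNear_snd rfl)
  exact h2.tendsto.eventually (hζ.isOpen.mem_nhds h)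

theorem exists_family (hζ : Γ.IsInvariantField Ω ζ) {x : M} (h : (x, Γ.one x) ∈ Ω) :
    ∃ η : ℝ × M → G, Γ.IsBisectionFamily η (0, x) ∧ (∀ᶠ z in 𝓝 x, η (0, z) = Γ.one z) ∧
      ∀ᶠ z in 𝓝 x, mderiv 𝓘(ℝ, ℝ) 𝓘(ℝ, EG) (fun u => η (u, z)) 0 1 = (ζ (x, Γ.one z)).2 :=
  exists_family_of_section (hζ.smoothField_one h)
    ((tendsto_mk_left.eventually (hζ.eventually_one_mem h)).mono fun _ hz => hζ.vertical hz)

theorem snd_eq_of_curve (hζ : Γ.IsInvariantField Ω ζ) {a : M} {X Y : G} (hX : (a, X) ∈ Ω)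
    (hXY : Γ.src X = Γ.tgt Y) {c : ℝ → G} (hc : MDifferentiableAt 𝓘(ℝ, ℝ) 𝓘(ℝ, EG) c 0)
    (hc0 : c 0 = X) (hw : mderiv 𝓘(ℝ, ℝ) 𝓘(ℝ, EG) c 0 1 = (ζ (a, X)).2)
    (hs : ∀ᶠ u in 𝓝 0, Γ.src (c u) = Γ.tgt Y) :
    (ζ (a, Γ.mul X Y)).2 = mderiv 𝓘(ℝ, ℝ) 𝓘(ℝ, EG) (fun u => Γ.mul (c u) Y) 0 1 := by
  rw [← rightTranslate_eq hc hc0 hw hs]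
  exact hζ.right_invariant a X Y hX hXY

theorem snd_eq_of_family (hζ : Γ.IsInvariantField Ω ζ) {a z : M} {X : G} (hX : (a, X) ∈ Ω)
    (hXz : Γ.tgt X = z) {c : ℝ → G} (hc : MDifferentiableAt 𝓘(ℝ, ℝ) 𝓘(ℝ, EG) c 0)
    (hc0 : c 0 = Γ.one z) (hw : mderiv 𝓘(ℝ, ℝ) 𝓘(ℝ, EG) c 0 1 = (ζ (a, Γ.one z)).2)
    (hs : ∀ᶠ u in 𝓝 0, Γ.src (c u) = z) :
    (ζ (a, X)).2 = mderiv 𝓘(ℝ, ℝ) 𝓘(ℝ, EG) (fun u => Γ.mul (c u) X) 0 1 := by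
  subst hXz
  rw [← hζ.snd_eq_of_curve (hζ.stable.mem_one_iff.2 hX) (Γ.src_one _) hc hc0 hw hs, Γ.one_mul]

end IsInvariantField

section Push

variable {σ : OpenPartialHomeomorph (M × G) (M × G)} {f : OpenPartialHomeomorph M M}
  {Ω : Set (M × G)} {ζ : M × G → EM × EG} {x : M} {y : ℝ → M} {η : ℝ × M → G}

theorem pushField_apply (q : M × G) : (LieGroupoid.pushField σ ζ q : EM × EG) =
    mderiv (𝓘(ℝ, EM).prod 𝓘(ℝ, EG)) (𝓘(ℝ, EM).prod 𝓘(ℝ, EG)) σ (σ.symm q) (ζ (σ.symm q)) := rfl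

theorem IsAdmissible.smoothNear (h : Γ.IsAdmissible σ f) {q : M × G} (hq : q ∈ σ.source) :
    SmoothNear (𝓘(ℝ, EM).prod 𝓘(ℝ, EG)) (𝓘(ℝ, EM).prod 𝓘(ℝ, EG)) σ q :=
  h.smooth.smoothNear (σ.open_source.mem_nhds hq)

theorem IsAdmissible.smoothNear_base (h : Γ.IsAdmissible σ f) {x : M} (hx : x ∈ f.source) :
    SmoothNear 𝓘(ℝ, EM) 𝓘(ℝ, EM) f x :=
  h.smooth_base.smoothNear (f.open_source.mem_nhds hx)

/-- The image of an invariant field under `σ`, along the identities. -/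
theorem pushField_one (h : Γ.IsAdmissible σ f) (hx : x ∈ f.source)
    (hζ : Γ.IsInvariantField Ω ζ) (hxΩ : (x, Γ.one x) ∈ Ω)
    (hy : SmoothNear 𝓘(ℝ, ℝ) 𝓘(ℝ, EM) y 0) (hy0 : y 0 = x)
    (hyv : mderiv 𝓘(ℝ, ℝ) 𝓘(ℝ, EM) y 0 1 = (ζ (x, Γ.one x)).1)
    (hη : Γ.IsBisectionFamily η (0, x)) (hη0 : ∀ᶠ z in 𝓝 x, η (0, z) = Γ.one z)
    (hηv : ∀ᶠ z in 𝓝 x, mderiv 𝓘(ℝ, ℝ) 𝓘(ℝ, EG) (fun u => η (u, z)) 0 1 =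
      (ζ (x, Γ.one z)).2) :
    ∀ᶠ y' in 𝓝 (f x), (LieGroupoid.pushField σ ζ (f x, Γ.one y') : EM × EG) =
      (mderiv 𝓘(ℝ, EM) 𝓘(ℝ, EM) f x (ζ (x, Γ.one x)).1,
        mderiv 𝓘(ℝ, ℝ) 𝓘(ℝ, EG) (fun u => Γ.conjFamily (fun q => (σ (q.1, Γ.one q.2)).2)
          (fun z => Γ.inv (σ (x, Γ.one (Γ.tgt (σ.symm (f x, Γ.one z)).2))).2) y η
            ((u, u), y')) 0 1) := by
  have hF := h.isBisectionGerm hx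
  have hg : Tendsto (fun y' => Γ.tgt (σ.symm (f x, Γ.one y')).2) (𝓝 (f x)) (𝓝 x) := by
    have := hF.tendsto_inv
    rwa [h.tgt_phi hx] at this
  have e1 := tendsto_mk_left.eventually
    (h.symm.eventually_mem_source (h.symm.diagonal _ (f.map_source hx)))
  have e2 := hg.eventually (tendsto_mk_left.eventually (hζ.eventually_one_mem hxΩ))
  have e3 := hg.eventually (tendsto_mk_left.eventually hη.smooth.eventually)
  have e4 := hg.eventually (tendsto_mk_left.eventually hη.src_eq.eventually_nhds)
  filter_upwards [e1, e2, e3, e4, hg.eventually hη0, hg.eventually hηv]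
    with y' h1 h2 h3 h4 h5 h6
  obtain ⟨hq, hs, ht⟩ := h.symm_apply_one hx h1
  set z := Γ.tgt (σ.symm (f x, Γ.one y')).2 with hz
  have hXs : (σ.symm (f x, Γ.one y')) ∈ σ.source := σ.map_target h1
  have hX : Γ.tgt (Γ.inv (σ (x, Γ.one z)).2) = z := by rw [Γ.tgt_inv, h.src_phi hs]
  rw [pushField_apply, hq]
  rw [hq] at hXs
  set X := Γ.inv (σ (x, Γ.one z)).2 with hXdef
  have hXΩ : (x, X) ∈ Ω := by rw [← hζ.stable.mem_one_iff, hX]; exact h2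
  have hηc : SmoothNear 𝓘(ℝ, ℝ) 𝓘(ℝ, EG) (fun u => η (u, z)) 0 := h3.slice_left
  have hsrc : ∀ᶠ u in 𝓝 (0 : ℝ), Γ.src (η (u, z)) = z :=
    ((continuous_id.prodMk continuous_const).tendsto (0 : ℝ)).eventually h4
  have hmul : SmoothNear 𝓘(ℝ, ℝ) 𝓘(ℝ, EG) (fun u => Γ.mul (η (u, z)) X) 0 :=
    Γ.smoothNear_mul hηc smoothNear_const (hsrc.mono fun u hu => hu.trans hX.symm)
  have hc : SmoothNear 𝓘(ℝ, ℝ) (𝓘(ℝ, EM).prod 𝓘(ℝ, EG))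
      (fun u => (y u, Γ.mul (η (u, z)) X)) 0 := hy.prodMk hmul
  have hc0 : (y 0, Γ.mul (η (0, z)) X) = (x, X) := by
    rw [hy0, h5, one_mul_of_eq hX]
  have hcv : mderiv 𝓘(ℝ, ℝ) (𝓘(ℝ, EM).prod 𝓘(ℝ, EG)) (fun u => (y u, Γ.mul (η (u, z)) X)) 0 1 =
      ζ (x, X) := by
    rw [mderiv_prodMk hy.mdifferentiableAt hmul.mdifferentiableAt]
    refine Prod.ext (hyv.trans (hζ.projectable x _ _ hxΩ hXΩ)) ?_
    exact (hζ.snd_eq_of_family hXΩ hX hηc.mdifferentiableAt h5 h6 hsrc).symm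
  have hA := (h.smoothNear hXs).comp_of_eq hc hc0
  rw [← hcv, ← mderiv_comp_apply (h.smoothNear hXs).mdifferentiableAt hc.mdifferentiableAt hc0]
  have hmem : ∀ᶠ u in 𝓝 (0 : ℝ), (y u, Γ.mul (η (u, z)) X) ∈ σ.source :=
    (hc.tendsto_of_eq hc0).eventually (σ.open_source.mem_nhds hXs)
  refine Prod.ext ?_ ?_
  · rw [mderiv_apply_fst hA.mdifferentiableAt]
    have e : (fun u => (σ (y u, Γ.mul (η (u, z)) X)).1) =ᶠ[𝓝 0] fun u => f (y u) :=
      hmem.mono fun u hu => h.projectable _ hu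
    rw [mderiv_congr e, mderiv_comp_apply (h.smoothNear_base hx).mdifferentiableAt
      hy.mdifferentiableAt hy0, hyv]
  · rw [mderiv_apply_snd hA.mdifferentiableAt]
    have e : (fun u => (σ (y u, Γ.mul (η (u, z)) X)).2) =ᶠ[𝓝 0]
        fun u => Γ.conjFamily (fun q => (σ (q.1, Γ.one q.2)).2)
          (fun z => Γ.inv (σ (x, Γ.one (Γ.tgt (σ.symm (f x, Γ.one z)).2))).2) y η
            ((u, u), y') := by
      filter_upwards [hmem, hsrc] with u hu hu'
      have hsX : Γ.src (η (u, z)) = Γ.tgt X := hu'.trans hX.symm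
      have hm := h.mem_one hu
      rw [Γ.tgt_mul _ _ hsX] at hm
      rw [h.apply_eq hu, Γ.tgt_mul _ _ hsX]
      simp only [conjFamily, ← hz, ← hXdef, hX]
      exact Γ.mul_assoc _ _ _ (h.src_phi hm) hsX
    rw [mderiv_congr e]

variable [CompleteSpace EM] [CompleteSpace EG] {k : ℕ}

theorem conjFamily_diag_isBisectionFamily {S : M → PreJet EM EG M G k} {T : M × M → G} {g : M → M}
    (hT : Γ.IsLocalFamily S T x)
    (hF : Γ.IsBisectionGerm (fun z => T (x, z)) g x) (hy : SmoothNear 𝓘(ℝ, ℝ) 𝓘(ℝ, EM) y 0)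
    (hy0 : y 0 = x) (hη : Γ.IsBisectionFamily η (0, x)) (hη0 : ∀ᶠ z in 𝓝 x, η (0, z) = Γ.one z) :
    Γ.IsBisectionFamily (fun q : ℝ × M => Γ.conjFamily T (fun z => Γ.inv (T (x, g z))) y η
      ((q.1, q.1), q.2)) (0, Γ.tgt (T (x, x))) :=
  (conjFamily_isBisectionFamily hT hF hy hy0 hη hη0).comp_left (a := fun u : ℝ => (u, u))
    (contDiff_id.prodMk contDiff_id) rfl

theorem toTan_upsilon_pushField (h : Γ.IsAdmissible σ f) (hx : x ∈ f.source)
    (hζ : Γ.IsInvariantField Ω ζ) (hxΩ : (x, Γ.one x) ∈ Ω)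
    (hy : SmoothNear 𝓘(ℝ, ℝ) 𝓘(ℝ, EM) y 0) (hy0 : y 0 = x)
    (hyv : mderiv 𝓘(ℝ, ℝ) 𝓘(ℝ, EM) y 0 1 = (ζ (x, Γ.one x)).1)
    (hη : Γ.IsBisectionFamily η (0, x)) (hη0 : ∀ᶠ z in 𝓝 x, η (0, z) = Γ.one z)
    (hηv : ∀ᶠ z in 𝓝 x, mderiv 𝓘(ℝ, ℝ) 𝓘(ℝ, EG) (fun u => η (u, z)) 0 1 =
      (ζ (x, Γ.one z)).2) :
    Γ.toTan (f x) (Γ.upsilon k (LieGroupoid.pushField σ ζ) (f x)) =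
      Γ.horiz k (f x) (LieGroupoid.pushVec f x (ζ (x, Γ.one x)).1) +
        Γ.velocity (fun u => jet k (fun z => Γ.conjFamily (fun q => (σ (q.1, Γ.one q.2)).2)
          (fun z => Γ.inv (σ (x, Γ.one (Γ.tgt (σ.symm (f x, Γ.one z)).2))).2) y η
            ((u, u), z)) (f x)) := by
  have hT := h.isLocalFamily hx k
  have hF := h.isBisectionGerm hx
  have hpush := pushField_one h hx hζ hxΩ hy hy0 hyv hη hη0 hηv
  have hκ := conjFamily_diag_isBisectionFamily (y := y) hT hF hy hy0 hη hη0
  have hκ0 := conjFamily_zero (T := fun q : M × M => (σ (q.1, Γ.one q.2)).2) hF hy0 hη0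
  have htx : Γ.tgt ((fun q : M × M => (σ (q.1, Γ.one q.2)).2) (x, x)) = f x := h.tgt_phi hx
  rw [htx] at hκ hκ0
  rw [velocity_eq_vert (k := k) hκ hκ0]
  have e1 : (Γ.upsilon k (LieGroupoid.pushField σ ζ) (f x)).1 =
      LieGroupoid.pushVec f x (ζ (x, Γ.one x)).1 := congrArg Prod.fst hpush.self_of_nhds
  have e2 := algJet_congr (Γ := Γ) (k := k)
    (θ := fun z => (LieGroupoid.pushField σ ζ (f x, Γ.one z) : EM × EG).2)
    (θ' := fun z => mderiv 𝓘(ℝ, ℝ) 𝓘(ℝ, EG)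
      (fun u => Γ.conjFamily (fun q => (σ (q.1, Γ.one q.2)).2)
          (fun z => Γ.inv (σ (x, Γ.one (Γ.tgt (σ.symm (f x, Γ.one z)).2))).2) y η
            ((u, u), z)) 0 1) (hpush.mono fun z hz => congrArg Prod.snd hz)
  rw [toTan, e1]
  congr 2

theorem algJet_zero (x : M) : Γ.algJet k (fun _ => (0 : EG)) x = 0 := by
  funext i
  have h : (fun e : EM => (mderiv 𝓘(ℝ, EG) 𝓘(ℝ, EG) (extChartAt 𝓘(ℝ, EG) (Γ.one x))
      (Γ.one ((extChartAt 𝓘(ℝ, EM) x).symm e)) (0 : EG))) = fun _ => 0 := by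
    funext e
    exact map_zero _
  change iteratedFDeriv ℝ (i : ℕ) (fun e : EM => (mderiv 𝓘(ℝ, EG) 𝓘(ℝ, EG)
    (extChartAt 𝓘(ℝ, EG) (Γ.one x)) (Γ.one ((extChartAt 𝓘(ℝ, EM) x).symm e)) (0 : EG))) _ = 0
  rw [h]
  exact congrFun (iteratedFDeriv_fun_zero) _

theorem IsLocalFamily.congr {S S' : M → PreJet EM EG M G k} {T : M × M → G}
    (h : Γ.IsLocalFamily S T x) (hS : S' =ᶠ[𝓝 x] S) : Γ.IsLocalFamily S' T x where
  smooth := h.smooth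
  src_eq := h.src_eq
  germ := h.germ
  jet_eq := by filter_upwards [h.jet_eq, hS] with z h1 h2 using h2.trans h1

theorem velocity_family_eq_vert (hη : Γ.IsBisectionFamily η (0, x))
    (hη0 : ∀ᶠ z in 𝓝 x, η (0, z) = Γ.one z)
    (hηv : ∀ᶠ z in 𝓝 x, mderiv 𝓘(ℝ, ℝ) 𝓘(ℝ, EG) (fun u => η (u, z)) 0 1 =
      (ζ (x, Γ.one z)).2) :
    Γ.velocity (fun u => jet k (fun z => η (u, z)) x) = vert (Γ.upsilon k ζ x).2 := by
  rw [velocity_eq_vert hη hη0]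
  exact congrArg vert (algJet_congr (Γ := Γ) (k := k) hηv)

theorem toTan_upsilon_pushField_eq (h : Γ.IsAdmissible σ f) (hx : x ∈ f.source)
    (hζ : Γ.IsInvariantField Ω ζ) (hxΩ : (x, Γ.one x) ∈ Ω) {S : M → PreJet EM EG M G k}
    (hS : S =ᶠ[𝓝 x] Γ.sigmaJet k σ) :
    Γ.toTan (f x) (Γ.upsilon k (LieGroupoid.pushField σ ζ) (f x)) =
      Γ.horiz k (f x) (LieGroupoid.pushVec f x (Γ.upsilon k ζ x).1) +
        (Γ.conjFirst S (Γ.sigmaJet (k + 1) σ x) x (Γ.horiz k x (Γ.upsilon k ζ x).1) -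
          Γ.conjLam (Γ.sigmaJet (k + 1) σ x) x (Γ.horiz k x (Γ.upsilon k ζ x).1)) +
        Γ.conjVert (Γ.sigmaJet (k + 1) σ x) x (Γ.upsilon k ζ x).2 := by
  obtain ⟨y, hy, hy0, hyv⟩ := exists_curve x (ζ (x, Γ.one x)).1
  obtain ⟨η, hη, hη0, hηv⟩ := hζ.exists_family hxΩ
  have h1 := toTan_upsilon_pushField (k := k) h hx hζ hxΩ hy hy0 hyv hη hη0 hηv
  have h2 := conj_sum ((h.isLocalFamily hx k).congr hS) (h.isBisectionGerm hx) hy hy0 hη hη0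
    (velocity_family_eq_vert (k := k) hη hη0 hηv)
  have htx : Γ.tgt ((fun q : M × M => (σ (q.1, Γ.one q.2)).2) (x, x)) = f x := h.tgt_phi hx
  rw [htx, hyv] at h2
  rw [h1, add_assoc]
  exact congrArg _ h2.symm

theorem toTan_upsilon_pushField_horizontal (h : Γ.IsAdmissible σ f) (hx : x ∈ f.source)
    (hζ : Γ.IsInvariantField Ω ζ) (hxΩ : (x, Γ.one x) ∈ Ω) (hH : LieGroupoid.IsHorizontal Ω ζ) :
    Γ.toTan (f x) (Γ.upsilon k (LieGroupoid.pushField σ ζ) (f x)) =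
      Γ.horiz k (f x) (LieGroupoid.pushVec f x (Γ.upsilon k ζ x).1) +
        (Γ.conjFirst (Γ.sigmaJet k σ) (Γ.sigmaJet (k + 1) σ x) x
            (Γ.horiz k x (Γ.upsilon k ζ x).1) -
          Γ.conjLam (Γ.sigmaJet (k + 1) σ x) x (Γ.horiz k x (Γ.upsilon k ζ x).1)) := by
  have h1 := toTan_upsilon_pushField_eq (k := k) h hx hζ hxΩ (EventuallyEq.refl _ _)
  have h2 : (Γ.upsilon k ζ x).2 = 0 := by
    have e : ∀ᶠ z in 𝓝 x, (ζ (x, Γ.one z)).2 = 0 :=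
      (tendsto_mk_left.eventually (hζ.eventually_one_mem hxΩ)).mono fun z hz => hH _ hz
    exact (algJet_congr (Γ := Γ) (k := k) e).trans (algJet_zero x)
  have h3 : Γ.conjVert (Γ.sigmaJet (k + 1) σ x) x (0 : JetCoeff EM EG k) = 0 :=
    conjVert_zero (T := fun q : M × M => (σ (q.1, Γ.one q.2)).2) (h.isBisectionGerm hx)
  rw [h1, h2, h3, add_zero]

theorem toTan_upsilon_pushField_vertical (h : Γ.IsAdmissible σ f) (hx : x ∈ f.source)
    (hζ : Γ.IsInvariantField Ω ζ) (hxΩ : (x, Γ.one x) ∈ Ω) (hV : LieGroupoid.IsVertical Ω ζ) :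
    Γ.toTan (f x) (Γ.upsilon k (LieGroupoid.pushField σ ζ) (f x)) =
      Γ.conjVert (Γ.sigmaJet (k + 1) σ x) x (Γ.upsilon k ζ x).2 := by
  have h1 := toTan_upsilon_pushField_eq (k := k) h hx hζ hxΩ (EventuallyEq.refl _ _)
  have h2 : (Γ.upsilon k ζ x).1 = (0 : EM) := hV _ hxΩ
  have h3 : Γ.conjFirst (Γ.sigmaJet k σ) (Γ.sigmaJet (k + 1) σ x) x (Γ.horiz k x (0 : EM)) = 0 :=
    conjFirst_zero (T := fun q : M × M => (σ (q.1, Γ.one q.2)).2) (h.isLocalFamily hx k) (h.isBisectionGerm hx)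
  have h4 : Γ.conjLam (Γ.sigmaJet (k + 1) σ x) x (Γ.horiz k x (0 : EM)) = 0 :=
    conjLam_zero (T := fun q : M × M => (σ (q.1, Γ.one q.2)).2) (h.isBisectionGerm hx)
  have h5 : Γ.horiz k (f x) (LieGroupoid.pushVec f x (0 : EM)) = 0 := by
    have h6 : (LieGroupoid.pushVec f x (0 : EM) : EM) = 0 := map_zero _
    exact (congrArg (fun v : EM => Γ.horiz k (f x) v) h6).trans (horiz_zero _)
  rw [h1, h2, h3, h4, h5, sub_zero, add_zero, zero_add]

theorem IsTangentBG.fst_eq (hB : Γ.IsTangentBG Ω ζ) {X : G} (hX : (Γ.tgt X, X) ∈ Ω) :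
    (ζ (Γ.tgt X, X)).1 = mderiv 𝓘(ℝ, EG) 𝓘(ℝ, EM) Γ.tgt X (ζ (Γ.tgt X, X)).2 := by
  obtain ⟨w, hw⟩ := hB X hX
  have h1 : MDifferentiableAt 𝓘(ℝ, EG) 𝓘(ℝ, EM) Γ.tgt X :=
    (Γ.contMDiff_tgt.smoothNear _).mdifferentiableAt
  have h2 := DFunLike.congr_fun (mderiv_prodMk h1 (mdifferentiableAt_id (I := 𝓘(ℝ, EG)))) w
  have h3 : mderiv 𝓘(ℝ, EG) (𝓘(ℝ, EM).prod 𝓘(ℝ, EG)) (fun Z : G => (Γ.tgt Z, Z)) X w =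
    ζ (Γ.tgt X, X) := hw
  have h4 : (w : EG) = (ζ (Γ.tgt X, X)).2 := by
    rw [← h3]
    exact (DFunLike.congr_fun (mderiv_id (I := 𝓘(ℝ, EG)) (x := X)) w).symm.trans
      (congrArg Prod.snd h2).symm
  rw [← h4, ← h3]
  exact congrArg Prod.fst h2

theorem toTan_upsilon_pushField_tangent (h : Γ.IsAdmissible σ f) (hx : x ∈ f.source)
    (hζ : Γ.IsInvariantField Ω ζ) (hxΩ : (x, Γ.one x) ∈ Ω) (hB : Γ.IsTangentBG Ω ζ) :
    Γ.toTan (f x) (Γ.upsilon k (LieGroupoid.pushField σ ζ) (f x)) =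
      Γ.horiz k (f x) (LieGroupoid.pushVec f x (Γ.upsilon k ζ x).1) +
        Γ.conjTangent (Γ.sigmaJet k σ) x (Γ.upsilon k ζ x).2 := by
  obtain ⟨η, hη, hη0, hηv⟩ := hζ.exists_family hxΩ
  have hηx : η (0, x) = Γ.one x := hη0.self_of_nhds
  have hc : SmoothNear 𝓘(ℝ, ℝ) 𝓘(ℝ, EG) (fun u => η (u, x)) 0 := hη.smooth.slice_left
  have hy : SmoothNear 𝓘(ℝ, ℝ) 𝓘(ℝ, EM) (fun u => Γ.tgt (η (u, x))) 0 :=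
    (Γ.contMDiff_tgt.smoothNear _).comp hc
  have hy0 : Γ.tgt (η (0, x)) = x := by rw [hηx, Γ.tgt_one]
  have hyv : mderiv 𝓘(ℝ, ℝ) 𝓘(ℝ, EM) (fun u => Γ.tgt (η (u, x))) 0 1 = (ζ (x, Γ.one x)).1 := by
    rw [mderiv_comp_apply (g := Γ.tgt) (y := Γ.one x)
      (Γ.contMDiff_tgt.smoothNear _).mdifferentiableAt hc.mdifferentiableAt hηx,
      hηv.self_of_nhds]
    have h1 := hB.fst_eq (X := Γ.one x) (by rwa [Γ.tgt_one])
    rw [Γ.tgt_one] at h1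
    exact h1.symm
  have h1 := toTan_upsilon_pushField (k := k) h hx hζ hxΩ hy hy0 hyv hη hη0 hηv
  have h2 := conjTangent_eq (h.isLocalFamily hx k) (h.isBisectionGerm hx) hη hη0
    (velocity_family_eq_vert (k := k) hη hη0 hηv)
  have htx : Γ.tgt ((fun q : M × M => (σ (q.1, Γ.one q.2)).2) (x, x)) = f x := h.tgt_phi hx
  rw [htx] at h2
  rw [h1]
  exact congrArg _ h2.symm

theorem act_eq_upsilon_pushField (h : Γ.IsAdmissible σ f) (hx : x ∈ f.source)
    (hζ : Γ.IsInvariantField Ω ζ) (hxΩ : (x, Γ.one x) ∈ Ω)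
    {S : M → PreJet EM EG M G (k + 1)} (hS : S =ᶠ[𝓝 x] Γ.sigmaJet (k + 1) σ)
    {f' : OpenPartialHomeomorph M M} (hf : f' =ᶠ[𝓝 x] f) (hfx : f'.symm (f x) = x)
    {a : M → CheckJet EM EG k} (ha : a x = Γ.upsilon k ζ x) :
    Γ.act S f' a (f x) = Γ.upsilon k (LieGroupoid.pushField σ ζ) (f x) := by
  have hS' : (fun z => (S z).proj) =ᶠ[𝓝 x] Γ.sigmaJet k σ := hS.mono fun z hz => by
    simp only [hz]; rfl
  have h1 := toTan_upsilon_pushField_eq h hx hζ hxΩ hS'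
  have h2 : ∀ v : EM, (LieGroupoid.pushVec f' x v : EM) = LieGroupoid.pushVec f x v := fun v =>
    DFunLike.congr_fun (mderiv_congr hf : mderiv 𝓘(ℝ, EM) 𝓘(ℝ, EM) f' x = _) v
  rw [← ofTan_toTan (Γ := Γ) (f x) (Γ.upsilon k (LieGroupoid.pushField σ ζ) (f x)), h1, act, hfx,
    ha, hS.self_of_nhds]
  congr 3
  exact congrArg _ (h2 _)

end Push

end LieGroupoid

namespace LieGroupoid

variable {EM EG M G : Type*}
  [NormedAddCommGroup EM] [NormedSpace ℝ EM] [NormedAddCommGroup EG] [NormedSpace ℝ EG]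
  [TopologicalSpace M] [ChartedSpace EM M] [TopologicalSpace G] [ChartedSpace EG G]
  {Γ : LieGroupoid EM EG M G}
  [IsManifold 𝓘(ℝ, EM) ∞ M] [IsManifold 𝓘(ℝ, EG) ∞ G]
  {σ : OpenPartialHomeomorph (M × G) (M × G)} {f : OpenPartialHomeomorph M M}
  {Ω : Set (M × G)} {ζ : M × G → EM × EG}

theorem IsInvariantField.exists_vertical_curve (hζ : Γ.IsInvariantField Ω ζ) {q : M × G}
    (hq : q ∈ Ω) : ∃ c : ℝ → G, SmoothNear 𝓘(ℝ, ℝ) 𝓘(ℝ, EG) c 0 ∧ c 0 = q.2 ∧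
      mderiv 𝓘(ℝ, ℝ) 𝓘(ℝ, EG) c 0 1 = (ζ q).2 ∧ ∀ᶠ u in 𝓝 0, Γ.src (c u) = Γ.src q.2 := by
  obtain ⟨K, hK, hK0, hKs⟩ := exists_vertical_flow (Γ := Γ) (hζ.smoothField_snd hq)
    (Filter.mem_of_superset (hζ.isOpen.mem_nhds hq) fun p hp => hζ.vertical hp)
  exact ⟨fun u => K (u, q), hK.slice_left, hK0.self_of_nhds.1, hK0.self_of_nhds.2,
    ((continuous_id.prodMk continuous_const).tendsto (0 : ℝ)).eventually hKs⟩

namespace IsAdmissible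

theorem pushField_eq_of_curve (h : Γ.IsAdmissible σ f) {q : M × G} (hq : q ∈ σ.target)
    {c : ℝ → M × G} (hc : SmoothNear 𝓘(ℝ, ℝ) (𝓘(ℝ, EM).prod 𝓘(ℝ, EG)) c 0) (hc0 : c 0 = σ.symm q)
    (hcv : mderiv 𝓘(ℝ, ℝ) (𝓘(ℝ, EM).prod 𝓘(ℝ, EG)) c 0 1 = ζ (σ.symm q)) :
    (LieGroupoid.pushField σ ζ q : EM × EG) =
      mderiv 𝓘(ℝ, ℝ) (𝓘(ℝ, EM).prod 𝓘(ℝ, EG)) (fun u => σ (c u)) 0 1 := by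
  rw [pushField_apply, ← hcv, mderiv_comp_apply
    (h.smoothNear (σ.map_target hq)).mdifferentiableAt hc.mdifferentiableAt hc0]

theorem fst_pushField (h : Γ.IsAdmissible σ f) {q : M × G} (hq : q ∈ σ.target) :
    (LieGroupoid.pushField σ ζ q : EM × EG).1 =
      mderiv 𝓘(ℝ, EM) 𝓘(ℝ, EM) f (σ.symm q).1 (ζ (σ.symm q)).1 := by
  have hp := σ.map_target hq
  have e : (fun r => (σ r).1) =ᶠ[𝓝 (σ.symm q)] fun r => f r.1 := by
    filter_upwards [σ.open_source.mem_nhds hp] with r hr using h.projectable r hr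
  rw [pushField_apply, mderiv_apply_fst (h.smoothNear hp).mdifferentiableAt, mderiv_congr e,
    mderiv_comp_apply (h.smoothNear_base (h.mem_source _ hp)).mdifferentiableAt
      mdifferentiableAt_fst rfl, mderiv_fst]
  rfl

theorem smoothField_pushField (h : Γ.IsAdmissible σ f) (hζ : Γ.IsInvariantField Ω ζ) {q : M × G}
    (hq : q ∈ σ.target) (hqΩ : σ.symm q ∈ Ω) :
    SmoothField (𝓘(ℝ, EM).prod 𝓘(ℝ, EG)) (𝓘(ℝ, EM).prod 𝓘(ℝ, EG)) (fun p => p)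
      (fun p => LieGroupoid.pushField σ ζ p) q := by
  have h1 := ((hζ.smoothField hqΩ).map (h.smoothNear (σ.map_target hq))).comp (c := σ.symm)
    (h.symm.smoothNear hq)
  refine h1.congr ?_ (EventuallyEq.refl _ _)
  filter_upwards [σ.open_target.mem_nhds hq] with p hp using σ.right_inv hp

theorem src_snd_pushField (h : Γ.IsAdmissible σ f) {q : M × G} (hq : q ∈ σ.target) :
    mderiv 𝓘(ℝ, EG) 𝓘(ℝ, EM) Γ.src q.2 (LieGroupoid.pushField σ ζ q : EM × EG).2 =
      mderiv 𝓘(ℝ, EG) 𝓘(ℝ, EM) Γ.src (σ.symm q).2 (ζ (σ.symm q)).2 := by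
  have hp := σ.map_target hq
  have hs : ∀ X, MDifferentiableAt 𝓘(ℝ, EG) 𝓘(ℝ, EM) Γ.src X := fun X =>
    (Γ.contMDiff_src.smoothNear _).mdifferentiableAt
  have e : (fun r => Γ.src (σ r).2) =ᶠ[𝓝 (σ.symm q)] fun r => Γ.src r.2 := by
    filter_upwards [σ.open_source.mem_nhds hp] with r hr using h.src_eq r.1 r.2 hr
  have hA : MDifferentiableAt (𝓘(ℝ, EM).prod 𝓘(ℝ, EG)) 𝓘(ℝ, EG) (fun r => (σ r).2) (σ.symm q) :=
    ((smoothNear_snd (N := M)).comp (h.smoothNear hp)).mdifferentiableAt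
  rw [pushField_apply, mderiv_apply_snd (h.smoothNear hp).mdifferentiableAt,
    ← mderiv_comp_apply (hs _) hA (by rw [σ.right_inv hq]), mderiv_congr e,
    mderiv_comp_apply (hs _) mdifferentiableAt_snd rfl, mderiv_snd]
  rfl

theorem pushField_isInvariantField (h : Γ.IsAdmissible σ f) (hζ : Γ.IsInvariantField Ω ζ) :
    Γ.IsInvariantField (σ.target ∩ σ.symm ⁻¹' Ω) (LieGroupoid.pushField σ ζ) where
  isOpen := σ.isOpen_inter_preimage_symm hζ.isOpen
  stable := by
    rintro b Z Y ⟨hZ, hZΩ⟩ hs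
    obtain ⟨h1, h2, h3⟩ := h.mul_mem_target hZ hs
    refine ⟨h1, ?_⟩
    rw [mem_preimage, h3]
    exact hζ.stable _ _ _ hZΩ (h2.trans hs)
  smooth := fun q hq => (h.smoothField_pushField hζ hq.1 hq.2).contMDiffAt.contMDiffWithinAt
  projectable := by
    rintro b X X' ⟨hX, hXΩ⟩ ⟨hX', hXΩ'⟩
    refine (h.fst_pushField hX).trans (Eq.trans ?_ (h.fst_pushField hX').symm)
    have e1 := h.symm.projectable _ hX
    have e2 := h.symm.projectable _ hX'
    have e3 : σ.symm (b, X) = (f.symm b, (σ.symm (b, X)).2) := Prod.ext e1 rfl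
    have e4 : σ.symm (b, X') = (f.symm b, (σ.symm (b, X')).2) := Prod.ext e2 rfl
    rw [mem_preimage] at hXΩ hXΩ'
    rw [e3] at hXΩ
    rw [e4] at hXΩ'
    have e5 : (ζ (f.symm b, (σ.symm (b, X)).2)).1 = (ζ (f.symm b, (σ.symm (b, X')).2)).1 :=
      hζ.projectable _ _ _ hXΩ hXΩ'
    rw [e3, e4, e5]
  tangent_fibre := fun q hq => (h.src_snd_pushField hq.1).trans (hζ.vertical hq.2)
  right_invariant := by
    rintro b Z Y ⟨hZ, hZΩ⟩ hs
    obtain ⟨h1, h2, h3⟩ := h.mul_mem_target hZ hs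
    have hp := σ.map_target hZ
    have hσ := σ.right_inv hZ
    rw [mem_preimage] at hZΩ
    obtain ⟨y, hy, hy0, hyv⟩ := exists_curve (σ.symm (b, Z)).1 (ζ (σ.symm (b, Z))).1
    obtain ⟨c, hc, hc0, hcv, hcs⟩ := hζ.exists_vertical_curve hZΩ
    have hcs' : ∀ᶠ u in 𝓝 0, Γ.src (c u) = Γ.tgt Y := hcs.mono fun u hu => hu.trans (h2.trans hs)
    have hyc : SmoothNear 𝓘(ℝ, ℝ) (𝓘(ℝ, EM).prod 𝓘(ℝ, EG)) (fun u => (y u, c u)) 0 := hy.prodMk hc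
    have hyc0 : (y 0, c 0) = σ.symm (b, Z) := Prod.ext hy0 hc0
    have hd := (h.smoothNear hp).comp_of_eq hyc hyc0
    have e1 := h.pushField_eq_of_curve hZ hyc hyc0 (by
      rw [mderiv_prodMk hy.mdifferentiableAt hc.mdifferentiableAt]
      exact Prod.ext hyv hcv)
    have hmul : SmoothNear 𝓘(ℝ, ℝ) 𝓘(ℝ, EG) (fun u => Γ.mul (c u) Y) 0 :=
      Γ.smoothNear_mul hc smoothNear_const hcs'
    have hΩY : ((σ.symm (b, Z)).1, Γ.mul (σ.symm (b, Z)).2 Y) ∈ Ω :=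
      hζ.stable _ _ _ hZΩ (h2.trans hs)
    have e2 := h.pushField_eq_of_curve (ζ := ζ) (q := (b, Γ.mul Z Y))
      (c := fun u => (y u, Γ.mul (c u) Y)) h1 (hy.prodMk hmul)
      (by rw [h3, hy0, hc0]) (by
      rw [mderiv_prodMk hy.mdifferentiableAt hmul.mdifferentiableAt, h3]
      refine Prod.ext (hyv.trans (hζ.projectable _ _ _ hZΩ hΩY)) ?_
      exact (hζ.snd_eq_of_curve hZΩ (h2.trans hs) hc.mdifferentiableAt hc0 hcv hcs').symm)
    have hmem : ∀ᶠ u in 𝓝 (0 : ℝ), (y u, c u) ∈ σ.source :=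
      (hyc.tendsto_of_eq hyc0).eventually (σ.open_source.mem_nhds hp)
    have e3 : (fun u => (σ (y u, Γ.mul (c u) Y)).2) =ᶠ[𝓝 0]
        fun u => Γ.mul (σ (y u, c u)).2 Y := by
      filter_upwards [hmem, hcs'] with u hu hu'
      rw [h.right_invariant _ _ _ hu hu']
    have hmc0 : (y 0, Γ.mul (c 0) Y) = σ.symm (b, Γ.mul Z Y) := by rw [h3, hy0, hc0]
    have hd2 : SmoothNear 𝓘(ℝ, ℝ) (𝓘(ℝ, EM).prod 𝓘(ℝ, EG))
        (fun u => σ (y u, Γ.mul (c u) Y)) 0 :=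
      (h.smoothNear (σ.map_target h1)).comp_of_eq (f := fun u => (y u, Γ.mul (c u) Y))
        (hy.prodMk hmul) hmc0
    have hds : SmoothNear 𝓘(ℝ, ℝ) 𝓘(ℝ, EG) (fun u => (σ (y u, c u)).2) 0 :=
      (smoothNear_snd (N := M)).comp hd
    have e4 := rightTranslate_eq (Γ := Γ) (X := Z) (Y := Y) hds.mdifferentiableAt (by rw [hyc0, hσ])
      (w := (LieGroupoid.pushField σ ζ (b, Z) : EM × EG).2) (by
        rw [e1, mderiv_apply_snd hd.mdifferentiableAt]) (by
        filter_upwards [hmem, hcs'] with u hu hu'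
        rw [h.src_eq _ _ hu, hu'])
    refine Eq.trans ?_ e4.symm
    rw [← mderiv_congr e3, ← mderiv_apply_snd hd2.mdifferentiableAt, ← e2]
    rfl

theorem pushField_isVertical (h : Γ.IsAdmissible σ f) (hV : LieGroupoid.IsVertical Ω ζ) :
    LieGroupoid.IsVertical (σ.target ∩ σ.symm ⁻¹' Ω) (LieGroupoid.pushField σ ζ) := by
  rintro q ⟨hq, hqΩ⟩
  refine (h.fst_pushField hq).trans ?_
  have h1 : (ζ (σ.symm q)).1 = 0 := hV _ hqΩ
  rw [h1, map_zero]
  rfl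

theorem pushField_isTangentBG (h : Γ.IsAdmissible σ f) (hB : Γ.IsTangentBG Ω ζ) :
    Γ.IsTangentBG (σ.target ∩ σ.symm ⁻¹' Ω) (LieGroupoid.pushField σ ζ) := by
  rintro X ⟨hX, hXΩ⟩
  rw [mem_preimage] at hXΩ
  have hp := σ.map_target hX
  obtain ⟨Z, hZ⟩ := h.symm.preserves ⟨_, ⟨hX, X, rfl⟩, rfl⟩
  have hj : ∀ X, SmoothNear 𝓘(ℝ, EG) (𝓘(ℝ, EM).prod 𝓘(ℝ, EG)) (fun Z : G => (Γ.tgt Z, Z)) X :=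
    fun X => (Γ.contMDiff_tgt.smoothNear X).prodMk smoothNear_id
  replace hZ : σ.symm (Γ.tgt X, X) = (Γ.tgt Z, Z) := hZ.symm
  have hσ := σ.right_inv hX
  rw [hZ] at hp hσ hXΩ
  obtain ⟨w, hw⟩ := hB Z hXΩ
  have hw' : mderiv 𝓘(ℝ, EG) (𝓘(ℝ, EM).prod 𝓘(ℝ, EG)) (fun Z : G => (Γ.tgt Z, Z)) Z w =
    ζ (Γ.tgt Z, Z) := hw
  have hA := (h.smoothNear hp).comp (f := fun Z : G => (Γ.tgt Z, Z)) (hj Z)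
  have hA2 : SmoothNear 𝓘(ℝ, EG) 𝓘(ℝ, EG) (fun Z : G => (σ (Γ.tgt Z, Z)).2) Z :=
    (smoothNear_snd (N := M)).comp hA
  refine ⟨mderiv 𝓘(ℝ, EG) 𝓘(ℝ, EG) (fun Z : G => (σ (Γ.tgt Z, Z)).2) Z w, ?_⟩
  have e1 : (LieGroupoid.pushField σ ζ (Γ.tgt X, X) : EM × EG) =
      mderiv 𝓘(ℝ, EG) (𝓘(ℝ, EM).prod 𝓘(ℝ, EG)) (fun Z : G => σ (Γ.tgt Z, Z)) Z w := by
    rw [pushField_apply, hZ, ← hw']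
    exact (mderiv_comp_apply (h.smoothNear hp).mdifferentiableAt
      (hj Z).mdifferentiableAt rfl w).symm
  have e2 : (fun Z : G => σ (Γ.tgt Z, Z)) =ᶠ[𝓝 Z]
      fun Z : G => (Γ.tgt (σ (Γ.tgt Z, Z)).2, (σ (Γ.tgt Z, Z)).2) := by
    filter_upwards [(hj Z).tendsto.eventually (σ.open_source.mem_nhds hp)] with Z' hZ'
    refine Prod.ext ?_ rfl
    rw [h.tgt_of_mem_BG hZ', h.projectable _ hZ']
  refine Eq.trans ?_ e1.symm
  rw [mderiv_congr e2]
  exact (mderiv_comp_apply (hj X).mdifferentiableAt hA2.mdifferentiableAt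
    (by rw [hσ]) w).symm

end IsAdmissible

end LieGroupoid

section Fields

variable {E H N : Type*} [NormedAddCommGroup E] [NormedSpace ℝ E] [TopologicalSpace H]
  [TopologicalSpace N] [ChartedSpace H N]
  {E' H' N' : Type*} [NormedAddCommGroup E'] [NormedSpace ℝ E'] [TopologicalSpace H']
  [TopologicalSpace N'] [ChartedSpace H' N']
  {E'' H'' N'' : Type*} [NormedAddCommGroup E''] [NormedSpace ℝ E''] [TopologicalSpace H'']
  [TopologicalSpace N''] [ChartedSpace H'' N'']
  {I : ModelWithCorners ℝ E H} {I' : ModelWithCorners ℝ E' H'} {I'' : ModelWithCorners ℝ E'' H''}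

theorem SmoothField.sub [IsManifold I' ∞ N'] {b : N → N'} {V V' : N → E'} {n : N}
    (h : SmoothField I I' b V n) (h' : SmoothField I I' b V' n) :
    SmoothField I I' b (fun z => V z - V' z) n := by
  rw [smoothField_iff (mem_chart_source H' (b n))] at h h' ⊢
  refine ⟨h.1, ?_⟩
  filter_upwards [h.2, h'.2] with z h1 h2
  simpa only [map_sub] using h1.sub h2

theorem SmoothField.prodMk [IsManifold I ∞ N] [I'.Boundaryless] [IsManifold I' ∞ N']
    [I''.Boundaryless] [IsManifold I'' ∞ N''] {b : N → N'} {V : N → E'} {c : N → N''} {U : N → E''}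
    {n : N} (h : SmoothField I I' b V n) (h' : SmoothField I I'' c U n) :
    SmoothField I (I'.prod I'') (fun z => (b z, c z)) (fun z => (V z, U z)) n := by
  obtain ⟨K, hK, hK0⟩ := h.exists_flow
  obtain ⟨L, hL, hL0⟩ := h'.exists_flow
  refine (smoothField_of_flow (hK.prodMk hL)).congr ?_ ?_
  · filter_upwards [hK0, hL0] with z h1 h2 using Prod.ext h1.1 h2.1
  · filter_upwards [hK0, hL0, tendsto_mk_left.eventually hK.eventually,
      tendsto_mk_left.eventually hL.eventually] with z h1 h2 h3 h4
    rw [mderiv_prodMk h3.slice_left.mdifferentiableAt h4.slice_left.mdifferentiableAt]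
    exact Prod.ext h1.2 h2.2

theorem smoothNear_prod_iff {f : E × E' → E''} {p : E × E'} :
    SmoothNear (𝓘(ℝ, E).prod 𝓘(ℝ, E')) 𝓘(ℝ, E'') f p ↔ ∀ᶠ q in 𝓝 p, ContDiffAt ℝ ∞ f q := by
  refine eventually_congr (Eventually.of_forall fun q => ?_)
  rw [← contMDiffAt_iff_contDiffAt, modelWithCornersSelf_prod, ← chartedSpaceSelf_prod]

theorem exists_bound_mderiv [I.Boundaryless] [I'.Boundaryless] [IsManifold I ∞ N]
    [IsManifold I' ∞ N'] {F : N → N'} {n a : N} {b : N'} (hF : SmoothNear I I' F n)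
    (ha : n ∈ (chartAt H a).source) (hb : F n ∈ (chartAt H' b).source) :
    ∃ C : ℝ, ∀ᶠ z in 𝓝 n, ∀ V : E, ‖mderiv I' 𝓘(ℝ, E') (extChartAt I' b) (F z)
      (mderiv I I' F z V)‖ ≤ C * ‖mderiv I 𝓘(ℝ, E) (extChartAt I a) z V‖ := by
  rw [← extChartAt_source (I := I)] at ha
  rw [← extChartAt_source (I := I')] at hb
  have hat : extChartAt I a n ∈ (extChartAt I a).target := (extChartAt I a).map_source ha
  have hR : SmoothNear 𝓘(ℝ, E) 𝓘(ℝ, E') (fun e => extChartAt I' b (F ((extChartAt I a).symm e)))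
      (extChartAt I a n) :=
    (smoothNear_extChartAt hb).comp_of_eq (hF.comp_of_eq (smoothNear_extChartAt_symm hat)
      ((extChartAt I a).left_inv ha)) (by rw [(extChartAt I a).left_inv ha])
  have hRc : ContinuousAt (fderiv ℝ (fun e => extChartAt I' b (F ((extChartAt I a).symm e))))
      (extChartAt I a n) :=
    (hR.contDiffAt.fderiv_right (m := 0) (by simp)).continuousAt
  refine ⟨‖fderiv ℝ (fun e => extChartAt I' b (F ((extChartAt I a).symm e)))
      (extChartAt I a n)‖ + 1, ?_⟩
  have hx := smoothNear_extChartAt (I := I) ha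
  have e1 := (hRc.norm.tendsto.comp hx.tendsto).eventually (gt_mem_nhds (lt_add_one _))
  filter_upwards [e1, hx.eventually, hx.tendsto.eventually hR.eventually, hF.eventually,
    hF.tendsto.eventually (smoothNear_extChartAt hb).eventually,
    (isOpen_extChartAt_source (I := I) a).mem_nhds ha] with z h1 h2 h3 h4 h5 h6 V
  have e2 : (fun z' => extChartAt I' b (F ((extChartAt I a).symm (extChartAt I a z'))))
      =ᶠ[𝓝 z] fun z' => extChartAt I' b (F z') := by
    filter_upwards [(isOpen_extChartAt_source (I := I) a).mem_nhds h6] with z' hz'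
    rw [(extChartAt I a).left_inv hz']
  have e3 := mderiv_comp_apply h3.mdifferentiableAt h2.mdifferentiableAt rfl V
  rw [mderiv_congr e2, mderiv_comp_apply h5.mdifferentiableAt h4.mdifferentiableAt rfl] at e3
  rw [e3, mderiv_eq_fderiv]
  exact (ContinuousLinearMap.le_opNorm _ _).trans
    (mul_le_mul_of_nonneg_right (le_of_lt h1) (norm_nonneg _))

end Fields

namespace LieGroupoid

variable {EM EG M G W : Type*}
  [NormedAddCommGroup EM] [NormedSpace ℝ EM] [NormedAddCommGroup EG] [NormedSpace ℝ EG]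
  [NormedAddCommGroup W] [NormedSpace ℝ W]
  [TopologicalSpace M] [ChartedSpace EM M] [TopologicalSpace G] [ChartedSpace EG G]
  {Γ : LieGroupoid EM EG M G} {k : ℕ}
  [IsManifold 𝓘(ℝ, EM) ∞ M] [IsManifold 𝓘(ℝ, EG) ∞ G]

/-- The expression of a field along the identities in the preferred charts at `a`. -/
def algForm (Γ : LieGroupoid EM EG M G) (a : M) (θ : M → EG) (e : EM) : EG :=
  mderiv 𝓘(ℝ, EG) 𝓘(ℝ, EG) (extChartAt 𝓘(ℝ, EG) (Γ.one a))
    (Γ.one ((extChartAt 𝓘(ℝ, EM) a).symm e)) (θ ((extChartAt 𝓘(ℝ, EM) a).symm e))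

theorem algCoeffs_apply (a : M) (θ : M → EG) (x : M) (i : Fin (k + 1)) :
    Γ.algCoeffs k a (fun z => θ z) x i =
      iteratedFDeriv ℝ (i : ℕ) (Γ.algForm a θ) (extChartAt 𝓘(ℝ, EM) a x) := rfl

theorem smoothNear_algForm {a x : M} {θ : M → EG}
    (hθ : SmoothField 𝓘(ℝ, EM) 𝓘(ℝ, EG) Γ.one θ x) (hx : x ∈ (chartAt EM a).source)
    (hx' : Γ.one x ∈ (chartAt EG (Γ.one a)).source) :
    SmoothNear 𝓘(ℝ, EM) 𝓘(ℝ, EG) (Γ.algForm a θ) (extChartAt 𝓘(ℝ, EM) a x) := by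
  rw [← extChartAt_source 𝓘(ℝ, EM)] at hx
  exact ((smoothField_iff hx').1 hθ).2.comp_of_eq
    (smoothNear_extChartAt_symm ((extChartAt 𝓘(ℝ, EM) a).map_source hx))
    ((extChartAt 𝓘(ℝ, EM) a).left_inv hx)

theorem smoothNear_algForm_family {a x : M} {w : W} {Θ : W × M → EG}
    (hθ : SmoothField (𝓘(ℝ, W).prod 𝓘(ℝ, EM)) 𝓘(ℝ, EG) (fun q : W × M => Γ.one q.2) Θ (w, x))
    (hx : x ∈ (chartAt EM a).source)
    (hx' : Γ.one x ∈ (chartAt EG (Γ.one a)).source) :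
    ∀ᶠ p in 𝓝 (w, extChartAt 𝓘(ℝ, EM) a x),
      ContDiffAt ℝ ∞ (fun p : W × EM => Γ.algForm a (fun z => Θ (p.1, z)) p.2) p := by
  rw [← extChartAt_source 𝓘(ℝ, EM)] at hx
  have h1 : SmoothNear (𝓘(ℝ, W).prod 𝓘(ℝ, EM)) (𝓘(ℝ, W).prod 𝓘(ℝ, EM))
      (fun p : W × EM => (p.1, (extChartAt 𝓘(ℝ, EM) a).symm p.2))
      (w, extChartAt 𝓘(ℝ, EM) a x) :=
    smoothNear_fst.prodMk ((smoothNear_extChartAt_symm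
      ((extChartAt 𝓘(ℝ, EM) a).map_source hx)).comp_of_eq smoothNear_snd rfl)
  have h2 := ((smoothField_iff (b := fun q : W × M => Γ.one q.2) hx').1 hθ).2.comp_of_eq h1
    (by rw [(extChartAt 𝓘(ℝ, EM) a).left_inv hx])
  exact smoothNear_prod_iff.1 h2

theorem contDiffAt_algCoeffs_family {a x : M} {w : W} {Θ : W × M → EG}
    (hθ : SmoothField (𝓘(ℝ, W).prod 𝓘(ℝ, EM)) 𝓘(ℝ, EG) (fun q : W × M => Γ.one q.2) Θ (w, x))
    (hx : x ∈ (chartAt EM a).source)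
    (hx' : Γ.one x ∈ (chartAt EG (Γ.one a)).source) :
    SmoothNear (𝓘(ℝ, W).prod 𝓘(ℝ, EM)) 𝓘(ℝ, JetCoeff EM EG k)
      (fun q : W × M => Γ.algCoeffs k a (fun z => Θ (q.1, z)) q.2) (w, x) := by
  have h0 := smoothNear_algForm_family hθ hx hx'
  have h1 : SmoothNear (𝓘(ℝ, W).prod 𝓘(ℝ, EM)) 𝓘(ℝ, JetCoeff EM EG k)
      (fun p : W × EM => (fun i : Fin (k + 1) => iteratedFDeriv ℝ (i : ℕ)
        (Γ.algForm a (fun z => Θ (p.1, z))) p.2 : JetCoeff EM EG k))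
      (w, extChartAt 𝓘(ℝ, EM) a x) := by
    rw [smoothNear_prod_iff]
    filter_upwards [h0] with p hp
    exact contDiffAt_pi.2 fun i => contDiffAt_iteratedFDeriv_partial (i : ℕ) hp
  rw [← extChartAt_source 𝓘(ℝ, EM)] at hx
  exact h1.comp_of_eq (f := fun q : W × M => (q.1, extChartAt 𝓘(ℝ, EM) a q.2))
    (smoothNear_fst.prodMk ((smoothNear_extChartAt hx).comp_of_eq smoothNear_snd rfl)) rfl

/-- The field `θ` along the identities vanishes to order `m` at `x`. -/
def AlgFlat (Γ : LieGroupoid EM EG M G) (m : ℕ) (a : M) (θ : M → EG) (x : M) : Prop :=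
  (fun z => mderiv 𝓘(ℝ, EG) 𝓘(ℝ, EG) (extChartAt 𝓘(ℝ, EG) (Γ.one a)) (Γ.one z) (θ z))
    =O[𝓝 x] fun z => chartGauge 𝓘(ℝ, EM) x z ^ m

theorem algFlat_iff_isBigO {a x : M} {θ : M → EG} {m : ℕ} (hx : x ∈ (chartAt EM a).source) :
    Γ.AlgFlat m a θ x ↔ Γ.algForm a θ =O[𝓝 (extChartAt 𝓘(ℝ, EM) a x)]
      fun e => ‖e - extChartAt 𝓘(ℝ, EM) a x‖ ^ m := by
  rw [← extChartAt_source 𝓘(ℝ, EM)] at hx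
  have hs := smoothNear_extChartAt (I := 𝓘(ℝ, EM)) hx
  have ht := smoothNear_extChartAt_symm (I := 𝓘(ℝ, EM)) ((extChartAt 𝓘(ℝ, EM) a).map_source hx)
  have hinv := (extChartAt 𝓘(ℝ, EM) a).left_inv hx
  constructor
  · intro h
    have h1 := h.comp_tendsto (ht.tendsto_of_eq hinv)
    refine h1.trans ?_
    have h2 := chartGauge_isBigO (ht.contMDiffAt.of_le (by simp : (1 : ℕ∞ω) ≤ ∞))
    rw [hinv] at h2
    exact h2.pow m
  · intro h
    have h1 := h.comp_tendsto hs.tendsto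
    have h2 := chartGauge_isBigO (hs.contMDiffAt.of_le (by simp : (1 : ℕ∞ω) ≤ ∞))
    refine (h1.congr' ?_ (EventuallyEq.refl _ _)).trans (h2.pow m)
    filter_upwards [(isOpen_extChartAt_source (I := 𝓘(ℝ, EM)) a).mem_nhds hx] with z hz
    simp only [Function.comp, algForm, (extChartAt 𝓘(ℝ, EM) a).left_inv hz]

theorem algFlat_iff {a x : M} {θ : M → EG} (hθ : SmoothField 𝓘(ℝ, EM) 𝓘(ℝ, EG) Γ.one θ x)
    (hx : x ∈ (chartAt EM a).source) (hx' : Γ.one x ∈ (chartAt EG (Γ.one a)).source) :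
    Γ.AlgFlat (k + 1) a θ x ↔ (Γ.algCoeffs k a (fun z => θ z) x : JetCoeff EM EG k) = 0 := by
  have h := (smoothNear_algForm hθ hx hx').contDiffAt
  rw [algFlat_iff_isBigO hx]
  constructor
  · intro h1
    funext i
    exact iteratedFDeriv_eq_zero_of_isBigO h h1 i (by omega)
  · intro h1
    exact isBigO_of_iteratedFDeriv_eq_zero h fun i hi => congrFun h1 ⟨i, by omega⟩

theorem AlgFlat.of_bound {a b x : M} {θ θ' : M → EG} {m : ℕ} (h : Γ.AlgFlat m a θ x) {C : ℝ}
    (hC : ∀ᶠ z in 𝓝 x,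
      ‖mderiv 𝓘(ℝ, EG) 𝓘(ℝ, EG) (extChartAt 𝓘(ℝ, EG) (Γ.one b)) (Γ.one z) (θ' z)‖ ≤
        C * ‖mderiv 𝓘(ℝ, EG) 𝓘(ℝ, EG) (extChartAt 𝓘(ℝ, EG) (Γ.one a)) (Γ.one z) (θ z)‖) :
    Γ.AlgFlat m b θ' x :=
  (Asymptotics.IsBigO.of_bound C hC).trans h

theorem AlgFlat.change {a b x : M} {θ : M → EG} {m : ℕ} (h : Γ.AlgFlat m a θ x)
    (ha : Γ.one x ∈ (chartAt EG (Γ.one a)).source) (hb : Γ.one x ∈ (chartAt EG (Γ.one b)).source) :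
    Γ.AlgFlat m b θ x := by
  obtain ⟨C, hC⟩ := exists_bound_mderiv (I := 𝓘(ℝ, EG)) (I' := 𝓘(ℝ, EG)) (smoothNear_id) ha hb
  refine h.of_bound (C := C) ?_
  filter_upwards [(Γ.contMDiff_one.smoothNear x).tendsto.eventually hC] with z hz
  have := hz (θ z)
  rwa [mderiv_id] at this

/-- The `s`-vertical part of a field along the identities. -/
def vertPart (Γ : LieGroupoid EM EG M G) (z : M) (v : EG) : EG :=
  v - mderiv 𝓘(ℝ, EM) 𝓘(ℝ, EG) Γ.one z (mderiv 𝓘(ℝ, EG) 𝓘(ℝ, EM) Γ.src (Γ.one z) v)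

theorem vertPart_of_vertical {z : M} {v : EG}
    (h : mderiv 𝓘(ℝ, EG) 𝓘(ℝ, EM) Γ.src (Γ.one z) v = 0) : Γ.vertPart z v = v := by
  rw [vertPart, h, map_zero, sub_zero]

theorem mderiv_src_vertPart (z : M) (v : EG) :
    mderiv 𝓘(ℝ, EG) 𝓘(ℝ, EM) Γ.src (Γ.one z) (Γ.vertPart z v) = 0 := by
  have h1 := mderiv_comp_apply (I := 𝓘(ℝ, EM)) (I'' := 𝓘(ℝ, EM)) (g := Γ.src) (f := Γ.one)
    (x := z) (Γ.contMDiff_src.smoothNear _).mdifferentiableAt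
    (Γ.contMDiff_one.smoothNear _).mdifferentiableAt rfl
    (mderiv 𝓘(ℝ, EG) 𝓘(ℝ, EM) Γ.src (Γ.one z) v)
  have h2 : (fun z => Γ.src (Γ.one z)) = fun z => z := funext Γ.src_one
  rw [h2, mderiv_id] at h1
  rw [vertPart, map_sub, ← h1]
  simp

theorem vertPart_sub (z : M) (v v' : EG) :
    Γ.vertPart z (v - v') = Γ.vertPart z v - Γ.vertPart z v' := by
  simp only [vertPart, map_sub]
  abel

theorem AlgFlat.vertPart {a x : M} {θ : M → EG} {m : ℕ} (h : Γ.AlgFlat m a θ x)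
    (ha : Γ.one x ∈ (chartAt EG (Γ.one a)).source) :
    Γ.AlgFlat m a (fun z => Γ.vertPart z (θ z)) x := by
  have hos : SmoothNear 𝓘(ℝ, EG) 𝓘(ℝ, EG) (fun Z => Γ.one (Γ.src Z)) (Γ.one x) :=
    (Γ.contMDiff_one.smoothNear _).comp (Γ.contMDiff_src.smoothNear _)
  obtain ⟨C, hC⟩ := exists_bound_mderiv (I := 𝓘(ℝ, EG)) (I' := 𝓘(ℝ, EG)) (b := Γ.one a) hos ha
    (by rwa [Γ.src_one])
  refine h.of_bound (C := 1 + C) ?_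
  filter_upwards [(Γ.contMDiff_one.smoothNear x).tendsto.eventually hC] with z hz
  have h1 := hz (θ z)
  have h2 := mderiv_comp_apply (I := 𝓘(ℝ, EG)) (I'' := 𝓘(ℝ, EG)) (g := Γ.one) (f := Γ.src)
    (x := Γ.one z) (Γ.contMDiff_one.smoothNear _).mdifferentiableAt
    (Γ.contMDiff_src.smoothNear _).mdifferentiableAt rfl (θ z)
  rw [h2, Γ.src_one] at h1
  rw [LieGroupoid.vertPart, map_sub, add_mul, _root_.one_mul]
  exact (norm_sub_le _ _).trans (add_le_add le_rfl h1)

theorem SmoothField.vertPart {E H N : Type*} [NormedAddCommGroup E] [NormedSpace ℝ E]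
    [TopologicalSpace H] [TopologicalSpace N] [ChartedSpace H N] {I : ModelWithCorners ℝ E H}
    [IsManifold I ∞ N] {b : N → M} {V : N → EG} {n : N}
    (h : SmoothField I 𝓘(ℝ, EG) (fun q => Γ.one (b q)) V n) :
    SmoothField I 𝓘(ℝ, EG) (fun q => Γ.one (b q)) (fun q => Γ.vertPart (b q) (V q)) n := by
  refine h.sub ?_
  have h1 := (h.map (Γ.contMDiff_src.smoothNear _)).map (Γ.contMDiff_one.smoothNear _)
  exact h1.congr (Eventually.of_forall fun q => by simp only [Γ.src_one])
    (Eventually.of_forall fun q => by simp only [Γ.src_one])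

theorem algCoeffs_sub {a x : M} {θ θ' : M → EG}
    (hθ : SmoothField 𝓘(ℝ, EM) 𝓘(ℝ, EG) Γ.one θ x) (hθ' : SmoothField 𝓘(ℝ, EM) 𝓘(ℝ, EG) Γ.one θ' x)
    (hx : x ∈ (chartAt EM a).source) (hx' : Γ.one x ∈ (chartAt EG (Γ.one a)).source) :
    (Γ.algCoeffs k a (fun z => θ z - θ' z) x : JetCoeff EM EG k) =
      Γ.algCoeffs k a (fun z => θ z) x - Γ.algCoeffs k a (fun z => θ' z) x := by
  funext i
  have e : Γ.algForm a (fun z => θ z - θ' z) = Γ.algForm a θ - Γ.algForm a θ' := by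
    funext e
    simp only [algForm, map_sub, Pi.sub_apply]
  have h1 := (smoothNear_algForm hθ hx hx').contDiffAt
  have h2 := (smoothNear_algForm hθ' hx hx').contDiffAt
  rw [Pi.sub_apply, algCoeffs_apply, algCoeffs_apply, algCoeffs_apply, e,
    iteratedFDeriv_sub_apply (h1.of_le (by exact_mod_cast le_top))
      (h2.of_le (by exact_mod_cast le_top))]

theorem algCoeffs_eq_iff {a x : M} {θ θ' : M → EG}
    (hθ : SmoothField 𝓘(ℝ, EM) 𝓘(ℝ, EG) Γ.one θ x) (hθ' : SmoothField 𝓘(ℝ, EM) 𝓘(ℝ, EG) Γ.one θ' x)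
    (hx : x ∈ (chartAt EM a).source) (hx' : Γ.one x ∈ (chartAt EG (Γ.one a)).source) :
    (Γ.algCoeffs k a (fun z => θ z) x : JetCoeff EM EG k) = Γ.algCoeffs k a (fun z => θ' z) x ↔
      Γ.AlgFlat (k + 1) a (fun z => θ z - θ' z) x := by
  rw [algFlat_iff (hθ.sub hθ') hx hx', algCoeffs_sub hθ hθ' hx hx', sub_eq_zero]

theorem algCoeffs_congr_chart {a b x : M} {θ θ' : M → EG}
    (hθ : SmoothField 𝓘(ℝ, EM) 𝓘(ℝ, EG) Γ.one θ x) (hθ' : SmoothField 𝓘(ℝ, EM) 𝓘(ℝ, EG) Γ.one θ' x)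
    (ha : x ∈ (chartAt EM a).source) (ha' : Γ.one x ∈ (chartAt EG (Γ.one a)).source)
    (hb : x ∈ (chartAt EM b).source) (hb' : Γ.one x ∈ (chartAt EG (Γ.one b)).source)
    (h : (Γ.algCoeffs k a (fun z => θ z) x : JetCoeff EM EG k) =
      Γ.algCoeffs k a (fun z => θ' z) x) :
    (Γ.algCoeffs k b (fun z => θ z) x : JetCoeff EM EG k) = Γ.algCoeffs k b (fun z => θ' z) x := by
  rw [algCoeffs_eq_iff hθ hθ' hb hb']
  rw [algCoeffs_eq_iff hθ hθ' ha ha'] at h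
  exact h.change ha' hb'

theorem algRepresents_algRep {x : M} {A : JetCoeff EM EG k} (h : A ∈ Γ.algJets k x) :
    Γ.AlgRepresents (Γ.algRep x A) x A := by
  exact @Classical.epsilon_spec_aux _ ⟨fun _ => 0⟩ (fun θ => Γ.AlgRepresents θ x A) h

theorem IsAlgSection.smoothField {θ : M → EG} {U : Set M} (h : Γ.IsAlgSection θ U)
    (hU : IsOpen U) {x : M} (hx : x ∈ U) : SmoothField 𝓘(ℝ, EM) 𝓘(ℝ, EG) Γ.one θ x :=
  h.smooth.smoothNear (hU.mem_nhds hx)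

theorem algRep_spec {x : M} {A : JetCoeff EM EG k} (h : A ∈ Γ.algJets k x) :
    SmoothField 𝓘(ℝ, EM) 𝓘(ℝ, EG) Γ.one (Γ.algRep x A) x ∧
      (∀ᶠ z in 𝓝 x, mderiv 𝓘(ℝ, EG) 𝓘(ℝ, EM) Γ.src (Γ.one z) (Γ.algRep x A z) = 0) ∧
      Γ.algJet k (Γ.algRep x A) x = A := by
  obtain ⟨⟨U, hU, hxU, hs⟩, h2⟩ := algRepresents_algRep h
  exact ⟨hs.smoothField hU hxU, by
    filter_upwards [hU.mem_nhds hxU] with z hz using hs.vertical z hz, h2⟩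

theorem algCoeffs_algRep {a x : M} {θ : M → EG} {A : JetCoeff EM EG k} (h : A ∈ Γ.algJets k x)
    (hθ : SmoothField 𝓘(ℝ, EM) 𝓘(ℝ, EG) Γ.one θ x) (hA : Γ.algJet k (fun z => θ z) x = A)
    (ha : x ∈ (chartAt EM a).source) (ha' : Γ.one x ∈ (chartAt EG (Γ.one a)).source) :
    Γ.algCoeffs k a (Γ.algRep x A) x = Γ.algCoeffs k a (fun z => θ z) x := by
  obtain ⟨h1, -, h3⟩ := algRep_spec h
  exact algCoeffs_congr_chart h1 hθ (mem_chart_source _ _) (mem_chart_source _ _) ha ha'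
    (h3.trans hA.symm)

theorem mem_algJets {x : M} {θ : M → EG} (hθ : SmoothField 𝓘(ℝ, EM) 𝓘(ℝ, EG) Γ.one θ x)
    (hv : ∀ᶠ z in 𝓝 x, mderiv 𝓘(ℝ, EG) 𝓘(ℝ, EM) Γ.src (Γ.one z) (θ z) = 0) :
    Γ.algJet k (fun z => θ z) x ∈ Γ.algJets k x := by
  obtain ⟨U, hU, hUo, hxU⟩ := mem_nhds_iff.1 (hv.and (eventually_eventually_nhds.2 hθ))
  exact ⟨θ, ⟨U, hUo, hxU, ⟨fun z hz => (hU hz).2.self_of_nhds.contMDiffWithinAt,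
    fun z hz => (hU hz).1⟩⟩, rfl⟩

end LieGroupoid

theorem mderiv_extChartAt_symm_apply {E H N : Type*} [NormedAddCommGroup E] [NormedSpace ℝ E]
    [TopologicalSpace H] [TopologicalSpace N] [ChartedSpace H N] {I : ModelWithCorners ℝ E H}
    [I.Boundaryless] [IsManifold I ∞ N] {a z : N} (hz : z ∈ (extChartAt I a).source) (v : E) :
    mderiv I 𝓘(ℝ, E) (extChartAt I a) z
      (mderiv 𝓘(ℝ, E) I (extChartAt I a).symm (extChartAt I a z) v) = v := by
  have ht := (extChartAt I a).map_source hz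
  have h1 := mderiv_comp_apply (g := extChartAt I a) (f := (extChartAt I a).symm)
    (smoothNear_extChartAt hz).mdifferentiableAt
    (smoothNear_extChartAt_symm ht).mdifferentiableAt ((extChartAt I a).left_inv hz) v
  rw [← h1]
  have h2 : (fun e => extChartAt I a ((extChartAt I a).symm e)) =ᶠ[𝓝 (extChartAt I a z)]
      fun e => e := by
    filter_upwards [(isOpen_extChartAt_target (I := I) a).mem_nhds ht] with e he
      using (extChartAt I a).right_inv he
  rw [mderiv_congr h2, mderiv_id]
  rfl

namespace LieGroupoid

variable {EM EG M G : Type*}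
  [NormedAddCommGroup EM] [NormedSpace ℝ EM] [NormedAddCommGroup EG] [NormedSpace ℝ EG]
  [TopologicalSpace M] [ChartedSpace EM M] [TopologicalSpace G] [ChartedSpace EG G]
  {Γ : LieGroupoid EM EG M G} {k : ℕ}
  [IsManifold 𝓘(ℝ, EM) ∞ M] [IsManifold 𝓘(ℝ, EG) ∞ G]

theorem eventually_mem_charts (x₀ : M) : ∀ᶠ x in 𝓝 x₀, x ∈ (chartAt EM x₀).source ∧
    Γ.one x ∈ (chartAt EG (Γ.one x₀)).source :=
  Filter.inter_mem ((chartAt EM x₀).open_source.mem_nhds (mem_chart_source _ _))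
    ((Γ.contMDiff_one.smoothNear x₀).tendsto.eventually
      ((chartAt EG (Γ.one x₀)).open_source.mem_nhds (mem_chart_source _ _)))

theorem smoothNear_algCoeffs_family {x₀ : M} {Θ : M × M → EG}
    (h : SmoothField (𝓘(ℝ, EM).prod 𝓘(ℝ, EM)) 𝓘(ℝ, EG) (fun q : M × M => Γ.one q.2) Θ (x₀, x₀)) :
    SmoothNear 𝓘(ℝ, EM) 𝓘(ℝ, JetCoeff EM EG k)
      (fun x => Γ.algCoeffs k x₀ (fun z => Θ (x, z)) x) x₀ := by
  set φ := extChartAt 𝓘(ℝ, EM) x₀ with hφ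
  have hc : SmoothNear (𝓘(ℝ, EM).prod 𝓘(ℝ, EM)) (𝓘(ℝ, EM).prod 𝓘(ℝ, EM))
      (fun p : EM × M => (φ.symm p.1, p.2)) (φ x₀, x₀) :=
    ((smoothNear_extChartAt_symm (mem_extChartAt_target x₀)).comp_of_eq smoothNear_fst rfl).prodMk
      smoothNear_snd
  have hc0 : (φ.symm (φ x₀), x₀) = (x₀, x₀) := by rw [hφ, extChartAt_to_inv]
  have h1 : SmoothField (𝓘(ℝ, EM).prod 𝓘(ℝ, EM)) 𝓘(ℝ, EG) (fun q : EM × M => Γ.one q.2)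
      (fun p : EM × M => Θ (φ.symm p.1, p.2)) (φ x₀, x₀) :=
    SmoothField.comp (b := fun q : M × M => Γ.one q.2) (V := Θ) (n := (φ x₀, x₀))
      (c := fun p : EM × M => (φ.symm p.1, p.2)) (by rw [hc0]; exact h) hc
  have h2 := contDiffAt_algCoeffs_family (k := k) h1 (mem_chart_source _ _) (mem_chart_source _ _)
  have h3 := h2.comp_of_eq (f := fun x : M => (φ x, x)) (x := x₀)
    ((smoothNear_extChartAt (mem_extChartAt_source x₀)).prodMk smoothNear_id) rfl
  refine h3.congr_of_eventuallyEq ?_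
  filter_upwards [extChartAt_source_mem_nhds (I := 𝓘(ℝ, EM)) x₀] with x hx
  simp only [φ.left_inv hx]

theorem IsInvariantField.mem_algJets (k : ℕ) {Ω : Set (M × G)} {ζ : M × G → EM × EG}
    (hζ : Γ.IsInvariantField Ω ζ) {x : M} (hx : (x, Γ.one x) ∈ Ω) :
    (Γ.upsilon k ζ x).2 ∈ Γ.algJets k x :=
  LieGroupoid.mem_algJets (hζ.smoothField_one hx)
    ((tendsto_mk_left.eventually (hζ.eventually_one_mem hx)).mono fun _ hz => hζ.vertical hz)

theorem IsInvariantField.isCheckSection (k : ℕ) {Ω : Set (M × G)} {ζ : M × G → EM × EG}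
    (hζ : Γ.IsInvariantField Ω ζ) {U : Set M} (hU : IsOpen U)
    (hUΩ : ∀ x ∈ U, (x, Γ.one x) ∈ Ω) : Γ.IsCheckSection (Γ.upsilon k ζ) U where
  isOpen := hU
  smooth_fst := fun x hx => by
    have h1 := (hζ.smoothField_fst (hUΩ x hx)).comp (c := fun z => (z, Γ.one z)) (n := x)
      (smoothNear_id.prodMk (Γ.contMDiff_one.smoothNear x))
    exact h1.contMDiffAt.contMDiffWithinAt
  mem := fun x hx => hζ.mem_algJets k (hUΩ x hx)
  smooth_snd := fun x₀ hx₀ => by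
    have h0 : SmoothField (𝓘(ℝ, EM).prod 𝓘(ℝ, EM)) 𝓘(ℝ, EG) (fun q : M × M => Γ.one q.2)
        (fun q : M × M => (ζ (q.1, Γ.one q.2)).2) (x₀, x₀) :=
      (hζ.smoothField_snd (hUΩ x₀ hx₀)).comp (c := fun q : M × M => (q.1, Γ.one q.2)) (n := (x₀, x₀))
        (smoothNear_fst.prodMk ((Γ.contMDiff_one.smoothNear x₀).comp_of_eq smoothNear_snd rfl))
    refine ((smoothNear_algCoeffs_family (k := k) h0).congr_of_eventuallyEq ?_).contMDiffAt
    filter_upwards [eventually_mem_charts (Γ := Γ) x₀, hU.mem_nhds hx₀] with x hx hxU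
    exact algCoeffs_algRep (hζ.mem_algJets k (hUΩ x hxU)) (hζ.smoothField_one (hUΩ x hxU)) rfl
      hx.1 hx.2

/-! ### Fields along the identities with given jets -/

section Polynomial

variable [CompleteSpace EG]

/-- The field along the identities with Taylor polynomial `w` in the preferred charts at `a`. -/
def polyField (Γ : LieGroupoid EM EG M G) (a : M) (w : JetTan EM EG k) (z : M) : EG :=
  mderiv 𝓘(ℝ, EG) 𝓘(ℝ, EG) (extChartAt 𝓘(ℝ, EG) (Γ.one a)).symm
    (extChartAt 𝓘(ℝ, EG) (Γ.one a) (Γ.one z)) (taylorPoly w.2 w.1 (extChartAt 𝓘(ℝ, EM) a z))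

theorem smoothNear_taylorPoly {a x : M} (hx : x ∈ (chartAt EM a).source) (w : JetTan EM EG k) :
    SmoothNear (𝓘(ℝ, JetTan EM EG k).prod 𝓘(ℝ, EM)) 𝓘(ℝ, EG)
      (fun q : JetTan EM EG k × M => taylorPoly q.1.2 q.1.1 (extChartAt 𝓘(ℝ, EM) a q.2)) (w, x) := by
  rw [← extChartAt_source 𝓘(ℝ, EM)] at hx
  have h1 : SmoothNear (𝓘(ℝ, JetTan EM EG k).prod 𝓘(ℝ, EM)) 𝓘(ℝ, EM)
      (fun q : JetTan EM EG k × M => extChartAt 𝓘(ℝ, EM) a q.2) (w, x) :=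
    (smoothNear_extChartAt hx).comp_of_eq smoothNear_snd rfl
  have h2 : SmoothNear (𝓘(ℝ, JetTan EM EG k).prod 𝓘(ℝ, EM)) 𝓘(ℝ, JetTan EM EG k)
      (fun q : JetTan EM EG k × M => q.1) (w, x) := smoothNear_fst
  filter_upwards [h1, h2] with q h1 h2
  exact ContDiff.comp_contMDiffAt
    (f := fun q : JetTan EM EG k × M => (q.1, extChartAt 𝓘(ℝ, EM) a q.2))
    (contDiff_taylorPoly (E := EM) (F := EG) (k := k)) (h2.prodMk_space h1)

theorem smoothField_polyField {a x : M} (hx : x ∈ (chartAt EM a).source)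
    (hx' : Γ.one x ∈ (chartAt EG (Γ.one a)).source) (w : JetTan EM EG k) :
    SmoothField (𝓘(ℝ, JetTan EM EG k).prod 𝓘(ℝ, EM)) 𝓘(ℝ, EG)
      (fun q : JetTan EM EG k × M => Γ.one q.2) (fun q => Γ.polyField a q.1 q.2) (w, x) := by
  have h1 : SmoothNear (𝓘(ℝ, JetTan EM EG k).prod 𝓘(ℝ, EM)) 𝓘(ℝ, EG)
      (fun q : JetTan EM EG k × M => Γ.one q.2) (w, x) :=
    (Γ.contMDiff_one.smoothNear x).comp_of_eq smoothNear_snd rfl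
  refine (smoothField_iff (b := fun q : JetTan EM EG k × M => Γ.one q.2) hx').2 ⟨h1, ?_⟩
  refine (smoothNear_taylorPoly hx w).congr_of_eventuallyEq ?_
  filter_upwards [h1.tendsto.eventually ((chartAt EG (Γ.one a)).open_source.mem_nhds hx')]
    with q hq
  rw [← extChartAt_source 𝓘(ℝ, EG)] at hq
  exact mderiv_extChartAt_symm_apply hq _

theorem smoothField_slice {E : Type*} [NormedAddCommGroup E] [NormedSpace ℝ E] {W : Type*}
    [TopologicalSpace W] [ChartedSpace E W] [IsManifold 𝓘(ℝ, E) ∞ W]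
    {Θ : W × M → EG} {w : W} {x : M}
    (h : SmoothField (𝓘(ℝ, E).prod 𝓘(ℝ, EM)) 𝓘(ℝ, EG) (fun q : W × M => Γ.one q.2) Θ (w, x)) :
    SmoothField 𝓘(ℝ, EM) 𝓘(ℝ, EG) Γ.one (fun z => Θ (w, z)) x :=
  SmoothField.comp (b := fun q : W × M => Γ.one q.2) (V := Θ) (c := fun z => (w, z)) h smoothNear_mk_left

theorem algCoeffs_polyField {a x : M} (hx : x ∈ (chartAt EM a).source)
    (hx' : Γ.one x ∈ (chartAt EG (Γ.one a)).source) {θ : M → EG}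
    (hθ : SmoothField 𝓘(ℝ, EM) 𝓘(ℝ, EG) Γ.one θ x)
    (hv : ∀ᶠ z in 𝓝 x, mderiv 𝓘(ℝ, EG) 𝓘(ℝ, EM) Γ.src (Γ.one z) (θ z) = 0) :
    (Γ.algCoeffs k a (fun z => Γ.vertPart z (Γ.polyField a
      ((extChartAt 𝓘(ℝ, EM) a x, Γ.algCoeffs k a (fun z => θ z) x) : JetTan EM EG k) z)) x :
        JetCoeff EM EG k) = Γ.algCoeffs k a (fun z => θ z) x := by
  set w : JetTan EM EG k := (extChartAt 𝓘(ℝ, EM) a x, Γ.algCoeffs k a (fun z => θ z) x) with hw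
  have hV := smoothField_slice (smoothField_polyField (Γ := Γ) hx hx' w)
  have hV' : SmoothField 𝓘(ℝ, EM) 𝓘(ℝ, EG) Γ.one (fun z => Γ.vertPart z (Γ.polyField a w z)) x :=
    SmoothField.vertPart (b := fun z => z) hV
  have hxe : x ∈ (extChartAt 𝓘(ℝ, EM) a).source := by rwa [extChartAt_source]
  have e1 : (Γ.algCoeffs k a (fun z => Γ.polyField a w z) x : JetCoeff EM EG k) =
      Γ.algCoeffs k a (fun z => θ z) x := by
    funext i
    have e2 : Γ.algForm a (fun z => Γ.polyField a w z) =ᶠ[𝓝 (extChartAt 𝓘(ℝ, EM) a x)]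
        taylorPoly w.2 w.1 := by
      have hs := smoothNear_extChartAt_symm (I := 𝓘(ℝ, EM))
        ((extChartAt 𝓘(ℝ, EM) a).map_source hxe)
      have h1 := (hs.tendsto_of_eq ((extChartAt 𝓘(ℝ, EM) a).left_inv hxe)).eventually
        ((Γ.contMDiff_one.smoothNear x).tendsto.eventually
          ((chartAt EG (Γ.one a)).open_source.mem_nhds hx'))
      filter_upwards [h1, (isOpen_extChartAt_target (I := 𝓘(ℝ, EM)) a).mem_nhds
        ((extChartAt 𝓘(ℝ, EM) a).map_source hxe)] with e he he'
      rw [← extChartAt_source 𝓘(ℝ, EG)] at he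
      refine (mderiv_extChartAt_symm_apply he _).trans ?_
      rw [(extChartAt 𝓘(ℝ, EM) a).right_inv he']
    rw [algCoeffs_apply, (e2.iteratedFDeriv ℝ (i : ℕ)).self_of_nhds]
    refine iteratedFDeriv_taylorPoly w.2 _ (fun j σ v => ?_) i
    exact iteratedFDeriv_comp_perm ((smoothNear_algForm hθ hx hx').contDiffAt.of_le
      (by exact_mod_cast le_top)) σ v
  rw [algCoeffs_eq_iff hV hθ hx hx'] at e1
  rw [algCoeffs_eq_iff hV' hθ hx hx']
  refine (e1.vertPart hx').congr' ?_ (EventuallyEq.refl _ _)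
  filter_upwards [hv] with z hz
  rw [vertPart_sub, vertPart_of_vertical hz]

theorem IsCheckSection.smoothNear_coeffs {a : M → CheckJet EM EG k} {U : Set M}
    (ha : Γ.IsCheckSection a U) {x₀ : M} (hx₀ : x₀ ∈ U) :
    SmoothNear 𝓘(ℝ, EM) 𝓘(ℝ, JetCoeff EM EG k)
      (fun x => Γ.algCoeffs k x₀ (Γ.algRep x (a x).2) x) x₀ := by
  filter_upwards [eventually_mem_charts (Γ := Γ) x₀, ha.isOpen.mem_nhds hx₀] with x₁ hx₁ hxU
  have hB := ha.smooth_snd x₁ hxU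
  set B : M → JetCoeff EM EG k := fun x => Γ.algCoeffs k x₁ (Γ.algRep x (a x).2) x with hBdef
  set w : M → JetTan EM EG k := fun x => (extChartAt 𝓘(ℝ, EM) x₁ x, B x) with hwdef
  have hw : ContMDiffAt 𝓘(ℝ, EM) 𝓘(ℝ, JetTan EM EG k) ∞ w x₁ :=
    (smoothNear_extChartAt (mem_extChartAt_source x₁)).contMDiffAt.prodMk_space hB
  have h1 : SmoothField (𝓘(ℝ, JetTan EM EG k).prod 𝓘(ℝ, EM)) 𝓘(ℝ, EG)
      (fun q : JetTan EM EG k × M => Γ.one q.2)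
      (fun q => Γ.vertPart q.2 (Γ.polyField x₁ q.1 q.2)) (w x₁, x₁) :=
    SmoothField.vertPart (b := fun q : JetTan EM EG k × M => q.2)
      (smoothField_polyField (mem_chart_source _ _) (mem_chart_source _ _) (w x₁))
  have h2 := (contDiffAt_algCoeffs_family (k := k) h1 hx₁.1 hx₁.2).contMDiffAt
  have h3 := ContMDiffAt.comp (g := fun q : JetTan EM EG k × M => (Γ.algCoeffs k x₀
      (fun z => Γ.vertPart z (Γ.polyField x₁ q.1 z)) q.2 : JetCoeff EM EG k))
      (f := fun x => (w x, x)) x₁ h2 (hw.prodMk contMDiffAt_id)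
  refine h3.congr_of_eventuallyEq ?_
  filter_upwards [eventually_mem_charts (Γ := Γ) x₁, ha.isOpen.mem_nhds hxU,
    (chartAt EM x₀).open_source.mem_nhds hx₁.1, (Γ.contMDiff_one.smoothNear x₁).tendsto.eventually
      ((chartAt EG (Γ.one x₀)).open_source.mem_nhds hx₁.2)] with x g1 g2 g3 g4
  obtain ⟨r1, r2, -⟩ := algRep_spec (ha.mem x g2)
  have hV : SmoothField 𝓘(ℝ, EM) 𝓘(ℝ, EG) Γ.one
      (fun z => Γ.vertPart z (Γ.polyField x₁ (w x) z)) x :=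
    SmoothField.vertPart (b := fun z => z)
      (smoothField_slice (smoothField_polyField (Γ := Γ) g1.1 g1.2 (w x)))
  exact (algCoeffs_congr_chart hV r1 g1.1 g1.2 g3 g4 (algCoeffs_polyField g1.1 g1.2 r1 r2)).symm

theorem IsCheckSection.exists_fields {a : M → CheckJet EM EG k} {U : Set M}
    (ha : Γ.IsCheckSection a U) {x₀ : M} (hx₀ : x₀ ∈ U) :
    ∃ Θ : M × M → EG, SmoothField (𝓘(ℝ, EM).prod 𝓘(ℝ, EM)) 𝓘(ℝ, EG)
        (fun q : M × M => Γ.one q.2) Θ (x₀, x₀) ∧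
      (∀ q, mderiv 𝓘(ℝ, EG) 𝓘(ℝ, EM) Γ.src (Γ.one q.2) (Θ q) = 0) ∧
      ∀ᶠ x in 𝓝 x₀, Γ.algJet k (fun z => Θ (x, z)) x = (a x).2 := by
  have hA := ha.smoothNear_coeffs hx₀
  set w : M → JetTan EM EG k := fun x =>
    (extChartAt 𝓘(ℝ, EM) x₀ x, Γ.algCoeffs k x₀ (Γ.algRep x (a x).2) x) with hwdef
  have hw : SmoothNear 𝓘(ℝ, EM) 𝓘(ℝ, JetTan EM EG k) w x₀ := by
    filter_upwards [hA, smoothNear_extChartAt (I := 𝓘(ℝ, EM)) (mem_extChartAt_source x₀)]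
      with x h1 h2 using h2.prodMk_space h1
  have h1 : SmoothField (𝓘(ℝ, JetTan EM EG k).prod 𝓘(ℝ, EM)) 𝓘(ℝ, EG)
      (fun q : JetTan EM EG k × M => Γ.one q.2)
      (fun q => Γ.vertPart q.2 (Γ.polyField x₀ q.1 q.2)) (w x₀, x₀) :=
    SmoothField.vertPart (b := fun q : JetTan EM EG k × M => q.2)
      (smoothField_polyField (mem_chart_source _ _) (mem_chart_source _ _) (w x₀))
  refine ⟨fun q => Γ.vertPart q.2 (Γ.polyField x₀ (w q.1) q.2), ?_,
    fun q => mderiv_src_vertPart _ _, ?_⟩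
  · exact h1.comp (c := fun q : M × M => (w q.1, q.2)) (n := (x₀, x₀))
      ((hw.comp_of_eq smoothNear_fst rfl).prodMk smoothNear_snd)
  · filter_upwards [eventually_mem_charts (Γ := Γ) x₀, ha.isOpen.mem_nhds hx₀] with x g1 g2
    obtain ⟨r1, r2, r3⟩ := algRep_spec (ha.mem x g2)
    have hV : SmoothField 𝓘(ℝ, EM) 𝓘(ℝ, EG) Γ.one
        (fun z => Γ.vertPart z (Γ.polyField x₀ (w x) z)) x :=
      SmoothField.vertPart (b := fun z => z)
        (smoothField_slice (smoothField_polyField (Γ := Γ) g1.1 g1.2 (w x)))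
    exact (algCoeffs_congr_chart hV r1 g1.1 g1.2 (mem_chart_source _ _) (mem_chart_source _ _)
      (algCoeffs_polyField g1.1 g1.2 r1 r2)).trans r3

end Polynomial

theorem exists_isInvariantField {v : M → EM} {Θ : M × M → EG} {x₀ : M}
    (hv : SmoothField 𝓘(ℝ, EM) 𝓘(ℝ, EM) (fun x => x) v x₀)
    (hΘ : SmoothField (𝓘(ℝ, EM).prod 𝓘(ℝ, EM)) 𝓘(ℝ, EG) (fun q : M × M => Γ.one q.2) Θ (x₀, x₀))
    (hs : ∀ q, mderiv 𝓘(ℝ, EG) 𝓘(ℝ, EM) Γ.src (Γ.one q.2) (Θ q) = 0) :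
    ∃ (Ω : Set (M × G)) (ζ : M × G → EM × EG), Γ.IsInvariantField Ω ζ ∧ (x₀, Γ.one x₀) ∈ Ω ∧
      ∀ x y, (x, Γ.one y) ∈ Ω → ζ (x, Γ.one y) = (v x, Θ (x, y)) := by
  set D : Set (M × M) := {p | SmoothField (𝓘(ℝ, EM).prod 𝓘(ℝ, EM)) 𝓘(ℝ, EG)
    (fun q : M × M => Γ.one q.2) Θ p} ∩ {p | SmoothField 𝓘(ℝ, EM) 𝓘(ℝ, EM) (fun x => x) v p.1}
    with hD
  have hDo : IsOpen D := by
    refine isOpen_iff_mem_nhds.2 fun p hp => ?_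
    exact Filter.inter_mem hp.1.eventually
      ((continuous_fst.tendsto p).eventually hp.2.eventually)
  have key : ∀ {x : M} {X : G}, (x, Γ.tgt X) ∈ D → ∃ K : ℝ × (M × G) → G,
      SmoothNear (𝓘(ℝ, ℝ).prod (𝓘(ℝ, EM).prod 𝓘(ℝ, EG))) 𝓘(ℝ, EG) K (0, (x, X)) ∧
      (∀ᶠ p in 𝓝 ((0 : ℝ), (x, X)), Γ.src (K p) = Γ.tgt p.2.2) ∧
      ∀ᶠ q in 𝓝 (x, X), K (0, q) = Γ.one (Γ.tgt q.2) ∧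
        (∀ᶠ u in 𝓝 (0 : ℝ), Γ.src (K (u, q)) = Γ.tgt q.2) ∧
        mderiv 𝓘(ℝ, ℝ) 𝓘(ℝ, EG) (fun u => K (u, q)) 0 1 = Θ (q.1, Γ.tgt q.2) := by
    intro x X hX
    obtain ⟨K, hK, hK0, hKs⟩ := exists_vertical_flow (Γ := Γ) hX.1 (Eventually.of_forall hs)
    have hc : SmoothNear (𝓘(ℝ, EM).prod 𝓘(ℝ, EG)) (𝓘(ℝ, EM).prod 𝓘(ℝ, EM))
        (fun q : M × G => (q.1, Γ.tgt q.2)) (x, X) :=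
      smoothNear_fst.prodMk ((Γ.contMDiff_tgt.smoothNear X).comp_of_eq smoothNear_snd rfl)
    refine ⟨fun p => K (p.1, (p.2.1, Γ.tgt p.2.2)), hK.comp_of_eq
      (f := fun p : ℝ × (M × G) => (p.1, (p.2.1, Γ.tgt p.2.2)))
      (smoothNear_fst.prodMk (hc.comp_of_eq smoothNear_snd rfl)) rfl, ?_⟩
    have h1 := hc.tendsto.eventually hK0
    have hc' : SmoothNear (𝓘(ℝ, ℝ).prod (𝓘(ℝ, EM).prod 𝓘(ℝ, EG)))
        (𝓘(ℝ, ℝ).prod (𝓘(ℝ, EM).prod 𝓘(ℝ, EM)))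
        (fun p : ℝ × (M × G) => (p.1, (p.2.1, Γ.tgt p.2.2))) (0, (x, X)) :=
      smoothNear_fst.prodMk (hc.comp_of_eq smoothNear_snd rfl)
    have h2 : ∀ᶠ p in 𝓝 ((0 : ℝ), (x, X)),
        Γ.src (K (p.1, (p.2.1, Γ.tgt p.2.2))) = Γ.tgt p.2.2 :=
      (hc'.tendsto.eventually hKs).mono fun p hp => hp.trans (Γ.src_one _)
    refine ⟨h2, ?_⟩
    filter_upwards [h1, tendsto_mk_left.eventually h2.eventually_nhds] with q g1 g2
    refine ⟨g1.1, ?_, g1.2⟩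
    have h3 : Tendsto (fun u : ℝ => (u, q)) (𝓝 0) (𝓝 (0, q)) :=
      (continuous_id.prodMk continuous_const).tendsto (0 : ℝ)
    exact h3.eventually g2
  set ζ : M × G → EM × EG := fun q =>
    (v q.1, Γ.rightTranslate (Γ.one (Γ.tgt q.2)) q.2 (Θ (q.1, Γ.tgt q.2))) with hζ
  have hmul : ∀ {x : M} {X Y : G} {K : ℝ × (M × G) → G},
      SmoothNear (𝓘(ℝ, ℝ).prod (𝓘(ℝ, EM).prod 𝓘(ℝ, EG))) 𝓘(ℝ, EG) K (0, (x, X)) →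
      (∀ᶠ u in 𝓝 (0 : ℝ), Γ.src (K (u, (x, X))) = Γ.tgt Y) →
      SmoothNear 𝓘(ℝ, ℝ) 𝓘(ℝ, EG) (fun u => Γ.mul (K (u, (x, X))) Y) 0 := fun hK h =>
    Γ.smoothNear_mul hK.slice_left smoothNear_const h
  have hζK : ∀ {x : M} {X : G} {K : ℝ × (M × G) → G},
      SmoothNear (𝓘(ℝ, ℝ).prod (𝓘(ℝ, EM).prod 𝓘(ℝ, EG))) 𝓘(ℝ, EG) K (0, (x, X)) →
      K (0, (x, X)) = Γ.one (Γ.tgt X) →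
      (∀ᶠ u in 𝓝 (0 : ℝ), Γ.src (K (u, (x, X))) = Γ.tgt X) →
        mderiv 𝓘(ℝ, ℝ) 𝓘(ℝ, EG) (fun u => K (u, (x, X))) 0 1 = Θ (x, Γ.tgt X) →
      (ζ (x, X)).2 = mderiv 𝓘(ℝ, ℝ) 𝓘(ℝ, EG) (fun u => Γ.mul (K (u, (x, X))) X) 0 1 :=
    fun hK h0 h1 h2 => rightTranslate_eq hK.slice_left.mdifferentiableAt h0 h2 h1
  refine ⟨{q | (q.1, Γ.tgt q.2) ∈ D}, ζ, ⟨?_, ?_, ?_, ?_, ?_, ?_⟩, ?_, ?_⟩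
  · exact hDo.preimage (continuous_fst.prodMk
      ((Γ.contMDiff_tgt.continuous).comp continuous_snd))
  · intro a X Y hX hXY
    show (a, Γ.tgt (Γ.mul X Y)) ∈ D
    rw [Γ.tgt_mul _ _ hXY]
    exact hX
  · rintro ⟨x, X⟩ hX
    obtain ⟨K, hK, hKs, hK0⟩ := key hX
    have hm : SmoothNear (𝓘(ℝ, ℝ).prod (𝓘(ℝ, EM).prod 𝓘(ℝ, EG))) 𝓘(ℝ, EG)
        (fun p : ℝ × (M × G) => Γ.mul (K p) p.2.2) (0, (x, X)) :=
      Γ.smoothNear_mul hK (smoothNear_snd.comp_of_eq smoothNear_snd rfl) hKs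
    have hL := (smoothField_of_flow hm).congr (b' := fun q : M × G => q.2)
      (V' := fun q => (ζ q).2) (by
        filter_upwards [hK0] with q g
        rw [g.1, Γ.one_mul]) (by
        filter_upwards [hK0, tendsto_mk_left.eventually hK.eventually] with q g g'
        exact (hζK g' g.1 g.2.1 g.2.2).symm)
    have hv' : SmoothField (𝓘(ℝ, EM).prod 𝓘(ℝ, EG)) 𝓘(ℝ, EM) (fun q : M × G => q.1)
        (fun q => (ζ q).1) (x, X) :=
      SmoothField.comp (b := fun x => x) (V := v) (c := fun q : M × G => q.1) (n := (x, X))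
        hX.2 smoothNear_fst
    exact (hv'.prodMk hL).contMDiffAt.contMDiffWithinAt
  · intro a X X' _ _
    rfl
  · rintro ⟨x, X⟩ hX
    obtain ⟨K, hK, hKs, hK0⟩ := key hX
    obtain ⟨h0, h1, h2⟩ := hK0.self_of_nhds
    have hm := hmul hK h1
    have e1 := hζK hK h0 h1 h2
    have e2 := mderiv_comp_apply (g := Γ.src) (f := fun u => Γ.mul (K (u, (x, X))) X) (y := X)
      (Γ.contMDiff_src.smoothNear _).mdifferentiableAt hm.mdifferentiableAt
      (by rw [h0, Γ.one_mul]) (1 : ℝ)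
    have e3 : (fun u => Γ.src (Γ.mul (K (u, (x, X))) X)) =ᶠ[𝓝 0] fun _ => Γ.src X := by
      filter_upwards [h1] with u hu using Γ.src_mul _ _ hu
    rw [mderiv_congr e3, mderiv_const, ← e1] at e2
    exact e2.symm
  · intro a X Y hX hXY
    obtain ⟨K, hK, hKs, hK0⟩ := key hX
    obtain ⟨h0, h1, h2⟩ := hK0.self_of_nhds
    have hm := hmul hK h1
    have htXY := Γ.tgt_mul _ _ hXY
    have e1 := rightTranslate_eq (Γ := Γ) (X := X) (Y := Y) hm.mdifferentiableAt
      (by rw [h0, Γ.one_mul]) (hζK hK h0 h1 h2).symm (by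
        filter_upwards [h1] with u hu
        rw [Γ.src_mul _ _ hu, hXY])
    refine Eq.trans ?_ e1.symm
    have e2 := rightTranslate_eq (Γ := Γ) (Y := Γ.mul X Y) hK.slice_left.mdifferentiableAt h0 h2
      (h1.mono fun u hu => hu.trans htXY.symm)
    have e3 : (fun u => Γ.mul (Γ.mul (K (u, (a, X))) X) Y) =ᶠ[𝓝 0]
        fun u => Γ.mul (K (u, (a, X))) (Γ.mul X Y) := by
      filter_upwards [h1] with u hu using (Γ.mul_assoc _ _ _ hu hXY).symm
    rw [mderiv_congr e3, ← e2]
    show (Γ.rightTranslate (Γ.one (Γ.tgt (Γ.mul X Y))) (Γ.mul X Y) (Θ (a, Γ.tgt (Γ.mul X Y))) : EG) = _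
    rw [htXY]
  · show (x₀, Γ.tgt (Γ.one x₀)) ∈ D
    rw [Γ.tgt_one]
    exact ⟨hΘ, hv⟩
  · intro x y hxy
    obtain ⟨K, hK, hKs, hK0⟩ := key hxy
    obtain ⟨h0, h1, h2⟩ := hK0.self_of_nhds
    refine Prod.ext rfl ((hζK hK h0 h1 h2).trans ?_)
    have e3 : (fun u => Γ.mul (K (u, (x, Γ.one y))) (Γ.one y)) =ᶠ[𝓝 0]
        fun u => K (u, (x, Γ.one y)) := by
      filter_upwards [h1] with u hu
      exact mul_one_of_eq (hu.trans (Γ.tgt_one y))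
    rw [mderiv_congr e3, h2]
    show Θ (x, Γ.tgt (Γ.one y)) = _
    rw [Γ.tgt_one]

theorem IsCheckSection.exists_isInvariantField [CompleteSpace EM] [CompleteSpace EG] {a : M → CheckJet EM EG k}
    {U : Set M} (ha : Γ.IsCheckSection a U) {x₀ : M} (hx₀ : x₀ ∈ U) :
    ∃ (Ω : Set (M × G)) (ζ : M × G → EM × EG), Γ.IsInvariantField Ω ζ ∧ (x₀, Γ.one x₀) ∈ Ω ∧
      ∀ᶠ x in 𝓝 x₀, Γ.upsilon k ζ x = a x := by
  obtain ⟨Θ, hΘ, hΘs, hΘa⟩ := ha.exists_fields hx₀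
  have hv : SmoothField 𝓘(ℝ, EM) 𝓘(ℝ, EM) (fun x => x) (fun x => (a x).1) x₀ := by
    filter_upwards [ha.isOpen.mem_nhds hx₀] with x hx
    exact ha.smooth_fst.contMDiffAt (ha.isOpen.mem_nhds hx)
  obtain ⟨Ω, ζ, hζ, hxΩ, h⟩ := LieGroupoid.exists_isInvariantField hv hΘ hΘs
  refine ⟨Ω, ζ, hζ, hxΩ, ?_⟩
  have h1 := hζ.eventually_one_mem hxΩ
  have h2 : Tendsto (fun x : M => (x, x)) (𝓝 x₀) (𝓝 (x₀, x₀)) :=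
    (continuous_id.prodMk continuous_id).tendsto x₀
  filter_upwards [hΘa, h2.eventually h1.eventually_nhds] with x g1 g2
  refine Prod.ext (show (ζ (x, Γ.one x)).1 = (a x).1 by rw [h x x g2.self_of_nhds]) (Eq.trans ?_ g1)
  refine algJet_congr (θ := fun y => (ζ (x, Γ.one y)).2) ?_
  filter_upwards [tendsto_mk_left.eventually g2] with y hy
  exact congrArg Prod.snd (h x y hy)

end LieGroupoid

namespace LieGroupoid

variable {EM EG M G : Type*}
  [NormedAddCommGroup EM] [NormedSpace ℝ EM] [NormedAddCommGroup EG] [NormedSpace ℝ EG]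
  [TopologicalSpace M] [ChartedSpace EM M] [TopologicalSpace G] [ChartedSpace EG G]
  {Γ : LieGroupoid EM EG M G} {k : ℕ}
  [IsManifold 𝓘(ℝ, EM) ∞ M] [IsManifold 𝓘(ℝ, EG) ∞ G] [CompleteSpace EM] [CompleteSpace EG]
  {S : M → PreJet EM EG M G k} {x₀ : M}

theorem smoothNear_jetChart (hS : ∀ᶠ x in 𝓝 x₀, Γ.SmoothJetMapAt S x)
    (hpt : ∀ᶠ x in 𝓝 x₀, (S x).pt = x) :
    SmoothNear 𝓘(ℝ, EM) 𝓘(ℝ, JetTan EM EG k) (fun x => Γ.jetChart (S x₀) (S x)) x₀ := by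
  have h0 := hS.self_of_nhds
  have hp0 := hpt.self_of_nhds
  have hval := h0.2.2.1.eventually ((chartAt EG (S x₀).val).open_source.mem_nhds
    (mem_chart_source _ _))
  filter_upwards [hS, hpt.eventually_nhds, hval.eventually_nhds,
    ((chartAt EM x₀).open_source.mem_nhds (mem_chart_source _ _))] with x₁ h1 h2 h3 h4
  have hp1 : (S x₁).pt = x₁ := h2.self_of_nhds
  obtain ⟨Φ, hΦ, hΦ0, hΦq⟩ := exists_jet_family h1.1.self_of_nhds
  have hw : ContMDiffAt 𝓘(ℝ, EM) 𝓘(ℝ, JetTan EM EG k) ∞ (fun x => Γ.jetChart (S x₁) (S x)) x₁ :=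
    h1.2.2.2
  have hΦs := hΦ.smooth
  rw [hp1] at hΦs hΦ0
  have h5 := contDiffAt_famCoeffs (k := k) (x₀ := x₀) (Z₀ := (S x₀).val) hΦs.contMDiffAt h4
    (by rw [hΦ0]; exact h3.self_of_nhds)
  have hφ : ContMDiffAt 𝓘(ℝ, EM) 𝓘(ℝ, EM) ∞ (extChartAt 𝓘(ℝ, EM) x₀) x₁ :=
    (smoothNear_extChartAt (by rwa [extChartAt_source])).contMDiffAt
  have h6 := ContDiffAt.comp_contMDiffAt
    (f := fun x => (Γ.jetChart (S x₁) (S x), extChartAt 𝓘(ℝ, EM) x₀ x)) (x := x₁) h5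
    (hw.prodMk_space hφ)
  refine (hφ.prodMk_space h6).congr_of_eventuallyEq ?_
  filter_upwards [h1.tendsto.eventually hΦq, h2, h3,
    ((chartAt EM x₀).open_source.mem_nhds h4)] with x g1 g2 g3 g4
  obtain ⟨⟨g, hg⟩, hj⟩ := g1
  rw [g2] at hg hj
  have hv : Φ (Γ.jetChart (S x₁) (S x), x) = (S x).val := congrArg PreJet.val hj
  have e := jetChart_jet (k := k) hg (p₀ := S x₀) (by rw [hp0]; exact g4)
    (show Φ (Γ.jetChart (S x₁) (S x), x) ∈ _ by rw [hv]; exact g3)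
  rw [hj, hp0] at e
  exact e

theorem exists_isLocalFamily (hS : ∀ᶠ x in 𝓝 x₀, Γ.SmoothJetMapAt S x)
    (hpt : ∀ᶠ x in 𝓝 x₀, (S x).pt = x) : ∃ T : M × M → G, Γ.IsLocalFamily S T x₀ := by
  have h0 := hS.self_of_nhds
  have hp0 : (S x₀).pt = x₀ := hpt.self_of_nhds
  obtain ⟨Φ, hΦ, hΦ0, hΦq⟩ := exists_jet_family h0.1.self_of_nhds
  have hw := smoothNear_jetChart hS hpt
  obtain ⟨hs1, hs2, -⟩ := hΦ
  rw [hp0] at hs1 hs2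
  have hc : SmoothNear (𝓘(ℝ, EM).prod 𝓘(ℝ, EM)) (𝓘(ℝ, JetTan EM EG k).prod 𝓘(ℝ, EM))
      (fun q : M × M => (Γ.jetChart (S x₀) (S q.1), q.2)) (x₀, x₀) :=
    (hw.comp_of_eq smoothNear_fst rfl).prodMk smoothNear_snd
  refine ⟨fun q => Φ (Γ.jetChart (S x₀) (S q.1), q.2), hs1.comp_of_eq hc rfl,
    hc.tendsto.eventually hs2, ?_, ?_⟩
  · filter_upwards [h0.tendsto.eventually hΦq, hpt] with x h1 h2
    obtain ⟨⟨g, hg⟩, -⟩ := h1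
    rw [h2] at hg
    exact ⟨g, hg⟩
  · filter_upwards [h0.tendsto.eventually hΦq, hpt] with x h1 h2
    have h3 := h1.2
    rw [h2] at h3
    exact h3.symm

theorem IsJetBisection.exists_isLocalFamily {f : OpenPartialHomeomorph M M}
    (h : Γ.IsJetBisection S f) (hx₀ : x₀ ∈ f.source) : ∃ T : M × M → G, Γ.IsLocalFamily S T x₀ :=
  LieGroupoid.exists_isLocalFamily
    (Filter.mem_of_superset (f.open_source.mem_nhds hx₀) fun x hx => h.smooth x hx)
    (Filter.mem_of_superset (f.open_source.mem_nhds hx₀) fun x hx => h.pt_eq x hx)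

/-- A smooth family of bisections of `G` over a local diffeomorphism `f` defines a right invariant
diffeomorphism of `M × G`. -/
theorem exists_isAdmissible {T : M × M → G} {f : OpenPartialHomeomorph M M}
    (hT : SmoothNear (𝓘(ℝ, EM).prod 𝓘(ℝ, EM)) 𝓘(ℝ, EG) T (x₀, x₀))
    (hs : ∀ᶠ q in 𝓝 (x₀, x₀), Γ.src (T q) = q.2) {g : M → M}
    (hg : Γ.IsBisectionGerm (fun z => T (x₀, z)) g x₀)
    (hf : ContMDiffOn 𝓘(ℝ, EM) 𝓘(ℝ, EM) ∞ f.symm f.target) (hx₀ : x₀ ∈ f.source)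
    (hTf : ∀ᶠ x in 𝓝 x₀, Γ.tgt (T (x, x)) = f x) :
    ∃ (σ : OpenPartialHomeomorph (M × G) (M × G)) (f₁ : OpenPartialHomeomorph M M),
      Γ.IsAdmissible σ f₁ ∧ x₀ ∈ f₁.source ∧ (f₁ : M → M) = f ∧
      (∀ y, f₁.symm y = f.symm y) ∧ f₁.source ⊆ f.source ∧
      ∀ x y, (x, Γ.one y) ∈ σ.source → (σ (x, Γ.one y)).2 = T (x, y) := by
  have hT0 : Γ.tgt (T (x₀, x₀)) = f x₀ := hTf.self_of_nhds
  obtain ⟨γ, hγ, hγ1, hγ2, -⟩ := IsBisectionGerm.exists_family (p := (x₀, x₀)) hT hs hg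
  set A : Set (M × M) := {q | ∀ᶠ q in 𝓝 q, ContMDiffAt (𝓘(ℝ, EM).prod 𝓘(ℝ, EM)) 𝓘(ℝ, EG) ∞ T q ∧
    Γ.src (T q) = q.2 ∧ γ (q.1, Γ.tgt (T q)) = q.2} with hA
  set B : Set (M × M) := {q | ∀ᶠ q in 𝓝 q, ContMDiffAt (𝓘(ℝ, EM).prod 𝓘(ℝ, EM)) 𝓘(ℝ, EM) ∞ γ q ∧
    Γ.tgt (T (q.1, γ q)) = q.2} with hB
  have hAo : IsOpen A := isOpen_setOfPred_eventually_nhds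
  have hBo : IsOpen B := isOpen_setOfPred_eventually_nhds
  have hAp : ∀ q ∈ A, SmoothNear (𝓘(ℝ, EM).prod 𝓘(ℝ, EM)) 𝓘(ℝ, EG) T q ∧ Γ.src (T q) = q.2 ∧
      γ (q.1, Γ.tgt (T q)) = q.2 := fun q hq =>
    ⟨hq.mono fun _ h => h.1, hq.self_of_nhds.2⟩
  have hBp : ∀ q ∈ B, SmoothNear (𝓘(ℝ, EM).prod 𝓘(ℝ, EM)) 𝓘(ℝ, EM) γ q ∧
      Γ.tgt (T (q.1, γ q)) = q.2 := fun q hq =>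
    ⟨hq.mono fun _ h => h.1, hq.self_of_nhds.2⟩
  have hA0 : (x₀, x₀) ∈ A := by filter_upwards [hT, hs, hγ1] with q h1 h2 h3 using ⟨h1, h2, h3⟩
  have hB0 : (x₀, f x₀) ∈ B := by
    rw [← hT0]; filter_upwards [hγ, hγ2] with q h1 h2 using ⟨h1, h2⟩
  have hτ : ∀ q ∈ A, SmoothNear (𝓘(ℝ, EM).prod 𝓘(ℝ, EM)) (𝓘(ℝ, EM).prod 𝓘(ℝ, EM))
      (fun q : M × M => (q.1, Γ.tgt (T q))) q := fun q hq =>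
    smoothNear_fst.prodMk ((Γ.contMDiff_tgt.smoothNear _).comp (hAp q hq).1)
  have hρ : ∀ q ∈ B, SmoothNear (𝓘(ℝ, EM).prod 𝓘(ℝ, EM)) (𝓘(ℝ, EM).prod 𝓘(ℝ, EM))
      (fun q : M × M => (q.1, γ q)) q := fun q hq =>
    smoothNear_fst.prodMk (hBp q hq).1
  set D : Set (M × M) := {q | q ∈ A ∧ (q.1, Γ.tgt (T q)) ∈ B} with hD
  set E : Set (M × M) := {q | q ∈ B ∧ (q.1, γ q) ∈ A} with hE
  have hDo : IsOpen D := by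
    refine isOpen_iff_mem_nhds.2 fun q hq => ?_
    exact Filter.inter_mem (hAo.mem_nhds hq.1)
      ((hτ q hq.1).tendsto.eventually (hBo.mem_nhds hq.2))
  have hEo : IsOpen E := by
    refine isOpen_iff_mem_nhds.2 fun q hq => ?_
    exact Filter.inter_mem (hBo.mem_nhds hq.1)
      ((hρ q hq.1).tendsto.eventually (hAo.mem_nhds hq.2))
  set U : Set M := {x | ∀ᶠ x in 𝓝 x, x ∈ f.source ∧ (x, x) ∈ D ∧ Γ.tgt (T (x, x)) = f x} with hU
  have hUo : IsOpen U := isOpen_setOfPred_eventually_nhds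
  have hUp : ∀ x ∈ U, x ∈ f.source ∧ (x, x) ∈ D ∧ Γ.tgt (T (x, x)) = f x :=
    fun x hx => hx.self_of_nhds
  have hU0 : x₀ ∈ U := by
    have h1 : Tendsto (fun x : M => (x, x)) (𝓝 x₀) (𝓝 (x₀, x₀)) :=
      (continuous_id.prodMk continuous_id).tendsto x₀
    filter_upwards [f.open_source.mem_nhds hx₀, hTf, h1.eventually (hDo.mem_nhds
      (show (x₀, x₀) ∈ D from ⟨hA0, by rw [hT0]; exact hB0⟩))] with x h1 h2 h3 using ⟨h1, h3, h2⟩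
  have hfU : ∀ x ∈ U, SmoothNear 𝓘(ℝ, EM) 𝓘(ℝ, EM) f x := fun x hx => by
    have h1 : SmoothNear 𝓘(ℝ, EM) 𝓘(ℝ, EM) (fun x => Γ.tgt (T (x, x))) x :=
      (Γ.contMDiff_tgt.smoothNear _).comp (SmoothNear.comp (f := fun x : M => (x, x))
        (hAp _ (hUp x hx).2.1.1).1 (smoothNear_id.prodMk smoothNear_id))
    refine h1.congr_of_eventuallyEq ?_
    filter_upwards [hUo.mem_nhds hx] with z hz using (hUp z hz).2.2.symm
  set toF : M × G → M × G := fun q => (f q.1, Γ.mul (T (q.1, Γ.tgt q.2)) q.2) with htoF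
  set invF : M × G → M × G := fun q =>
    (f.symm q.1, Γ.mul (Γ.inv (T (f.symm q.1, γ (f.symm q.1, Γ.tgt q.2)))) q.2) with hinvF
  set s : Set (M × G) := {q | q.1 ∈ U ∧ (q.1, Γ.tgt q.2) ∈ D} with hsdef
  set t : Set (M × G) := {q | q.1 ∈ f.target ∧ f.symm q.1 ∈ U ∧ (f.symm q.1, Γ.tgt q.2) ∈ E}
    with htdef
  have hc1 : ∀ q : M × G, SmoothNear (𝓘(ℝ, EM).prod 𝓘(ℝ, EG)) (𝓘(ℝ, EM).prod 𝓘(ℝ, EM))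
      (fun q : M × G => (q.1, Γ.tgt q.2)) q := fun q =>
    smoothNear_fst.prodMk ((Γ.contMDiff_tgt.smoothNear _).comp smoothNear_snd)
  have hc2 : ∀ q : M × G, q.1 ∈ f.target → SmoothNear (𝓘(ℝ, EM).prod 𝓘(ℝ, EG))
      (𝓘(ℝ, EM).prod 𝓘(ℝ, EM)) (fun q : M × G => (f.symm q.1, Γ.tgt q.2)) q := fun q hq =>
    ((hf.smoothNear (f.open_target.mem_nhds hq)).comp smoothNear_fst).prodMk
      ((Γ.contMDiff_tgt.smoothNear _).comp smoothNear_snd)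
  have hso : IsOpen s := (hUo.preimage continuous_fst).inter
    (hDo.preimage (continuous_fst.prodMk (Γ.contMDiff_tgt.continuous.comp continuous_snd)))
  have hto : IsOpen t := by
    refine isOpen_iff_mem_nhds.2 fun q hq => ?_
    filter_upwards [(continuous_fst.tendsto q).eventually (f.open_target.mem_nhds hq.1),
      (continuous_fst.tendsto q).eventually
        ((f.continuousAt_symm hq.1).eventually (hUo.mem_nhds hq.2.1)),
      (hc2 q hq.1).tendsto.eventually (hEo.mem_nhds hq.2.2)] with p h1 h2 h3 using ⟨h1, h2, h3⟩
  have htoFs : ∀ q ∈ s, SmoothNear (𝓘(ℝ, EM).prod 𝓘(ℝ, EG)) (𝓘(ℝ, EM).prod 𝓘(ℝ, EG)) toF q := by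
    intro q hq
    refine ((hfU q.1 hq.1).comp smoothNear_fst).prodMk
      (Γ.smoothNear_mul ((hAp _ hq.2.1).1.comp_of_eq (hc1 q) rfl) smoothNear_snd ?_)
    filter_upwards [hso.mem_nhds hq] with p hp using (hAp _ hp.2.1).2.1
  have hinvFs : ∀ q ∈ t, SmoothNear (𝓘(ℝ, EM).prod 𝓘(ℝ, EG)) (𝓘(ℝ, EM).prod 𝓘(ℝ, EG)) invF q := by
    intro q hq
    have h1 := (hf.smoothNear (f.open_target.mem_nhds hq.1)).comp_of_eq
      (smoothNear_fst (I := 𝓘(ℝ, EM)) (I' := 𝓘(ℝ, EG)) (x := q)) rfl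
    have h2 : SmoothNear (𝓘(ℝ, EM).prod 𝓘(ℝ, EG)) (𝓘(ℝ, EM).prod 𝓘(ℝ, EM))
        (fun q : M × G => (f.symm q.1, γ (f.symm q.1, Γ.tgt q.2))) q :=
      (hρ _ hq.2.2.1).comp_of_eq (hc2 q hq.1) rfl
    refine h1.prodMk (Γ.smoothNear_mul ((Γ.contMDiff_inv.smoothNear _).comp
      ((hAp _ hq.2.2.2).1.comp_of_eq h2 rfl)) smoothNear_snd ?_)
    filter_upwards [hto.mem_nhds hq] with p hp
    rw [Γ.src_inv]
    exact (hBp _ hp.2.2.1).2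
  have hmaps : ∀ q ∈ s, toF q ∈ t ∧ invF (toF q) = q := by
    rintro ⟨x, Y⟩ ⟨h1, h2⟩
    have h3 := hUp x h1
    have h4 := hAp _ h2.1
    have h5 : f.symm (f x) = x := f.left_inv h3.1
    have h6 : Γ.tgt (Γ.mul (T (x, Γ.tgt Y)) Y) = Γ.tgt (T (x, Γ.tgt Y)) := Γ.tgt_mul _ _ h4.2.1
    have h7 : γ (x, Γ.tgt (T (x, Γ.tgt Y))) = Γ.tgt Y := h4.2.2
    refine ⟨⟨f.map_source h3.1, ?_, ?_⟩, ?_⟩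
    · show f.symm (f x) ∈ U
      rwa [h5]
    · show (f.symm (f x), Γ.tgt (Γ.mul (T (x, Γ.tgt Y)) Y)) ∈ E
      rw [h5, h6]
      refine ⟨h2.2, ?_⟩
      show (x, γ (x, Γ.tgt (T (x, Γ.tgt Y)))) ∈ A
      rw [h7]
      exact h2.1
    · show (f.symm (f x), Γ.mul (Γ.inv (T (f.symm (f x), γ (f.symm (f x),
        Γ.tgt (Γ.mul (T (x, Γ.tgt Y)) Y))))) (Γ.mul (T (x, Γ.tgt Y)) Y)) = (x, Y)
      rw [h5, h6, h7, Γ.mul_assoc _ _ _ (Γ.src_inv _) h4.2.1, Γ.inv_mul, h4.2.1, Γ.one_mul]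
  have hmaps' : ∀ q ∈ t, invF q ∈ s ∧ toF (invF q) = q := by
    rintro ⟨b, Z⟩ ⟨h1, h2, h3⟩
    set a := f.symm b with ha
    have h4 : f a = b := f.right_inv h1
    have h5 : Γ.tgt (T (a, γ (a, Γ.tgt Z))) = Γ.tgt Z := (hBp _ h3.1).2
    have h6 : Γ.src (T (a, γ (a, Γ.tgt Z))) = γ (a, Γ.tgt Z) := (hAp _ h3.2).2.1
    have h7 : Γ.tgt (Γ.mul (Γ.inv (T (a, γ (a, Γ.tgt Z)))) Z) = γ (a, Γ.tgt Z) := by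
      rw [Γ.tgt_mul _ _ ((Γ.src_inv _).trans h5), Γ.tgt_inv, h6]
    refine ⟨⟨h2, ?_⟩, ?_⟩
    · show (a, Γ.tgt (Γ.mul (Γ.inv (T (a, γ (a, Γ.tgt Z)))) Z)) ∈ D
      rw [h7]
      refine ⟨h3.2, ?_⟩
      show (a, Γ.tgt (T (a, γ (a, Γ.tgt Z)))) ∈ B
      rw [h5]
      exact h3.1
    · show (f a, Γ.mul (T (a, Γ.tgt (Γ.mul (Γ.inv (T (a, γ (a, Γ.tgt Z)))) Z)))
        (Γ.mul (Γ.inv (T (a, γ (a, Γ.tgt Z)))) Z)) = (b, Z)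
      rw [h7, h4, mul_inv_cancel_left' h5]
  let σ : OpenPartialHomeomorph (M × G) (M × G) :=
    { toFun := toF
      invFun := invF
      source := s
      target := t
      map_source' := fun q hq => (hmaps q hq).1
      map_target' := fun q hq => (hmaps' q hq).1
      left_inv' := fun q hq => (hmaps q hq).2
      right_inv' := fun q hq => (hmaps' q hq).2
      open_source := hso
      open_target := hto
      continuousOn_toFun := fun q hq => (htoFs q hq).continuousAt.continuousWithinAt
      continuousOn_invFun := fun q hq => (hinvFs q hq).continuousAt.continuousWithinAt }
  have hf₁ : (f.restrOpen U hUo).source = f.source ∩ U := rfl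
  refine ⟨σ, f.restrOpen U hUo, ⟨?_, ?_, ?_, ?_, ?_, ?_, ?_, ?_, ?_, ?_, ?_⟩, ⟨hx₀, hU0⟩, rfl,
    fun _ => rfl, inter_subset_left, ?_⟩
  · exact fun q hq => (htoFs q hq).contMDiffAt.contMDiffWithinAt
  · exact fun q hq => (hinvFs q hq).contMDiffAt.contMDiffWithinAt
  · exact fun x hx => (hfU x hx.2).contMDiffAt.contMDiffWithinAt
  · exact hf.mono fun y hy => hy.1
  · intro a X Y hX hXY
    refine ⟨hX.1, ?_⟩
    show (a, Γ.tgt (Γ.mul X Y)) ∈ D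
    rw [Γ.tgt_mul _ _ hXY]
    exact hX.2
  · intro a X hX
    exact Γ.src_mul _ _ (hAp _ hX.2.1).2.1
  · intro a X Y hX hXY
    show (f a, Γ.mul (T (a, Γ.tgt (Γ.mul X Y))) (Γ.mul X Y)) =
      (f a, Γ.mul (Γ.mul (T (a, Γ.tgt X)) X) Y)
    rw [Γ.tgt_mul _ _ hXY, Γ.mul_assoc _ _ _ (hAp _ hX.2.1).2.1 hXY]
  · exact fun q hq => ⟨(hUp _ hq.1).1, hq.1⟩
  · exact fun q hq => rfl
  · intro x hx
    refine ⟨hx.2, ?_⟩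
    show (x, Γ.tgt (Γ.one x)) ∈ D
    rw [Γ.tgt_one]
    exact (hUp x hx.2).2.1
  · rintro _ ⟨q, ⟨hq, X, rfl⟩, rfl⟩
    refine ⟨Γ.mul (T (Γ.tgt X, Γ.tgt X)) X, ?_⟩
    show (Γ.tgt (Γ.mul (T (Γ.tgt X, Γ.tgt X)) X), Γ.mul (T (Γ.tgt X, Γ.tgt X)) X) =
      (f (Γ.tgt X), Γ.mul (T (Γ.tgt X, Γ.tgt X)) X)
    rw [Γ.tgt_mul _ _ (hAp _ hq.2.1).2.1, (hUp _ hq.1).2.2]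
  · intro x y hxy
    have h1 : (x, Γ.tgt (Γ.one y)) ∈ D := hxy.2
    rw [Γ.tgt_one] at h1
    show Γ.mul (T (x, Γ.tgt (Γ.one y))) (Γ.one y) = _
    rw [Γ.tgt_one]
    exact mul_one_of_eq (hAp _ h1.1).2.1

theorem IsJetBisection.exists_isAdmissible {f : OpenPartialHomeomorph M M}
    (h : Γ.IsJetBisection S f) (hx₀ : x₀ ∈ f.source) :
    ∃ (σ : OpenPartialHomeomorph (M × G) (M × G)) (f₁ : OpenPartialHomeomorph M M),
      Γ.IsAdmissible σ f₁ ∧ x₀ ∈ f₁.source ∧ (f₁ : M → M) = f ∧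
      (∀ y, f₁.symm y = f.symm y) ∧ f₁.source ⊆ f.source ∧ S =ᶠ[𝓝 x₀] Γ.sigmaJet k σ := by
  obtain ⟨T, hT⟩ := h.exists_isLocalFamily hx₀
  obtain ⟨g, hg⟩ := hT.germ.self_of_nhds
  obtain ⟨σ, f₁, hσ, h1, h2, h3, h4, h5⟩ := LieGroupoid.exists_isAdmissible hT.smooth hT.src_eq hg
    h.smooth_symm hx₀ (by
      filter_upwards [hT.jet_eq, f.open_source.mem_nhds hx₀] with x h1 h2
      rw [← h.tgt_eq x h2, h1]
      rfl)
  refine ⟨σ, f₁, hσ, h1, h2, h3, h4, ?_⟩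
  have hd : Tendsto (fun x : M => (x, x)) (𝓝 x₀) (𝓝 (x₀, x₀)) :=
    (continuous_id.prodMk continuous_id).tendsto x₀
  filter_upwards [hT.jet_eq, hd.eventually
    (hσ.eventually_mem_source (hσ.diagonal x₀ h1)).eventually_nhds] with x g1 g2
  rw [g1]
  refine jet_congr ?_
  filter_upwards [tendsto_mk_left.eventually g2] with y hy using (h5 x y hy).symm

end LieGroupoid

namespace LieGroupoid

variable {EM EG M G : Type*}
  [NormedAddCommGroup EM] [NormedSpace ℝ EM] [NormedAddCommGroup EG] [NormedSpace ℝ EG]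
  [TopologicalSpace M] [ChartedSpace EM M] [TopologicalSpace G] [ChartedSpace EG G]
  {Γ : LieGroupoid EM EG M G} {k : ℕ}
  [IsManifold 𝓘(ℝ, EM) ∞ M] [IsManifold 𝓘(ℝ, EG) ∞ G]

theorem upsilon_congr [CompleteSpace EM] [CompleteSpace EG] {ζ ζ' : M × G → EM × EG} {x : M} (h : ζ =ᶠ[𝓝 (x, Γ.one x)] ζ') :
    (Γ.upsilon k ζ x : CheckJet EM EG k) = Γ.upsilon k ζ' x := by
  have h1 : Tendsto (fun y => (x, Γ.one y)) (𝓝 x) (𝓝 (x, Γ.one x)) :=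
    tendsto_mk_left.comp (Γ.contMDiff_one.continuous.tendsto x)
  refine Prod.ext (show (ζ (x, Γ.one x)).1 = (ζ' (x, Γ.one x)).1 by rw [h.self_of_nhds]) ?_
  exact algJet_congr (θ := fun y => (ζ (x, Γ.one y)).2) (θ' := fun y => (ζ' (x, Γ.one y)).2)
    ((h1.eventually h).mono fun y hy => congrArg Prod.snd hy)

theorem isCheckSection_of_locally {a : M → CheckJet EM EG k} {U : Set M} (hU : IsOpen U)
    (h : ∀ x ∈ U, ∃ (V : Set M) (b : M → CheckJet EM EG k), x ∈ V ∧ Γ.IsCheckSection b V ∧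
      a =ᶠ[𝓝 x] b) : Γ.IsCheckSection a U where
  isOpen := hU
  smooth_fst := fun x hx => by
    obtain ⟨V, b, hxV, hb, hab⟩ := h x hx
    refine ((hb.smooth_fst.contMDiffAt (hb.isOpen.mem_nhds hxV)).congr_of_eventuallyEq
      ?_).contMDiffWithinAt
    filter_upwards [hab] with z hz
    rw [hz]
  mem := fun x hx => by
    obtain ⟨V, b, hxV, hb, hab⟩ := h x hx
    rw [hab.self_of_nhds]
    exact hb.mem x hxV
  smooth_snd := fun x hx => by
    obtain ⟨V, b, hxV, hb, hab⟩ := h x hx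
    refine (hb.smooth_snd x hxV).congr_of_eventuallyEq ?_
    filter_upwards [hab] with z hz
    rw [hz]

variable {σ σ' : OpenPartialHomeomorph (M × G) (M × G)} {f f' : OpenPartialHomeomorph M M}
  {Ω : Set (M × G)} {ζ : M × G → EM × EG} {x : M}

theorem IsAdmissible.one_mem_pushField (h : Γ.IsAdmissible σ f) (hζ : Γ.IsInvariantField Ω ζ)
    (hx : x ∈ f.source) (hxΩ : (x, Γ.one x) ∈ Ω) :
    (f x, Γ.one (f x)) ∈ σ.target ∩ σ.symm ⁻¹' Ω := by
  have h1 : σ (x, Γ.one x) = (f x, (σ (x, Γ.one x)).2) :=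
    Prod.ext (h.projectable _ (h.diagonal x hx)) rfl
  have h2 : (f x, (σ (x, Γ.one x)).2) ∈ σ.target ∩ σ.symm ⁻¹' Ω := by
    rw [← h1]
    refine ⟨σ.map_source (h.diagonal x hx), ?_⟩
    rw [mem_preimage, σ.left_inv (h.diagonal x hx)]
    exact hxΩ
  have h3 := (h.pushField_isInvariantField hζ).stable.mem_one_iff.2 h2
  rwa [h.tgt_phi hx] at h3

theorem IsAdmissible.apply_one_mem_source (h : Γ.IsAdmissible σ f) (h' : Γ.IsAdmissible σ' f')
    (hx : x ∈ f.source) (hfx : f x ∈ f'.source) : σ (x, Γ.one x) ∈ σ'.source := by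
  have h1 : σ (x, Γ.one x) = (f x, (σ (x, Γ.one x)).2) :=
    Prod.ext (h.projectable _ (h.diagonal x hx)) rfl
  rw [h1, ← h'.stable.mem_one_iff, h.tgt_phi hx]
  exact h'.diagonal _ hfx

theorem IsAdmissible.sigmaJet_trans (h : Γ.IsAdmissible σ f) (h' : Γ.IsAdmissible σ' f')
    (hx : x ∈ f.source) (hfx : f x ∈ f'.source) (k : ℕ) :
    Γ.sigmaJet k (σ.trans σ') x = Γ.jetMul (Γ.sigmaJet k σ' (f x)) (Γ.sigmaJet k σ x) := by
  have hF := h.isBisectionGerm hx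
  have hH := h'.isBisectionGerm hfx
  have hb : f x = Γ.tgt (σ (x, Γ.one x)).2 := (h.tgt_phi hx).symm
  have e1 := jetMul_jet (k := k) hF (H := fun z => (σ' (f x, Γ.one z)).2)
    (h := fun y => Γ.tgt (σ'.symm (f' (f x), Γ.one y)).2) (by rw [← hb]; exact hH)
  have e2 : Γ.sigmaJet k σ' (f x) =
      jet k (fun z => (σ' (f x, Γ.one z)).2) (Γ.tgt (σ (x, Γ.one x)).2) := by
    rw [← hb]; rfl
  rw [e2]
  refine Eq.trans ?_ e1.symm
  refine jet_congr ?_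
  have h1 : Tendsto (fun y => (x, Γ.one y)) (𝓝 x) (𝓝 (x, Γ.one x)) :=
    tendsto_mk_left.comp (Γ.contMDiff_one.continuous.tendsto x)
  filter_upwards [h1.eventually (σ.open_source.mem_nhds (h.diagonal x hx)),
    (h1.eventually ((σ.continuousAt (h.diagonal x hx)).eventually
      (σ'.open_source.mem_nhds (h.apply_one_mem_source h' hx hfx))))] with z g1 g2
  have g3 : σ (x, Γ.one z) = (f x, (σ (x, Γ.one z)).2) := Prod.ext (h.projectable _ g1) rfl
  show (σ' (σ (x, Γ.one z))).2 = _
  rw [g3] at g2 ⊢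
  exact congrArg Prod.snd (h'.apply_eq g2)

theorem pushField_refl :
    (LieGroupoid.pushField (OpenPartialHomeomorph.refl (M × G)) ζ : M × G → EM × EG) = ζ := by
  funext q
  refine (pushField_apply (σ := OpenPartialHomeomorph.refl (M × G)) q).trans ?_
  have e : (OpenPartialHomeomorph.refl (M × G) : M × G → M × G) = fun z => z := rfl
  rw [e, mderiv_id]
  rfl

theorem IsAdmissible.pushField_trans (h : Γ.IsAdmissible σ f) (h' : Γ.IsAdmissible σ' f')
    {q : M × G} (hq : q ∈ (σ.trans σ').target) :
    (LieGroupoid.pushField (σ.trans σ') ζ q : EM × EG) =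
      LieGroupoid.pushField σ' (LieGroupoid.pushField σ ζ) q := by
  rw [OpenPartialHomeomorph.trans_target] at hq
  have h1 : σ.symm (σ'.symm q) ∈ σ.source := σ.map_target hq.2
  exact mderiv_comp_apply (g := σ') (f := σ) (y := σ'.symm q)
    (h'.smoothNear (σ'.map_target hq.1)).mdifferentiableAt
    (h.smoothNear h1).mdifferentiableAt (σ.right_inv hq.2) _

variable [CompleteSpace EM] [CompleteSpace EG]

theorem isJetBisection_of_locally {S : M → PreJet EM EG M G k}
    (hf : ContMDiffOn 𝓘(ℝ, EM) 𝓘(ℝ, EM) ∞ f.symm f.target)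
    (h : ∀ x ∈ f.source, ∃ (σ : OpenPartialHomeomorph (M × G) (M × G))
      (f₁ : OpenPartialHomeomorph M M), Γ.IsAdmissible σ f₁ ∧ x ∈ f₁.source ∧ f₁ x = f x ∧
      S =ᶠ[𝓝 x] Γ.sigmaJet k σ) : Γ.IsJetBisection S f where
  smooth := fun x hx => by
    obtain ⟨σ, f₁, hσ, hx1, -, hS⟩ := h x hx
    exact ((hσ.isLocalFamily hx1 k).congr hS).smoothJetMapAt
  pt_eq := fun x hx => by
    obtain ⟨σ, f₁, hσ, hx1, -, hS⟩ := h x hx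
    rw [hS.self_of_nhds]
    rfl
  tgt_eq := fun x hx => by
    obtain ⟨σ, f₁, hσ, hx1, hfx, hS⟩ := h x hx
    rw [hS.self_of_nhds, ← hfx]
    exact hσ.tgt_phi hx1
  smooth_symm := hf

theorem IsJetBisection.proj {S : M → PreJet EM EG M G (k + 1)} (h : Γ.IsJetBisection S f) :
    Γ.IsJetBisection (fun z => (S z).proj) f :=
  isJetBisection_of_locally h.smooth_symm fun x hx => by
    obtain ⟨σ, f₁, hσ, hx1, hff, -, -, hS⟩ := h.exists_isAdmissible hx
    exact ⟨σ, f₁, hσ, hx1, congrFun hff x, hS.mono fun z hz => congrArg PreJet.proj hz⟩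

theorem isJetBisection_jetOne :
    Γ.IsJetBisection (Γ.jetOne k) (OpenPartialHomeomorph.refl M) :=
  IsAdmissible.refl.isJetBisection k

theorem IsJetBisection.mul {S S' : M → PreJet EM EG M G k} (h : Γ.IsJetBisection S f)
    (h' : Γ.IsJetBisection S' f') :
    Γ.IsJetBisection (fun x => Γ.jetMul (S' (f x)) (S x)) (f.trans f') := by
  refine isJetBisection_of_locally ?_ fun x hx => ?_
  · refine h.smooth_symm.comp (h'.smooth_symm.mono ?_) ?_
    · rw [OpenPartialHomeomorph.trans_target]; exact inter_subset_left
    · rw [OpenPartialHomeomorph.trans_target]; exact fun y hy => hy.2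
  · rw [OpenPartialHomeomorph.trans_source] at hx
    obtain ⟨σ, f₁, hσ, hx1, hff, -, -, hS⟩ := h.exists_isAdmissible hx.1
    obtain ⟨σ', f₁', hσ', hx1', hff', -, -, hS'⟩ := h'.exists_isAdmissible hx.2
    have hfx : f₁ x ∈ f₁'.source := by rw [hff]; exact hx1'
    refine ⟨σ.trans σ', f₁.trans f₁', hσ.trans hσ', by
      rw [OpenPartialHomeomorph.trans_source]; exact ⟨hx1, hfx⟩, ?_, ?_⟩
    · show f₁' (f₁ x) = f' (f x)
      rw [hff, hff']
    · have hc : Tendsto f (𝓝 x) (𝓝 (f x)) := f.continuousAt hx.1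
      filter_upwards [hS, hc.eventually hS', f₁.open_source.mem_nhds hx1,
        hc.eventually (f₁'.open_source.mem_nhds hx1')] with z g1 g2 g3 g4
      rw [g1, g2, hσ.sigmaJet_trans hσ' g3 (by rw [hff]; exact g4), hff]

section Action

variable {S : M → PreJet EM EG M G (k + 1)} {a : M → CheckJet EM EG k}

theorem act_eventuallyEq (h : Γ.IsAdmissible σ f') (hx : x ∈ f'.source) (hxf : x ∈ f.source)
    (hff : (f' : M → M) = f) (hS : S =ᶠ[𝓝 x] Γ.sigmaJet (k + 1) σ) (hζ : Γ.IsInvariantField Ω ζ)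
    (hxΩ : (x, Γ.one x) ∈ Ω) (ha : ∀ᶠ z in 𝓝 x, Γ.upsilon k ζ z = a z) :
    Γ.act S f a =ᶠ[𝓝 (f x)] Γ.upsilon k (LieGroupoid.pushField σ ζ) := by
  have hc : Tendsto f.symm (𝓝 (f x)) (𝓝 x) := by
    have h1 := f.continuousAt_symm (f.map_source hxf)
    rwa [ContinuousAt, f.left_inv hxf] at h1
  have hd : Tendsto (fun z => (z, Γ.one z)) (𝓝 x) (𝓝 (x, Γ.one x)) :=
    (continuous_id.prodMk Γ.contMDiff_one.continuous).tendsto x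
  have key : ∀ᶠ z in 𝓝 x, Γ.act S f a (f z) = Γ.upsilon k (LieGroupoid.pushField σ ζ) (f z) := by
    filter_upwards [f'.open_source.mem_nhds hx, f.open_source.mem_nhds hxf, hS.eventually_nhds,
      hd.eventually (hζ.isOpen.mem_nhds hxΩ), ha] with z g1 g2 g3 g4 g5
    have h1 := act_eq_upsilon_pushField h g1 hζ g4 g3 (f' := f) (Eventually.of_forall fun _ => by rw [hff])
      (by rw [hff]; exact f.left_inv g2) (a := a) g5.symm
    rwa [hff] at h1
  filter_upwards [hc.eventually key, f.open_target.mem_nhds (f.map_source hxf)] with y g1 g2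
  rwa [f.right_inv g2] at g1

theorem IsJetBisection.act_isCheckSection (h : Γ.IsJetBisection S f) {U : Set M}
    (hU : U ⊆ f.source) (ha : Γ.IsCheckSection a U) : Γ.IsCheckSection (Γ.act S f a) (f '' U) := by
  refine isCheckSection_of_locally (f.isOpen_image_of_subset_source ha.isOpen hU) ?_
  rintro _ ⟨x, hx, rfl⟩
  obtain ⟨Ω, ζ, hζ, hxΩ, haζ⟩ := ha.exists_isInvariantField hx
  obtain ⟨σ, f₁, hσ, hx1, hff, -, -, hS⟩ := h.exists_isAdmissible (hU hx)
  have hp := hσ.pushField_isInvariantField hζ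
  have hm := hσ.one_mem_pushField hζ hx1 hxΩ
  rw [hff] at hm
  have hd : Continuous (fun z => (z, Γ.one z)) :=
    continuous_id.prodMk Γ.contMDiff_one.continuous
  exact ⟨_, _, hm, hp.isCheckSection k (hp.isOpen.preimage hd) fun _ hz => hz,
    act_eventuallyEq hσ hx1 (hU hx) hff hS hζ hxΩ haζ⟩

theorem act_jetOne {U : Set M} (ha : Γ.IsCheckSection a U) (hx : x ∈ U) :
    Γ.act (Γ.jetOne (k + 1)) (OpenPartialHomeomorph.refl M) a x = a x := by
  obtain ⟨Ω, ζ, hζ, hxΩ, haζ⟩ := ha.exists_isInvariantField hx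
  have h1 := act_eventuallyEq (Γ := Γ) (S := Γ.jetOne (k + 1)) (f := OpenPartialHomeomorph.refl M)
    IsAdmissible.refl (mem_univ x)
    (mem_univ x) rfl (Eventually.of_forall fun _ => rfl) hζ hxΩ haζ
  refine h1.self_of_nhds.trans ?_
  rw [pushField_refl]
  exact haζ.self_of_nhds

theorem IsJetBisection.act_mul {S' : M → PreJet EM EG M G (k + 1)} (h : Γ.IsJetBisection S f)
    (h' : Γ.IsJetBisection S' f') {U : Set M} (ha : Γ.IsCheckSection a U) (hx : x ∈ U)
    (hxf : x ∈ f.source) (hxf' : f x ∈ f'.source) :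
    Γ.act (fun z => Γ.jetMul (S' (f z)) (S z)) (f.trans f') a (f' (f x)) =
      Γ.act S' f' (Γ.act S f a) (f' (f x)) := by
  obtain ⟨Ω, ζ, hζ, hxΩ, haζ⟩ := ha.exists_isInvariantField hx
  obtain ⟨σ, f₁, hσ, hx1, hff, -, -, hS⟩ := h.exists_isAdmissible hxf
  obtain ⟨σ', f₁', hσ', hx1', hff', -, -, hS'⟩ := h'.exists_isAdmissible hxf'
  have hfx : f₁ x ∈ f₁'.source := by rw [hff]; exact hx1'
  have hSS : (fun z => Γ.jetMul (S' (f z)) (S z)) =ᶠ[𝓝 x] Γ.sigmaJet (k + 1) (σ.trans σ') := by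
    have hc : Tendsto f (𝓝 x) (𝓝 (f x)) := f.continuousAt hxf
    filter_upwards [hS, hc.eventually hS', f₁.open_source.mem_nhds hx1,
      hc.eventually (f₁'.open_source.mem_nhds hx1')] with z g1 g2 g3 g4
    rw [g1, g2, hσ.sigmaJet_trans hσ' g3 (by rw [hff]; exact g4), hff]
  have hx2 : x ∈ (f₁.trans f₁').source := by
    rw [OpenPartialHomeomorph.trans_source]; exact ⟨hx1, hfx⟩
  have e1 := (act_eventuallyEq (f := f.trans f') (hσ.trans hσ') hx2 (by
      rw [OpenPartialHomeomorph.trans_source]; exact ⟨hxf, hxf'⟩)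
    (by funext z; show f₁' (f₁ z) = f' (f z); rw [hff, hff']) hSS hζ hxΩ haζ).self_of_nhds
  have e2 := act_eventuallyEq hσ hx1 hxf hff hS hζ hxΩ haζ
  have hp := hσ.pushField_isInvariantField hζ
  have hm := hσ.one_mem_pushField hζ hx1 hxΩ
  rw [hff] at hm
  have e3 := (act_eventuallyEq hσ' hx1' hxf' hff' hS' hp hm (e2.mono fun _ hz => hz.symm)).self_of_nhds
  refine e1.trans (Eq.trans ?_ e3.symm)
  refine upsilon_congr ?_
  have hm' := (hσ.trans hσ').one_mem_pushField hζ hx2 hxΩ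
  have hm2 : (f' (f x), Γ.one (f' (f x))) ∈ (σ.trans σ').target := by
    have h2 : (f₁.trans f₁') x = f' (f x) := by show f₁' (f₁ x) = f' (f x); rw [hff, hff']
    rw [h2] at hm'
    exact hm'.1
  filter_upwards [(σ.trans σ').open_target.mem_nhds hm2] with q hq
  exact hσ.pushField_trans hσ' hq

end Action

end LieGroupoid

theorem minSmoothness_two_le : minSmoothness ℝ 2 ≤ (∞ : ℕ∞ω) := by
  rw [minSmoothness_of_isRCLikeNormedField]
  exact WithTop.coe_le_coe.2 (le_top : (2 : ℕ∞) ≤ ⊤)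

section Bracket

variable {E H N : Type*} [NormedAddCommGroup E] [NormedSpace ℝ E] [TopologicalSpace H]
  [TopologicalSpace N] [ChartedSpace H N]
  {E' H' N' : Type*} [NormedAddCommGroup E'] [NormedSpace ℝ E'] [TopologicalSpace H']
  [TopologicalSpace N'] [ChartedSpace H' N']
  {I : ModelWithCorners ℝ E H} {I' : ModelWithCorners ℝ E' H'}

/-- The bracket of vector fields, with values in the model space. -/
def vbracket (I : ModelWithCorners ℝ E H) (V W : N → E) (x : N) : E :=
  VectorField.mlieBracket I V W x

/-- The expression of the vector field `V` in the preferred chart at `a`. -/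
def chartField (I : ModelWithCorners ℝ E H) (a : N) (V : N → E) (e : E) : E :=
  mderiv I 𝓘(ℝ, E) (extChartAt I a) ((extChartAt I a).symm e) (V ((extChartAt I a).symm e))

theorem vbracket_congr {V V' W W' : N → E} {x : N} (hV : V =ᶠ[𝓝 x] V') (hW : W =ᶠ[𝓝 x] W') :
    vbracket I V W x = vbracket I V' W' x :=
  Filter.EventuallyEq.mlieBracket_vectorField_eq (V := V') (W := W') (V₁ := V) (W₁ := W) hV hW

variable [I.Boundaryless] [I'.Boundaryless] [IsManifold I ∞ N] [IsManifold I' ∞ N']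

theorem SmoothField.smoothNear_chartField {V : N → E} {a z : N}
    (hV : SmoothField I I (fun x => x) V z) (hz : z ∈ (chartAt H a).source) :
    SmoothNear 𝓘(ℝ, E) 𝓘(ℝ, E) (chartField I a V) (extChartAt I a z) := by
  have hz' : z ∈ (extChartAt I a).source := by rwa [extChartAt_source]
  exact ((smoothField_iff (b := fun x => x) (V := V) hz).1 hV).2.comp_of_eq
    (smoothNear_extChartAt_symm ((extChartAt I a).map_source hz'))
    ((extChartAt I a).left_inv hz')

theorem chartField_extChartAt {V : N → E} {a z : N} (hz : z ∈ (chartAt H a).source) :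
    chartField I a V (extChartAt I a z) = mderiv I 𝓘(ℝ, E) (extChartAt I a) z (V z) := by
  unfold chartField
  rw [(extChartAt I a).left_inv (by rwa [extChartAt_source])]

variable [CompleteSpace E] [CompleteSpace E']

theorem mderiv_extChartAt_vbracket {V W : N → E} {a z : N}
    (hV : SmoothField I I (fun x => x) V z) (hW : SmoothField I I (fun x => x) W z)
    (hz : z ∈ (chartAt H a).source) :
    mderiv I 𝓘(ℝ, E) (extChartAt I a) z (vbracket I V W z) =
      VectorField.lieBracket ℝ (chartField I a V) (chartField I a W) (extChartAt I a z) := by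
  have hm2 : IsManifold I (minSmoothness ℝ 2) N := IsManifold.of_le (n := ∞) minSmoothness_two_le
  have hz' : z ∈ (extChartAt I a).source := by rwa [extChartAt_source]
  have hmd : ∀ {V : N → E}, SmoothField I I (fun x => x) V z →
      MDifferentiableAt 𝓘(ℝ, E) 𝓘(ℝ, E).tangent
        (fun e => (⟨e, chartField (E := E) I a V e⟩ : TangentBundle 𝓘(ℝ, E) E)) (extChartAt I a z) := by
    intro V hV
    have h1 : SmoothField 𝓘(ℝ, E) 𝓘(ℝ, E) (fun e => e) (chartField I a V) (extChartAt I a z) := by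
      refine (smoothField_iff (b := fun e : E => e) (Z₀ := extChartAt I a z)
        (mem_chart_source _ _)).2 ⟨smoothNear_id, ?_⟩
      refine (hV.smoothNear_chartField hz).congr_of_eventuallyEq (Eventually.of_forall fun e => ?_)
      have e1 : (extChartAt 𝓘(ℝ, E) (extChartAt I a z) : E → E) = fun z => z := by
        funext; simp only [extChartAt, chartAt_self_eq, mfld_simps]
      show mderiv 𝓘(ℝ, E) 𝓘(ℝ, E) (extChartAt 𝓘(ℝ, E) (extChartAt I a z)) e _ = _
      rw [e1, mderiv_id]
      rfl
    exact (SmoothNear.contMDiffAt h1).mdifferentiableAt (by simp)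
  have hinv : (mderiv I 𝓘(ℝ, E) (extChartAt I a) z).IsInvertible :=
    isInvertible_mfderiv_extChartAt hz'
  have hpull : ∀ V : N → E, (VectorField.mpullback I 𝓘(ℝ, E) (extChartAt I a) (chartField I a V) :
      N → E) =ᶠ[𝓝 z] V := by
    intro V
    filter_upwards [(chartAt H a).open_source.mem_nhds hz] with y hy
    show (mderiv I 𝓘(ℝ, E) (extChartAt I a) y).inverse (chartField I a V (extChartAt I a y)) = V y
    have hy' : y ∈ (extChartAt I a).source := by rwa [extChartAt_source]
    have hi : (mderiv I 𝓘(ℝ, E) (extChartAt I a) y).IsInvertible :=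
      isInvertible_mfderiv_extChartAt hy'
    rw [chartField_extChartAt hy, hi.inverse_apply_eq]
  have key := VectorField.mpullback_mlieBracket (I := I) (I' := 𝓘(ℝ, E)) (f := extChartAt I a)
    (n := ∞) (hmd hV) (hmd hW) (smoothNear_extChartAt hz').contMDiffAt
    minSmoothness_two_le
  have e1 : (mderiv I 𝓘(ℝ, E) (extChartAt I a) z).inverse
      (VectorField.lieBracket ℝ (chartField I a V) (chartField I a W) (extChartAt I a z)) =
      vbracket I V W z := by
    have hc := vbracket_congr (E := E) (I := I) (hpull V) (hpull W)
    refine Eq.trans ?_ (key.trans hc)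
    show _ = (mderiv I 𝓘(ℝ, E) (extChartAt I a) z).inverse _
    congr 1
    have := VectorField.mlieBracketWithin_eq_lieBracketWithin (𝕜 := ℝ) (V := chartField I a V)
      (W := chartField I a W) (s := univ)
    rw [VectorField.lieBracketWithin_univ] at this
    exact (congrFun this _).symm
  exact ((hinv.inverse_apply_eq).1 e1).symm

theorem SmoothField.vbracket {V W : N → E} {x : N} (hV : SmoothField I I (fun x => x) V x)
    (hW : SmoothField I I (fun x => x) W x) : SmoothField I I (fun x => x) (vbracket I V W) x := by
  refine (smoothField_iff (b := fun x => x) (Z₀ := x) (mem_chart_source _ _)).2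
    ⟨smoothNear_id, ?_⟩
  have h1 : SmoothNear 𝓘(ℝ, E) 𝓘(ℝ, E)
      (VectorField.lieBracket ℝ (chartField I x V) (chartField I x W)) (extChartAt I x x) := by
    rw [smoothNear_iff_contDiffAt]
    filter_upwards [smoothNear_iff_contDiffAt.1 (hV.smoothNear_chartField (mem_chart_source H x)),
      smoothNear_iff_contDiffAt.1 (hW.smoothNear_chartField (mem_chart_source H x))] with e h1 h2
    exact h1.lieBracket_vectorField h2 (by simp)
  refine (h1.comp_of_eq (smoothNear_extChartAt (mem_extChartAt_source x)) rfl).congr_of_eventuallyEq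
    ?_
  filter_upwards [hV.eventually, hW.eventually, (chartAt H x).open_source.mem_nhds
    (mem_chart_source H x)] with z h1 h2 h3 using mderiv_extChartAt_vbracket h1 h2 h3

theorem mderiv_vbracket {F : N → N'} {x : N} {V W : N → E} {V' W' : N' → E'}
    (hF : SmoothNear I I' F x) (hV : SmoothField I I (fun x => x) V x)
    (hW : SmoothField I I (fun x => x) W x) (hV' : SmoothField I' I' (fun x => x) V' (F x))
    (hW' : SmoothField I' I' (fun x => x) W' (F x))
    (hVV' : ∀ᶠ z in 𝓝 x, mderiv I I' F z (V z) = V' (F z))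
    (hWW' : ∀ᶠ z in 𝓝 x, mderiv I I' F z (W z) = W' (F z)) :
    mderiv I I' F x (vbracket I V W x) = vbracket I' V' W' (F x) := by
  set φ := extChartAt I x with hφ
  set ψ := extChartAt I' (F x) with hψ
  have hxs : x ∈ φ.source := mem_extChartAt_source x
  have hF0 : φ.symm (φ x) = x := extChartAt_to_inv x
  set f : E → E' := fun e => ψ (F (φ.symm e)) with hf
  have hs := smoothNear_extChartAt_symm (I := I) (mem_extChartAt_target x)
  have hfs : SmoothNear 𝓘(ℝ, E) 𝓘(ℝ, E') f (φ x) :=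
    (smoothNear_extChartAt (mem_extChartAt_source (F x))).comp_of_eq
      (hF.comp_of_eq hs hF0) (by rw [hF0])
  have hfx : f (φ x) = ψ (F x) := by simp only [hf, hF0]
  have hψs := hF.tendsto.eventually
    ((chartAt H' (F x)).open_source.mem_nhds (mem_chart_source H' (F x)))
  have hrel : ∀ {V : N → E} {V' : N' → E'}, (∀ᶠ z in 𝓝 x, mderiv I I' F z (V z) = V' (F z)) →
      ∀ᶠ e in 𝓝 (φ x), fderiv ℝ f e (chartField I x V e) = chartField I' (F x) V' (f e) := by
    intro V V' h
    have h1 := (hs.tendsto_of_eq hF0).eventually (h.and (hF.eventually.and hψs))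
    filter_upwards [h1, (isOpen_extChartAt_target (I := I) x).mem_nhds (mem_extChartAt_target x)]
      with e he het
    obtain ⟨e1, e2, e3⟩ := he
    have e3' : F (φ.symm e) ∈ ψ.source := by rwa [hψ, extChartAt_source]
    have hsrc : φ.symm e ∈ (chartAt H x).source := by
      rw [← extChartAt_source I]; exact φ.map_target het
    have e4 : ∀ v, mderiv I 𝓘(ℝ, E') (fun z => ψ (F z)) (φ.symm e) v =
        fderiv ℝ f e (mderiv I 𝓘(ℝ, E) φ (φ.symm e) v) := by
      intro v
      have e5 : (fun z => ψ (F z)) =ᶠ[𝓝 (φ.symm e)] fun z => f (φ z) := by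
        filter_upwards [(chartAt H x).open_source.mem_nhds hsrc] with z hz
        simp only [hf]
        rw [φ.left_inv (by rwa [hφ, extChartAt_source])]
      have e6 : SmoothNear 𝓘(ℝ, E) 𝓘(ℝ, E') f e :=
        (smoothNear_extChartAt e3').comp_of_eq (e2.comp_of_eq (smoothNear_extChartAt_symm het) rfl) rfl
      rw [mderiv_congr e5, mderiv_comp_apply (g := f) (f := φ) (y := e) e6.mdifferentiableAt
        (smoothNear_extChartAt (φ.map_target het)).mdifferentiableAt (φ.right_inv het),
        mderiv_eq_fderiv]
    have e7 := e4 (V (φ.symm e))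
    rw [mderiv_comp_apply (g := ψ) (f := F) (y := F (φ.symm e))
      (smoothNear_extChartAt e3').mdifferentiableAt e2.mdifferentiableAt rfl, e1] at e7
    refine e7.symm.trans ?_
    exact (chartField_extChartAt (by rwa [hψ, extChartAt_source] at e3')).symm
  have hV1 := (hV.smoothNear_chartField (mem_chart_source H x)).contDiffAt
  have hW1 := (hW.smoothNear_chartField (mem_chart_source H x)).contDiffAt
  have hV2 := (hV'.smoothNear_chartField (mem_chart_source H' (F x))).contDiffAt
  have hW2 := (hW'.smoothNear_chartField (mem_chart_source H' (F x))).contDiffAt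
  have n1 : (∞ : ℕ∞ω) ≠ 0 := by simp
  have main := VectorField.fderiv_apply_lieBracket (𝕜 := ℝ) hfs.contDiffAt
    minSmoothness_two_le (hW1.differentiableAt n1) (hV1.differentiableAt n1)
  have hcomp : ∀ {X : E' → E'}, ContDiffAt ℝ ∞ X (ψ (F x)) → ∀ v,
      fderiv ℝ (fun e => X (f e)) (φ x) v = fderiv ℝ X (ψ (F x)) (fderiv ℝ f (φ x) v) := by
    intro X hX v
    have := fderiv_comp (φ x) (g := X) (f := f) (by rw [hfx]; exact hX.differentiableAt n1)
      (hfs.contDiffAt.differentiableAt n1)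
    rw [hfx] at this
    exact congrArg (fun L : E →L[ℝ] E' => L v) this
  rw [Filter.EventuallyEq.fderiv_eq (hrel hWW'), Filter.EventuallyEq.fderiv_eq (hrel hVV'),
    hcomp hW2, hcomp hV2, (hrel hVV').self_of_nhds, (hrel hWW').self_of_nhds, hfx] at main
  have b1 := mderiv_extChartAt_vbracket hV hW (mem_chart_source H x)
  have b2 := mderiv_extChartAt_vbracket hV' hW' (mem_chart_source H' (F x))
  have hid : ∀ {w w' : E'}, mderiv I' 𝓘(ℝ, E') ψ (F x) w = mderiv I' 𝓘(ℝ, E') ψ (F x) w' →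
      w = w' := by
    intro w w' hw
    have hi : (mderiv I' 𝓘(ℝ, E') ψ (F x)).IsInvertible :=
      isInvertible_mfderiv_extChartAt (mem_extChartAt_source (F x))
    exact hi.injective hw
  apply hid
  rw [b2]
  refine Eq.trans ?_ main
  rw [← b1]
  have e5 : (fun z => ψ (F z)) =ᶠ[𝓝 x] fun z => f (φ z) := by
    filter_upwards [(chartAt H x).open_source.mem_nhds (mem_chart_source H x)] with z hz
    simp only [hf]
    rw [φ.left_inv (by rwa [hφ, extChartAt_source])]
  rw [← mderiv_comp_apply (g := ψ) (f := F) (y := F x)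
      (smoothNear_extChartAt (mem_extChartAt_source (F x))).mdifferentiableAt
      hF.mdifferentiableAt rfl, mderiv_congr e5, mderiv_comp_apply (g := f) (f := φ) (y := φ x)
      hfs.mdifferentiableAt (smoothNear_extChartAt hxs).mdifferentiableAt rfl,
      mderiv_eq_fderiv]

end Bracket

section Bracket

variable {E H N : Type*} [NormedAddCommGroup E] [NormedSpace ℝ E] [TopologicalSpace H]
  [TopologicalSpace N] [ChartedSpace H N] {I : ModelWithCorners ℝ E H}

theorem vbracket_zero (x : N) : vbracket I (fun _ => (0 : E)) (fun _ => 0) x = 0 := by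
  have h := VectorField.mlieBracketWithin_eq_zero_of_eq_zero (I := I) (V := fun _ => (0 : E))
    (W := fun _ => (0 : E)) (s := univ) (x := x) rfl rfl
  exact h

theorem smoothField_zero [IsManifold I ∞ N] (x : N) :
    SmoothField I I (fun z : N => z) (fun _ => (0 : E)) x := by
  refine (smoothField_of_flow (K := fun p : ℝ × N => p.2) (n := x) smoothNear_snd).congr
    (EventuallyEq.refl _ _) (Eventually.of_forall fun z => ?_)
  show mderiv 𝓘(ℝ, ℝ) I (fun _ => z) 0 1 = 0
  rw [mderiv_const]
  rfl

end Bracket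

namespace LieGroupoid

variable {EM EG M G : Type*}
  [NormedAddCommGroup EM] [NormedSpace ℝ EM] [NormedAddCommGroup EG] [NormedSpace ℝ EG]
  [TopologicalSpace M] [ChartedSpace EM M] [TopologicalSpace G] [ChartedSpace EG G]
  {Γ : LieGroupoid EM EG M G} {k : ℕ}
  [IsManifold 𝓘(ℝ, EM) ∞ M] [IsManifold 𝓘(ℝ, EG) ∞ G]
  {σ : OpenPartialHomeomorph (M × G) (M × G)} {f : OpenPartialHomeomorph M M}
  {Ω Ω' : Set (M × G)} {ζ η : M × G → EM × EG}

theorem IsInvariantField.inter (hζ : Γ.IsInvariantField Ω ζ) (hΩ : IsOpen Ω')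
    (hs : Γ.RightStable Ω') : Γ.IsInvariantField (Ω ∩ Ω') ζ where
  isOpen := hζ.isOpen.inter hΩ
  stable := fun a X Y h hXY => ⟨hζ.stable a X Y h.1 hXY, hs a X Y h.2 hXY⟩
  smooth := hζ.smooth.mono inter_subset_left
  projectable := fun a X X' h h' => hζ.projectable a X X' h.1 h'.1
  tangent_fibre := fun q hq => hζ.tangent_fibre q hq.1
  right_invariant := fun a X Y h => hζ.right_invariant a X Y h.1

variable [CompleteSpace EM] [CompleteSpace EG]

theorem IsInvariantField.smoothField_fst_slice (hζ : Γ.IsInvariantField Ω ζ) {a : M} {X : G}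
    (h : (a, X) ∈ Ω) :
    SmoothField 𝓘(ℝ, EM) 𝓘(ℝ, EM) (fun z => z) (fun z => (ζ (z, X)).1) a :=
  (hζ.smoothField_fst h).comp (c := fun z => (z, X)) (n := a)
    (smoothNear_id.prodMk smoothNear_const)

theorem IsInvariantField.fst_vbracket (hζ : Γ.IsInvariantField Ω ζ) (hη : Γ.IsInvariantField Ω η)
    {a : M} {X : G} (h : (a, X) ∈ Ω) :
    (vbracket (𝓘(ℝ, EM).prod 𝓘(ℝ, EG)) ζ η (a, X)).1 =
      vbracket 𝓘(ℝ, EM) (fun z => (ζ (z, X)).1) (fun z => (η (z, X)).1) a := by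
  have hrel : ∀ {ζ : M × G → EM × EG}, Γ.IsInvariantField Ω ζ → ∀ᶠ z in 𝓝 (a, X),
      mderiv (𝓘(ℝ, EM).prod 𝓘(ℝ, EG)) 𝓘(ℝ, EM) Prod.fst z (ζ z) = (ζ (z.1, X)).1 := by
    intro ζ hζ
    have hc : Tendsto (fun z : M × G => (z.1, X)) (𝓝 (a, X)) (𝓝 (a, X)) :=
      (continuous_fst.prodMk continuous_const).tendsto (a, X)
    filter_upwards [hζ.isOpen.mem_nhds h, hc.eventually (hζ.isOpen.mem_nhds h)] with z h1 h2
    rw [mderiv_fst]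
    exact hζ.projectable z.1 z.2 X h1 h2
  have key := mderiv_vbracket (F := Prod.fst) (x := (a, X)) (V := ζ) (W := η)
    (V' := fun z => (ζ (z, X)).1) (W' := fun z => (η (z, X)).1)
    smoothNear_fst (hζ.smoothField h) (hη.smoothField h)
    (hζ.smoothField_fst_slice h) (hη.smoothField_fst_slice h) (hrel hζ) (hrel hη)
  rwa [mderiv_fst] at key

theorem IsInvariantField.src_vbracket (hζ : Γ.IsInvariantField Ω ζ) (hη : Γ.IsInvariantField Ω η)
    {q : M × G} (h : q ∈ Ω) : mderiv 𝓘(ℝ, EG) 𝓘(ℝ, EM) Γ.src q.2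
      (vbracket (𝓘(ℝ, EM).prod 𝓘(ℝ, EG)) ζ η q).2 = 0 := by
  have hF : ∀ z : M × G, ∀ v : EM × EG, mderiv (𝓘(ℝ, EM).prod 𝓘(ℝ, EG)) 𝓘(ℝ, EM)
      (fun z : M × G => Γ.src z.2) z v = mderiv 𝓘(ℝ, EG) 𝓘(ℝ, EM) Γ.src z.2 v.2 := by
    intro z v
    rw [mderiv_comp_apply (g := Γ.src) (f := Prod.snd) (y := z.2)
      (Γ.contMDiff_src.smoothNear z.2).mdifferentiableAt
      (smoothNear_snd (I := 𝓘(ℝ, EM))).mdifferentiableAt rfl, mderiv_snd]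
    rfl
  have hrel : ∀ {ζ : M × G → EM × EG}, Γ.IsInvariantField Ω ζ → ∀ᶠ z in 𝓝 q,
      mderiv (𝓘(ℝ, EM).prod 𝓘(ℝ, EG)) 𝓘(ℝ, EM) (fun z : M × G => Γ.src z.2) z (ζ z) = 0 := by
    intro ζ hζ
    filter_upwards [hζ.isOpen.mem_nhds h] with z h1
    rw [hF]
    exact hζ.vertical h1
  have key := mderiv_vbracket (F := fun z : M × G => Γ.src z.2) (x := q) (V := ζ) (W := η)
    (V' := fun _ => 0) (W' := fun _ => 0)
    ((Γ.contMDiff_src.smoothNear _).comp_of_eq smoothNear_snd rfl) (hζ.smoothField h)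
    (hη.smoothField h) (smoothField_zero _) (smoothField_zero _) (hrel hζ) (hrel hη)
  rwa [hF, vbracket_zero] at key

theorem IsInvariantField.vbracket (hζ : Γ.IsInvariantField Ω ζ) (hη : Γ.IsInvariantField Ω η) :
    Γ.IsInvariantField Ω (vbracket (𝓘(ℝ, EM).prod 𝓘(ℝ, EG)) ζ η) where
  isOpen := hζ.isOpen
  stable := hζ.stable
  smooth := fun q hq => (SmoothNear.contMDiffAt ((hζ.smoothField hq).vbracket
    (hη.smoothField hq))).contMDiffWithinAt
  projectable := fun a X X' h h' => by
    have hrel : ∀ {ζ : M × G → EM × EG}, Γ.IsInvariantField Ω ζ →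
        (fun z => (ζ (z, X)).1) =ᶠ[𝓝 a] fun z => (ζ (z, X')).1 := by
      intro ζ hζ
      have hc : ∀ X : G, Tendsto (fun z : M => (z, X)) (𝓝 a) (𝓝 (a, X)) := fun X =>
        (continuous_id.prodMk continuous_const).tendsto a
      filter_upwards [(hc X).eventually (hζ.isOpen.mem_nhds h),
        (hc X').eventually (hζ.isOpen.mem_nhds h')] with z h1 h2
      exact hζ.projectable z X X' h1 h2
    exact (hζ.fst_vbracket hη h).trans ((vbracket_congr (hrel hζ) (hrel hη)).trans
      (hζ.fst_vbracket hη h').symm)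
  tangent_fibre := fun q hq => hζ.src_vbracket hη hq
  right_invariant := fun a X Y hX hXY => by
    obtain ⟨r, hr, hr1, hr2⟩ := (Γ.submersion_tgt Y).exists_retraction
    set b : M → G := fun z => r (z, Y) with hb
    have hbs : SmoothNear 𝓘(ℝ, EM) 𝓘(ℝ, EG) b (Γ.tgt Y) := hr.slice_left
    have hb0 : b (Γ.src X) = Y := by rw [hXY]; exact hr2.self_of_nhds
    have hbt : ∀ᶠ z in 𝓝 (Γ.tgt Y), Γ.tgt (b z) = z :=
      ((continuous_id.prodMk continuous_const).tendsto (Γ.tgt Y) : Tendsto (fun z : M => (z, Y))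
        (𝓝 (Γ.tgt Y)) (𝓝 (Γ.tgt Y, Y))).eventually hr1
    set h : G → G := fun Z => Γ.mul Z (b (Γ.src Z)) with hh
    have hsX := (Γ.contMDiff_src.smoothNear X).tendsto_of_eq hXY
    have hhs : SmoothNear 𝓘(ℝ, EG) 𝓘(ℝ, EG) h X :=
      Γ.smoothNear_mul smoothNear_id (hbs.comp_of_eq (Γ.contMDiff_src.smoothNear X) hXY)
        ((hsX.eventually hbt).mono fun Z hZ => hZ.symm)
    have hcurve : ∀ {Z : G} {w : EG} {c : ℝ → G}, MDifferentiableAt 𝓘(ℝ, EG) 𝓘(ℝ, EG) h Z →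
        SmoothNear 𝓘(ℝ, ℝ) 𝓘(ℝ, EG) c 0 → c 0 = Z → mderiv 𝓘(ℝ, ℝ) 𝓘(ℝ, EG) c 0 1 = w →
        (∀ᶠ u in 𝓝 0, Γ.src (c u) = Γ.src Z) → mderiv 𝓘(ℝ, EG) 𝓘(ℝ, EG) h Z w =
          mderiv 𝓘(ℝ, ℝ) 𝓘(ℝ, EG) (fun u => Γ.mul (c u) (b (Γ.src Z))) 0 1 := by
      intro Z w c hZ hc hc0 hcw hcs
      rw [← hcw, ← mderiv_comp_apply (g := h) (f := c) (y := Z) hZ hc.mdifferentiableAt hc0]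
      refine congrArg (fun L : ℝ →L[ℝ] EG => L 1) (mderiv_congr ?_)
      filter_upwards [hcs] with u hu
      simp only [hh, hu]
    set R : M × G → M × G := fun q => (q.1, h q.2) with hR
    have hRs : SmoothNear (𝓘(ℝ, EM).prod 𝓘(ℝ, EG)) (𝓘(ℝ, EM).prod 𝓘(ℝ, EG)) R (a, X) :=
      smoothNear_fst.prodMk (hhs.comp_of_eq smoothNear_snd rfl)
    have hRd : ∀ {z : M × G}, MDifferentiableAt 𝓘(ℝ, EG) 𝓘(ℝ, EG) h z.2 → ∀ v : EM × EG,
        mderiv (𝓘(ℝ, EM).prod 𝓘(ℝ, EG)) (𝓘(ℝ, EM).prod 𝓘(ℝ, EG)) R z v =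
          (v.1, mderiv 𝓘(ℝ, EG) 𝓘(ℝ, EG) h z.2 v.2) := by
      intro z hz v
      have h2 : MDifferentiableAt (𝓘(ℝ, EM).prod 𝓘(ℝ, EG)) 𝓘(ℝ, EG) (fun q : M × G => h q.2) z :=
        MDifferentiableAt.comp (g := h) z hz
          (smoothNear_snd (I := 𝓘(ℝ, EM)) (I' := 𝓘(ℝ, EG))).mdifferentiableAt
      rw [hR, mderiv_prodMk (f := Prod.fst)
        (smoothNear_fst (I := 𝓘(ℝ, EM)) (I' := 𝓘(ℝ, EG))).mdifferentiableAt h2, mderiv_fst,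
        mderiv_comp (g := h) (f := Prod.snd) (y := z.2) hz
          (smoothNear_snd (I := 𝓘(ℝ, EM)) (I' := 𝓘(ℝ, EG))).mdifferentiableAt rfl, mderiv_snd]
      rfl
    have hhs' : ∀ᶠ z in 𝓝 (a, X), MDifferentiableAt 𝓘(ℝ, EG) 𝓘(ℝ, EG) h z.2 ∧
        Γ.src z.2 = Γ.tgt (b (Γ.src z.2)) :=
      (continuous_snd.tendsto (a, X)).eventually
        ((hhs.eventually.mono fun _ h => h.mdifferentiableAt).and
          ((hsX.eventually hbt).mono fun Z hZ => hZ.symm))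
    have hrel : ∀ {ζ : M × G → EM × EG}, Γ.IsInvariantField Ω ζ → ∀ᶠ z in 𝓝 (a, X),
        mderiv (𝓘(ℝ, EM).prod 𝓘(ℝ, EG)) (𝓘(ℝ, EM).prod 𝓘(ℝ, EG)) R z (ζ z) = ζ (R z) := by
      intro ζ hζ
      filter_upwards [hζ.isOpen.mem_nhds hX, hhs'] with z h1 h2
      obtain ⟨c, c1, c2, c3, c4⟩ := hζ.exists_vertical_curve h1
      have h3 : (z.1, h z.2) ∈ Ω := hζ.stable z.1 z.2 _ h1 h2.2
      rw [hRd h2.1]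
      refine Prod.ext (hζ.projectable z.1 z.2 (h z.2) h1 h3) ?_
      exact (hcurve h2.1 c1 c2 c3 c4).trans (hζ.snd_eq_of_curve (a := z.1) (X := z.2) h1 h2.2
        c1.mdifferentiableAt c2 c3 (c4.mono fun u hu => hu.trans h2.2)).symm
    have hRX : R (a, X) = (a, Γ.mul X Y) := by simp only [hR, hh, hb0]
    have hRΩ : R (a, X) ∈ Ω := by rw [hRX]; exact hζ.stable a X Y hX hXY
    have key := mderiv_vbracket (F := R) (x := (a, X)) (V := ζ) (W := η) (V' := ζ) (W' := η) hRs
      (hζ.smoothField hX) (hη.smoothField hX) (hζ.smoothField hRΩ) (hη.smoothField hRΩ)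
      (hrel hζ) (hrel hη)
    rw [hRd hhs.mdifferentiableAt, hRX] at key
    have hB : SmoothField (𝓘(ℝ, EM).prod 𝓘(ℝ, EG)) 𝓘(ℝ, EG) (fun q : M × G => q.2)
        (fun q => (_root_.vbracket (𝓘(ℝ, EM).prod 𝓘(ℝ, EG)) ζ η q).2) (a, X) := by
      have h1 := ((hζ.smoothField hX).vbracket (hη.smoothField hX)).map (f := Prod.snd)
        (smoothNear_snd (I := 𝓘(ℝ, EM)) (I' := 𝓘(ℝ, EG)))
      refine h1.congr (EventuallyEq.refl _ _) (Eventually.of_forall fun z => ?_)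
      show mderiv (𝓘(ℝ, EM).prod 𝓘(ℝ, EG)) 𝓘(ℝ, EG) Prod.snd z _ = _
      rw [mderiv_snd]
      rfl
    obtain ⟨K, hK, hK0, hKs⟩ := exists_vertical_flow (Γ := Γ) hB (by
      filter_upwards [hζ.isOpen.mem_nhds hX] with z hz using hζ.src_vbracket hη hz)
    have hKc : Tendsto (fun u : ℝ => (u, (a, X))) (𝓝 0) (𝓝 (0, (a, X))) :=
      (continuous_id.prodMk continuous_const).tendsto (0 : ℝ)
    have e1 := hcurve hhs.mdifferentiableAt hK.slice_left hK0.self_of_nhds.1 hK0.self_of_nhds.2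
      (hKc.eventually hKs)
    rw [hb0] at e1
    refine ((congrArg Prod.snd key).symm.trans e1).trans ?_
    exact (rightTranslate_eq (Γ := Γ) hK.slice_left.mdifferentiableAt hK0.self_of_nhds.1
      hK0.self_of_nhds.2 ((hKc.eventually hKs).mono fun u hu => hu.trans hXY)).symm

theorem IsAdmissible.vbracket_pushField (h : Γ.IsAdmissible σ f) (hζ : Γ.IsInvariantField Ω ζ)
    (hη : Γ.IsInvariantField Ω η) {q : M × G} (hq : q ∈ σ.target) (hqΩ : σ.symm q ∈ Ω) :
    vbracket (𝓘(ℝ, EM).prod 𝓘(ℝ, EG)) (fun p => LieGroupoid.pushField σ ζ p)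
        (fun p => LieGroupoid.pushField σ η p) q =
      LieGroupoid.pushField σ (vbracket (𝓘(ℝ, EM).prod 𝓘(ℝ, EG)) ζ η) q := by
  have hs := σ.map_target hq
  have hσq : σ (σ.symm q) = q := σ.right_inv hq
  have hrel : ∀ ζ : M × G → EM × EG, ∀ᶠ z in 𝓝 (σ.symm q),
      mderiv (𝓘(ℝ, EM).prod 𝓘(ℝ, EG)) (𝓘(ℝ, EM).prod 𝓘(ℝ, EG)) σ z (ζ z) =
        LieGroupoid.pushField σ ζ (σ z) := by
    intro ζ
    filter_upwards [σ.open_source.mem_nhds hs] with z hz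
    refine Eq.trans ?_ (pushField_apply (σ := σ) (ζ := ζ) (σ z)).symm
    rw [σ.left_inv hz]
  have key := mderiv_vbracket (F := σ) (x := σ.symm q) (V := ζ) (W := η)
    (V' := fun p => LieGroupoid.pushField σ ζ p) (W' := fun p => LieGroupoid.pushField σ η p)
    (h.smoothNear hs) (hζ.smoothField hqΩ) (hη.smoothField hqΩ)
    (by rw [hσq]; exact h.smoothField_pushField hζ hq hqΩ)
    (by rw [hσq]; exact h.smoothField_pushField hη hq hqΩ) (hrel ζ) (hrel η)
  rw [hσq] at key
  exact key.symm

end LieGroupoid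

section Calculus

variable {E F A B P X : Type*} [NormedAddCommGroup E] [NormedSpace ℝ E] [NormedAddCommGroup F]
  [NormedSpace ℝ F] [NormedAddCommGroup A] [NormedSpace ℝ A] [NormedAddCommGroup B]
  [NormedSpace ℝ B] [NormedAddCommGroup P] [NormedSpace ℝ P]

theorem isBigO_fderiv_of_flat_on_diagonal {H : E × E → F} {x : E} {m : ℕ}
    (hH : ∀ᶠ q in 𝓝 (x, x), ContDiffAt ℝ ∞ H q)
    (h : ∀ᶠ a in 𝓝 x, ∀ j ≤ m + 1, iteratedFDeriv ℝ j (fun z => H (a, z)) a = 0) :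
    (fun e => fderiv ℝ H (x, e)) =O[𝓝 x] fun e => ‖e - x‖ ^ (m + 1) := by
  have hHx : ContDiffAt ℝ ∞ H (x, x) := hH.self_of_nhds
  have hs : ContDiffAt ℝ ∞ (fun z => H (x, z)) x :=
    ContDiffAt.comp (g := H) (f := fun z : E => (x, z)) x hHx (contDiffAt_const.prodMk contDiffAt_id)
  have hfd : ContDiffAt ℝ ∞ (fun e => fderiv ℝ H (x, e)) x :=
    ContDiffAt.comp (g := fderiv ℝ H) (f := fun z : E => (x, z)) x
      (hHx.fderiv_right (by simp)) (contDiffAt_const.prodMk contDiffAt_id)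
  have hinl : (fun e => (fderiv ℝ H (x, e)).comp (ContinuousLinearMap.inl ℝ E E)) =O[𝓝 x]
      fun e => ‖e - x‖ ^ (m + 1) := by
    refine isBigO_of_iteratedFDeriv_eq_zero (hfd.clm_comp contDiffAt_const) fun i hi => ?_
    have key : ∀ w : E, iteratedFDeriv ℝ i (fun z => fderiv ℝ H (x, z) (w, 0)) x = 0 := by
      intro w
      have e1 := fderiv_iteratedFDeriv_partial_inl i hHx w
      set Gi : E × E → E [×i]→L[ℝ] F := fun q => iteratedFDeriv ℝ i (fun z => H (q.1, z)) q.2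
        with hGi
      have hGd : DifferentiableAt ℝ Gi (x, x) :=
        (contDiffAt_iteratedFDeriv_partial i hHx).differentiableAt (by simp)
      have e2 : (fun a => Gi (a, a)) =ᶠ[𝓝 x] fun _ => 0 := by
        filter_upwards [h] with a ha using ha i (by omega)
      have e3 : fderiv ℝ Gi (x, x) (w, w) = 0 := by
        have := fderiv_comp x (g := Gi) (f := fun a : E => (a, a)) hGd
          (differentiableAt_id.prodMk differentiableAt_id)
        have h4 : fderiv ℝ (fun a : E => (a, a)) x w = (w, w) := by
          have := ((hasFDerivAt_id x).prodMk (hasFDerivAt_id (𝕜 := ℝ) x)).fderiv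
          exact congrArg (fun L : E →L[ℝ] E × E => L w) this
        have h5 := congrArg (fun L : E →L[ℝ] _ => L w) this
        simp only [ContinuousLinearMap.comp_apply, h4] at h5
        rw [← h5]
        have h6 : fderiv ℝ (Gi ∘ fun a : E => (a, a)) x = 0 := by
          exact (Filter.EventuallyEq.fderiv_eq (𝕜 := ℝ) (f₁ := Gi ∘ fun a : E => (a, a)) e2).trans
            (fderiv_const_apply _)
        rw [h6]
        rfl
      have e4 : fderiv ℝ Gi (x, x) (0, w) = 0 := by
        have := fderiv_comp x (g := Gi) (f := fun a : E => (x, a)) hGd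
          ((differentiableAt_const x).prodMk differentiableAt_id)
        have h4 : fderiv ℝ (fun a : E => (x, a)) x w = (0, w) := by
          have := ((hasFDerivAt_const x x).prodMk (hasFDerivAt_id (𝕜 := ℝ) x)).fderiv
          exact congrArg (fun L : E →L[ℝ] E × E => L w) this
        have h5 := congrArg (fun L : E →L[ℝ] _ => L w) this
        simp only [ContinuousLinearMap.comp_apply, h4] at h5
        rw [← h5]
        refine ContinuousMultilinearMap.ext fun v => ?_
        have h6 := congrArg (fun L : E [×(i + 1)]→L[ℝ] F => L (Fin.cons w v))
          (h.self_of_nhds (i + 1) (by omega))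
        exact (iteratedFDeriv_succ_apply_left (𝕜 := ℝ) (f := fun z => H (x, z)) (x := x)
          (Fin.cons w v)).symm.trans h6
      rw [← e1]
      have e5 : ((w, 0) : E × E) = (w, w) - (0, w) := by simp
      rw [e5, map_sub, e3, e4, sub_zero]
    ext v w
    have h1 := (ContinuousLinearMap.apply ℝ F w).iteratedFDeriv_comp_left
      (hfd.clm_comp (contDiffAt_const (c := ContinuousLinearMap.inl ℝ E E)))
      (i := i) (by exact_mod_cast le_top)
    have h2 := congrArg (fun L : E [×i]→L[ℝ] F => L v) h1
    refine Eq.trans h2.symm ?_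
    exact congrArg (fun L : E [×i]→L[ℝ] F => L v) (key w)
  have hinr : (fun e => (fderiv ℝ H (x, e)).comp (ContinuousLinearMap.inr ℝ E E)) =O[𝓝 x]
      fun e => ‖e - x‖ ^ (m + 1) := by
    have h1 := iteratedFDeriv_isBigO_of_eq_zero (k := m + 1) hs (h.self_of_nhds) (j := 1)
      (l := m + 1) (by omega)
    refine Asymptotics.IsBigO.trans (Asymptotics.IsBigO.of_norm_eventuallyLE ?_) h1.norm_left
    filter_upwards [((continuous_const.prodMk continuous_id).tendsto x :
      Tendsto (fun e : E => (x, e)) (𝓝 x) (𝓝 (x, x))).eventually hH] with e he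
    have h2 := fderiv_comp e (g := H) (f := fun a : E => (x, a)) (he.differentiableAt (by simp))
      ((differentiableAt_const x).prodMk differentiableAt_id)
    have h3 : fderiv ℝ (fun a : E => (x, a)) e = ContinuousLinearMap.inr ℝ E E :=
      ((hasFDerivAt_const x e).prodMk (hasFDerivAt_id (𝕜 := ℝ) e)).fderiv
    rw [h3] at h2
    rw [← h2, norm_iteratedFDeriv_one]
    exact le_rfl
  have h1 : (fun e => ‖(fderiv ℝ H (x, e)).comp (ContinuousLinearMap.inl ℝ E E)‖ +
      ‖(fderiv ℝ H (x, e)).comp (ContinuousLinearMap.inr ℝ E E)‖) =O[𝓝 x]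
        fun e => ‖e - x‖ ^ (m + 1) := hinl.norm_left.add hinr.norm_left
  refine Asymptotics.IsBigO.trans (Asymptotics.IsBigO.of_norm_le fun e => ?_) h1
  refine ContinuousLinearMap.opNorm_le_bound _ (by positivity) fun v => ?_
  have e1 : fderiv ℝ H (x, e) v = (fderiv ℝ H (x, e)).comp (ContinuousLinearMap.inl ℝ E E) v.1 +
      (fderiv ℝ H (x, e)).comp (ContinuousLinearMap.inr ℝ E E) v.2 := by
    rw [ContinuousLinearMap.comp_apply, ContinuousLinearMap.comp_apply, ← map_add]
    simp
  rw [e1, add_mul]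
  refine (norm_add_le _ _).trans (add_le_add ?_ ?_)
  · exact (ContinuousLinearMap.le_opNorm _ _).trans
      (mul_le_mul_of_nonneg_left (norm_fst_le v) (norm_nonneg _))
  · exact (ContinuousLinearMap.le_opNorm _ _).trans
      (mul_le_mul_of_nonneg_left (norm_snd_le v) (norm_nonneg _))

theorem isBigO_clm_apply {l : Filter X} {L : P → A →L[ℝ] B} {u : X → A} {γ : X → P} {p : P}
    {g : X → ℝ} (hL : ContinuousAt L p) (hγ : Tendsto γ l (𝓝 p)) (hu : u =O[l] g) :
    (fun z => L (γ z) (u z)) =O[l] g := by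
  have h1 : (fun z => L (γ z)) =O[l] fun _ => (1 : ℝ) := (hL.tendsto.comp hγ).isBigO_one ℝ
  have h2 := h1.norm_left.mul hu.norm_left
  simp only [_root_.one_mul] at h2
  exact Asymptotics.IsBigO.trans (Asymptotics.IsBigO.of_norm_le fun z => (L (γ z)).le_opNorm _) h2

theorem ContDiffAt.eventually_differentiableAt {v : P → A} {p : P} (hv : ContDiffAt ℝ ∞ v p) :
    ∀ᶠ q in 𝓝 p, DifferentiableAt ℝ v q := by
  have h2 : ContDiffAt ℝ 1 v p := hv.of_le (by exact_mod_cast le_top)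
  exact (h2.eventually (by simp)).mono fun q hq => hq.differentiableAt (by simp)

theorem isBigO_fderiv_clm_apply {l : Filter X} {L : P → A →L[ℝ] B} {u : P → A} {γ : X → P} {p : P}
    {g : X → ℝ} (hL : ContDiffAt ℝ ∞ L p) (hu : ContDiffAt ℝ ∞ u p) (hγ : Tendsto γ l (𝓝 p))
    (h0 : (fun z => u (γ z)) =O[l] g) (h1 : (fun z => fderiv ℝ u (γ z)) =O[l] g) :
    (fun z => fderiv ℝ (fun q => L q (u q)) (γ z)) =O[l] g := by
  have e1 : ∀ᶠ z in l, fderiv ℝ (fun q => L q (u q)) (γ z) =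
      (ContinuousLinearMap.compL ℝ P A B (L (γ z))) (fderiv ℝ u (γ z)) +
        (ContinuousLinearMap.flipₗᵢ ℝ P A B (fderiv ℝ L (γ z))) (u (γ z)) := by
    filter_upwards [hγ.eventually hL.eventually_differentiableAt,
      hγ.eventually hu.eventually_differentiableAt] with z hz1 hz2
    rw [fderiv_clm_apply hz1 hz2]
    rfl
  refine (Asymptotics.IsBigO.add ?_ ?_).congr' (e1.mono fun z hz => hz.symm) (EventuallyEq.refl _ _)
  · exact isBigO_clm_apply (L := fun q => ContinuousLinearMap.compL ℝ P A B (L q))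
      ((ContinuousLinearMap.continuous _).continuousAt.comp hL.continuousAt) hγ h1
  · refine isBigO_clm_apply (L := fun q => (ContinuousLinearMap.flipₗᵢ ℝ P A B (fderiv ℝ L q) :
      A →L[ℝ] P →L[ℝ] B)) ?_ hγ h0
    exact (LinearIsometryEquiv.continuous _).continuousAt.comp
      (hL.fderiv_right (m := ∞) (by simp)).continuousAt

end Calculus

section ProductChart

variable {E E' N N' : Type*} [NormedAddCommGroup E] [NormedSpace ℝ E] [NormedAddCommGroup E']
  [NormedSpace ℝ E'] [TopologicalSpace N] [ChartedSpace E N] [TopologicalSpace N']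
  [ChartedSpace E' N'] [IsManifold 𝓘(ℝ, E) ∞ N] [IsManifold 𝓘(ℝ, E') ∞ N']

theorem mderiv_extChartAt_prod {a z : N} {b z' : N'} (hz : z ∈ (chartAt E a).source)
    (hz' : z' ∈ (chartAt E' b).source) (v : E × E') :
    mderiv (𝓘(ℝ, E).prod 𝓘(ℝ, E')) 𝓘(ℝ, E × E')
        (extChartAt (𝓘(ℝ, E).prod 𝓘(ℝ, E')) (a, b)) (z, z') v =
      (mderiv 𝓘(ℝ, E) 𝓘(ℝ, E) (extChartAt 𝓘(ℝ, E) a) z v.1,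
        mderiv 𝓘(ℝ, E') 𝓘(ℝ, E') (extChartAt 𝓘(ℝ, E') b) z' v.2) := by
  rw [← extChartAt_source 𝓘(ℝ, E)] at hz
  rw [← extChartAt_source 𝓘(ℝ, E')] at hz'
  have h1 := (smoothNear_extChartAt hz).comp_of_eq (x := ((z, z') : N × N'))
    (f := Prod.fst) (smoothNear_fst (I' := 𝓘(ℝ, E'))) rfl
  have h2 := (smoothNear_extChartAt hz').comp_of_eq (x := ((z, z') : N × N'))
    (f := Prod.snd) (smoothNear_snd (I := 𝓘(ℝ, E))) rfl
  have e1 : (extChartAt (𝓘(ℝ, E).prod 𝓘(ℝ, E')) (a, b) : N × N' → E × E') =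
      fun p => (extChartAt 𝓘(ℝ, E) a p.1, extChartAt 𝓘(ℝ, E') b p.2) := by
    rw [extChartAt_prod]
    rfl
  rw [e1, modelWithCornersSelf_prod, ← chartedSpaceSelf_prod,
    mderiv_prodMk h1.mdifferentiableAt h2.mdifferentiableAt,
    mderiv_comp (g := extChartAt 𝓘(ℝ, E) a) (f := Prod.fst)
      (smoothNear_extChartAt hz).mdifferentiableAt
      (smoothNear_fst (I' := 𝓘(ℝ, E'))).mdifferentiableAt rfl,
    mderiv_comp (g := extChartAt 𝓘(ℝ, E') b) (f := Prod.snd)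
      (smoothNear_extChartAt hz').mdifferentiableAt
      (smoothNear_snd (I := 𝓘(ℝ, E))).mdifferentiableAt rfl, mderiv_fst, mderiv_snd]
  rfl

end ProductChart

namespace LieGroupoid

variable {EM EG M G : Type*}
  [NormedAddCommGroup EM] [NormedSpace ℝ EM] [NormedAddCommGroup EG] [NormedSpace ℝ EG]
  [TopologicalSpace M] [ChartedSpace EM M] [TopologicalSpace G] [ChartedSpace EG G]
  {Γ : LieGroupoid EM EG M G} {k : ℕ}
  [IsManifold 𝓘(ℝ, EM) ∞ M] [IsManifold 𝓘(ℝ, EG) ∞ G]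

/-- In charts, an invariant field is obtained from its values along the identities by applying the
differentials of the right translations. -/
theorem exists_rightTranslation_chart (Γ : LieGroupoid EM EG M G) (x : M) :
    ∃ L : EG → EG →L[ℝ] EG, ContDiffAt ℝ ∞ L (extChartAt 𝓘(ℝ, EG) (Γ.one x) (Γ.one x)) ∧
      ∀ᶠ X in 𝓝 (Γ.one x), ∀ (a : M) (Ω : Set (M × G)) (ζ : M × G → EM × EG),
        Γ.IsInvariantField Ω ζ → (a, X) ∈ Ω →
        mderiv 𝓘(ℝ, EG) 𝓘(ℝ, EG) (extChartAt 𝓘(ℝ, EG) (Γ.one x)) X (ζ (a, X)).2 =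
          L (extChartAt 𝓘(ℝ, EG) (Γ.one x) X)
            (mderiv 𝓘(ℝ, EG) 𝓘(ℝ, EG) (extChartAt 𝓘(ℝ, EG) (Γ.one x)) (Γ.one (Γ.tgt X))
              (ζ (a, Γ.one (Γ.tgt X))).2) := by
  obtain ⟨m, hm, hm'⟩ := Γ.exists_mul_extension (Y := Γ.one x) (X := Γ.one x)
    (by rw [Γ.src_one, Γ.tgt_one])
  set ψ := extChartAt 𝓘(ℝ, EG) (Γ.one x) with hψ
  set p := ψ (Γ.one x) with hp
  have h0 : Γ.one x ∈ ψ.source := mem_extChartAt_source _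
  have hm0 : m (Γ.one x, Γ.one x) = Γ.one x := by
    rw [hm'.self_of_nhds (by rw [Γ.src_one, Γ.tgt_one])]
    exact one_mul_of_eq (Γ.tgt_one x)
  have hsymm : SmoothNear 𝓘(ℝ, EG) 𝓘(ℝ, EG) ψ.symm p := smoothNear_extChartAt_symm (ψ.map_source h0)
  set mh : EG × EG → EG := fun q => ψ (m (ψ.symm q.1, ψ.symm q.2)) with hmh
  have hmhs : ∀ᶠ q in 𝓝 (p, p), ContDiffAt ℝ ∞ mh q := by
    refine smoothNear_prod_iff.1 ?_
    have h1 : SmoothNear (𝓘(ℝ, EG).prod 𝓘(ℝ, EG)) (𝓘(ℝ, EG).prod 𝓘(ℝ, EG))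
        (fun q : EG × EG => (ψ.symm q.1, ψ.symm q.2)) (p, p) :=
      (hsymm.comp_of_eq smoothNear_fst rfl).prodMk (hsymm.comp_of_eq smoothNear_snd rfl)
    have h2 := hm.comp_of_eq h1 (by rw [hp, ψ.left_inv h0])
    refine (smoothNear_extChartAt (I := 𝓘(ℝ, EG)) h0).comp_of_eq h2 ?_
    rw [hp, ψ.left_inv h0, hm0]
  have ht : Tendsto (fun X => Γ.one (Γ.tgt X)) (𝓝 (Γ.one x)) (𝓝 (Γ.one x)) := by
    have := (Γ.contMDiff_one.continuous.comp Γ.contMDiff_tgt.continuous).tendsto (Γ.one x)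
    rwa [Function.comp_apply, Γ.tgt_one] at this
  have hι : ContDiffAt ℝ ∞ (fun g => ψ (Γ.one (Γ.tgt (ψ.symm g)))) p := by
    have h1 : SmoothNear 𝓘(ℝ, EG) 𝓘(ℝ, EM) (fun g => Γ.tgt (ψ.symm g)) p :=
      (Γ.contMDiff_tgt.smoothNear _).comp hsymm
    have h2 : SmoothNear 𝓘(ℝ, EG) 𝓘(ℝ, EG) (fun g => Γ.one (Γ.tgt (ψ.symm g))) p :=
      (Γ.contMDiff_one.smoothNear _).comp h1
    exact SmoothNear.contDiffAt ((smoothNear_extChartAt (I := 𝓘(ℝ, EG)) h0).comp_of_eq h2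
      (by rw [hp, ψ.left_inv h0, Γ.tgt_one]))
  have hι0 : ψ (Γ.one (Γ.tgt (ψ.symm p))) = p := by rw [hp, ψ.left_inv h0, Γ.tgt_one]
  refine ⟨fun g => (fderiv ℝ mh (ψ (Γ.one (Γ.tgt (ψ.symm g))), g)).comp
    (ContinuousLinearMap.inl ℝ EG EG), ?_, ?_⟩
  · refine ContDiffAt.clm_comp ?_ contDiffAt_const
    refine ContDiffAt.comp (g := fderiv ℝ mh)
      (f := fun g => (ψ (Γ.one (Γ.tgt (ψ.symm g))), g)) p ?_ (hι.prodMk contDiffAt_id)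
    rw [hι0]
    exact hmhs.self_of_nhds.fderiv_right (by simp)
  · have hpair : Tendsto (fun X => (Γ.one (Γ.tgt X), X)) (𝓝 (Γ.one x)) (𝓝 (Γ.one x, Γ.one x)) :=
      ht.prodMk_nhds tendsto_id
    have hψt : Tendsto ψ (𝓝 (Γ.one x)) (𝓝 p) := (continuousAt_extChartAt _).tendsto
    filter_upwards [hpair.eventually (eventually_eventually_nhds.2 hm'),
      hpair.eventually hm.eventually, extChartAt_source_mem_nhds (I := 𝓘(ℝ, EG)) (Γ.one x),
      ht.eventually (extChartAt_source_mem_nhds (I := 𝓘(ℝ, EG)) (Γ.one x)),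
      ((hψt.comp ht).prodMk_nhds hψt).eventually hmhs]
      with X h1 h2 h3 h4 h5 a Ω ζ hζ haX
    have ha1 : (a, Γ.one (Γ.tgt X)) ∈ Ω := hζ.stable.mem_one_iff.2 haX
    obtain ⟨c, hc, hc0, hcv, hcs⟩ := hζ.exists_vertical_curve ha1
    have hcs' : ∀ᶠ u in 𝓝 0, Γ.src (c u) = Γ.tgt X := by
      filter_upwards [hcs] with u hu
      rw [hu]
      exact Γ.src_one _
    have hct : Tendsto c (𝓝 0) (𝓝 (Γ.one (Γ.tgt X))) := hc.tendsto_of_eq hc0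
    have e1 := hζ.snd_eq_of_family haX rfl hc.mdifferentiableAt hc0 hcv hcs'
    have e2 : (fun u => Γ.mul (c u) X) =ᶠ[𝓝 0] fun u => m (c u, X) := by
      filter_upwards [(hct.prodMk_nhds (tendsto_const_nhds (x := X))).eventually h1, hcs'] with u hu hu'
      exact (hu hu').symm
    have hmc : SmoothNear 𝓘(ℝ, ℝ) 𝓘(ℝ, EG) (fun u => m (c u, X)) 0 :=
      SmoothNear.comp_of_eq h2 (hc.prodMk smoothNear_const) (by rw [hc0])
    have hψc : SmoothNear 𝓘(ℝ, ℝ) 𝓘(ℝ, EG) (fun u => ψ (c u)) 0 :=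
      (smoothNear_extChartAt (I := 𝓘(ℝ, EG)) h4).comp_of_eq hc hc0
    have e3 : mderiv 𝓘(ℝ, ℝ) 𝓘(ℝ, EG) (fun u => ψ (c u)) 0 1 =
        mderiv 𝓘(ℝ, EG) 𝓘(ℝ, EG) ψ (Γ.one (Γ.tgt X)) (ζ (a, Γ.one (Γ.tgt X))).2 := by
      rw [mderiv_comp_apply (g := ψ) (f := c) (smoothNear_extChartAt (I := 𝓘(ℝ, EG)) h4).mdifferentiableAt
        hc.mdifferentiableAt hc0, hcv]
    have hm00 : m (c 0, X) = X := by
      rw [hc0, h1.self_of_nhds (Γ.src_one _), Γ.one_mul]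
    have e4 : mderiv 𝓘(ℝ, EG) 𝓘(ℝ, EG) ψ X (ζ (a, X)).2 =
        mderiv 𝓘(ℝ, ℝ) 𝓘(ℝ, EG) (fun u => ψ (m (c u, X))) 0 1 := by
      rw [e1, mderiv_congr e2]
      exact (mderiv_comp_apply (g := ψ) (f := fun u => m (c u, X))
        (smoothNear_extChartAt (I := 𝓘(ℝ, EG)) h3).mdifferentiableAt hmc.mdifferentiableAt hm00 1).symm
    have e5 : (fun u => ψ (m (c u, X))) =ᶠ[𝓝 0] fun u => mh (ψ (c u), ψ X) := by
      filter_upwards [hct.eventually (Filter.eventually_of_mem ((isOpen_extChartAt_source (I := 𝓘(ℝ, EG))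
        (Γ.one x)).mem_nhds h4) fun _ h => h)] with u hu
      rw [hmh]
      simp only
      rw [ψ.left_inv hu, ψ.left_inv h3]
    rw [e4, mderiv_congr e5, mderiv_eq_fderiv, ← e3, mderiv_eq_fderiv]
    have hd1 : HasFDerivAt (fun u : ℝ => (ψ (c u), ψ X)) ((fderiv ℝ (fun u => ψ (c u)) 0).prod 0) 0 :=
      (hψc.contDiffAt.differentiableAt (by simp)).hasFDerivAt.prodMk (hasFDerivAt_const _ _)
    have hd2 : HasFDerivAt mh (fderiv ℝ mh (ψ (c 0), ψ X)) (ψ (c 0), ψ X) := by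
      rw [hc0]
      exact (h5.differentiableAt (by simp)).hasFDerivAt
    have hd := (hd2.comp (0 : ℝ) hd1).fderiv
    refine (congrArg (fun L : ℝ →L[ℝ] EG => L 1) hd).trans ?_
    rw [hc0, ψ.left_inv h3]
    rfl

end LieGroupoid

namespace LieGroupoid

variable {EM EG M G : Type*}
  [NormedAddCommGroup EM] [NormedSpace ℝ EM] [NormedAddCommGroup EG] [NormedSpace ℝ EG]
  [TopologicalSpace M] [ChartedSpace EM M] [TopologicalSpace G] [ChartedSpace EG G]
  {Γ : LieGroupoid EM EG M G} {k : ℕ}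
  [IsManifold 𝓘(ℝ, EM) ∞ M] [IsManifold 𝓘(ℝ, EG) ∞ G]
  {Ω : Set (M × G)} {ζ ζ' η : M × G → EM × EG} {x : M}

theorem IsInvariantField.smoothField_one_family (hζ : Γ.IsInvariantField Ω ζ) {y : M}
    (h : (x, Γ.one y) ∈ Ω) : SmoothField (𝓘(ℝ, EM).prod 𝓘(ℝ, EM)) 𝓘(ℝ, EG)
      (fun q : M × M => Γ.one q.2) (fun q : M × M => (ζ (q.1, Γ.one q.2)).2) (x, y) :=
  (hζ.smoothField_snd h).comp (c := fun q : M × M => (q.1, Γ.one q.2)) (n := (x, y))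
    (smoothNear_fst.prodMk ((Γ.contMDiff_one.smoothNear y).comp_of_eq smoothNear_snd rfl))

theorem fst_eq_of_upsilon_eq {z : M}
    (h : (Γ.upsilon k ζ z : CheckJet EM EG k) = Γ.upsilon k ζ' z) :
    (ζ (z, Γ.one z)).1 = (ζ' (z, Γ.one z)).1 := by
  have h1 := congrArg Prod.fst h
  exact h1

theorem isBigO_fderiv_algForm_of_upsilon_eq (hζ : Γ.IsInvariantField Ω ζ)
    (hζ' : Γ.IsInvariantField Ω ζ') (hx : (x, Γ.one x) ∈ Ω)
    (h : ∀ᶠ z in 𝓝 x, (Γ.upsilon (k + 1) ζ z : CheckJet EM EG (k + 1)) = Γ.upsilon (k + 1) ζ' z)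
    {Θ : EM × EM → EG} (hΘ : Θ = fun p => Γ.algForm x
      (fun z => (ζ ((extChartAt 𝓘(ℝ, EM) x).symm p.1, Γ.one z)).2 -
        (ζ' ((extChartAt 𝓘(ℝ, EM) x).symm p.1, Γ.one z)).2) p.2) :
    (∀ᶠ p in 𝓝 (extChartAt 𝓘(ℝ, EM) x x, extChartAt 𝓘(ℝ, EM) x x), ContDiffAt ℝ ∞ Θ p) ∧
      ((fun e => Θ (extChartAt 𝓘(ℝ, EM) x x, e)) =O[𝓝 (extChartAt 𝓘(ℝ, EM) x x)]
        fun e => ‖e - extChartAt 𝓘(ℝ, EM) x x‖ ^ (k + 1)) ∧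
      (fun e => fderiv ℝ Θ (extChartAt 𝓘(ℝ, EM) x x, e)) =O[𝓝 (extChartAt 𝓘(ℝ, EM) x x)]
        fun e => ‖e - extChartAt 𝓘(ℝ, EM) x x‖ ^ (k + 1) := by
  set φ := extChartAt 𝓘(ℝ, EM) x with hφ
  have hxφ : x ∈ φ.source := mem_extChartAt_source x
  have hsymm : SmoothNear 𝓘(ℝ, EM) 𝓘(ℝ, EM) φ.symm (φ x) :=
    smoothNear_extChartAt_symm (φ.map_source hxφ)
  have hsymm0 : φ.symm (φ x) = x := φ.left_inv hxφ
  have hs : ∀ᶠ p in 𝓝 (φ x, φ x), ContDiffAt ℝ ∞ Θ p := by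
    rw [hΘ]
    refine smoothNear_algForm_family (W := EM) (w := φ x) (Θ := fun q : EM × M =>
      (ζ (φ.symm q.1, Γ.one q.2)).2 - (ζ' (φ.symm q.1, Γ.one q.2)).2) ?_ (mem_chart_source _ _)
      (mem_chart_source _ _)
    have h1 := (hζ.smoothField_one_family hx).sub (hζ'.smoothField_one_family hx)
    refine SmoothField.comp
      (b := fun q : M × M => Γ.one q.2) (V := fun q : M × M =>
        (ζ (q.1, Γ.one q.2)).2 - (ζ' (q.1, Γ.one q.2)).2)
      (c := fun q : EM × M => (φ.symm q.1, q.2)) (n := (φ x, x)) ?_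
      ((hsymm.comp_of_eq smoothNear_fst rfl).prodMk smoothNear_snd)
    refine hsymm0.symm ▸ h1
  have hflat : ∀ᶠ e in 𝓝 (φ x), ∀ j ≤ k + 1, iteratedFDeriv ℝ j (fun z => Θ (e, z)) e = 0 := by
    have hd : ∀ᶠ z in 𝓝 x, (z, Γ.one z) ∈ Ω :=
      (continuous_id.prodMk Γ.contMDiff_one.continuous).continuousAt.eventually
        (hζ.isOpen.mem_nhds hx)
    filter_upwards [(hsymm.tendsto_of_eq hsymm0).eventually h,
      (hsymm.tendsto_of_eq hsymm0).eventually hd,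
      (hsymm.tendsto_of_eq hsymm0).eventually (eventually_mem_charts (Γ := Γ) x),
      (isOpen_extChartAt_target (I := 𝓘(ℝ, EM)) x).mem_nhds (φ.map_source hxφ)]
      with e h1 h2 h3 h4 j hj
    have hjet : Γ.algJet (k + 1) (fun z => (ζ (φ.symm e, Γ.one z)).2) (φ.symm e) =
        Γ.algJet (k + 1) (fun z => (ζ' (φ.symm e, Γ.one z)).2) (φ.symm e) := congrArg Prod.snd h1
    have h5 := algCoeffs_congr_chart (k := k + 1) (b := x) (hζ.smoothField_one h2)
      (hζ'.smoothField_one h2) (mem_chart_source _ _) (mem_chart_source _ _) h3.1 h3.2 hjet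
    have h6 := algCoeffs_sub (k := k + 1) (a := x) (hζ.smoothField_one h2)
      (hζ'.smoothField_one h2) h3.1 h3.2
    rw [h5, sub_self] at h6
    have h7 := congrFun h6 ⟨j, by omega⟩
    rw [algCoeffs_apply, ← hφ, φ.right_inv h4] at h7
    rw [hΘ]
    exact h7
  refine ⟨hs, ?_, isBigO_fderiv_of_flat_on_diagonal hs hflat⟩
  exact isBigO_of_iteratedFDeriv_eq_zero (hs.self_of_nhds.comp (φ x)
    (contDiffAt_const.prodMk contDiffAt_id)) fun i hi => hflat.self_of_nhds i (by omega)

end LieGroupoid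

namespace LieGroupoid

variable {EM EG M G : Type*}
  [NormedAddCommGroup EM] [NormedSpace ℝ EM] [NormedAddCommGroup EG] [NormedSpace ℝ EG]
  [TopologicalSpace M] [ChartedSpace EM M] [TopologicalSpace G] [ChartedSpace EG G]
  {Γ : LieGroupoid EM EG M G} {k : ℕ}
  [IsManifold 𝓘(ℝ, EM) ∞ M] [IsManifold 𝓘(ℝ, EG) ∞ G]
  {Ω : Set (M × G)} {ζ ζ' η : M × G → EM × EG} {x : M}

/-- The difference of two invariant fields with the same image by `Υ_{k+1}` vanishes to order `k`
along `{x} × I`, together with its first derivatives. -/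
theorem isBigO_chartField_sub (hζ : Γ.IsInvariantField Ω ζ) (hζ' : Γ.IsInvariantField Ω ζ')
    (hx : (x, Γ.one x) ∈ Ω)
    (h : ∀ᶠ z in 𝓝 x, (Γ.upsilon (k + 1) ζ z : CheckJet EM EG (k + 1)) = Γ.upsilon (k + 1) ζ' z)
    {δ : EM × EG → EM × EG} (hδ : δ = fun e =>
      chartField (𝓘(ℝ, EM).prod 𝓘(ℝ, EG)) (x, Γ.one x) ζ e -
        chartField (𝓘(ℝ, EM).prod 𝓘(ℝ, EG)) (x, Γ.one x) ζ' e) {γ : M → EM × EG}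
    (hγ : γ = fun y => (extChartAt 𝓘(ℝ, EM) x x, extChartAt 𝓘(ℝ, EG) (Γ.one x) (Γ.one y))) :
    ((fun y => δ (γ y)) =O[𝓝 x] fun y => chartGauge 𝓘(ℝ, EM) x y ^ (k + 1)) ∧
      (fun y => fderiv ℝ δ (γ y)) =O[𝓝 x] fun y => chartGauge 𝓘(ℝ, EM) x y ^ (k + 1) := by
  obtain ⟨hΘs, hΘ0, hΘ1⟩ := isBigO_fderiv_algForm_of_upsilon_eq hζ hζ' hx h rfl
  obtain ⟨L, hL, hLζ⟩ := exists_rightTranslation_chart Γ x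
  set φ := extChartAt 𝓘(ℝ, EM) x with hφ
  set ψ := extChartAt 𝓘(ℝ, EG) (Γ.one x) with hψ
  set Θ : EM × EM → EG := fun p => Γ.algForm x
      (fun z => (ζ (φ.symm p.1, Γ.one z)).2 - (ζ' (φ.symm p.1, Γ.one z)).2) p.2 with hΘ
  have hxφ : x ∈ φ.source := mem_extChartAt_source x
  have hxψ : Γ.one x ∈ ψ.source := mem_extChartAt_source _
  have hφs : SmoothNear 𝓘(ℝ, EM) 𝓘(ℝ, EM) φ.symm (φ x) :=
    smoothNear_extChartAt_symm (φ.map_source hxφ)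
  have hψs : SmoothNear 𝓘(ℝ, EG) 𝓘(ℝ, EG) ψ.symm (ψ (Γ.one x)) :=
    smoothNear_extChartAt_symm (ψ.map_source hxψ)
  have hφ0 : φ.symm (φ x) = x := φ.left_inv hxφ
  have hψ0 : ψ.symm (ψ (Γ.one x)) = Γ.one x := ψ.left_inv hxψ
  have hφt : Tendsto φ (𝓝 x) (𝓝 (φ x)) := (continuousAt_extChartAt x).tendsto
  have honet : Tendsto Γ.one (𝓝 x) (𝓝 (Γ.one x)) := Γ.contMDiff_one.continuous.tendsto x
  have hψt : Tendsto ψ (𝓝 (Γ.one x)) (𝓝 (ψ (Γ.one x))) := (continuousAt_extChartAt _).tendsto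
  have hγt : Tendsto γ (𝓝 x) (𝓝 (φ x, ψ (Γ.one x))) := by
    rw [hγ]
    exact tendsto_const_nhds.prodMk_nhds (hψt.comp honet)
  have hτ : SmoothNear 𝓘(ℝ, EG) 𝓘(ℝ, EM) (fun g => φ (Γ.tgt (ψ.symm g))) (ψ (Γ.one x)) := by
    have h1 : SmoothNear 𝓘(ℝ, EG) 𝓘(ℝ, EM) (fun g => Γ.tgt (ψ.symm g)) (ψ (Γ.one x)) :=
      (Γ.contMDiff_tgt.smoothNear _).comp hψs
    exact (smoothNear_extChartAt (I := 𝓘(ℝ, EM)) hxφ).comp_of_eq h1 (by rw [hψ0, Γ.tgt_one])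
  have hτ0 : φ (Γ.tgt (ψ.symm (ψ (Γ.one x)))) = φ x := by rw [hψ0, Γ.tgt_one]
  set q : EM × EG → EM × EM := fun e => (e.1, φ (Γ.tgt (ψ.symm e.2))) with hq
  set p₀ : EM × EG := (φ x, ψ (Γ.one x)) with hp₀
  have hqs : ContDiffAt ℝ ∞ q p₀ :=
    contDiffAt_fst.prodMk (ContDiffAt.comp p₀
      (g := fun g => φ (Γ.tgt (ψ.symm g))) (f := Prod.snd) hτ.contDiffAt contDiffAt_snd)
  have hq0 : q p₀ = (φ x, φ x) := by rw [hq]; exact congrArg _ hτ0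
  have hqγ : ∀ᶠ y in 𝓝 x, q (γ y) = (φ x, φ y) := by
    filter_upwards [honet.eventually (extChartAt_source_mem_nhds (I := 𝓘(ℝ, EG)) (Γ.one x))]
      with y hy
    rw [hγ]
    show (φ x, φ (Γ.tgt (ψ.symm (ψ (Γ.one y))))) = _
    rw [ψ.left_inv hy, Γ.tgt_one]
  have hu : ContDiffAt ℝ ∞ (fun e => Θ (q e)) p₀ := by
    refine ContDiffAt.comp (g := Θ) (f := q) p₀ ?_ hqs
    rw [hq0]
    exact hΘs.self_of_nhds
  have hu0 : (fun y => Θ (q (γ y))) =O[𝓝 x] fun y => chartGauge 𝓘(ℝ, EM) x y ^ (k + 1) := by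
    refine (hΘ0.comp_tendsto hφt).congr' ?_ (EventuallyEq.refl _ _)
    filter_upwards [hqγ] with y hy
    rw [hy]
    rfl
  have hu1 : (fun y => fderiv ℝ (fun e => Θ (q e)) (γ y)) =O[𝓝 x]
      fun y => chartGauge 𝓘(ℝ, EM) x y ^ (k + 1) := by
    have h1 : (fun y => fderiv ℝ Θ (q (γ y))) =O[𝓝 x]
        fun y => chartGauge 𝓘(ℝ, EM) x y ^ (k + 1) := by
      refine (hΘ1.comp_tendsto hφt).congr' ?_ (EventuallyEq.refl _ _)
      filter_upwards [hqγ] with y hy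
      rw [hy]
      rfl
    have h2 := isBigO_clm_apply (L := fun e => (ContinuousLinearMap.compL ℝ (EM × EG) (EM × EM)
      EG).flip (fderiv ℝ q e)) (γ := γ) (p := p₀)
      ((ContinuousLinearMap.continuous _).continuousAt.comp
        (hqs.fderiv_right (m := ∞) (by simp)).continuousAt) hγt h1
    refine h2.congr' ?_ (EventuallyEq.refl _ _)
    have hqt : Tendsto (fun y => q (γ y)) (𝓝 x) (𝓝 (φ x, φ x)) := by
      rw [← hq0]
      exact hqs.continuousAt.tendsto.comp hγt
    filter_upwards [hγt.eventually hqs.eventually_differentiableAt, hqt.eventually hΘs] with y h3 h4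
    exact (fderiv_comp (γ y) (g := Θ) (f := q) (h4.differentiableAt (by simp)) h3).symm
  have hδ' : δ =ᶠ[𝓝 p₀] fun e => ((ContinuousLinearMap.inr ℝ EM EG).comp (L e.2)) (Θ (q e)) := by
    have ha : Tendsto (fun e : EM × EG => φ.symm e.1) (𝓝 p₀) (𝓝 x) :=
      (hφs.tendsto_of_eq hφ0).comp continuous_fst.continuousAt
    have hX : Tendsto (fun e : EM × EG => ψ.symm e.2) (𝓝 p₀) (𝓝 (Γ.one x)) :=
      (hψs.tendsto_of_eq hψ0).comp continuous_snd.continuousAt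
    have ht : Tendsto Γ.tgt (𝓝 (Γ.one x)) (𝓝 x) := by
      have := Γ.contMDiff_tgt.continuous.tendsto (Γ.one x)
      rwa [Γ.tgt_one] at this
    have haX : ∀ᶠ e in 𝓝 p₀, (φ.symm e.1, ψ.symm e.2) ∈ Ω :=
      (ha.prodMk_nhds hX).eventually (hζ.isOpen.mem_nhds hx)
    have hd : ∀ᶠ z in 𝓝 x, (z, Γ.one z) ∈ Ω :=
      (continuous_id.prodMk Γ.contMDiff_one.continuous).continuousAt.eventually
        (hζ.isOpen.mem_nhds hx)
    have hφtg : ∀ᶠ e : EM × EG in 𝓝 p₀, e.1 ∈ φ.target :=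
      continuous_fst.continuousAt.eventually
        ((isOpen_extChartAt_target (I := 𝓘(ℝ, EM)) x).mem_nhds (φ.map_source hxφ))
    have hψtg : ∀ᶠ e : EM × EG in 𝓝 p₀, e.2 ∈ ψ.target :=
      continuous_snd.continuousAt.eventually
        ((isOpen_extChartAt_target (I := 𝓘(ℝ, EG)) (Γ.one x)).mem_nhds (ψ.map_source hxψ))
    filter_upwards [haX, ha.eventually h, ha.eventually hd, hX.eventually hLζ,
      (ht.comp hX).eventually (extChartAt_source_mem_nhds (I := 𝓘(ℝ, EM)) x), hφtg, hψtg]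
      with e h1 h2 h3 h4 h5 h6 h7
    have hfst : (ζ (φ.symm e.1, ψ.symm e.2)).1 = (ζ' (φ.symm e.1, ψ.symm e.2)).1 :=
      (hζ.projectable _ _ _ h1 h3).trans ((fst_eq_of_upsilon_eq h2).trans
        (hζ'.projectable _ _ _ h3 h1))
    have hchart : ∀ ξ : M × G → EM × EG, chartField (𝓘(ℝ, EM).prod 𝓘(ℝ, EG)) (x, Γ.one x) ξ e =
        (mderiv 𝓘(ℝ, EM) 𝓘(ℝ, EM) φ (φ.symm e.1) (ξ (φ.symm e.1, ψ.symm e.2)).1,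
          mderiv 𝓘(ℝ, EG) 𝓘(ℝ, EG) ψ (ψ.symm e.2) (ξ (φ.symm e.1, ψ.symm e.2)).2) := by
      intro ξ
      have e1 : (extChartAt (𝓘(ℝ, EM).prod 𝓘(ℝ, EG)) (x, Γ.one x)).symm e =
          (φ.symm e.1, ψ.symm e.2) := by
        rw [extChartAt_prod]
        rfl
      unfold chartField
      rw [e1]
      refine mderiv_extChartAt_prod ?_ ?_ _
      · rw [← extChartAt_source 𝓘(ℝ, EM)]
        exact φ.map_target h6
      · rw [← extChartAt_source 𝓘(ℝ, EG)]
        exact ψ.map_target h7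
    rw [hδ]
    simp only [hchart]
    have h8 := h4 (φ.symm e.1) Ω ζ hζ h1
    have h9 := h4 (φ.symm e.1) Ω ζ' hζ' h1
    rw [Prod.mk_sub_mk, hfst, sub_self, h8, h9, ← map_sub, ← map_sub, ψ.right_inv h7]
    show ((0 : EM), _) = ((0 : EM), L e.2 (Θ (q e)))
    congr 2
    show _ = mderiv 𝓘(ℝ, EG) 𝓘(ℝ, EG) ψ (Γ.one (φ.symm (φ (Γ.tgt (ψ.symm e.2)))))
      ((ζ (φ.symm e.1, Γ.one (φ.symm (φ (Γ.tgt (ψ.symm e.2)))))).2 -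
        (ζ' (φ.symm e.1, Γ.one (φ.symm (φ (Γ.tgt (ψ.symm e.2)))))).2)
    have h10 : φ.symm (φ (Γ.tgt (ψ.symm e.2))) = Γ.tgt (ψ.symm e.2) := φ.left_inv h5
    rw [h10]
  have hL' : ContDiffAt ℝ ∞ (fun e : EM × EG => (ContinuousLinearMap.inr ℝ EM EG).comp (L e.2)) p₀ :=
    contDiffAt_const.clm_comp (ContDiffAt.comp p₀ (g := L) (f := Prod.snd) hL contDiffAt_snd)
  refine ⟨(isBigO_clm_apply hL'.continuousAt hγt hu0).congr' ?_ (EventuallyEq.refl _ _),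
    (isBigO_fderiv_clm_apply hL' hu hγt hu0 hu1).congr' ?_ (EventuallyEq.refl _ _)⟩
  · exact (hγt.eventually hδ').mono fun y hy => hy.symm
  · exact (hγt.eventually (eventually_eventually_nhds.2 hδ')).mono fun y hy =>
      (EventuallyEq.fderiv_eq hy).symm

variable [CompleteSpace EM] [CompleteSpace EG]

theorem algFlat_vbracket_sub (hζ : Γ.IsInvariantField Ω ζ) (hζ' : Γ.IsInvariantField Ω ζ')
    (hη : Γ.IsInvariantField Ω η) (hx : (x, Γ.one x) ∈ Ω)
    (h : ∀ᶠ z in 𝓝 x, (Γ.upsilon (k + 1) ζ z : CheckJet EM EG (k + 1)) = Γ.upsilon (k + 1) ζ' z) :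
    Γ.AlgFlat (k + 1) x (fun y => (vbracket (𝓘(ℝ, EM).prod 𝓘(ℝ, EG)) ζ η (x, Γ.one y)).2 -
      (vbracket (𝓘(ℝ, EM).prod 𝓘(ℝ, EG)) ζ' η (x, Γ.one y)).2) x := by
  set φ := extChartAt 𝓘(ℝ, EM) x with hφ
  set ψ := extChartAt 𝓘(ℝ, EG) (Γ.one x) with hψ
  set I := 𝓘(ℝ, EM).prod 𝓘(ℝ, EG) with hI
  set γ : M → EM × EG := fun y => (φ x, ψ (Γ.one y)) with hγ
  set δ : EM × EG → EM × EG := fun e =>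
      chartField I (x, Γ.one x) ζ e - chartField I (x, Γ.one x) ζ' e with hδ
  obtain ⟨h0, h1⟩ := isBigO_chartField_sub hζ hζ' hx h hδ hγ
  have hc : (x, Γ.one x) ∈ (chartAt (ModelProd EM EG) (x, Γ.one x)).source := mem_chart_source _ _
  have hγ0 : (extChartAt I (x, Γ.one x)) (x, Γ.one x) = (φ x, ψ (Γ.one x)) := by
    rw [hI, extChartAt_prod]
    rfl
  have hγt : Tendsto γ (𝓝 x) (𝓝 (φ x, ψ (Γ.one x))) :=
    tendsto_const_nhds.prodMk_nhds ((continuousAt_extChartAt _).tendsto.comp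
      (Γ.contMDiff_one.continuous.tendsto x))
  have hsm : ∀ {ξ : M × G → EM × EG}, Γ.IsInvariantField Ω ξ →
      ContDiffAt ℝ ∞ (chartField I (x, Γ.one x) ξ) (φ x, ψ (Γ.one x)) := by
    intro ξ hξ
    rw [← hγ0]
    exact ((hξ.smoothField hx).smoothNear_chartField hc).contDiffAt
  have hA := isBigO_clm_apply (L := fderiv ℝ (chartField I (x, Γ.one x) η))
    ((hsm hη).fderiv_right (m := ∞) (by simp)).continuousAt hγt h0
  have hB := isBigO_clm_apply (L := fun e => ContinuousLinearMap.apply ℝ (EM × EG)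
    (chartField I (x, Γ.one x) η e)) (((ContinuousLinearMap.apply ℝ (EM × EG)).continuous.tendsto
      _).comp (hsm hη).continuousAt) hγt h1
  have hAB := hA.sub hB
  have hsnd : ∀ w : EM × EG, ‖w.2‖ ≤ ‖w‖ := norm_snd_le
  refine Asymptotics.IsBigO.trans (Asymptotics.IsBigO.of_norm_eventuallyLE ?_) hAB.norm_left
  have hxΩ : ∀ᶠ y in 𝓝 x, (x, Γ.one y) ∈ Ω :=
    (continuous_const.prodMk Γ.contMDiff_one.continuous).continuousAt.eventually
      (hζ.isOpen.mem_nhds hx)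
  filter_upwards [hxΩ, (eventually_mem_charts (Γ := Γ) x),
    hγt.eventually (hsm hζ).eventually_differentiableAt,
    hγt.eventually (hsm hζ').eventually_differentiableAt] with y h2 h3 h4 h5
  have hyc : (x, Γ.one y) ∈ (chartAt (ModelProd EM EG) (x, Γ.one x)).source := by
    rw [prodChartedSpace_chartAt]
    exact ⟨mem_chart_source _ _, h3.2⟩
  have hγy : (extChartAt I (x, Γ.one x)) (x, Γ.one y) = γ y := by
    rw [hI, extChartAt_prod]
    rfl
  have e1 := mderiv_extChartAt_vbracket (a := (x, Γ.one x)) (hζ.smoothField h2) (hη.smoothField h2) hyc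
  have e2 := mderiv_extChartAt_vbracket (a := (x, Γ.one x)) (hζ'.smoothField h2) (hη.smoothField h2) hyc
  rw [← hI] at e1 e2
  have e3 : mderiv I 𝓘(ℝ, EM × EG) (extChartAt I (x, Γ.one x)) (x, Γ.one y)
      (vbracket I ζ η (x, Γ.one y) - vbracket I ζ' η (x, Γ.one y)) =
      fderiv ℝ (chartField I (x, Γ.one x) η) (γ y) (δ (γ y)) -
        fderiv ℝ δ (γ y) (chartField I (x, Γ.one x) η (γ y)) := by
    have e4 : fderiv ℝ δ (γ y) = fderiv ℝ (chartField I (x, Γ.one x) ζ) (γ y) -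
        fderiv ℝ (chartField I (x, Γ.one x) ζ') (γ y) := fderiv_sub h4 h5
    rw [map_sub, e1, e2, hγy, e4]
    simp only [VectorField.lieBracket, hδ, map_sub, sub_apply]
    abel
  have e5 := mderiv_extChartAt_prod (a := x) (z := x) (b := Γ.one x) (z' := Γ.one y)
    (mem_chart_source _ _) h3.2 (vbracket I ζ η (x, Γ.one y) - vbracket I ζ' η (x, Γ.one y))
  rw [← hI, e3] at e5
  have e6 := congrArg Prod.snd e5
  refine Eq.trans_le (congrArg norm e6.symm) ?_
  exact hsnd _

end LieGroupoid

namespace LieGroupoid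

variable {EM EG M G : Type*}
  [NormedAddCommGroup EM] [NormedSpace ℝ EM] [NormedAddCommGroup EG] [NormedSpace ℝ EG]
  [TopologicalSpace M] [ChartedSpace EM M] [TopologicalSpace G] [ChartedSpace EG G]
  {Γ : LieGroupoid EM EG M G} {k : ℕ}
  [IsManifold 𝓘(ℝ, EM) ∞ M] [IsManifold 𝓘(ℝ, EG) ∞ G] [CompleteSpace EM] [CompleteSpace EG]
  {Ω Ω' : Set (M × G)} {ζ ζ' η η' : M × G → EM × EG} {x : M}

theorem IsInvariantField.fst_one_eventuallyEq (hζ : Γ.IsInvariantField Ω ζ)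
    (hζ' : Γ.IsInvariantField Ω ζ') (hx : (x, Γ.one x) ∈ Ω)
    (h : ∀ᶠ z in 𝓝 x, (Γ.upsilon k ζ z : CheckJet EM EG k) = Γ.upsilon k ζ' z) :
    (fun z => (ζ (z, Γ.one x)).1) =ᶠ[𝓝 x] fun z => (ζ' (z, Γ.one x)).1 := by
  have h1 : ∀ᶠ z in 𝓝 x, (z, Γ.one z) ∈ Ω :=
    (continuous_id.prodMk Γ.contMDiff_one.continuous).continuousAt.eventually
      (hζ.isOpen.mem_nhds hx)
  have h2 : ∀ᶠ z in 𝓝 x, (z, Γ.one x) ∈ Ω :=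
    (continuous_id.prodMk continuous_const).continuousAt.eventually (hζ.isOpen.mem_nhds hx)
  filter_upwards [h, h1, h2] with z h3 h4 h5
  exact (hζ.projectable _ _ _ h5 h4).trans ((fst_eq_of_upsilon_eq h3).trans
    (hζ'.projectable _ _ _ h4 h5))

theorem upsilon_vbracket_congr (hζ : Γ.IsInvariantField Ω ζ) (hζ' : Γ.IsInvariantField Ω ζ')
    (hη : Γ.IsInvariantField Ω η) (hη' : Γ.IsInvariantField Ω η') (hx : (x, Γ.one x) ∈ Ω)
    (h : ∀ᶠ z in 𝓝 x, (Γ.upsilon (k + 1) ζ z : CheckJet EM EG (k + 1)) = Γ.upsilon (k + 1) ζ' z)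
    (h' : ∀ᶠ z in 𝓝 x, (Γ.upsilon (k + 1) η z : CheckJet EM EG (k + 1)) =
      Γ.upsilon (k + 1) η' z) :
    (Γ.upsilon k (vbracket (𝓘(ℝ, EM).prod 𝓘(ℝ, EG)) ζ η) x : CheckJet EM EG k) =
      Γ.upsilon k (vbracket (𝓘(ℝ, EM).prod 𝓘(ℝ, EG)) ζ' η') x := by
  refine Prod.ext ?_ ?_
  · show (vbracket (𝓘(ℝ, EM).prod 𝓘(ℝ, EG)) ζ η (x, Γ.one x)).1 =
      (vbracket (𝓘(ℝ, EM).prod 𝓘(ℝ, EG)) ζ' η' (x, Γ.one x)).1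
    rw [hζ.fst_vbracket hη hx, hζ'.fst_vbracket hη' hx]
    exact vbracket_congr (hζ.fst_one_eventuallyEq hζ' hx h) (hη.fst_one_eventuallyEq hη' hx h')
  · have e1 := (algCoeffs_eq_iff (k := k) ((hζ.vbracket hη).smoothField_one hx)
      ((hζ'.vbracket hη).smoothField_one hx) (mem_chart_source _ _) (mem_chart_source _ _)).2
      (algFlat_vbracket_sub hζ hζ' hη hx h)
    have hswap : ∀ (V W : M × G → EM × EG) (q : M × G),
        vbracket (𝓘(ℝ, EM).prod 𝓘(ℝ, EG)) V W q = -vbracket (𝓘(ℝ, EM).prod 𝓘(ℝ, EG)) W V q :=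
      fun V W q => VectorField.mlieBracket_swap_apply
    have e2 : Γ.AlgFlat (k + 1) x
        (fun y => (vbracket (𝓘(ℝ, EM).prod 𝓘(ℝ, EG)) ζ' η (x, Γ.one y)).2 -
          (vbracket (𝓘(ℝ, EM).prod 𝓘(ℝ, EG)) ζ' η' (x, Γ.one y)).2) x := by
      have e3 := algFlat_vbracket_sub hη' hη hζ' hx (h'.mono fun z hz => hz.symm)
      convert e3 using 2 with y
      rw [hswap ζ' η, hswap ζ' η', Prod.snd_neg, Prod.snd_neg]
      abel
    have e4 := (algCoeffs_eq_iff (k := k) ((hζ'.vbracket hη).smoothField_one hx)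
      ((hζ'.vbracket hη').smoothField_one hx) (mem_chart_source _ _) (mem_chart_source _ _)).2 e2
    exact e1.trans e4

theorem firstBracket_eq {a b : M → CheckJet EM EG (k + 1)} (hζ : Γ.IsInvariantField Ω ζ)
    (hη : Γ.IsInvariantField Ω η) (hx : (x, Γ.one x) ∈ Ω)
    (ha : ∀ᶠ z in 𝓝 x, Γ.upsilon (k + 1) ζ z = a z)
    (hb : ∀ᶠ z in 𝓝 x, Γ.upsilon (k + 1) η z = b z) :
    Γ.firstBracket k a b x = Γ.upsilon k (vbracket (𝓘(ℝ, EM).prod 𝓘(ℝ, EG)) ζ η) x := by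
  have hex : ∃ ζη : ((q : M × G) → TangentSpace (𝓘(ℝ, EM).prod 𝓘(ℝ, EG)) q) ×
      ((q : M × G) → TangentSpace (𝓘(ℝ, EM).prod 𝓘(ℝ, EG)) q),
      Γ.IsLift a x ζη.1 ∧ Γ.IsLift b x ζη.2 :=
    ⟨(ζ, η), ⟨⟨Ω, hx, hζ⟩, ha⟩, ⟨⟨Ω, hx, hη⟩, hb⟩⟩
  unfold firstBracket
  rw [dif_pos hex]
  obtain ⟨⟨⟨Ω₁, hx₁, hζ'⟩, ha'⟩, ⟨⟨Ω₂, hx₂, hη'⟩, hb'⟩⟩ := hex.choose_spec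
  have hst : Γ.RightStable (Ω ∩ (Ω₁ ∩ Ω₂)) := fun a X Y h hXY =>
    ⟨hζ.stable a X Y h.1 hXY, hζ'.stable a X Y h.2.1 hXY, hη'.stable a X Y h.2.2 hXY⟩
  have hop : IsOpen (Ω ∩ (Ω₁ ∩ Ω₂)) := hζ.isOpen.inter (hζ'.isOpen.inter hη'.isOpen)
  have hr : ∀ {Ω₃ : Set (M × G)} {ξ : M × G → EM × EG}, Γ.IsInvariantField Ω₃ ξ →
      Ω ∩ (Ω₁ ∩ Ω₂) ⊆ Ω₃ → Γ.IsInvariantField (Ω ∩ (Ω₁ ∩ Ω₂)) ξ := fun hξ hsub => by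
    have := hξ.inter hop hst
    rwa [inter_eq_self_of_subset_right hsub] at this
  exact upsilon_vbracket_congr (hr hζ' fun _ h => h.2.1) (hr hζ fun _ h => h.1)
    (hr hη' fun _ h => h.2.2) (hr hη fun _ h => h.1) ⟨hx, hx₁, hx₂⟩
    (by filter_upwards [ha, ha'] with z h1 h2 using h2.trans h1.symm)
    (by filter_upwards [hb, hb'] with z h1 h2 using h2.trans h1.symm)

variable {f : OpenPartialHomeomorph M M} {U : Set M}

theorem IsJetBisection.firstBracket_act {S : M → PreJet EM EG M G (k + 2)}
    (h : Γ.IsJetBisection S f) {a b : M → CheckJet EM EG (k + 1)} (hU : U ⊆ f.source)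
    (ha : Γ.IsCheckSection a U) (hb : Γ.IsCheckSection b U) (hx : x ∈ U) :
    Γ.firstBracket k (Γ.act S f a) (Γ.act S f b) (f x) =
      Γ.act (fun z => (S z).proj) f (Γ.firstBracket k a b) (f x) := by
  obtain ⟨σ, f₁, hσ, hx₁, hff, hsymm, -, hS⟩ := h.exists_isAdmissible (hU hx)
  obtain ⟨Ω₁, ζ, hζ₁, hxΩ₁, hζa⟩ := ha.exists_isInvariantField hx
  obtain ⟨Ω₂, η, hη₁, hxΩ₂, hηb⟩ := hb.exists_isInvariantField hx
  have hζ : Γ.IsInvariantField (Ω₁ ∩ Ω₂) ζ := hζ₁.inter hη₁.isOpen hη₁.stable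
  have hη : Γ.IsInvariantField (Ω₁ ∩ Ω₂) η := by
    rw [inter_comm]
    exact hη₁.inter hζ₁.isOpen hζ₁.stable
  have hxΩ : (x, Γ.one x) ∈ Ω₁ ∩ Ω₂ := ⟨hxΩ₁, hxΩ₂⟩
  have hfx : f₁ x = f x := congrFun hff x
  have hmem := hσ.one_mem_pushField hζ hx₁ hxΩ
  rw [hfx] at hmem
  have e1 := firstBracket_eq (hσ.pushField_isInvariantField hζ) (hσ.pushField_isInvariantField hη)
    hmem ((act_eventuallyEq hσ hx₁ (hU hx) hff hS hζ hxΩ hζa).mono fun z hz => hz.symm)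
    ((act_eventuallyEq hσ hx₁ (hU hx) hff hS hη hxΩ hηb).mono fun z hz => hz.symm)
  have e2 : (Γ.upsilon k (vbracket (𝓘(ℝ, EM).prod 𝓘(ℝ, EG))
        (fun p => LieGroupoid.pushField σ ζ p) (fun p => LieGroupoid.pushField σ η p)) (f x) :
        CheckJet EM EG k) =
      Γ.upsilon k (LieGroupoid.pushField σ (vbracket (𝓘(ℝ, EM).prod 𝓘(ℝ, EG)) ζ η)) (f x) := by
    refine upsilon_congr ?_
    filter_upwards [(hσ.pushField_isInvariantField hζ).isOpen.mem_nhds hmem] with q hq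
    exact hσ.vbracket_pushField hζ hη hq.1 hq.2
  have e3 := act_eq_upsilon_pushField (k := k) hσ hx₁ (hζ.vbracket hη) hxΩ
    (S := fun z => (S z).proj) (f' := f) (a := Γ.firstBracket k a b)
    (by filter_upwards [hS] with z hz; rw [hz]; rfl) (by rw [hff])
    (by rw [← hsymm]; exact f₁.left_inv hx₁) (firstBracket_eq hζ hη hxΩ hζa hηb)
  rw [hfx] at e3
  exact e1.trans (e2.trans e3.symm)

theorem IsCheckSection.smoothField_fst {a : M → CheckJet EM EG k} (ha : Γ.IsCheckSection a U)
    (hx : x ∈ U) : SmoothField 𝓘(ℝ, EM) 𝓘(ℝ, EM) (fun z => z) (fun z => (a z).1) x :=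
  ha.smooth_fst.smoothNear (ha.isOpen.mem_nhds hx)

theorem IsJetBisection.fst_act {S : M → PreJet EM EG M G (k + 1)} (h : Γ.IsJetBisection S f)
    {a : M → CheckJet EM EG k} (hU : U ⊆ f.source) (ha : Γ.IsCheckSection a U) (hx : x ∈ U) :
    SmoothNear 𝓘(ℝ, EM) 𝓘(ℝ, EM) f x ∧
      mderiv 𝓘(ℝ, EM) 𝓘(ℝ, EM) f x (a x).1 = (Γ.act S f a (f x)).1 := by
  obtain ⟨σ, f₁, hσ, hx₁, hff, hsymm, -, hS⟩ := h.exists_isAdmissible (hU hx)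
  obtain ⟨Ω, ζ, hζ, hxΩ, hζa⟩ := ha.exists_isInvariantField hx
  have hmem := hσ.one_mem_pushField hζ hx₁ hxΩ
  refine ⟨hff ▸ hσ.smoothNear_base hx₁, ?_⟩
  have e1 := (act_eventuallyEq hσ hx₁ (hU hx) hff hS hζ hxΩ hζa).self_of_nhds
  have e2 : (Γ.act S f a (f x)).1 =
      (LieGroupoid.pushField σ ζ (f₁ x, Γ.one (f₁ x)) : EM × EG).1 := by
    rw [e1, hff]
    rfl
  rw [e2, hσ.fst_pushField hmem.1]
  have e3 : (σ.symm (f₁ x, Γ.one (f₁ x))).1 = x := by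
    rw [(hσ.symm_apply_one hx₁ hmem.1).1]
  have e4 : (σ.symm (f₁ x, Γ.one (f₁ x))) = (x, (σ.symm (f₁ x, Γ.one (f₁ x))).2) :=
    Prod.ext e3 rfl
  have e5 : (x, (σ.symm (f₁ x, Γ.one (f₁ x))).2) ∈ Ω := e4 ▸ hmem.2
  have e6 : (ζ (σ.symm (f₁ x, Γ.one (f₁ x)))).1 = (a x).1 := by
    rw [e4, ← hζa.self_of_nhds]
    exact hζ.projectable _ _ _ e5 hxΩ
  rw [e3, e6, hff]

theorem IsJetBisection.firstBracketZero_act {S : M → PreJet EM EG M G 1}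
    (h : Γ.IsJetBisection S f) {a b : M → CheckJet EM EG 0} (hU : U ⊆ f.source)
    (ha : Γ.IsCheckSection a U) (hb : Γ.IsCheckSection b U) (hx : x ∈ U) :
    LieGroupoid.firstBracketZero (Γ.act S f a) (Γ.act S f b) (f x) =
      LieGroupoid.pushVec f x (LieGroupoid.firstBracketZero a b x) := by
  have hrel : ∀ {c : M → CheckJet EM EG 0}, Γ.IsCheckSection c U →
      ∀ᶠ z in 𝓝 x, mderiv 𝓘(ℝ, EM) 𝓘(ℝ, EM) f z (c z).1 = (Γ.act S f c (f z)).1 := fun hc =>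
    mem_of_superset (hc.isOpen.mem_nhds hx) fun z hz => (h.fst_act hU hc hz).2
  exact (mderiv_vbracket (F := f) (V := fun z => (a z).1) (W := fun z => (b z).1)
    (V' := fun z => (Γ.act S f a z).1) (W' := fun z => (Γ.act S f b z).1) (h.fst_act hU ha hx).1
    (ha.smoothField_fst hx) (hb.smoothField_fst hx)
    ((h.act_isCheckSection hU ha).smoothField_fst (mem_image_of_mem f hx))
    ((h.act_isCheckSection hU hb).smoothField_fst (mem_image_of_mem f hx))
    (hrel ha) (hrel hb)).symm

end LieGroupoid

end

theorem proposition3p5 {EM EG M G : Type*}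
    [NormedAddCommGroup EM] [NormedSpace ℝ EM] [FiniteDimensional ℝ EM]
    [NormedAddCommGroup EG] [NormedSpace ℝ EG] [FiniteDimensional ℝ EG]
    [TopologicalSpace M] [T2Space M] [ChartedSpace EM M] [IsManifold 𝓘(ℝ, EM) ∞ M]
    [TopologicalSpace G] [T2Space G] [ChartedSpace EG G] [IsManifold 𝓘(ℝ, EG) ∞ G]
    (Γ : LieGroupoid EM EG M G) (k : ℕ) :
    -- the action of an admissible diffeomorphism on right invariant fields
    (∀ (σ : OpenPartialHomeomorph (M × G) (M × G)) (f : OpenPartialHomeomorph M M),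
      Γ.IsAdmissible σ f →
      Γ.IsJetBisection (Γ.sigmaJet k σ) f ∧
      Γ.IsJetBisection (Γ.sigmaJet (k + 1) σ) f ∧
      (∀ x ∈ f.source, (Γ.sigmaJet (k + 1) σ x).proj = Γ.sigmaJet k σ x) ∧
      ∀ (Ω : Set (M × G)) (ζ : (q : M × G) → TangentSpace (𝓘(ℝ, EM).prod 𝓘(ℝ, EG)) q),
        Γ.IsInvariantField Ω ζ →
        Γ.IsInvariantField (σ.target ∩ σ.symm ⁻¹' Ω) (LieGroupoid.pushField σ ζ) ∧
        (∀ x ∈ f.source, (x, Γ.one x) ∈ Ω →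
          -- horizontal fields
          (LieGroupoid.IsHorizontal Ω ζ →
            Γ.toTan (f x) (Γ.upsilon k (LieGroupoid.pushField σ ζ) (f x)) =
              Γ.horiz k (f x) (LieGroupoid.pushVec f x (Γ.upsilon k ζ x).1) +
                (Γ.conjFirst (Γ.sigmaJet k σ) (Γ.sigmaJet (k + 1) σ x) x
                    (Γ.horiz k x (Γ.upsilon k ζ x).1) -
                  Γ.conjLam (Γ.sigmaJet (k + 1) σ x) x (Γ.horiz k x (Γ.upsilon k ζ x).1))) ∧
          -- vertical fields
          (LieGroupoid.IsVertical Ω ζ →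
            Γ.toTan (f x) (Γ.upsilon k (LieGroupoid.pushField σ ζ) (f x)) =
              Γ.conjVert (Γ.sigmaJet (k + 1) σ x) x (Γ.upsilon k ζ x).2) ∧
          -- fields tangent to `B(G)`
          (Γ.IsTangentBG Ω ζ →
            Γ.toTan (f x) (Γ.upsilon k (LieGroupoid.pushField σ ζ) (f x)) =
              Γ.horiz k (f x) (LieGroupoid.pushVec f x (Γ.upsilon k ζ x).1) +
                Γ.conjTangent (Γ.sigmaJet k σ) x (Γ.upsilon k ζ x).2) ∧
          -- the action projects to the action of bisections of `G_{k+1}`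
          Γ.upsilon k (LieGroupoid.pushField σ ζ) (f x) =
            Γ.act (Γ.sigmaJet (k + 1) σ) f (Γ.upsilon k ζ) (f x)) ∧
        (LieGroupoid.IsVertical Ω ζ →
          LieGroupoid.IsVertical (σ.target ∩ σ.symm ⁻¹' Ω) (LieGroupoid.pushField σ ζ)) ∧
        (Γ.IsTangentBG Ω ζ →
          Γ.IsTangentBG (σ.target ∩ σ.symm ⁻¹' Ω) (LieGroupoid.pushField σ ζ))) ∧
    -- bisections of `G_{k+1}` act on sections of `T ⊕ J^k 𝔤`
    (∀ (S : M → PreJet EM EG M G (k + 1)) (f : OpenPartialHomeomorph M M),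
      Γ.IsJetBisection S f →
      ∀ (U : Set M) (a : M → LieGroupoid.CheckJet EM EG k),
        U ⊆ f.source → Γ.IsCheckSection a U → Γ.IsCheckSection (Γ.act S f a) (f '' U)) ∧
    (Γ.IsJetBisection (Γ.jetOne (k + 1)) (OpenPartialHomeomorph.refl M) ∧
      ∀ (U : Set M) (a : M → LieGroupoid.CheckJet EM EG k), Γ.IsCheckSection a U →
        ∀ x ∈ U, Γ.act (Γ.jetOne (k + 1)) (OpenPartialHomeomorph.refl M) a x = a x) ∧
    (∀ (S S' : M → PreJet EM EG M G (k + 1)) (f f' : OpenPartialHomeomorph M M),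
      Γ.IsJetBisection S f → Γ.IsJetBisection S' f' →
      Γ.IsJetBisection (fun x => Γ.jetMul (S' (f x)) (S x)) (f.trans f') ∧
      ∀ (U : Set M) (a : M → LieGroupoid.CheckJet EM EG k),
        U ⊆ (f.trans f').source → Γ.IsCheckSection a U →
        ∀ x ∈ U, Γ.act (fun z => Γ.jetMul (S' (f z)) (S z)) (f.trans f') a (f' (f x)) =
          Γ.act S' f' (Γ.act S f a) (f' (f x))) ∧
    -- this action preserves the first bracket of order `k + 1`, and the one of order `0`
    (∀ (S : M → PreJet EM EG M G (k + 2)) (f : OpenPartialHomeomorph M M),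
      Γ.IsJetBisection S f →
      Γ.IsJetBisection (fun z => (S z).proj) f ∧
      ∀ (U : Set M) (a b : M → LieGroupoid.CheckJet EM EG (k + 1)),
        U ⊆ f.source → Γ.IsCheckSection a U → Γ.IsCheckSection b U →
        ∀ x ∈ U, Γ.firstBracket k (Γ.act S f a) (Γ.act S f b) (f x) =
          Γ.act (fun z => (S z).proj) f (Γ.firstBracket k a b) (f x)) ∧
    (∀ (S : M → PreJet EM EG M G 1) (f : OpenPartialHomeomorph M M),
      Γ.IsJetBisection S f →
      ∀ (U : Set M) (a b : M → LieGroupoid.CheckJet EM EG 0),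
        U ⊆ f.source → Γ.IsCheckSection a U → Γ.IsCheckSection b U →
        ∀ x ∈ U, LieGroupoid.firstBracketZero (Γ.act S f a) (Γ.act S f b) (f x) =
          LieGroupoid.pushVec f x (LieGroupoid.firstBracketZero a b x)) := by
  have : CompleteSpace EM := FiniteDimensional.complete ℝ EM
  have : CompleteSpace EG := FiniteDimensional.complete ℝ EG
  refine ⟨fun σ f h => ⟨h.isJetBisection k, h.isJetBisection (k + 1), fun _ _ => rfl,
    fun Ω ζ hζ => ⟨h.pushField_isInvariantField hζ, fun x hx hxΩ =>
      ⟨LieGroupoid.toTan_upsilon_pushField_horizontal h hx hζ hxΩ,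
        LieGroupoid.toTan_upsilon_pushField_vertical h hx hζ hxΩ,
        LieGroupoid.toTan_upsilon_pushField_tangent h hx hζ hxΩ,
        (LieGroupoid.act_eq_upsilon_pushField h hx hζ hxΩ (EventuallyEq.refl _ _)
          (EventuallyEq.refl _ _) (f.left_inv hx) rfl).symm⟩,
      h.pushField_isVertical, h.pushField_isTangentBG⟩⟩,
    fun S f h U a hU ha => h.act_isCheckSection hU ha,
    ⟨LieGroupoid.isJetBisection_jetOne, fun U a ha x hx => LieGroupoid.act_jetOne ha hx⟩,
    fun S S' f f' h h' => ⟨h.mul h', fun U a hU ha x hx => ?_⟩,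
    fun S f h => ⟨h.proj, fun U a b hU ha hb x hx => h.firstBracket_act hU ha hb hx⟩,
    fun S f h U a b hU ha hb x hx => h.firstBracketZero_act hU ha hb hx⟩
  have hxs := hU hx
  rw [OpenPartialHomeomorph.trans_source] at hxs
  exact h.act_mul h' ha hx hxs.1 hxs.2
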